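/- Let $\hat K=\{(\xi,\eta,\zeta): 0\le\zeta\le 1,\ 0\le\xi,\eta\le 1-\zeta\}$ be the reference pyramid, let $\phi(x,y,z)=\left(\frac{x}{1+z},\frac{y}{1+z},\frac{z}{1+z}\right)$ map the infinite pyramid $K_\infty=\{0\le x,y\le 1,\ 0\le z<\infty\}$ to $\hat K$, and let $K=\phi_K(\hat K)$ be an affine pyramid, where $\phi_K:\mathbb R^3\to\mathbb R^3$ is an affine isomorphism. Let $k\ge 1$ and $s\in\{0,1,2\}$. Identify $s$-forms on $K$ with their scalar ($s=0$) or vector ($s=1,2$) proxies. For integers $n,l,m$ let $$Q_n^{[l,m]}=\operatorname{span}\left\{\tfrac{x^ay^b}{(1+z)^c}: a,b,c\in\mathbb Z_{\ge0},\ c\le n,\ a\le c+l-n,\ b\le c+m-n\right\},$$ and put $$\mathcal P^{(0)}_k=Q_k^{[k,k]},\qquad \mathcal P^{(1)}_k=\left(Q_{k+1}^{[k-1,k]}\times Q_{k+1}^{[k,k-1]}\times\{0\}\right)+\nabla Q_k^{[k,k]},$$ $$\mathcal P^{(2)}_k=\left(\{0\}\times\{0\}\times Q_{k+2}^{[k-1,k-1]}\right)+\nabla\times\left(Q_{k+1}^{[k-1,k]}\times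 Q_{k+1}^{[k,k-1]}\times\{0\}\right).$$ Let $\mathcal P^{(s)}_k(K)$ be the space of $s$-forms $u$ on $K$ whose components in the coordinates $(x,y,z)$ lie in $\mathcal P^{(s)}_k$; with $F=\phi_K\circ\phi$ these components are $u\circ F$, $DF^{T}(u\circ F)$ and $\det(DF)\,DF^{-1}(u\circ F)$ for $s=0,1,2$. Let $\mathcal H^{(s)}(K)$ be $H^1(K)$, $H(\operatorname{curl},K)$, $H(\operatorname{div},K)$ for $s=0,1,2$. The trace $\operatorname{tr}_K u$ of $u\in\mathcal H^{(s)}(K)$ is the functional on smooth compactly supported test fields $v$ on $\mathbb R^3$ (vector fields for $s=0,1$, scalar fields for $s=2$) given by $$\operatorname{tr}_K u(v)=\int_K(\nabla u\cdot v+u\operatorname{div}v),\qquad \int_K(\operatorname{curl}u\cdot v-u\cdot\operatorname{curl}v),\qquad \int_K(\operatorname{div}u\,v+u\cdot\nabla v)$$ for $s=0,1,2$ respectively (for smooth $u$ and the outer unit normal $n$ this is $\int_{\partial K}u\,v\cdot n$, $\int_{\partial K}(n\times u)\cdot v$, $\int_{\partial K}(u\cdot n)v$). For each triangular face $F$ of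 $K$ let $N_F$ be a tetrahedron, and for the quadrilateral face $F$ let $N_F$ be an affine hexahedron (a parallelepiped), such that $F$ is a face of $N_F$ and $N_F\cap K=F$. Let $W^{(s)}_k(N_F)$ be the $k$th order Lagrange ($s=0$), Nédélec edge ($s=1$) or Nédélec face ($s=2$) space of the first kind on $N_F$: on tetrahedra $$P_k,\qquad P_{k-1}^3\oplus\{q\in\tilde P_k^3: x\cdot q=0\},\qquad P_{k-1}^3\oplus\tilde P_{k-1}\,x,$$ where $P_k$ and $\tilde P_k$ are the polynomials of degree at most $k$ and the homogeneous polynomials of degree $k$; on the unit cube $$Q_{k,k,k},\qquad Q_{k-1,k,k}\times Q_{k,k-1,k}\times Q_{k,k,k-1},\qquad Q_{k,k-1,k-1}\times Q_{k-1,k,k-1}\times Q_{k-1,k-1,k},$$ where $Q_{l,m,n}$ are the polynomials of degree at most $l,m,n$ in the three variables; these are transported to a parallelepiped by the pullback of $s$-forms under the affine map. Then: 1. $\operatorname{tr}_K$ is a linear operator from $\mathcal H^{(s)}(K)$ to distributions on $\partial K$: each $\operatorname{tr}_K u$ is a continuous linear functional on the test fields, and $\operatorname{tr}_K u(v)$ depends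 only on $v|_{\partial K}$. 2. $\mathcal P^{(s)}_k(K)\subset\mathcal H^{(s)}(K)$. 3. The image of $\mathcal P^{(s)}_k(K)$ under $\operatorname{tr}_K$ is exactly the set of all $\tau\in\operatorname{tr}_K\left(\mathcal H^{(s)}(K)\right)$ such that for every face $F$ of $K$ the restriction of $\tau$ to $F$ is the restriction to $F$ of the trace of some $w\in W^{(s)}_k(N_F)$. Here equality of the restrictions to $F$ means, since $K$ and $N_F$ induce opposite orientations on $F$, that $\tau(v)=-\operatorname{tr}_{N_F}w(v)$ for all test fields $v$ whose support does not meet $\overline{\partial K\setminus F}\cup\overline{\partial N_F\setminus F}$. -/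

import Mathlib

open MeasureTheory TopologicalSpace

noncomputable section

namespace Pyr

abbrev V3 := Fin 3 → ℝ

/-- The number `binom(3, s)` of components of the proxy of an `s`-form in three dimensions. -/
def proxyDim : ℕ → ℕ
  | 0 => 1
  | 1 => 3
  | 2 => 3
  | 3 => 1
  | _ => 0

/-- Proxy fields of `s`-forms: scalar fields for `s = 0, 3`, vector fields for `s = 1, 2`. A form on
a set `K` is represented by a total function of which only the values on `K` are ever used. -/
abbrev Form (s : ℕ) := V3 → Fin (proxyDim s) → ℝ

/-! ### Vector calculus -/

/-- The `i`-th partial derivative. -/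
def pd (i : Fin 3) (f : V3 → ℝ) (x : V3) : ℝ := fderiv ℝ f x (Pi.single i 1)

def grad (f : V3 → ℝ) (x : V3) : V3 := fun i => pd i f x

def curl (v : V3 → V3) (x : V3) : V3 :=
  ![pd 1 (fun y => v y 2) x - pd 2 (fun y => v y 1) x,
    pd 2 (fun y => v y 0) x - pd 0 (fun y => v y 2) x,
    pd 0 (fun y => v y 1) x - pd 1 (fun y => v y 0) x]

def diver (v : V3 → V3) (x : V3) : ℝ := ∑ i, pd i (fun y => v y i) x

/-- The Jacobian matrix of a map. -/
def jac (F : V3 → V3) (x : V3) : Matrix (Fin 3) (Fin 3) ℝ :=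
  Matrix.of fun i j => pd j (fun y => F y i) x

/-- The formal adjoint of the exterior derivative from `s`-forms to `(s+1)`-forms, that is, of
grad, curl and div: it is `-div`, `curl` and `-grad` for `s = 0, 1, 2`. -/
def codiff : (s : Fin 3) → Form (s + 1) → Form s
  | 0 => fun (v : V3 → V3) x _ => -diver v x
  | 1 => fun (v : V3 → V3) => curl v
  | 2 => fun (f : V3 → Fin 1 → ℝ) x => -grad (fun y => f y 0) x

/-- The components of the form `u` in the coordinates `x'`, where `x = F x'`:
`u ∘ F`, `DFᵀ (u ∘ F)` and `det(DF) DF⁻¹ (u ∘ F)` for `s = 0, 1, 2`. -/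
def pull : (s : Fin 3) → (V3 → V3) → Form s → Form s
  | 0 => fun F u x' => u (F x')
  | 1 => fun F (u : V3 → V3) x' => (jac F x').transpose.mulVec (u (F x'))
  | 2 => fun F (u : V3 → V3) x' => (jac F x').adjugate.mulVec (u (F x'))

/-! ### The spaces `H¹(K)`, `H(curl, K)`, `H(div, K)` and their traces -/

/-- Smooth compactly supported fields on `ℝ³`, used as test fields for the traces of `s`-forms
(for `s = 0, 1, 2` these are proxies of `(2 - s)`-forms). -/
abbrev Test (s : Fin 3) := TestFunction (⊤ : Opens V3) (Fin (proxyDim (s + 1)) → ℝ) ⊤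

/-- `g ∈ L²(K)` is the weak gradient, curl or divergence of `u` in the interior of `K`. -/
def HasWeakD (s : Fin 3) (K : Set V3) (u : Form s) (g : Form (s + 1)) : Prop :=
  MemLp g 2 (volume.restrict K) ∧
    ∀ v : Test s, tsupport v ⊆ interior K →
      ∫ x in K, u x ⬝ᵥ codiff s v x = ∫ x in K, g x ⬝ᵥ v x

/-- `H¹(K)`, `H(curl, K)`, `H(div, K)` for `s = 0, 1, 2`. -/
def hSpace (s : Fin 3) (K : Set V3) : Set (Form s) :=
  {u | MemLp u 2 (volume.restrict K) ∧ ∃ g, HasWeakD s K u g}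

open Classical in
/-- The weak gradient, curl or divergence of an element of `hSpace s K`. -/
def weakD (s : Fin 3) (K : Set V3) (u : Form s) : Form (s + 1) :=
  if h : ∃ g, HasWeakD s K u g then h.choose else 0

/-- The trace operator, defined through Green's formula. With the outer unit normal `n` of `K`, the
value `traceOp s K u v` for smooth `u` is `∫_{∂K} u (v · n)` if `s = 0`, `∫_{∂K} (n × u) · v` if
`s = 1` and `∫_{∂K} (u · n) v` if `s = 2`. -/
def traceOp (s : Fin 3) (K : Set V3) (u : Form s) (v : Test s) : ℝ :=
  ∫ x in K, (weakD s K u x ⬝ᵥ v x - u x ⬝ᵥ codiff s v x)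

/-- `τ` is a distribution on the boundary of `K`: it is a continuous linear functional of the test
field and depends only on the values of the test field on the boundary. -/
def IsBoundaryDistribution (s : Fin 3) (K : Set V3) (τ : Test s → ℝ) : Prop :=
  (∃ D : Test s →L[ℝ] ℝ, ∀ v, D v = τ v) ∧
    ∀ v w : Test s, (∀ x ∈ frontier K, v x = w x) → τ v = τ w

/-! ### The pyramid and its neighbours -/

/-- The reference pyramid. -/
def refPyramid : Set V3 :=
  {x | 0 ≤ x 2 ∧ x 2 ≤ 1 ∧ 0 ≤ x 0 ∧ x 0 ≤ 1 - x 2 ∧ 0 ≤ x 1 ∧ x 1 ≤ 1 - x 2}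

/-- The triangular faces of the reference pyramid. -/
def refTriFace : Fin 4 → Set V3
  | 0 => {x ∈ refPyramid | x 1 = 0}
  | 1 => {x ∈ refPyramid | x 0 = 1 - x 2}
  | 2 => {x ∈ refPyramid | x 1 = 1 - x 2}
  | 3 => {x ∈ refPyramid | x 0 = 0}

/-- The quadrilateral face of the reference pyramid. -/
def refBase : Set V3 := {x ∈ refPyramid | x 2 = 0}

def refTet : Set V3 := {x | (∀ i, 0 ≤ x i) ∧ ∑ i, x i ≤ 1}

def refCube : Set V3 := {x | ∀ i, 0 ≤ x i ∧ x i ≤ 1}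

/-- The element `B '' N`, where `N` is the reference tetrahedron or the unit cube, is a neighbour of
`K` across `F`: the two elements meet exactly in `F`, which is a whole face of `B '' N`. By the
symmetry of `N` under affine maps, `B` is chosen such that this is the image of the face
`x 2 = 0`. -/
def IsNeighbour (K F N : Set V3) (B : V3 ≃ᵃ[ℝ] V3) : Prop :=
  (B '' N) ∩ K = F ∧ B '' {x ∈ N | x 2 = 0} = F

/-! ### The approximation spaces on the pyramid -/

/-- The infinite pyramid, without its vertex at infinity. -/
def infPyramid : Set V3 := {x | 0 ≤ x 0 ∧ x 0 ≤ 1 ∧ 0 ≤ x 1 ∧ x 1 ≤ 1 ∧ 0 ≤ x 2}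

/-- The projective map from the infinite pyramid to the reference pyramid. -/
def projMap (x : V3) : V3 := ![x 0 / (1 + x 2), x 1 / (1 + x 2), x 2 / (1 + x 2)]

/-- The space `Q_k^{[l,m]}` of `k`-weighted polynomials, spanned by `x^a y^b / (1+z)^c` with
`a, b, c ≥ 0`, `c ≤ k`, `a ≤ c + l - k`, `b ≤ c + m - k`. -/
def weighted (k l m : ℤ) : Submodule ℝ (V3 → ℝ) :=
  Submodule.span ℝ {f | ∃ a b c : ℕ, (c : ℤ) ≤ k ∧ (a : ℤ) ≤ c + l - k ∧ (b : ℤ) ≤ c + m - k ∧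
    f = fun x => x 0 ^ a * x 1 ^ b / (1 + x 2) ^ c}

/-- The spaces of proxies of `s`-forms on the infinite pyramid. -/
def infSpace : (s : Fin 3) → ℕ → Set (Form s)
  | 0, k => {u : V3 → Fin 1 → ℝ | ∃ p ∈ weighted k k k, ∀ x, u x = fun _ => p x}
  | 1, k => {u : V3 → V3 | ∃ f ∈ weighted (k + 1) (k - 1) k, ∃ g ∈ weighted (k + 1) k (k - 1),
      ∃ p ∈ weighted k k k, ∀ x, u x = ![f x, g x, 0] + grad p x}
  | 2, k => {u : V3 → V3 | ∃ h ∈ weighted (k + 2) (k - 1) (k - 1),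
      ∃ f ∈ weighted (k + 1) (k - 1) k, ∃ g ∈ weighted (k + 1) k (k - 1),
        ∀ x, u x = ![0, 0, h x] + curl (fun y => ![f y, g y, 0]) x}

/-- The approximation space on the pyramid `A '' refPyramid`: the forms whose components in the
infinite pyramid coordinate system lie in `infSpace s k`. -/
def approxSpace (s : Fin 3) (k : ℕ) (A : V3 ≃ᵃ[ℝ] V3) : Set (Form s) :=
  {u | ∃ f ∈ infSpace s k, ∀ x ∈ infPyramid, pull s (fun y => A (projMap y)) u x = f x}

/-! ### Lagrange, Nédélec edge and Nédélec face spaces -/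

open MvPolynomial in
/-- The spaces of order `k ≥ 1` on a tetrahedron: `P_k` for `s = 0`,
`P_{k-1}³ ⊕ {q homogeneous of degree k with x · q = 0}` for `s = 1`, and
`P_{k-1}³ ⊕ {q x : q homogeneous of degree k - 1}` for `s = 2`. -/
def tetSpace : (s : Fin 3) → ℕ → Set (Form s)
  | 0, k => {w : V3 → Fin 1 → ℝ | ∃ p : MvPolynomial (Fin 3) ℝ, p.totalDegree ≤ k ∧
      ∀ x, w x = fun _ => eval x p}
  | 1, k => {w : V3 → V3 | ∃ p q : Fin 3 → MvPolynomial (Fin 3) ℝ,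
      (∀ j, (p j).totalDegree ≤ k - 1) ∧ (∀ j, (q j).IsHomogeneous k) ∧ ∑ j, X j * q j = 0 ∧
      ∀ x, w x = fun j => eval x (p j) + eval x (q j)}
  | 2, k => {w : V3 → V3 | ∃ (p : Fin 3 → MvPolynomial (Fin 3) ℝ) (q : MvPolynomial (Fin 3) ℝ),
      (∀ j, (p j).totalDegree ≤ k - 1) ∧ q.IsHomogeneous (k - 1) ∧
      ∀ x, w x = fun j => eval x (p j) + eval x q * x j}

open MvPolynomial in
/-- The spaces of order `k ≥ 1` on the unit cube: `Q_{k,k,k}` for `s = 0`,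
`Q_{k-1,k,k} × Q_{k,k-1,k} × Q_{k,k,k-1}` for `s = 1`, and
`Q_{k,k-1,k-1} × Q_{k-1,k,k-1} × Q_{k-1,k-1,k}` for `s = 2`. -/
def cubeSpace : (s : Fin 3) → ℕ → Set (Form s)
  | 0, k => {w : V3 → Fin 1 → ℝ | ∃ p : MvPolynomial (Fin 3) ℝ, (∀ i, p.degreeOf i ≤ k) ∧
      ∀ x, w x = fun _ => eval x p}
  | 1, k => {w : V3 → V3 | ∃ p : Fin 3 → MvPolynomial (Fin 3) ℝ,
      (∀ i j, (p j).degreeOf i ≤ if i = j then k - 1 else k) ∧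
      ∀ x, w x = fun j => eval x (p j)}
  | 2, k => {w : V3 → V3 | ∃ p : Fin 3 → MvPolynomial (Fin 3) ℝ,
      (∀ i j, (p j).degreeOf i ≤ if i = j then k else k - 1) ∧
      ∀ x, w x = fun j => eval x (p j)}

/-- The spaces on the hexahedron `B '' refCube`, transported from the unit cube. -/
def hexSpace (s : Fin 3) (k : ℕ) (B : V3 ≃ᵃ[ℝ] V3) : Set (Form s) :=
  {w | pull s B w ∈ cubeSpace s k}

/-- The restriction of `τ`, a distribution on the boundary of `K`, to the face `F` coincides with
the restriction to `F` of the trace of some `w ∈ W` from the neighbouring element `N`. The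
restrictions are tested with fields supported away from the other faces of `K` and `N`; the sign is
due to the opposite orientations of `F` as a part of the boundaries of `K` and of `N`. -/
def MatchesOnFace (s : Fin 3) (K F N : Set V3) (W : Set (Form s)) (τ : Test s → ℝ) : Prop :=
  ∃ w ∈ W, ∀ v : Test s, Disjoint (tsupport v) (closure (frontier K \ F)) →
    Disjoint (tsupport v) (closure (frontier N \ F)) → τ v = -traceOp s N w v

end Pyr

end

open scoped Manifold

noncomputable section

namespace Pyr

/-! ### First order calculus -/

/-! The trace is the boundary term of Green's formula. On a face with normal `n` its integrand is
`symb s n u ⬝ᵥ v`, so only the tangential part of the form counts: the value for `s = 0`, the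
tangential components for `s = 1`, the normal component for `s = 2`. The structure constants `cc`
allow all three degrees to be treated at once.

Analysis. Three facts about traces on a polyhedron are obtained by cutting off with smooth functions
of `m * l j`, where the affine functions `l j` define the faces. A test field that vanishes on the
boundary is annihilated, since its decay towards a face compensates the factor `m` from
differentiating the cutoff (`traceOp_eq_zero_of_frontier`). A trace that vanishes on all open faces
vanishes, since near the edges the gradient of the cutoff is of order `m` on a set of volume of
order `m⁻²`, hence bounded in L², while the mass of the form there tends to zero
(`traceOp_eq_zero_of_openFace`). If a trace is that of smooth forms on two adjacent faces, then
these forms agree on the common edge as far as an edge can see them: in the value for `s = 0`, in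
the component along the edge for `s = 1`, and without any condition for `s = 2`. Indeed, a jump
would leave a nonzero limit when tested with fields whose gradient is of order `m²` at the edge
(`edge_jump`, `tang_edge`).

Neighbours. Polynomial forms are smooth on the whole space, so their traces from the two sides of a
face are opposite and the neighbouring element can be eliminated (`matchesOnFace_iff`). The spaces
on tetrahedra are affine invariant. For hexahedra, an affine map between squares only permutes,
rescales and reflects the axes.

Algebra. In coordinates centred at the apex the pyramid becomes `cone`, and `1 / (1 + z)` becomes
the third coordinate. The generators turn into functions that are homogeneous of nonnegative degree.
They are bounded and their derivatives are bounded by a multiple of the inverse distance from the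
apex, which is square integrable in dimension three; hence the approximation space lies in the
Sobolev space. On a triangular face one of the quotients `x 0 / x 2`, `x 1 / x 2` is constant and
the restrictions on the exponents leave polynomials of the right degree; on the base `x 2 = 1`
leaves tensor product polynomials (`good_of_mem_infSpace`).

Conversely, let the traces of `u` on the faces be polynomial. They are compatible along the edges,
so some form of the approximation space has the same traces on the triangular faces
(`lateral_lift`). After subtracting it, the trace on the base has no tangential part on the base
edges and extends to a form without traces on the triangular faces (`base_lift`). What is left has
no trace on any open face, hence no trace at all (`exists_approx`). -/

theorem pd_mul {i : Fin 3} {f g : V3 → ℝ} {x : V3} (hf : DifferentiableAt ℝ f x)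
    (hg : DifferentiableAt ℝ g x) :
    pd i (fun y => f y * g y) x = f x * pd i g x + pd i f x * g x := by
  simp only [pd]
  rw [fderiv_fun_mul hf hg]
  simp [mul_comm]

theorem pd_const_mul {i : Fin 3} {c : ℝ} {g : V3 → ℝ} {x : V3} (hg : DifferentiableAt ℝ g x) :
    pd i (fun y => c * g y) x = c * pd i g x := by
  simp only [pd]
  rw [fderiv_const_mul hg]
  simp

theorem pd_add {i : Fin 3} {f g : V3 → ℝ} {x : V3} (hf : DifferentiableAt ℝ f x)
    (hg : DifferentiableAt ℝ g x) : pd i (fun y => f y + g y) x = pd i f x + pd i g x := by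
  simp only [pd]
  rw [fderiv_fun_add hf hg]
  simp

theorem pd_sum {ι : Type*} {t : Finset ι} {i : Fin 3} {f : ι → V3 → ℝ} {x : V3}
    (hf : ∀ j ∈ t, DifferentiableAt ℝ (f j) x) :
    pd i (fun y => ∑ j ∈ t, f j y) x = ∑ j ∈ t, pd i (f j) x := by
  simp only [pd]
  rw [fderiv_fun_sum hf]
  simp

theorem pd_congr {i : Fin 3} {f g : V3 → ℝ} {x : V3} (h : f =ᶠ[nhds x] g) :
    pd i f x = pd i g x := by
  simp only [pd]
  rw [h.fderiv_eq]

theorem continuous_pd {i : Fin 3} {f : V3 → ℝ} (hf : ContDiff ℝ 1 f) : Continuous (pd i f) :=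
  (hf.continuous_fderiv (by norm_num)).clm_apply continuous_const

theorem continuousOn_pd {i : Fin 3} {f : V3 → ℝ} {U : Set V3} (hU : IsOpen U)
    (hf : ContDiffOn ℝ 1 f U) : ContinuousOn (pd i f) U :=
  (hf.continuousOn_fderiv_of_isOpen hU (by norm_num)).clm_apply continuousOn_const

theorem hasCompactSupport_pd {i : Fin 3} {f : V3 → ℝ} (hf : HasCompactSupport f) :
    HasCompactSupport (pd i f) :=
  hf.fderiv_apply (𝕜 := ℝ) (Pi.single i (1 : ℝ))

theorem pd_eq_zero_of_notMem_tsupport {i : Fin 3} {f : V3 → ℝ} {x : V3} (h : x ∉ tsupport f) :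
    pd i f x = 0 := by
  simp only [pd]
  rw [fderiv_of_notMem_tsupport (𝕜 := ℝ) h]
  rfl

theorem integral_pd_eq_zero (i : Fin 3) {g : V3 → ℝ} (hg : ContDiff ℝ 1 g)
    (hc : HasCompactSupport g) : ∫ x, pd i g x = 0 := by
  have h1 : Integrable (pd i g) :=
    (continuous_pd hg).integrable_of_hasCompactSupport (hasCompactSupport_pd hc)
  have h2 : Integrable g := hg.continuous.integrable_of_hasCompactSupport hc
  -- Integration by parts against the constant function one.
  have h := integral_mul_fderiv_eq_neg_fderiv_mul_of_integrable (μ := (volume : Measure V3))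
    (f := fun _ : V3 => (1 : ℝ)) (g := g) (v := Pi.single i (1 : ℝ)) (by simp)
    (by simp only [one_mul]; exact h1) (by simpa only [one_mul] using h2)
    (fun x _ => differentiableAt_const _) (fun x _ => hg.differentiable (by norm_num) x)
  simpa [pd] using h

theorem integral_diver_eq_zero {G : V3 → V3} (hG : ∀ i, ContDiff ℝ 1 (fun x => G x i))
    (hc : ∀ i, HasCompactSupport (fun x => G x i)) : ∫ x, diver G x = 0 := by
  simp only [diver]
  rw [integral_finsetSum]
  · exact Finset.sum_eq_zero fun i _ => integral_pd_eq_zero i (hG i) (hc i)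
  · intro i _
    exact (continuous_pd (hG i)).integrable_of_hasCompactSupport (hasCompactSupport_pd (hc i))

/-! ### Structure constants of the exterior derivative -/

/-- The structure constants of grad, curl and div: the `b`-th component of the exterior derivative
of `u` is `∑ i a, cc s i a b * ∂ᵢ uₐ`. -/
def cc : (s : Fin 3) → Fin 3 → Fin (proxyDim s) → Fin (proxyDim (s + 1)) → ℝ
  | 0 => fun i _ (b : Fin 3) => if i = b then 1 else 0
  | 1 => fun i (a b : Fin 3) =>
      if b = i + 1 ∧ a = i + 2 then -1 else if b = i + 2 ∧ a = i + 1 then 1 else 0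
  | 2 => fun i (a : Fin 3) _ => if i = a then 1 else 0

/-- The classical exterior derivative of an `s`-form. -/
def extD (s : Fin 3) (u : Form s) : Form (s + 1) := fun x b =>
  ∑ i, ∑ a, cc s i a b * pd i (fun y => u y a) x

/-- The vector field whose divergence occurs in Green's formula. -/
def flux (s : Fin 3) (u : Fin (proxyDim s) → ℝ) (v : Fin (proxyDim (s + 1)) → ℝ) : V3 := fun i =>
  ∑ a, ∑ b, cc s i a b * (u a * v b)

/-- The symbol of the exterior derivative, that is, the exterior product with a covector. -/
def symb (s : Fin 3) (n : V3) (u : Fin (proxyDim s) → ℝ) : Fin (proxyDim (s + 1)) → ℝ := fun b =>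
  ∑ i, ∑ a, cc s i a b * (n i * u a)

/-- Expresses the three adjoints by the same constants as `extD`, so that the analysis needs no
distinction between the degrees. -/
theorem dot_codiff (s : Fin 3) (w : Fin (proxyDim s) → ℝ) (v : Form (s + 1)) (x : V3) :
    w ⬝ᵥ codiff s v x = -∑ i, ∑ a, ∑ b, cc s i a b * (w a * pd i (fun y => v y b) x) := by
  fin_cases s
  · change ∑ a : Fin 1, w a * (-diver v x) = -∑ i : Fin 3, ∑ a : Fin 1, ∑ b : Fin 3,
      (if i = b then (1 : ℝ) else 0) * (w a * pd i (fun y => v y b) x)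
    simp [diver, Fin.sum_univ_three]
    ring
  · change ∑ a : Fin 3, w a * (curl v x a) = -∑ i : Fin 3, ∑ a : Fin 3, ∑ b : Fin 3,
      (if b = i + 1 ∧ a = i + 2 then (-1 : ℝ) else if b = i + 2 ∧ a = i + 1 then 1 else 0) *
        (w a * pd i (fun y => v y b) x)
    simp [curl, Fin.sum_univ_three]
    ring
  · change ∑ a : Fin 3, w a * (-grad (fun y => v y (0 : Fin 1)) x a) = -∑ i : Fin 3, ∑ a : Fin 3,
      ∑ b : Fin 1, (if i = a then (1 : ℝ) else 0) * (w a * pd i (fun y => v y b) x)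
    simp [grad, Fin.sum_univ_three]

/-- Identifies the boundary integrand of Green's formula: on a face with normal `n` the form enters
only through `symb s n u`. -/
theorem dot_flux (s : Fin 3) (n : V3) (u : Fin (proxyDim s) → ℝ)
    (v : Fin (proxyDim (s + 1)) → ℝ) : n ⬝ᵥ flux s u v = symb s n u ⬝ᵥ v := by
  simp only [dotProduct, flux, symb, Finset.mul_sum, Finset.sum_mul]
  conv_rhs => rw [Finset.sum_comm]
  refine Finset.sum_congr rfl fun i _ => ?_
  rw [Finset.sum_comm]
  refine Finset.sum_congr rfl fun b _ => Finset.sum_congr rfl fun a _ => ?_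
  ring

/-- The pointwise form of Green's formula. In the product rule the derivatives of `u` produce `extD`
and those of `v` produce `codiff`, with the sign built into `dot_codiff`. -/
theorem diver_flux (s : Fin 3) {u : Form s} {v : Form (s + 1)} {x : V3}
    (hu : ∀ a, DifferentiableAt ℝ (fun y => u y a) x)
    (hv : ∀ b, DifferentiableAt ℝ (fun y => v y b) x) :
    diver (fun y => flux s (u y) (v y)) x = extD s u x ⬝ᵥ v x - u x ⬝ᵥ codiff s v x := by
  rw [dot_codiff]
  have h1 : ∀ i, pd i (fun y => flux s (u y) (v y) i) x =
      ∑ a, ∑ b, cc s i a b * (u x a * pd i (fun y => v y b) x + pd i (fun y => u y a) x * v x b) := by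
    intro i
    simp only [flux]
    rw [pd_sum fun a _ => DifferentiableAt.fun_sum fun b _ =>
      (((hu a).fun_mul (hv b)).const_mul _)]
    refine Finset.sum_congr rfl fun a _ => ?_
    rw [pd_sum fun b _ => (((hu a).fun_mul (hv b)).const_mul _)]
    refine Finset.sum_congr rfl fun b _ => ?_
    rw [pd_const_mul ((hu a).fun_mul (hv b)), pd_mul (hu a) (hv b)]
  simp only [diver, h1, mul_add, Finset.sum_add_distrib, sub_neg_eq_add]
  rw [add_comm]
  congr 1
  simp only [dotProduct, extD, Finset.sum_mul]
  conv_rhs => rw [Finset.sum_comm]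
  refine Finset.sum_congr rfl fun i _ => ?_
  rw [Finset.sum_comm]
  refine Finset.sum_congr rfl fun b _ => Finset.sum_congr rfl fun a _ => ?_
  ring

/-- Cutting off a test field creates only one new term, in which `grad φ` is paired with `flux`. The
limit arguments below amount to controlling this term. -/
theorem dot_codiff_mul (s : Fin 3) (w : Fin (proxyDim s) → ℝ) {φ : V3 → ℝ} {v : Form (s + 1)}
    {x : V3} (hφ : DifferentiableAt ℝ φ x) (hv : ∀ b, DifferentiableAt ℝ (fun y => v y b) x) :
    w ⬝ᵥ codiff s (fun y => φ y • v y) x =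
      φ x * (w ⬝ᵥ codiff s v x) - grad φ x ⬝ᵥ flux s w (v x) := by
  simp only [dot_codiff, Pi.smul_apply, smul_eq_mul]
  simp only [fun i b => pd_mul (i := i) hφ (hv b), dotProduct, flux, grad, Finset.mul_sum,
    mul_neg, ← Finset.sum_neg_distrib, ← Finset.sum_sub_distrib]
  refine Finset.sum_congr rfl fun i _ => Finset.sum_congr rfl fun a _ =>
    Finset.sum_congr rfl fun b _ => ?_
  ring

/-! ### Weak derivatives and the trace operator -/

/-- A smooth compactly supported field as a test field. -/
def mkTest (s : Fin 3) (f : Form (s + 1)) (hf : ContDiff ℝ ((⊤ : ℕ∞) : WithTop ℕ∞) f)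
    (hc : HasCompactSupport f) : Test s :=
  TestFunction.mk f hf hc (by simp)

@[simp]
theorem mkTest_apply (s : Fin 3) (f : Form (s + 1)) (hf : ContDiff ℝ ((⊤ : ℕ∞) : WithTop ℕ∞) f)
    (hc : HasCompactSupport f) (x : V3) : mkTest s f hf hc x = f x := rfl

/-- The product of a smooth function and a test field. -/
def mulTest {s : Fin 3} (φ : V3 → ℝ) (hφ : ContDiff ℝ ((⊤ : ℕ∞) : WithTop ℕ∞) φ) (v : Test s) :
    Test s :=
  mkTest s (fun x => φ x • v x) (hφ.smul v.contDiff) (v.hasCompactSupport.smul_left (f := φ))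

theorem coe_mulTest {s : Fin 3} (φ : V3 → ℝ) (hφ : ContDiff ℝ ((⊤ : ℕ∞) : WithTop ℕ∞) φ)
    (v : Test s) : (mulTest φ hφ v : V3 → _) = fun x => φ x • v x := rfl

theorem Test.contDiff_apply {s : Fin 3} (v : Test s) (b : Fin (proxyDim (s + 1))) :
    ContDiff ℝ ((⊤ : ℕ∞) : WithTop ℕ∞) (fun x => v x b) :=
  contDiff_pi.1 v.contDiff b

theorem Test.contDiff_one {s : Fin 3} (v : Test s) (b : Fin (proxyDim (s + 1))) :
    ContDiff ℝ 1 (fun x => v x b) :=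
  (v.contDiff_apply b).of_le (by exact_mod_cast le_top)

theorem Test.differentiable_apply {s : Fin 3} (v : Test s) (b : Fin (proxyDim (s + 1))) :
    Differentiable ℝ (fun x => v x b) :=
  (v.contDiff_one b).differentiable (by norm_num)

theorem Test.hasCompactSupport_apply {s : Fin 3} (v : Test s) (b : Fin (proxyDim (s + 1))) :
    HasCompactSupport (fun x => v x b) :=
  v.hasCompactSupport.comp_left (g := fun w : Fin (proxyDim (s + 1)) → ℝ => w b) rfl

theorem Test.memLp_apply {s : Fin 3} (v : Test s) (b : Fin (proxyDim (s + 1)))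
    (μ : Measure V3) [IsFiniteMeasureOnCompacts μ] : MemLp (fun x => v x b) 2 μ :=
  (v.contDiff_one b).continuous.memLp_of_hasCompactSupport (v.hasCompactSupport_apply b)

theorem Test.memLp_pd {s : Fin 3} (v : Test s) (b : Fin (proxyDim (s + 1))) (i : Fin 3)
    (μ : Measure V3) [IsFiniteMeasureOnCompacts μ] : MemLp (pd i fun x => v x b) 2 μ :=
  (continuous_pd (v.contDiff_one b)).memLp_of_hasCompactSupport
    (hasCompactSupport_pd (v.hasCompactSupport_apply b))

theorem memLp_apply {n : ℕ} {g : V3 → Fin n → ℝ} {μ : Measure V3} (hg : MemLp g 2 μ) (b : Fin n) :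
    MemLp (fun x => g x b) 2 μ := by
  refine MemLp.mono hg ?_ (Filter.Eventually.of_forall fun x => norm_le_pi_norm (g x) b)
  exact (continuous_apply b).comp_aestronglyMeasurable hg.1

theorem memLp_pi {n : ℕ} {g : V3 → Fin n → ℝ} {μ : Measure V3}
    (hg : ∀ b, MemLp (fun x => g x b) 2 μ) : MemLp g 2 μ := by
  refine MemLp.mono (g := fun x => ∑ b, ‖g x b‖) (memLp_finsetSum _ fun b _ => (hg b).norm) ?_ ?_
  · have : AEMeasurable g μ := aemeasurable_pi_lambda _ fun b => (hg b).1.aemeasurable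
    exact this.aestronglyMeasurable
  · refine Filter.Eventually.of_forall fun x => ?_
    refine (pi_norm_le_iff_of_nonneg (norm_nonneg _)).2 fun b => ?_
    refine le_trans ?_ (le_abs_self _)
    exact Finset.single_le_sum (f := fun b => ‖g x b‖) (fun _ _ => norm_nonneg _) (Finset.mem_univ b)

theorem integrable_dot {n : ℕ} {g w : V3 → Fin n → ℝ} {μ : Measure V3}
    (hg : ∀ b, MemLp (fun x => g x b) 2 μ) (hw : ∀ b, MemLp (fun x => w x b) 2 μ) :
    Integrable (fun x => g x ⬝ᵥ w x) μ := by
  simp only [dotProduct]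
  exact integrable_finsetSum _ fun b _ => (hg b).integrable_mul (hw b)

theorem integrable_dot_test {s : Fin 3} {g : Form (s + 1)} {μ : Measure V3}
    [IsFiniteMeasureOnCompacts μ] (hg : MemLp g 2 μ) (v : Test s) :
    Integrable (fun x => g x ⬝ᵥ v x) μ :=
  integrable_dot (memLp_apply hg) fun b => v.memLp_apply b μ

theorem integrable_dot_codiff {s : Fin 3} {u : Form s} {μ : Measure V3}
    [IsFiniteMeasureOnCompacts μ] (hu : MemLp u 2 μ) (v : Test s) :
    Integrable (fun x => u x ⬝ᵥ codiff s v x) μ := by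
  simp only [dot_codiff]
  refine Integrable.neg ?_
  refine integrable_finsetSum _ fun i _ => integrable_finsetSum _ fun a _ =>
    integrable_finsetSum _ fun b _ => Integrable.const_mul ?_ _
  exact (memLp_apply hu a).integrable_mul (v.memLp_pd b i μ)

/-- Compact sets with a negligible boundary. -/
structure IsBody (K : Set V3) : Prop where
  isCompact : IsCompact K
  ae_mem_interior : ∀ᵐ x ∂(volume.restrict K), x ∈ interior K

/-- Test fields supported in the interior determine the weak derivative there, and the boundary of a
body is negligible. Hence the choice made in `weakD` is immaterial. -/
theorem HasWeakD.ae_eq {s : Fin 3} {K : Set V3} (hK : IsBody K) {u : Form s} {g g' : Form (s + 1)}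
    (h : HasWeakD s K u g) (h' : HasWeakD s K u g') : g =ᵐ[volume.restrict K] g' := by
  have key : ∀ b, ∀ᵐ x ∂(volume.restrict K), x ∈ interior K → g x b - g' x b = 0 := by
    intro b
    refine isOpen_interior.ae_eq_zero_of_integral_contDiff_smul_eq_zero ?_ ?_
    · have h1 : MemLp (fun x => g x b - g' x b) 2 (volume.restrict K) :=
        (memLp_apply h.1 b).sub (memLp_apply h'.1 b)
      exact (h1.locallyIntegrable (by norm_num)).locallyIntegrableOn _
    · intro φ hφ hc hs
      let v : Test s := mkTest s (fun x => φ x • Pi.single b (1 : ℝ))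
        (hφ.smul contDiff_const) (hc.smul_right)
      have hv : tsupport v ⊆ interior K := by
        refine Set.Subset.trans (closure_mono ?_) hs
        intro x hx hx'
        apply hx
        change φ x • Pi.single b (1 : ℝ) = 0
        rw [hx', zero_smul]
      have e : ∫ x in K, g x ⬝ᵥ v x = ∫ x in K, g' x ⬝ᵥ v x := by
        rw [← h.2 v hv, ← h'.2 v hv]
      rw [← sub_eq_zero, ← integral_sub (integrable_dot_test h.1 v) (integrable_dot_test h'.1 v)] at e
      rw [← e]
      refine integral_congr_ae (Filter.Eventually.of_forall fun x => ?_)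
      change φ x • (g x b - g' x b) = g x ⬝ᵥ (φ x • Pi.single b (1 : ℝ)) -
        g' x ⬝ᵥ (φ x • Pi.single b (1 : ℝ))
      simp [dotProduct_smul]
      ring
  have := ae_all_iff.2 key
  filter_upwards [this, hK.ae_mem_interior] with x hx hxi
  ext b
  exact sub_eq_zero.1 (hx b hxi)

theorem hasWeakD_weakD {s : Fin 3} {K : Set V3} {u : Form s} (hu : u ∈ hSpace s K) :
    HasWeakD s K u (weakD s K u) := by
  rw [weakD, dif_pos hu.2]
  exact hu.2.choose_spec

theorem traceOp_eq {s : Fin 3} {K : Set V3} (hK : IsBody K) {u : Form s} {g : Form (s + 1)}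
    (h : HasWeakD s K u g) (v : Test s) :
    traceOp s K u v = ∫ x in K, (g x ⬝ᵥ v x - u x ⬝ᵥ codiff s v x) := by
  have h0 : HasWeakD s K u (weakD s K u) := by
    rw [weakD, dif_pos ⟨g, h⟩]
    exact Exists.choose_spec (⟨g, h⟩ : ∃ g, HasWeakD s K u g)
  refine integral_congr_ae ?_
  filter_upwards [h0.ae_eq hK h] with x hx
  rw [hx]

theorem HasWeakD.congr_left {s : Fin 3} {K : Set V3} {u u' : Form s} {g : Form (s + 1)}
    (h : HasWeakD s K u g) (e : u =ᵐ[volume.restrict K] u') : HasWeakD s K u' g := by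
  refine ⟨h.1, fun v hv => ?_⟩
  rw [← h.2 v hv]
  refine integral_congr_ae ?_
  filter_upwards [e] with x hx
  rw [hx]

theorem HasWeakD.add_smul {s : Fin 3} {K : Set V3} {u u' : Form s}
    {g g' : Form (s + 1)} (hu : MemLp u 2 (volume.restrict K)) (hu' : MemLp u' 2 (volume.restrict K))
    (h : HasWeakD s K u g) (h' : HasWeakD s K u' g') (c : ℝ) :
    HasWeakD s K (u + c • u') (g + c • g') := by
  refine ⟨h.1.add (h'.1.const_smul c), fun v hv => ?_⟩
  have e1 : ∀ x, (u + c • u') x ⬝ᵥ codiff s v x =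
      u x ⬝ᵥ codiff s v x + c * (u' x ⬝ᵥ codiff s v x) := fun x => by
    simp [add_dotProduct]
  have e2 : ∀ x, (g + c • g') x ⬝ᵥ v x = g x ⬝ᵥ v x + c * (g' x ⬝ᵥ v x) := fun x => by
    simp [add_dotProduct]
  simp only [e1, e2]
  rw [integral_add (integrable_dot_codiff hu v) ((integrable_dot_codiff hu' v).const_mul c),
    integral_add (integrable_dot_test h.1 v) ((integrable_dot_test h'.1 v).const_mul c),
    integral_const_mul, integral_const_mul, h.2 v hv, h'.2 v hv]

theorem add_smul_mem_hSpace {s : Fin 3} {K : Set V3} {u u' : Form s}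
    (hu : u ∈ hSpace s K) (hu' : u' ∈ hSpace s K) (c : ℝ) : u + c • u' ∈ hSpace s K :=
  ⟨hu.1.add (hu'.1.const_smul c), _,
    (hasWeakD_weakD hu).add_smul hu.1 hu'.1 (hasWeakD_weakD hu') c⟩

theorem traceOp_add_smul {s : Fin 3} {K : Set V3} (hK : IsBody K) {u u' : Form s}
    (hu : u ∈ hSpace s K) (hu' : u' ∈ hSpace s K) (c : ℝ) (v : Test s) :
    traceOp s K (u + c • u') v = traceOp s K u v + c * traceOp s K u' v := by
  rw [traceOp_eq hK ((hasWeakD_weakD hu).add_smul hu.1 hu'.1 (hasWeakD_weakD hu') c)]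
  simp only [traceOp]
  rw [← integral_const_mul, ← integral_add]
  · refine integral_congr_ae (Filter.Eventually.of_forall fun x => ?_)
    simp [add_dotProduct]
    ring
  · exact (integrable_dot_test (hasWeakD_weakD hu).1 v).sub (integrable_dot_codiff hu.1 v)
  · exact ((integrable_dot_test (hasWeakD_weakD hu').1 v).sub
      (integrable_dot_codiff hu'.1 v)).const_mul c

/-- By `dot_codiff` the pairing is a finite sum of integrals of square integrable functions against
components of the test field and of its first derivatives; each summand is a composition of
continuous maps. -/
theorem exists_trace_clm {s : Fin 3} {K : Set V3} {u : Form s} (hu : u ∈ hSpace s K) :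
    ∃ D : Test s →L[ℝ] ℝ, ∀ v, D v = traceOp s K u v := by
  set μ := (volume : Measure V3).restrict K
  have hg := (hasWeakD_weakD hu).1
  let I (f : V3 → ℝ) (b : Fin (proxyDim (s + 1))) : Test s →L[ℝ] ℝ :=
    (TestFunction.integralAgainstBilinCLM (ContinuousLinearMap.mul ℝ ℝ) μ f).comp
      (TestFunction.postcompCLM (ContinuousLinearMap.proj b))
  have hI : ∀ f : V3 → ℝ, MemLp f 2 μ → ∀ b (v : Test s), I f b v = ∫ x, v x b * f x ∂μ := by
    intro f hf b v
    change TestFunction.integralAgainstBilinCLM (ContinuousLinearMap.mul ℝ ℝ) μ f _ = _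
    rw [TestFunction.integralAgainstBilinCLM_eq_integral]
    · rfl
    · exact (hf.locallyIntegrable (by norm_num)).locallyIntegrableOn _
  let ld (i : Fin 3) : Test s →L[ℝ] Test s :=
    TestFunction.lineDerivCLM (n := ⊤) (k := ⊤) ℝ (Pi.single i (1 : ℝ))
  have hld : ∀ i (v : Test s) x b, ld i v x b = pd i (fun y => v y b) x := by
    intro i v x b
    change (TestFunction.lineDerivCLM (n := ⊤) (k := ⊤) ℝ (Pi.single i (1 : ℝ)) v) x b = _
    rw [TestFunction.lineDerivCLM_apply_of_le (by simp)]
    have hd : DifferentiableAt ℝ v x := differentiableAt_pi.2 fun b => v.differentiable_apply b x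
    rw [hd.lineDeriv_eq_fderiv]
    simp only [pd]
    rw [fderiv_apply hd]
    rfl
  refine ⟨∑ b, I (fun x => weakD s K u x b) b + ∑ i, ∑ a, ∑ b,
    cc s i a b • (I (fun x => u x a) b).comp (ld i), fun v => ?_⟩
  rw [traceOp, integral_sub (integrable_dot_test hg v) (integrable_dot_codiff hu.1 v)]
  simp only [dot_codiff]
  rw [integral_neg, sub_neg_eq_add, add_apply]
  have hInt : ∀ i a b, Integrable (fun x => cc s i a b * (u x a * pd i (fun y => v y b) x)) μ :=
    fun i a b => ((memLp_apply hu.1 a).integrable_mul (v.memLp_pd b i μ)).const_mul _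
  congr 1
  · simp only [dotProduct, sum_apply]
    rw [integral_finsetSum]
    · refine Finset.sum_congr rfl fun b _ => ?_
      rw [hI _ (memLp_apply hg b)]
      simp only [mul_comm]
      rfl
    · exact fun b _ => (memLp_apply hg b).integrable_mul (v.memLp_apply b μ)
  · simp only [sum_apply]
    rw [integral_finsetSum _ fun i _ => integrable_finsetSum _ fun a _ =>
      integrable_finsetSum _ fun b _ => hInt i a b]
    refine Finset.sum_congr rfl fun i _ => ?_
    rw [integral_finsetSum _ fun a _ => integrable_finsetSum _ fun b _ => hInt i a b]
    refine Finset.sum_congr rfl fun a _ => ?_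
    rw [integral_finsetSum _ fun b _ => hInt i a b]
    refine Finset.sum_congr rfl fun b _ => ?_
    rw [integral_const_mul]
    change cc s i a b * (I (fun x => u x a) b (ld i v)) = _
    rw [hI _ (memLp_apply hu.1 a)]
    simp only [hld, mul_comm (u _ a)]

/-- Fields that are continuously differentiable in the interior have the classical derivative. -/
theorem hasWeakD_extD {s : Fin 3} {K : Set V3} (hK : IsBody K) {u : Form s}
    (hu : ∀ a, ContDiffOn ℝ 1 (fun x => u x a) (interior K))
    (hd : MemLp (extD s u) 2 (volume.restrict K)) : HasWeakD s K u (extD s u) := by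
  refine ⟨hd, fun v hv => ?_⟩
  -- the field `flux u v`, extended by zero, is smooth with compact support
  set G : V3 → V3 := fun x => flux s (u x) (v x)
  have hGs : ∀ i, tsupport (fun x => G x i) ⊆ tsupport v := by
    intro i
    refine closure_mono fun x hx hx' => hx ?_
    simp [G, flux, hx']
  have hG : ∀ i, ContDiff ℝ 1 (fun x => G x i) := by
    intro i
    rw [contDiff_iff_contDiffAt]
    intro x
    by_cases hx : x ∈ interior K
    · refine ContDiffAt.sum fun a _ => ContDiffAt.sum fun b _ => contDiffAt_const.mul
        (ContDiffAt.mul ?_ (v.contDiff_one b).contDiffAt)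
      exact (hu a).contDiffAt (isOpen_interior.mem_nhds hx)
    · have : x ∉ tsupport (fun x => G x i) := fun h => hx (hv (hGs i h))
      rw [notMem_tsupport_iff_eventuallyEq] at this
      exact contDiffAt_const.congr_of_eventuallyEq this
  have hc : ∀ i, HasCompactSupport (fun x => G x i) := fun i =>
    v.hasCompactSupport.of_isClosed_subset (isClosed_tsupport _) (hGs i)
  have h0 := integral_diver_eq_zero hG hc
  have hout : ∀ x ∉ interior K, diver G x = 0 := by
    intro x hx
    exact Finset.sum_eq_zero fun i _ => pd_eq_zero_of_notMem_tsupport fun h => hx (hv (hGs i h))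
  have h1 : ∫ x in K, diver G x = 0 := by
    rw [setIntegral_eq_integral_of_forall_compl_eq_zero, h0]
    exact fun x hx => hout x fun h => hx (interior_subset h)
  have h2 : ∫ x in K, (extD s u x ⬝ᵥ v x - u x ⬝ᵥ codiff s v x) = 0 := by
    rw [← h1]
    refine integral_congr_ae ?_
    filter_upwards [hK.ae_mem_interior] with x hx
    rw [diver_flux]
    · intro a
      exact ((hu a).contDiffAt (isOpen_interior.mem_nhds hx)).differentiableAt (by norm_num)
    · exact fun b => v.differentiable_apply b x
  -- No integrability of `u` is assumed. In the pointwise Green formula the other two terms are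
  -- integrable, so this one must be as well.
  by_cases hi : Integrable (fun x => u x ⬝ᵥ codiff s v x) (volume.restrict K)
  · rw [integral_sub (integrable_dot_test hd v) hi] at h2
    linarith
  · exfalso
    apply hi
    have h3 : Integrable (diver G) (volume.restrict K) := by
      refine Integrable.restrict ?_
      change Integrable (fun x => ∑ i, pd i (fun y => G y i) x) _
      exact integrable_finsetSum _ fun i _ =>
        (continuous_pd (hG i)).integrable_of_hasCompactSupport (hasCompactSupport_pd (hc i))
    refine ((integrable_dot_test hd v).sub h3).congr ?_
    filter_upwards [hK.ae_mem_interior] with x hx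
    simp only [Pi.sub_apply]
    rw [diver_flux]
    · ring
    · intro a
      exact ((hu a).contDiffAt (isOpen_interior.mem_nhds hx)).differentiableAt (by norm_num)
    · exact fun b => v.differentiable_apply b x

/-! ### Affine functions and polyhedra -/

/-- The gradient of an affine function. -/
def nv (l : V3 →ᵃ[ℝ] ℝ) : V3 := fun i => l.linear (Pi.single i 1)

theorem linear_eq_dot (l : V3 →ᵃ[ℝ] ℝ) (x : V3) : l.linear x = nv l ⬝ᵥ x := by
  conv_lhs => rw [← Finset.univ_sum_single x]
  rw [map_sum]
  refine Finset.sum_congr rfl fun i _ => ?_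
  have : (Pi.single i (x i) : V3) = x i • Pi.single i 1 := by simp [← Pi.single_smul]
  rw [this, map_smul, nv, smul_eq_mul, mul_comm]

theorem aff_add (l : V3 →ᵃ[ℝ] ℝ) (x e : V3) : l (x + e) = l x + nv l ⬝ᵥ e := by
  rw [← linear_eq_dot, add_comm x e]
  have := l.map_vadd x e
  simpa [vadd_eq_add, add_comm] using this

theorem hasFDerivAt_aff (l : V3 →ᵃ[ℝ] ℝ) (x : V3) :
    HasFDerivAt l (LinearMap.toContinuousLinearMap l.linear) x := by
  have h : (l : V3 → ℝ) = fun y => LinearMap.toContinuousLinearMap l.linear y + l 0 := by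
    ext y
    have := aff_add l 0 y
    rw [zero_add] at this
    simp [this, linear_eq_dot, add_comm]
  rw [h]
  exact (ContinuousLinearMap.hasFDerivAt _).add_const _

theorem contDiff_aff (l : V3 →ᵃ[ℝ] ℝ) {n : WithTop ℕ∞} : ContDiff ℝ n l := by
  have h : (l : V3 → ℝ) = fun y => LinearMap.toContinuousLinearMap l.linear y + l 0 := by
    ext y
    have := aff_add l 0 y
    rw [zero_add] at this
    simp [this, linear_eq_dot, add_comm]
  rw [h]
  exact (ContinuousLinearMap.contDiff _).add contDiff_const

theorem pd_aff (l : V3 →ᵃ[ℝ] ℝ) (i : Fin 3) (x : V3) : pd i l x = nv l i := by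
  simp only [pd]
  rw [(hasFDerivAt_aff l x).fderiv]
  rfl

theorem continuous_aff (l : V3 →ᵃ[ℝ] ℝ) : Continuous l := (contDiff_aff l (n := 0)).continuous

theorem dot_self_pos {n : V3} (hn : n ≠ 0) : 0 < n ⬝ᵥ n := by
  have h0 : 0 ≤ n ⬝ᵥ n := Finset.sum_nonneg fun i _ => mul_self_nonneg _
  exact lt_of_le_of_ne h0 fun h => hn (dotProduct_self_eq_zero.1 h.symm)

theorem volume_aff_eq_zero {l : V3 →ᵃ[ℝ] ℝ} (hl : nv l ≠ 0) : volume {x | l x = 0} = 0 := by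
  have h : {x | l x = 0} = ((AffineSubspace.mk' (0 : ℝ) ⊥).comap l : Set V3) := by
    ext x
    simp [AffineSubspace.mem_mk']
  rw [h]
  refine Measure.addHaar_affineSubspace _ _ fun htop => ?_
  have hall : ∀ x, l x = 0 := by
    intro x
    have hx : x ∈ ((AffineSubspace.mk' (0 : ℝ) ⊥).comap l : Set V3) := by rw [htop]; simp
    rw [← h] at hx
    exact hx
  have h1 := aff_add l 0 (nv l)
  rw [hall, hall] at h1
  have := dot_self_pos hl
  linarith

/-- The set `K` is the compact polyhedron cut out by the inequalities `0 ≤ l j`, none of which is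
superfluous. -/
structure IsPoly {ι : Type*} (l : ι → V3 →ᵃ[ℝ] ℝ) (K : Set V3) : Prop where
  mem_iff : ∀ x, x ∈ K ↔ ∀ j, 0 ≤ l j x
  bounded : Bornology.IsBounded K
  nv_ne : ∀ j, nv (l j) ≠ 0
  face : ∀ j, ∃ x, l j x = 0 ∧ ∀ i ≠ j, 0 < l i x

/-- The relative interior of a face. -/
def openFace {ι : Type*} (l : ι → V3 →ᵃ[ℝ] ℝ) (i : ι) : Set V3 :=
  {x | l i x = 0 ∧ ∀ j ≠ i, 0 < l j x}

section Poly

variable {ι : Type*} {l : ι → V3 →ᵃ[ℝ] ℝ} {K : Set V3}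

theorem isOpen_pos [Finite ι] (l : ι → V3 →ᵃ[ℝ] ℝ) (p : ι → Prop) : IsOpen {x | ∀ j, p j → 0 < l j x} := by
  have : {x | ∀ j, p j → 0 < l j x} = ⋂ j, {x | p j → 0 < l j x} := by ext; simp
  rw [this]
  refine isOpen_iInter_of_finite fun j => ?_
  by_cases h : p j
  · simpa [h] using isOpen_lt continuous_const (continuous_aff (l j))
  · simp [h]

theorem IsPoly.isClosed (h : IsPoly l K) : IsClosed K := by
  have : K = ⋂ j, {x | 0 ≤ l j x} := by ext x; simp [h.mem_iff]
  rw [this]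
  exact isClosed_iInter fun j => isClosed_le continuous_const (continuous_aff (l j))

theorem IsPoly.isCompact (h : IsPoly l K) : IsCompact K :=
  Metric.isCompact_of_isClosed_isBounded h.isClosed h.bounded

theorem IsPoly.mem_interior [Finite ι] (h : IsPoly l K) {x : V3} : x ∈ interior K ↔ ∀ j, 0 < l j x := by
  constructor
  · intro hx j
    have h0 : 0 ≤ l j x := (h.mem_iff x).1 (interior_subset hx) j
    rcases h0.lt_or_eq with h0 | h0
    · exact h0
    exfalso
    -- At a point where `l j` vanishes, an arbitrarily small step against its gradient leaves `K`.
    have hc : Continuous fun t : ℝ => x + t • nv (l j) := by fun_prop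
    have hn : ∀ᶠ t : ℝ in nhds 0, x + t • nv (l j) ∈ interior K := by
      refine hc.continuousAt.eventually_mem ?_
      simpa using isOpen_interior.mem_nhds hx
    obtain ⟨ε, hε, hb⟩ := Metric.eventually_nhds_iff.1 hn
    have := hb (y := -(ε / 2)) (by
      rw [Real.dist_eq, sub_zero, abs_neg, abs_of_pos (by linarith)]
      linarith)
    have h1 := (h.mem_iff _).1 (interior_subset this) j
    rw [aff_add, ← h0, dotProduct_smul, smul_eq_mul] at h1
    have := dot_self_pos (h.nv_ne j)
    nlinarith
  · intro hx
    refine _root_.mem_interior.2 ⟨{x | ∀ j, True → 0 < l j x}, ?_, isOpen_pos l _, by simpa using hx⟩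
    intro y hy
    exact (h.mem_iff y).2 fun j => (hy j trivial).le

theorem IsPoly.mem_frontier [Finite ι] (h : IsPoly l K) {x : V3} :
    x ∈ frontier K ↔ x ∈ K ∧ ∃ j, l j x = 0 := by
  rw [h.isClosed.frontier_eq, Set.mem_sdiff, h.mem_interior]
  refine and_congr_right fun hx => ?_
  push Not
  refine exists_congr fun j => ?_
  exact ⟨fun h' => le_antisymm h' ((h.mem_iff x).1 hx j), fun h' => h'.le⟩

theorem IsPoly.isBody [Finite ι] (h : IsPoly l K) : IsBody K := by
  refine ⟨h.isCompact, ?_⟩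
  have h1 : ∀ᵐ x ∂(volume.restrict K), ∀ j, l j x ≠ 0 := by
    rw [ae_all_iff]
    intro j
    refine ae_restrict_of_ae ?_
    rw [ae_iff]
    simpa using volume_aff_eq_zero (h.nv_ne j)
  filter_upwards [h1, ae_restrict_mem h.isClosed.measurableSet] with x hx hxK
  exact h.mem_interior.2 fun j => lt_of_le_of_ne ((h.mem_iff x).1 hxK j) (hx j).symm

end Poly

/-! ### Cutoff functions -/

/-- A smooth function that vanishes for `m * t ≤ 1` and equals one for `2 ≤ m * t`. -/
def chi (m : ℕ) (t : ℝ) : ℝ := Real.smoothTransition (m * t - 1)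

/-- The derivative of the smooth transition. -/
def stD (t : ℝ) : ℝ := deriv Real.smoothTransition t

theorem contDiff_chi (m : ℕ) : ContDiff ℝ ((⊤ : ℕ∞) : WithTop ℕ∞) (chi m) :=
  Real.smoothTransition.contDiff.comp ((contDiff_const.mul contDiff_id).sub contDiff_const)

theorem hasDerivAt_chi (m : ℕ) (t : ℝ) : HasDerivAt (chi m) (m * stD (m * t - 1)) t := by
  have h1 : HasDerivAt Real.smoothTransition (stD (m * t - 1)) (m * t - 1) :=
    ((Real.smoothTransition.contDiff (n := 1)).differentiable (by norm_num) _).hasDerivAt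
  have h2 : HasDerivAt (fun t : ℝ => m * t - 1) (m : ℝ) t := by
    simpa using ((hasDerivAt_id t).const_mul (m : ℝ)).sub_const 1
  have := h1.comp t h2
  rw [mul_comm]
  exact this

theorem chi_of_le {m : ℕ} {t : ℝ} (h : m * t ≤ 1) : chi m t = 0 :=
  Real.smoothTransition.zero_of_nonpos (by linarith)

theorem chi_of_ge {m : ℕ} {t : ℝ} (h : 2 ≤ m * t) : chi m t = 1 :=
  Real.smoothTransition.one_of_one_le (by linarith)

theorem chi_mem (m : ℕ) (t : ℝ) : chi m t ∈ Set.Icc (0 : ℝ) 1 :=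
  ⟨Real.smoothTransition.nonneg _, Real.smoothTransition.le_one _⟩

theorem stD_of_neg {t : ℝ} (h : t < 0) : stD t = 0 := by
  have : Real.smoothTransition =ᶠ[nhds t] fun _ => (0 : ℝ) := by
    filter_upwards [Iio_mem_nhds h] with y hy
    exact Real.smoothTransition.zero_of_nonpos (le_of_lt hy)
  rw [stD, this.deriv_eq, deriv_const]

theorem stD_of_gt {t : ℝ} (h : 1 < t) : stD t = 0 := by
  have : Real.smoothTransition =ᶠ[nhds t] fun _ => (1 : ℝ) := by
    filter_upwards [Ioi_mem_nhds h] with y hy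
    exact Real.smoothTransition.one_of_one_le (le_of_lt hy)
  rw [stD, this.deriv_eq, deriv_const]

theorem contDiff_stD : ContDiff ℝ ((⊤ : ℕ∞) : WithTop ℕ∞) stD :=
  (contDiff_infty_iff_deriv.1 Real.smoothTransition.contDiff).2

theorem stD_nonneg (t : ℝ) : 0 ≤ stD t := Real.smoothTransition.monotone.deriv_nonneg

theorem exists_stD_le : ∃ C, 0 < C ∧ ∀ t, |stD t| ≤ C := by
  have hc : HasCompactSupport stD := by
    refine HasCompactSupport.intro (isCompact_Icc (a := (0 : ℝ)) (b := 1)) fun t ht => ?_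
    rw [Set.mem_Icc, not_and_or, not_le, not_le] at ht
    rcases ht with ht | ht
    · exact stD_of_neg ht
    · exact stD_of_gt ht
  obtain ⟨C, hC⟩ := hc.exists_bound_of_continuous contDiff_stD.continuous
  exact ⟨max C 1, by positivity, fun t => (hC t).trans (le_max_left _ _)⟩

/-- The tuple of cutoff functions of several affine functions. -/
def cut {ι : Type*} (l : ι → V3 →ᵃ[ℝ] ℝ) (m : ℕ) (x : V3) : ι → ℝ := fun j => chi m (l j x)

theorem cut_mem {ι : Type*} (l : ι → V3 →ᵃ[ℝ] ℝ) (m : ℕ) (x : V3) :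
    cut l m x ∈ Set.Icc (0 : ι → ℝ) 1 :=
  ⟨fun _ => (chi_mem _ _).1, fun _ => (chi_mem _ _).2⟩

theorem contDiff_chi_aff (l : V3 →ᵃ[ℝ] ℝ) (m : ℕ) :
    ContDiff ℝ ((⊤ : ℕ∞) : WithTop ℕ∞) (fun x => chi m (l x)) :=
  (contDiff_chi m).comp (contDiff_aff l)

theorem contDiff_cut {ι : Type*} [Fintype ι] (l : ι → V3 →ᵃ[ℝ] ℝ) (m : ℕ) :
    ContDiff ℝ ((⊤ : ℕ∞) : WithTop ℕ∞) (cut l m) :=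
  contDiff_pi.2 fun j => contDiff_chi_aff (l j) m

theorem pd_comp_aff {f : ℝ → ℝ} {f' : ℝ} (l : V3 →ᵃ[ℝ] ℝ) {x : V3} (h : HasDerivAt f f' (l x))
    (i : Fin 3) : pd i (fun x => f (l x)) x = f' * nv l i := by
  have := h.comp_hasFDerivAt x (hasFDerivAt_aff l x)
  simp only [pd]
  have e : (fun x => f (l x)) = f ∘ l := rfl
  rw [e, this.fderiv]
  rfl

theorem pd_chi_aff (l : V3 →ᵃ[ℝ] ℝ) (m : ℕ) (i : Fin 3) (x : V3) :
    pd i (fun x => chi m (l x)) x = m * stD (m * l x - 1) * nv l i :=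
  pd_comp_aff l (hasDerivAt_chi m (l x)) i

theorem pd_comp_cut {ι : Type*} [Fintype ι] [DecidableEq ι] (l : ι → V3 →ᵃ[ℝ] ℝ) (m : ℕ)
    {F : (ι → ℝ) → ℝ} (hF : Differentiable ℝ F) (i : Fin 3) (x : V3) :
    pd i (fun x => F (cut l m x)) x =
      ∑ j, fderiv ℝ F (cut l m x) (Pi.single j 1) * (m * stD (m * l j x - 1) * nv (l j) i) := by
  have hd : DifferentiableAt ℝ (cut l m) x := (contDiff_cut l m).differentiable (by simp) x
  simp only [pd]
  have e : (fun x => F (cut l m x)) = F ∘ cut l m := rfl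
  rw [e, fderiv_comp x (hF _) hd, ContinuousLinearMap.comp_apply]
  set w := fderiv ℝ (cut l m) x (Pi.single i 1) with hw
  have hwj : ∀ j, w j = m * stD (m * l j x - 1) * nv (l j) i := by
    intro j
    rw [← pd_chi_aff, pd, hw]
    have := fderiv_apply (𝕜 := ℝ) hd j
    change _ = fderiv ℝ (fun x => cut l m x j) x _
    rw [this]
    rfl
  conv_lhs => rw [← Finset.univ_sum_single w]
  rw [map_sum]
  refine Finset.sum_congr rfl fun j _ => ?_
  have : (Pi.single j (w j) : ι → ℝ) = w j • Pi.single j 1 := by simp [← Pi.single_smul]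
  rw [this, map_smul, smul_eq_mul, hwj, mul_comm]

/-- The cutoffs take values in the unit cube, which is compact, so the bound is uniform in `m` and
`x`. -/
theorem exists_fderiv_cut_le {ι : Type*} [Fintype ι] [DecidableEq ι] {F : (ι → ℝ) → ℝ}
    (hF : ContDiff ℝ 1 F) (l : ι → V3 →ᵃ[ℝ] ℝ) :
    ∃ C, 0 < C ∧ ∀ m x j, |fderiv ℝ F (cut l m x) (Pi.single j 1)| ≤ C := by
  have hc : ∀ j, ∃ C, ∀ y ∈ Set.Icc (0 : ι → ℝ) 1, ‖fderiv ℝ F y (Pi.single j 1)‖ ≤ C := fun j =>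
    isCompact_Icc.exists_bound_of_continuousOn
      ((hF.continuous_fderiv (by norm_num)).clm_apply continuous_const).continuousOn
  choose C hC using hc
  refine ⟨∑ j, |C j| + 1, by positivity, fun m x j => ?_⟩
  refine (hC j _ (cut_mem l m x)).trans ?_
  have := Finset.single_le_sum (f := fun j => |C j|) (fun _ _ => abs_nonneg _) (Finset.mem_univ j)
  linarith [le_abs_self (C j)]

/-! ### Traces only depend on boundary values -/

theorem abs_cc_le (s : Fin 3) (i : Fin 3) (a : Fin (proxyDim s)) (b : Fin (proxyDim (s + 1))) :
    |cc s i a b| ≤ 1 := by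
  match s, a, b with
  | 0, a, b =>
    change |(fun b : Fin 3 => if i = b then (1 : ℝ) else 0) b| ≤ 1
    dsimp only
    split_ifs <;> simp
  | 1, a, b =>
    change |(fun a b : Fin 3 => if b = i + 1 ∧ a = i + 2 then (-1 : ℝ) else
      if b = i + 2 ∧ a = i + 1 then 1 else 0) a b| ≤ 1
    dsimp only
    split_ifs <;> simp
  | 2, a, b =>
    change |(fun a : Fin 3 => if i = a then (1 : ℝ) else 0) a| ≤ 1
    dsimp only
    split_ifs <;> simp

theorem abs_dot_flux_le {s : Fin 3} {n : V3} {v : Fin (proxyDim (s + 1)) → ℝ} {B : ℝ}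
    (h : ∀ i b, |n i * v b| ≤ B) (u : Fin (proxyDim s) → ℝ) :
    |n ⬝ᵥ flux s u v| ≤ B * (3 * proxyDim (s + 1) * ∑ a, |u a|) := by
  have e : n ⬝ᵥ flux s u v = ∑ i, ∑ a, ∑ b, cc s i a b * (u a * (n i * v b)) := by
    simp only [dotProduct, flux, Finset.mul_sum]
    refine Finset.sum_congr rfl fun i _ => Finset.sum_congr rfl fun a _ =>
      Finset.sum_congr rfl fun b _ => ?_
    ring
  rw [e]
  have h1 : ∀ i a b, |cc s i a b * (u a * (n i * v b))| ≤ |u a| * B := by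
    intro i a b
    rw [abs_mul, abs_mul]
    calc |cc s i a b| * (|u a| * |n i * v b|) ≤ 1 * (|u a| * B) := by
          gcongr
          · exact abs_cc_le s i a b
          · exact h i b
      _ = _ := one_mul _
  calc |∑ i, ∑ a, ∑ b, cc s i a b * (u a * (n i * v b))|
      ≤ ∑ i : Fin 3, ∑ a, ∑ b : Fin (proxyDim (s + 1)), |u a| * B := by
        refine (Finset.abs_sum_le_sum_abs _ _).trans (Finset.sum_le_sum fun i _ => ?_)
        refine (Finset.abs_sum_le_sum_abs _ _).trans (Finset.sum_le_sum fun a _ => ?_)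
        exact (Finset.abs_sum_le_sum_abs _ _).trans (Finset.sum_le_sum fun b _ => h1 i a b)
    _ = _ := by
        simp only [Finset.sum_const, Finset.card_univ, Fintype.card_fin, nsmul_eq_mul,
          ← Finset.sum_mul, ← Finset.mul_sum]
        push_cast
        ring

theorem traceOp_mulTest {s : Fin 3} {K : Set V3} {u : Form s} (φ : V3 → ℝ)
    (hφ : ContDiff ℝ ((⊤ : ℕ∞) : WithTop ℕ∞) φ) (v : Test s) :
    traceOp s K u (mulTest φ hφ v) = ∫ x in K,
      (φ x * (weakD s K u x ⬝ᵥ v x - u x ⬝ᵥ codiff s v x) + grad φ x ⬝ᵥ flux s (u x) (v x)) := by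
  refine integral_congr_ae (Filter.Eventually.of_forall fun x => ?_)
  simp only [coe_mulTest]
  rw [dot_codiff_mul s _ (hφ.differentiable (by simp) x) fun b => v.differentiable_apply b x,
    dotProduct_smul, smul_eq_mul]
  ring

theorem integrable_mulTest {s : Fin 3} {K : Set V3} {u : Form s} (hu : u ∈ hSpace s K) (φ : V3 → ℝ)
    (hφ : ContDiff ℝ ((⊤ : ℕ∞) : WithTop ℕ∞) φ) (v : Test s) :
    Integrable (fun x => φ x * (weakD s K u x ⬝ᵥ v x - u x ⬝ᵥ codiff s v x) +
      grad φ x ⬝ᵥ flux s (u x) (v x)) (volume.restrict K) := by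
  refine ((integrable_dot_test (hasWeakD_weakD hu).1 (mulTest φ hφ v)).sub
    (integrable_dot_codiff hu.1 (mulTest φ hφ v))).congr
    (Filter.Eventually.of_forall fun x => ?_)
  simp only [coe_mulTest, Pi.sub_apply]
  rw [dot_codiff_mul s _ (hφ.differentiable (by simp) x) fun b => v.differentiable_apply b x,
    dotProduct_smul, smul_eq_mul]
  ring

/-- The point obtained by moving `x` to the zero set of `l` along its gradient. -/
theorem aff_foot {l : V3 →ᵃ[ℝ] ℝ} (hl : nv l ≠ 0) (x : V3) :
    l (x + (-(l x / (nv l ⬝ᵥ nv l))) • nv l) = 0 := by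
  rw [aff_add, dotProduct_smul, smul_eq_mul, neg_mul, div_mul_cancel₀ _ (dot_self_pos hl).ne']
  ring

/-- A Lipschitz function that vanishes on the zero set of `l` is bounded by a multiple of `l`. -/
theorem abs_le_of_vanish_aff {f : V3 → ℝ} {L : NNReal} (hf : LipschitzWith L f) {l : V3 →ᵃ[ℝ] ℝ}
    (hl : nv l ≠ 0) (h0 : ∀ x, l x = 0 → f x = 0) (x : V3) :
    |f x| ≤ L * ‖nv l‖ / (nv l ⬝ᵥ nv l) * |l x| := by
  have hp := dot_self_pos hl
  have h1 := hf.dist_le_mul x (x + (-(l x / (nv l ⬝ᵥ nv l))) • nv l)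
  rw [h0 _ (aff_foot hl x), Real.dist_eq, sub_zero, dist_self_add_right, norm_smul, norm_neg,
    norm_div, Real.norm_eq_abs, Real.norm_eq_abs, abs_of_pos hp] at h1
  refine h1.trans (le_of_eq ?_)
  field_simp

/-- A Lipschitz field that vanishes on the boundary of a polyhedron is bounded by a multiple of each
of its defining functions. -/
theorem IsPoly.norm_le_of_vanish {ι : Type*} [Finite ι] {l : ι → V3 →ᵃ[ℝ] ℝ} {K : Set V3}
    (hP : IsPoly l K) {E : Type*} [NormedAddCommGroup E] {f : V3 → E} {L : NNReal}
    (hf : LipschitzWith L f) (h0 : ∀ x ∈ frontier K, f x = 0) {x : V3} (hx : x ∈ K) (j : ι) :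
    ‖f x‖ ≤ L * ‖nv (l j)‖ / (nv (l j) ⬝ᵥ nv (l j)) * l j x := by
  have hp := dot_self_pos (hP.nv_ne j)
  have hlx : 0 ≤ l j x := (hP.mem_iff x).1 hx j
  set y := x + (-(l j x / (nv (l j) ⬝ᵥ nv (l j)))) • nv (l j) with hy
  have hly : l j y = 0 := aff_foot (hP.nv_ne j) x
  -- The foot `y` of the perpendicular may lie outside `K`. Then, by connectedness, the segment
  -- crosses the frontier at a point no farther from `x` than `y` is.
  have hex : (segment ℝ x y ∩ frontier K).Nonempty := by
    by_cases hyK : y ∈ K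
    · exact ⟨y, right_mem_segment ℝ x y, hP.mem_frontier.2 ⟨hyK, j, hly⟩⟩
    · by_contra hne
      have hsub : ∀ z ∈ segment ℝ x y, z ∈ K → z ∈ interior K := fun z hz hzK => by
        by_contra hzi
        exact hne ⟨z, hz, hP.isClosed.frontier_eq ▸ ⟨hzK, hzi⟩⟩
      obtain ⟨z, -, hz1, hz2⟩ := (convex_segment x y).isPreconnected (interior K) Kᶜ
        isOpen_interior hP.isClosed.isOpen_compl
        (fun z hz => by
          by_cases hzK : z ∈ K
          · exact Or.inl (hsub z hz hzK)
          · exact Or.inr hzK)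
        ⟨x, left_mem_segment ℝ x y, hsub x (left_mem_segment ℝ x y) hx⟩
        ⟨y, right_mem_segment ℝ x y, hyK⟩
      exact hz2 (interior_subset hz1)
  obtain ⟨z, hz, hzf⟩ := hex
  have h1 := hf.dist_le_mul x z
  rw [h0 z hzf, dist_zero_right] at h1
  have h2 : dist x z ≤ dist x y := by
    rw [segment_eq_image_lineMap] at hz
    obtain ⟨t, ht, rfl⟩ := hz
    rw [dist_left_lineMap, Real.norm_of_nonneg ht.1]
    nlinarith [dist_nonneg (x := x) (y := y), ht.2]
  have h3 : dist x y = l j x / (nv (l j) ⬝ᵥ nv (l j)) * ‖nv (l j)‖ := by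
    rw [hy, dist_self_add_right, norm_smul, norm_neg, Real.norm_of_nonneg (by positivity)]
  calc ‖f x‖ ≤ L * dist x z := h1
    _ ≤ L * dist x y := by gcongr
    _ = _ := by rw [h3]; field_simp

theorem Test.exists_lipschitz {s : Fin 3} (v : Test s) : ∃ L : NNReal, LipschitzWith L v :=
  (v.contDiff.of_le (by exact_mod_cast le_top)).lipschitzWith_of_hasCompactSupport
    v.hasCompactSupport (by norm_num : (1 : WithTop ℕ∞) ≠ 0)

/-- The derivative of the cutoff vanishes for `m * t > 2`, so the distance `t` absorbs the factor
`m`. -/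
theorem mul_stD_le {C : ℝ} (hC : ∀ t, |stD t| ≤ C) (m : ℕ) {t : ℝ} (ht : 0 ≤ t) :
    m * |stD (m * t - 1)| * t ≤ 2 * C := by
  have hC0 : 0 ≤ C := (abs_nonneg _).trans (hC 0)
  rcases lt_or_ge 1 (m * t - 1) with h | h
  · rw [stD_of_gt h]; simp; linarith
  · have := hC (m * t - 1)
    have h0 : 0 ≤ m * t := by positivity
    calc m * |stD (m * t - 1)| * t = (m * t) * |stD (m * t - 1)| := by ring
      _ ≤ 2 * C := by
        apply mul_le_mul _ this (abs_nonneg _) (by norm_num)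
        linarith

/-- Multiplied by the product of all cutoffs, the test field is supported in the interior, where the
definition of the weak derivative makes the pairing vanish. As `m` grows the pairing converges to
that of `v`: the gradient of the cutoff is of order `m` only within distance of order `1 / m` from
the boundary, where the Lipschitz field `v` is of order `1 / m`, so dominated convergence applies.
-/
theorem traceOp_eq_zero_of_frontier {ι : Type*} [Fintype ι] {l : ι → V3 →ᵃ[ℝ] ℝ} {K : Set V3}
    (hP : IsPoly l K) {s : Fin 3} {u : Form s} (hu : u ∈ hSpace s K) {v : Test s}
    (hv : ∀ x ∈ frontier K, v x = 0) : traceOp s K u v = 0 := by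
  classical
  set F : (ι → ℝ) → ℝ := fun y => ∏ j, y j with hFdef
  have hF : ContDiff ℝ ((⊤ : ℕ∞) : WithTop ℕ∞) F := contDiff_prod fun j _ => contDiff_apply ℝ ℝ j
  have hF1 : ContDiff ℝ 1 F := hF.of_le (by exact_mod_cast le_top)
  have hφ : ∀ m, ContDiff ℝ ((⊤ : ℕ∞) : WithTop ℕ∞) (fun x => F (cut l m x)) :=
    fun m => hF.comp (contDiff_cut l m)
  obtain ⟨CF, hCF0, hCF⟩ := exists_fderiv_cut_le hF1 l
  obtain ⟨C, hC0, hC⟩ := exists_stD_le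
  obtain ⟨L, hL⟩ := v.exists_lipschitz
  -- the cut off test fields are supported in the interior
  have hzero : ∀ m : ℕ, 1 ≤ m → traceOp s K u (mulTest _ (hφ m) v) = 0 := by
    intro m hm
    have hm' : (0 : ℝ) < m := by exact_mod_cast hm
    have hs : tsupport (mulTest _ (hφ m) v) ⊆ interior K := by
      have hcl : IsClosed {x | ∀ j, 1 ≤ m * l j x} := by
        have : {x | ∀ j, 1 ≤ m * l j x} = ⋂ j, {x | 1 ≤ m * l j x} := by ext; simp
        rw [this]
        exact isClosed_iInter fun j =>
          isClosed_le continuous_const (continuous_const.mul (continuous_aff (l j)))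
      refine (closure_minimal ?_ hcl).trans ?_
      · intro x hx j
        by_contra hlt
        apply hx
        change F (cut l m x) • v x = 0
        have : F (cut l m x) = 0 :=
          Finset.prod_eq_zero (Finset.mem_univ j) (chi_of_le (by linarith))
        rw [this, zero_smul]
      · intro x hx
        refine hP.mem_interior.2 fun j => ?_
        by_contra hlt
        have := hx j
        nlinarith
    have h := (hasWeakD_weakD hu).2 _ hs
    rw [traceOp, integral_sub (integrable_dot_test (hasWeakD_weakD hu).1 _)
      (integrable_dot_codiff hu.1 _), h, sub_self]
  set g := weakD s K u
  set N := ∑ j, ‖nv (l j)‖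
  set M := ∑ j, L * ‖nv (l j)‖ / (nv (l j) ⬝ᵥ nv (l j))
  -- A bound for the product of the gradient of the cutoff with `v` which does not depend on `m`:
  -- `mul_stD_le` trades the factor `m` for the factor `l j x` supplied by
  -- `IsPoly.norm_le_of_vanish`.
  set B := ∑ j : ι, CF * (‖nv (l j)‖ * (L * ‖nv (l j)‖ / (nv (l j) ⬝ᵥ nv (l j)) * (2 * C)))
  have hB : ∀ (m : ℕ), ∀ x ∈ K, ∀ i b, |grad (fun x => F (cut l m x)) x i * v x b| ≤ B := by
    intro m x hx i b
    simp only [grad]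
    rw [pd_comp_cut l m (hF1.differentiable (by norm_num)) i x, Finset.sum_mul]
    refine (Finset.abs_sum_le_sum_abs _ _).trans (Finset.sum_le_sum fun j _ => ?_)
    have hl : 0 ≤ l j x := (hP.mem_iff x).1 hx j
    have hp := dot_self_pos (hP.nv_ne j)
    have h1 : |v x b| ≤ L * ‖nv (l j)‖ / (nv (l j) ⬝ᵥ nv (l j)) * l j x :=
      (norm_le_pi_norm (v x) b).trans (hP.norm_le_of_vanish hL hv hx j)
    have h2 : |nv (l j) i| ≤ ‖nv (l j)‖ := norm_le_pi_norm (nv (l j)) i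
    have h3 := mul_stD_le hC m hl
    rw [abs_mul, abs_mul, abs_mul, abs_mul, Nat.abs_cast]
    calc |fderiv ℝ F (cut l m x) (Pi.single j 1)| * (m * |stD (m * l j x - 1)| * |nv (l j) i|) *
          |v x b| ≤ CF * (m * |stD (m * l j x - 1)| * ‖nv (l j)‖) *
          (L * ‖nv (l j)‖ / (nv (l j) ⬝ᵥ nv (l j)) * l j x) := by
            gcongr
            exact hCF m x j
      _ = CF * (‖nv (l j)‖ * (L * ‖nv (l j)‖ / (nv (l j) ⬝ᵥ nv (l j)) *
            (m * |stD (m * l j x - 1)| * l j x))) := by ring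
      _ ≤ _ := by gcongr
  have hmeas := ae_restrict_mem (μ := volume) hP.isClosed.measurableSet
  have hlim : Filter.Tendsto (fun m => traceOp s K u (mulTest _ (hφ m) v)) Filter.atTop
      (nhds (traceOp s K u v)) := by
    simp only [traceOp_mulTest]
    refine tendsto_integral_of_dominated_convergence (fun x => |g x ⬝ᵥ v x - u x ⬝ᵥ codiff s v x| +
      B * (3 * proxyDim (s + 1) * ∑ a, |u x a|)) ?_ ?_ ?_ ?_
    · exact fun m => (integrable_mulTest hu _ (hφ m) v).1
    · refine ((integrable_dot_test (hasWeakD_weakD hu).1 v).sub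
        (integrable_dot_codiff hu.1 v)).abs.add (Integrable.const_mul (Integrable.const_mul
          (integrable_finsetSum _ fun a _ => Integrable.abs ?_) _) _)
      have : IsFiniteMeasure (volume.restrict K) :=
        isFiniteMeasure_restrict.2 hP.isCompact.measure_lt_top.ne
      exact (memLp_apply hu.1 a).integrable (by norm_num)
    · intro m
      filter_upwards [hmeas] with x hx
      refine (abs_add_le _ _).trans (add_le_add ?_ (abs_dot_flux_le (hB m x hx) _))
      rw [abs_mul]
      have h01 : F (cut l m x) ∈ Set.Icc (0 : ℝ) 1 :=
        ⟨Finset.prod_nonneg fun j _ => (chi_mem _ _).1,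
          Finset.prod_le_one (fun j _ => (chi_mem _ _).1) fun j _ => (chi_mem _ _).2⟩
      rw [abs_of_nonneg h01.1]
      exact mul_le_of_le_one_left (abs_nonneg _) h01.2
    · filter_upwards [hP.isBody.ae_mem_interior] with x hx
      refine tendsto_const_nhds.congr' ?_
      have hpos := hP.mem_interior.1 hx
      have hev : ∀ j, ∀ᶠ m : ℕ in Filter.atTop, 2 < m * l j x := fun j =>
        (tendsto_natCast_atTop_atTop.atTop_mul_const (hpos j)).eventually_gt_atTop 2
      filter_upwards [Filter.eventually_all.2 hev] with m hm
      have hone : F (cut l m x) = 1 := Finset.prod_eq_one fun j _ => chi_of_ge (hm j).le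
      have hgr : grad (fun x => F (cut l m x)) x = 0 := by
        ext i
        simp only [grad]
        rw [pd_comp_cut l m (hF1.differentiable (by norm_num)) i x]
        refine Finset.sum_eq_zero fun j _ => ?_
        rw [stD_of_gt (by linarith [hm j])]
        simp
      rw [hone, hgr]
      simp
  refine tendsto_nhds_unique hlim (tendsto_const_nhds.congr' ?_)
  filter_upwards [Filter.eventually_ge_atTop 1] with m hm
  rw [hzero m hm]

theorem isBoundaryDistribution_traceOp {ι : Type*} [Fintype ι] {l : ι → V3 →ᵃ[ℝ] ℝ} {K : Set V3}
    (hP : IsPoly l K) {s : Fin 3} {u : Form s} (hu : u ∈ hSpace s K) :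
    IsBoundaryDistribution s K (traceOp s K u) := by
  obtain ⟨D, hD⟩ := exists_trace_clm hu
  refine ⟨⟨D, hD⟩, fun v w h => ?_⟩
  have : traceOp s K u (v - w) = 0 := by
    refine traceOp_eq_zero_of_frontier hP hu fun x hx => ?_
    change v x - w x = 0
    rw [h x hx, sub_self]
  rw [← hD, map_sub, hD, hD, sub_eq_zero] at this
  exact this

/-! ### The divergence theorem in a half space -/

/-- The integral of the divergence of the cut off field over the whole space is zero. The extra term
contains `m` times the normal component, which is bounded by a multiple of `l`; it stays bounded and
tends to zero pointwise. -/
theorem integral_halfspace_diver {G : V3 → V3} (hG : ∀ i, ContDiff ℝ 1 (fun x => G x i))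
    (hc : ∀ i, HasCompactSupport (fun x => G x i)) {l : V3 →ᵃ[ℝ] ℝ} (hl : nv l ≠ 0)
    (h0 : ∀ x, l x = 0 → nv l ⬝ᵥ G x = 0) : ∫ x in {x | 0 < l x}, diver G x = 0 := by
  obtain ⟨C, hC0, hC⟩ := exists_stD_le
  have hnG : ContDiff ℝ 1 (fun x => nv l ⬝ᵥ G x) :=
    ContDiff.sum fun i _ => contDiff_const.mul (hG i)
  have hnc : HasCompactSupport (fun x => nv l ⬝ᵥ G x) := by
    have hcG : HasCompactSupport G := by
      refine HasCompactSupport.intro (K := ⋃ i, tsupport (fun x => G x i))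
        (isCompact_iUnion fun i => hc i) fun x hx => ?_
      ext i
      simp only [Set.mem_iUnion, not_exists] at hx
      exact image_eq_zero_of_notMem_tsupport (f := fun x => G x i) (hx i)
    exact hcG.comp_left (g := fun w => nv l ⬝ᵥ w) (by simp)
  obtain ⟨L, hL⟩ := hnG.lipschitzWith_of_hasCompactSupport hnc (by norm_num)
  have hbd := abs_le_of_vanish_aff hL hl h0
  set D := L * ‖nv l‖ / (nv l ⬝ᵥ nv l)
  have hD : 0 ≤ D := div_nonneg (by positivity) (dot_self_pos hl).le
  have hφ : ∀ m, ContDiff ℝ 1 (fun x => chi m (l x)) := fun m =>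
    (contDiff_chi_aff l m).of_le (by exact_mod_cast le_top)
  have hdiv : ∀ m x, diver (fun x => chi m (l x) • G x) x =
      chi m (l x) * diver G x + m * stD (m * l x - 1) * (nv l ⬝ᵥ G x) := by
    intro m x
    simp only [diver, Pi.smul_apply, smul_eq_mul, dotProduct, Finset.mul_sum]
    rw [← Finset.sum_add_distrib]
    refine Finset.sum_congr rfl fun i _ => ?_
    rw [pd_mul ((hφ m).differentiable (by norm_num) x) ((hG i).differentiable (by norm_num) x),
      pd_chi_aff]
    ring
  have hz : ∀ m, ∫ x, (chi m (l x) * diver G x + m * stD (m * l x - 1) * (nv l ⬝ᵥ G x)) = 0 := by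
    intro m
    simp only [← hdiv]
    refine integral_diver_eq_zero (fun i => (hφ m).mul (hG i)) fun i => (hc i).mul_left
  have hdG : Continuous (diver G) := continuous_finsetSum _ fun i _ => continuous_pd (hG i)
  have hdi : Integrable (diver G) := by
    change Integrable (fun x => ∑ i, pd i (fun y => G y i) x) _
    exact integrable_finsetSum _ fun i _ =>
      (continuous_pd (hG i)).integrable_of_hasCompactSupport (hasCompactSupport_pd (hc i))
  have hopen : IsOpen {x | 0 < l x} := isOpen_lt continuous_const (continuous_aff l)
  rw [← integral_indicator hopen.measurableSet]
  refine tendsto_nhds_unique (f := fun m : ℕ => ∫ x, (chi m (l x) * diver G x +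
    m * stD (m * l x - 1) * (nv l ⬝ᵥ G x))) (l := Filter.atTop) ?_ ?_
  · refine tendsto_integral_of_dominated_convergence (fun x => |diver G x| +
      (tsupport fun x => nv l ⬝ᵥ G x).indicator (fun _ => D * (2 * C)) x) ?_ ?_ ?_ ?_
    · intro m
      refine Continuous.aestronglyMeasurable ?_
      refine ((hφ m).continuous.mul hdG).add ((continuous_const.mul ?_).mul hnG.continuous)
      exact contDiff_stD.continuous.comp
        ((continuous_const.mul (continuous_aff l)).sub continuous_const)
    · refine hdi.abs.add ?_
      rw [integrable_indicator_iff (isClosed_tsupport _).measurableSet]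
      exact integrableOn_const hnc.isCompact.measure_lt_top.ne
    · intro m
      refine Filter.Eventually.of_forall fun x => ?_
      refine (abs_add_le _ _).trans (add_le_add ?_ ?_)
      · rw [abs_mul, abs_of_nonneg (chi_mem m (l x)).1]
        exact mul_le_of_le_one_left (abs_nonneg _) (chi_mem m (l x)).2
      · by_cases hx : x ∈ tsupport fun x => nv l ⬝ᵥ G x
        · rw [Set.indicator_of_mem hx]
          rcases lt_or_ge (l x) 0 with hneg | hnn
          · rw [stD_of_neg]
            · simp
              positivity
            · have : (m : ℝ) * l x ≤ 0 := mul_nonpos_of_nonneg_of_nonpos (by positivity) hneg.le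
              linarith
          · have h1 := mul_stD_le hC m hnn
            have h2 := hbd x
            rw [abs_of_nonneg hnn] at h2
            rw [abs_mul, abs_mul, Nat.abs_cast]
            calc m * |stD (m * l x - 1)| * |nv l ⬝ᵥ G x| ≤ m * |stD (m * l x - 1)| * (D * l x) := by
                  gcongr
              _ = D * (m * |stD (m * l x - 1)| * l x) := by ring
              _ ≤ _ := by gcongr
        · rw [Set.indicator_of_notMem hx]
          have : nv l ⬝ᵥ G x = 0 :=
            image_eq_zero_of_notMem_tsupport (f := fun x => nv l ⬝ᵥ G x) hx
          rw [this]
          simp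
    · refine Filter.Eventually.of_forall fun x => ?_
      refine tendsto_const_nhds.congr' ?_
      rcases lt_or_ge 0 (l x) with hpos | hnp
      · have hev : ∀ᶠ m : ℕ in Filter.atTop, 2 < m * l x :=
          (tendsto_natCast_atTop_atTop.atTop_mul_const hpos).eventually_gt_atTop 2
        filter_upwards [hev] with m hm
        rw [chi_of_ge hm.le, stD_of_gt (by linarith), Set.indicator_of_mem (by exact hpos)]
        simp
      · filter_upwards with m
        have : (m : ℝ) * l x ≤ 0 := mul_nonpos_of_nonneg_of_nonpos (by positivity) hnp
        rw [chi_of_le (by linarith), stD_of_neg (by linarith),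
          Set.indicator_of_notMem (by simpa using hnp)]
        simp
  · simp only [hz]
    exact tendsto_const_nhds

/-! ### Concentration of test fields near edges -/

/-- The functions `F m` are bounded in L², being of order `m` on sets of measure of order `m⁻²`,
while the L² mass of `u` on the sets where they do not vanish tends to zero. This is exactly the
growth produced by cutting off around an edge, a set of codimension two. -/
theorem tendsto_integral_of_concentrated {K : Set V3} (hK : IsCompact K) {u : V3 → ℝ}
    (hu : MemLp u 2 (volume.restrict K)) {F : ℕ → V3 → ℝ} (hF : ∀ m, Continuous (F m))
    {S : ℕ → Set V3} {C B : ℝ}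
    (hS : ∀ m, ∀ x ∈ K, F m x ≠ 0 → x ∈ S m)
    (hv : ∀ m : ℕ, 1 ≤ m → volume (S m) ≤ ENNReal.ofReal (C / m ^ 2))
    (hb : ∀ m, ∀ x ∈ K, |F m x| ≤ B * m)
    (h0 : ∀ᵐ x ∂(volume.restrict K), ∀ᶠ m in Filter.atTop, F m x = 0) :
    Filter.Tendsto (fun m => ∫ x in K, u x * F m x) Filter.atTop (nhds 0) := by
  set μ := (volume : Measure V3).restrict K
  have hfin : IsFiniteMeasure μ := isFiniteMeasure_restrict.2 hK.measure_lt_top.ne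
  have hFL : ∀ m, MemLp (F m) 2 μ := fun m => by
    refine MemLp.of_bound (hF m).aestronglyMeasurable (B * m) ?_
    filter_upwards [ae_restrict_mem hK.isClosed.measurableSet] with x hx using hb m x hx
  have hFsq : ∀ m, Integrable (fun x => F m x ^ 2) μ := fun m => (hFL m).integrable_sq
  have husq : Integrable (fun x => u x ^ 2) μ := hu.integrable_sq
  have hmeas : ∀ m, MeasurableSet {x | F m x ≠ 0} := fun m =>
    (isOpen_ne_fun (hF m) continuous_const).measurableSet
  set a : ℕ → ℝ := fun m => ∫ x, {x | F m x ≠ 0}.indicator (fun x => u x ^ 2) x ∂μ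
  have ha : Filter.Tendsto a Filter.atTop (nhds 0) := by
    have := tendsto_integral_of_dominated_convergence (μ := μ) (f := fun _ => (0 : ℝ))
      (F := fun m x => {x | F m x ≠ 0}.indicator (fun x => u x ^ 2) x) (fun x => u x ^ 2)
      (fun m => (husq.indicator (hmeas m)).1) husq
      (fun m => Filter.Eventually.of_forall fun x => by
        rw [Real.norm_eq_abs, abs_of_nonneg (Set.indicator_nonneg (fun _ _ => sq_nonneg _) _)]
        exact Set.indicator_le_self' (fun _ _ => sq_nonneg _) _)
      (by
        filter_upwards [h0] with x hx
        refine tendsto_const_nhds.congr' ?_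
        filter_upwards [hx] with m hm
        rw [Set.indicator_of_notMem (by simp [hm])])
    simpa using this
  have hsq : ∀ m : ℕ, 1 ≤ m → ∫ x, F m x ^ 2 ∂μ ≤ B ^ 2 * |C| := by
    intro m hm
    have hm0 : (0 : ℝ) < m := by exact_mod_cast hm
    have h1 : μ {x | F m x ≠ 0} ≤ ENNReal.ofReal (C / m ^ 2) := by
      rw [Measure.restrict_apply (hmeas m)]
      exact (measure_mono fun x hx => hS m x hx.2 hx.1).trans (hv m hm)
    have h2 : ∫ x, F m x ^ 2 ∂μ ≤ ∫ x, {x | F m x ≠ 0}.indicator (fun _ => (B * m) ^ 2) x ∂μ := by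
      refine integral_mono_ae (hFsq m) ((integrable_const _).indicator (hmeas m)) ?_
      filter_upwards [ae_restrict_mem hK.isClosed.measurableSet] with x hx
      by_cases hx0 : F m x = 0
      · rw [hx0, Set.indicator_of_notMem (by simp [hx0])]
        simp
      · rw [Set.indicator_of_mem (by exact hx0)]
        rw [← sq_abs]
        exact pow_le_pow_left₀ (abs_nonneg _) (hb m x hx) 2
    refine h2.trans ?_
    rw [integral_indicator_const _ (hmeas m), smul_eq_mul]
    have h3 : μ.real {x | F m x ≠ 0} ≤ |C| / m ^ 2 := by
      refine ENNReal.toReal_le_of_le_ofReal (by positivity) (h1.trans ?_)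
      exact ENNReal.ofReal_le_ofReal (by gcongr; exact le_abs_self C)
    calc μ.real {x | F m x ≠ 0} * (B * m) ^ 2 ≤ |C| / m ^ 2 * (B * m) ^ 2 := by gcongr
      _ = _ := by field_simp
  rw [Metric.tendsto_atTop]
  intro ε hε
  set D := B ^ 2 * |C| + 1
  have hD : 0 < D := by positivity
  -- The weight in Young's inequality `|u F| ≤ η⁻¹ u² + η F²`, chosen such that the second term
  -- contributes at most `ε / 2`; the summand one in `D` only ensures positivity.
  set η := ε / (2 * D)
  have hη : 0 < η := by positivity
  obtain ⟨N, hN⟩ := Metric.tendsto_atTop.1 ha (η * (ε / 2)) (by positivity)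
  refine ⟨max N 1, fun m hm => ?_⟩
  have ham := hN m ((le_max_left _ _).trans hm)
  have hm1 : 1 ≤ m := (le_max_right _ _).trans hm
  rw [Real.dist_eq, sub_zero] at ham ⊢
  have hle : |∫ x, u x * F m x ∂μ| ≤ η⁻¹ * a m + η * ∫ x, F m x ^ 2 ∂μ := by
    refine (abs_integral_le_integral_abs).trans ?_
    rw [← integral_const_mul, ← integral_const_mul, ← integral_add
      ((husq.indicator (hmeas m)).const_mul _) ((hFsq m).const_mul _)]
    refine integral_mono (hu.integrable_mul (hFL m)).abs
      (((husq.indicator (hmeas m)).const_mul _).add ((hFsq m).const_mul _)) fun x => ?_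
    by_cases hx0 : F m x = 0
    · have : {x | F m x ≠ 0}.indicator (fun x => u x ^ 2) x = 0 :=
        Set.indicator_of_notMem (by simp [hx0]) _
      simp [hx0]
    · have : {x | F m x ≠ 0}.indicator (fun x => u x ^ 2) x = u x ^ 2 :=
        Set.indicator_of_mem (by exact hx0) _
      simp only [this]
      change |u x * F m x| ≤ _
      rw [abs_mul]
      have e1 : η⁻¹ * u x ^ 2 + η * F m x ^ 2 - |u x| * |F m x| =
          η⁻¹ * ((|u x| - η * |F m x| / 2) ^ 2 + 3 / 4 * (η * |F m x|) ^ 2) := by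
        rw [← sq_abs (u x), ← sq_abs (F m x)]
        field_simp
        ring
      have : 0 ≤ η⁻¹ * ((|u x| - η * |F m x| / 2) ^ 2 + 3 / 4 * (η * |F m x|) ^ 2) := by positivity
      linarith
  have h5 : η⁻¹ * a m < ε / 2 := by
    have := lt_of_le_of_lt (le_abs_self _) ham
    rw [inv_mul_lt_iff₀ hη]
    exact this
  have h6 : η * ∫ x, F m x ^ 2 ∂μ ≤ ε / 2 := by
    calc η * ∫ x, F m x ^ 2 ∂μ ≤ η * D := by
          gcongr
          linarith [hsq m hm1]
      _ = ε / 2 := by simp only [η]; field_simp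
  linarith

/-- The linear map whose components are two given functionals and their cross product. -/
def edgeMap (n₁ n₂ : V3) : V3 →ₗ[ℝ] V3 := Matrix.toLin' (Matrix.of ![n₁, n₂, crossProduct n₁ n₂])

theorem edgeMap_apply (n₁ n₂ x : V3) :
    edgeMap n₁ n₂ x = ![n₁ ⬝ᵥ x, n₂ ⬝ᵥ x, crossProduct n₁ n₂ ⬝ᵥ x] := by
  ext i
  fin_cases i <;> simp [edgeMap, Matrix.toLin'_apply, Matrix.mulVec]

theorem det_edgeMap (n₁ n₂ : V3) :
    LinearMap.det (edgeMap n₁ n₂) = crossProduct n₁ n₂ ⬝ᵥ crossProduct n₁ n₂ := by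
  rw [edgeMap, LinearMap.det_toLin', Matrix.det_fin_three]
  simp [cross_apply, dotProduct, Fin.sum_univ_three]
  ring

theorem det_edgeMap_ne {n₁ n₂ : V3} (h : crossProduct n₁ n₂ ≠ 0) :
    LinearMap.det (edgeMap n₁ n₂) ≠ 0 := by
  rw [det_edgeMap]
  exact (dot_self_pos h).ne'

theorem aff_eq (l : V3 →ᵃ[ℝ] ℝ) (x : V3) : l x = nv l ⬝ᵥ x + l 0 := by
  have := aff_add l 0 x
  rw [zero_add] at this
  rw [this, add_comm]

/-- In the linear coordinates given by `edgeMap` the set is a box. -/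
theorem volume_slab {l₁ l₂ : V3 →ᵃ[ℝ] ℝ} (h : crossProduct (nv l₁) (nv l₂) ≠ 0)
    (a b c d e f : ℝ) :
    volume {x | l₁ x ∈ Set.Icc a b ∧ l₂ x ∈ Set.Icc c d ∧
      crossProduct (nv l₁) (nv l₂) ⬝ᵥ x ∈ Set.Icc e f} =
    ENNReal.ofReal |(LinearMap.det (edgeMap (nv l₁) (nv l₂)))⁻¹| *
      (ENNReal.ofReal (b - a) * ENNReal.ofReal (d - c) * ENNReal.ofReal (f - e)) := by
  have hset : {x | l₁ x ∈ Set.Icc a b ∧ l₂ x ∈ Set.Icc c d ∧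
      crossProduct (nv l₁) (nv l₂) ⬝ᵥ x ∈ Set.Icc e f} =
      edgeMap (nv l₁) (nv l₂) ⁻¹' Set.Icc ![a - l₁ 0, c - l₂ 0, e] ![b - l₁ 0, d - l₂ 0, f] := by
    ext x
    rw [Set.mem_preimage, edgeMap_apply, Set.mem_ofPred_eq, aff_eq l₁ x, aff_eq l₂ x]
    simp only [Set.mem_Icc, Pi.le_def, Fin.forall_fin_succ, Matrix.cons_val_zero,
      Matrix.cons_val_succ, IsEmpty.forall_iff, and_true, sub_le_iff_le_add, le_sub_iff_add_le]
    tauto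
  rw [hset, Measure.addHaar_preimage_linearMap _ (det_edgeMap_ne h), Real.volume_Icc_pi,
    Fin.prod_univ_three]
  simp

/-- Two transversal slabs of width `2 / m` meet in a tube around the edge line, and the boundedness
of `K` limits its length. -/
theorem exists_volume_edge_le {K : Set V3} (hK : Bornology.IsBounded K) {l₁ l₂ : V3 →ᵃ[ℝ] ℝ}
    (h : crossProduct (nv l₁) (nv l₂) ≠ 0) : ∃ C : ℝ, 0 ≤ C ∧ ∀ m : ℕ, 1 ≤ m →
      volume {x | x ∈ K ∧ (0 ≤ l₁ x ∧ m * l₁ x ≤ 2) ∧ (0 ≤ l₂ x ∧ m * l₂ x ≤ 2)} ≤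
        ENNReal.ofReal (C / m ^ 2) := by
  set n := crossProduct (nv l₁) (nv l₂)
  obtain ⟨R, hR0, hR⟩ : ∃ R : ℝ, 0 ≤ R ∧ ∀ x ∈ K, |n ⬝ᵥ x| ≤ R := by
    obtain ⟨r, hr⟩ := hK.exists_norm_le
    refine ⟨∑ i, |n i| * |r|, by positivity, fun x hx => ?_⟩
    refine (Finset.abs_sum_le_sum_abs _ _).trans (Finset.sum_le_sum fun i _ => ?_)
    rw [abs_mul]
    exact mul_le_mul_of_nonneg_left ((norm_le_pi_norm x i).trans ((hr x hx).trans (le_abs_self r)))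
      (abs_nonneg _)
  set D := |(LinearMap.det (edgeMap (nv l₁) (nv l₂)))⁻¹| with hDdef
  -- The box has sides `2 / m`, `2 / m` and `2 * R`.
  refine ⟨D * (8 * R), by positivity, fun m hm => ?_⟩
  have hm0 : (0 : ℝ) < m := by exact_mod_cast hm
  refine (measure_mono (t := {x | l₁ x ∈ Set.Icc 0 (2 / (m : ℝ)) ∧ l₂ x ∈ Set.Icc 0 (2 / (m : ℝ)) ∧
    n ⬝ᵥ x ∈ Set.Icc (-R) R}) ?_).trans ?_
  · rintro x ⟨hxK, h1, h2⟩
    refine ⟨⟨h1.1, ?_⟩, ⟨h2.1, ?_⟩, abs_le.1 (hR x hxK)⟩ <;> rw [le_div_iff₀ hm0] <;> linarith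
  · rw [volume_slab h, ← ENNReal.ofReal_mul (by rw [sub_zero]; positivity), ← ENNReal.ofReal_mul (by rw [sub_zero]; positivity),
      ← ENNReal.ofReal_mul (by positivity)]
    rw [← hDdef]
    refine ENNReal.ofReal_le_ofReal (le_of_eq ?_)
    field_simp
    ring

/-- The counterpart of the upper bound: for large `m` the region contains a box with two sides `(β -
α) / m` and a third one of fixed length, which stays in the given neighbourhood of the edge point.
-/
theorem exists_le_volume_edge {U : Set V3} {x₀ : V3} (hU : U ∈ nhds x₀) {l₁ l₂ : V3 →ᵃ[ℝ] ℝ}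
    (h : crossProduct (nv l₁) (nv l₂) ≠ 0) (h₁ : l₁ x₀ = 0) (h₂ : l₂ x₀ = 0) {α β : ℝ}
    (hα : 0 < α) (hαβ : α < β) : ∃ c : ℝ, 0 < c ∧ ∀ᶠ m : ℕ in Filter.atTop,
      ENNReal.ofReal (c / m ^ 2) ≤
        volume {x | x ∈ U ∧ m * l₁ x ∈ Set.Icc α β ∧ m * l₂ x ∈ Set.Icc α β} := by
  set n := crossProduct (nv l₁) (nv l₂) with hn
  have hdet : IsUnit (LinearMap.det (edgeMap (nv l₁) (nv l₂))) := (det_edgeMap_ne h).isUnit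
  set Φ := LinearEquiv.ofIsUnitDet (v := Pi.basisFun ℝ (Fin 3)) (v' := Pi.basisFun ℝ (Fin 3))
    (f := edgeMap (nv l₁) (nv l₂)) (by rwa [LinearMap.det_toMatrix]) with hΦ
  have hΦa : ∀ x, Φ x = edgeMap (nv l₁) (nv l₂) x := fun x => rfl
  have hcont : Continuous fun y : V3 => x₀ + Φ.symm y :=
    continuous_const.add (LinearMap.continuous_of_finiteDimensional Φ.symm.toLinearMap)
  have hnhds : ∀ᶠ y : V3 in nhds 0, x₀ + Φ.symm y ∈ U := by
    refine hcont.continuousAt.eventually_mem ?_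
    simpa using hU
  obtain ⟨r, hr, hball⟩ := Metric.eventually_nhds_iff.1 hnhds
  set D := |(LinearMap.det (edgeMap (nv l₁) (nv l₂)))⁻¹| with hDdef
  have hD : 0 < D := abs_pos.2 (inv_ne_zero (det_edgeMap_ne h))
  refine ⟨D * ((β - α) * (β - α) * (r / 2)), by
    have := sub_pos.2 hαβ
    positivity, ?_⟩
  have hev : ∀ᶠ m : ℕ in Filter.atTop, β < m * r :=
    (tendsto_natCast_atTop_atTop.atTop_mul_const hr).eventually_gt_atTop β
  filter_upwards [hev, Filter.eventually_ge_atTop 1] with m hm hm1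
  have hm0 : (0 : ℝ) < m := by exact_mod_cast hm1
  refine le_trans ?_ (measure_mono (s := {x | l₁ x ∈ Set.Icc (α / m) (β / m) ∧
    l₂ x ∈ Set.Icc (α / m) (β / m) ∧ n ⬝ᵥ x ∈ Set.Icc (n ⬝ᵥ x₀) (n ⬝ᵥ x₀ + r / 2)}) ?_)
  · rw [volume_slab h, ← ENNReal.ofReal_mul (by rw [← sub_div]; have := sub_pos.2 hαβ; positivity),
      ← ENNReal.ofReal_mul (by rw [← sub_div]; have := sub_pos.2 hαβ; positivity),
      ← ENNReal.ofReal_mul (by positivity)]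
    rw [← hDdef]
    refine ENNReal.ofReal_le_ofReal (le_of_eq ?_)
    field_simp
    ring
  · rintro x ⟨hx1, hx2, hx3⟩
    have e1 : nv l₁ ⬝ᵥ (x - x₀) = l₁ x := by
      have := aff_add l₁ x₀ (x - x₀)
      rw [add_sub_cancel, h₁, zero_add] at this
      exact this.symm
    have e2 : nv l₂ ⬝ᵥ (x - x₀) = l₂ x := by
      have := aff_add l₂ x₀ (x - x₀)
      rw [add_sub_cancel, h₂, zero_add] at this
      exact this.symm
    have hb1 : β / m < r := by rw [div_lt_iff₀ hm0]; linarith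
    have hx1' : |l₁ x| < r := by
      rw [abs_of_nonneg (le_trans (by positivity) hx1.1)]
      exact lt_of_le_of_lt hx1.2 hb1
    have hx2' : |l₂ x| < r := by
      rw [abs_of_nonneg (le_trans (by positivity) hx2.1)]
      exact lt_of_le_of_lt hx2.2 hb1
    have hx3' : |n ⬝ᵥ (x - x₀)| < r := by
      rw [dotProduct_sub, abs_lt]
      constructor <;> linarith [hx3.1, hx3.2]
    refine ⟨?_, ⟨?_, ?_⟩, ⟨?_, ?_⟩⟩
    · have := hball (y := Φ (x - x₀)) ?_
      · simpa using this
      rw [dist_zero_right, pi_norm_lt_iff hr, hΦa, edgeMap_apply]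
      intro i
      fin_cases i
      · simpa [e1] using hx1'
      · simpa [e2] using hx2'
      · simpa using hx3'
    · have := hx1.1; rw [div_le_iff₀ hm0] at this; linarith
    · have := hx1.2; rw [le_div_iff₀ hm0] at this; linarith
    · have := hx2.1; rw [div_le_iff₀ hm0] at this; linarith
    · have := hx2.2; rw [le_div_iff₀ hm0] at this; linarith

theorem isClosed_levels {ι : Type*} (l : ι → V3 →ᵃ[ℝ] ℝ) (p : ι → Prop) (m : ℕ) :
    IsClosed {x | ∀ j, p j → 1 ≤ m * l j x} := by
  have : {x | ∀ j, p j → 1 ≤ m * l j x} = ⋂ j, ⋂ (_ : p j), {x | 1 ≤ m * l j x} := by ext; simp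
  rw [this]
  exact isClosed_iInter fun j => isClosed_iInter fun _ =>
    isClosed_le continuous_const (continuous_const.mul (continuous_aff (l j)))

/-- The weight of the region where at least two of the cutoffs are active. -/
def edgeWeight {ι : Type*} [Fintype ι] [DecidableEq ι] (y : ι → ℝ) : ℝ :=
  1 - ∏ j, y j - ∑ i, (1 - y i) * ∏ j ∈ Finset.univ.erase i, y j

/-- With a single active cutoff `y i`, the subtracted terms are `y i` and `1 - y i`. -/
theorem edgeWeight_eq_zero {ι : Type*} [Fintype ι] [DecidableEq ι] {y : ι → ℝ} {i : ι}
    (h : ∀ j ≠ i, y j = 1) : edgeWeight y = 0 := by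
  have h1 : ∏ j, y j = y i := Finset.prod_eq_single i (fun j _ hj => h j hj) (by simp)
  have h2 : ∑ i, (1 - y i) * ∏ j ∈ Finset.univ.erase i, y j = 1 - y i := by
    rw [Finset.sum_eq_single i]
    · rw [Finset.prod_eq_one fun j hj => h j (Finset.ne_of_mem_erase hj), mul_one]
    · intro j _ hj
      rw [h j hj, sub_self, zero_mul]
    · simp
  rw [edgeWeight, h1, h2, sub_self]

theorem contDiff_edgeWeight {ι : Type*} [Fintype ι] [DecidableEq ι] {n : WithTop ℕ∞} :
    ContDiff ℝ n (edgeWeight : (ι → ℝ) → ℝ) := by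
  unfold edgeWeight
  refine (contDiff_const.sub (contDiff_prod fun j _ => contDiff_apply ℝ ℝ j)).sub
    (ContDiff.sum fun i _ => (contDiff_const.sub (contDiff_apply ℝ ℝ i)).mul
      (contDiff_prod fun j _ => contDiff_apply ℝ ℝ j))

/-- A trace cannot be concentrated on the edges. -/
theorem traceOp_eq_zero_of_openFace {ι : Type*} [Fintype ι] [Nonempty ι]
    {l : ι → V3 →ᵃ[ℝ] ℝ} {K : Set V3} (hP : IsPoly l K)
    (hind : ∀ i j, i ≠ j → crossProduct (nv (l i)) (nv (l j)) ≠ 0) {s : Fin 3} {u : Form s}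
    (hu : u ∈ hSpace s K)
    (h : ∀ i, ∀ v : Test s, tsupport v ∩ frontier K ⊆ openFace l i → traceOp s K u v = 0)
    (v : Test s) : traceOp s K u v = 0 := by
  classical
  have hsm : ∀ (F : (ι → ℝ) → ℝ) (m : ℕ), ContDiff ℝ ((⊤ : ℕ∞) : WithTop ℕ∞) F →
      ContDiff ℝ ((⊤ : ℕ∞) : WithTop ℕ∞) (fun x => F (cut l m x)) :=
    fun F m hF => hF.comp (contDiff_cut l m)
  have hF0 : ContDiff ℝ ((⊤ : ℕ∞) : WithTop ℕ∞) fun y : ι → ℝ => ∏ j, y j :=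
    contDiff_prod fun j _ => contDiff_apply ℝ ℝ j
  have hFi : ∀ i, ContDiff ℝ ((⊤ : ℕ∞) : WithTop ℕ∞)
      fun y : ι → ℝ => (1 - y i) * ∏ j ∈ Finset.univ.erase i, y j := fun i =>
    (contDiff_const.sub (contDiff_apply ℝ ℝ i)).mul (contDiff_prod fun j _ => contDiff_apply ℝ ℝ j)
  have hE : ContDiff ℝ ((⊤ : ℕ∞) : WithTop ℕ∞) (edgeWeight : (ι → ℝ) → ℝ) := contDiff_edgeWeight
  have hE1 : Differentiable ℝ (edgeWeight : (ι → ℝ) → ℝ) := hE.differentiable (by simp)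
  -- only the part near the edges contributes
  have hstep : ∀ m : ℕ, 1 ≤ m → traceOp s K u v = traceOp s K u (mulTest _ (hsm _ m hE) v) := by
    intro m hm
    have hm0 : (0 : ℝ) < m := by exact_mod_cast hm
    obtain ⟨D, hD⟩ := exists_trace_clm hu
    have hdec : v = mulTest _ (hsm _ m hF0) v + ∑ i, mulTest _ (hsm _ m (hFi i)) v +
        mulTest _ (hsm _ m hE) v := by
      ext x : 1
      simp only [add_apply, sum_apply, coe_mulTest, edgeWeight]
      rw [← Finset.sum_smul, ← add_smul, ← add_smul]
      simp
    -- On the frontier some `l j` is zero, so the full product of cutoffs vanishes there.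
    have h0 : traceOp s K u (mulTest _ (hsm _ m hF0) v) = 0 := by
      refine traceOp_eq_zero_of_frontier hP hu fun x hx => ?_
      obtain ⟨-, j, hj⟩ := hP.mem_frontier.1 hx
      have : ∏ j, cut l m x j = 0 :=
        Finset.prod_eq_zero (Finset.mem_univ j) (chi_of_le (by rw [hj]; simp))
      simp [coe_mulTest, this]
    -- The `i`-th part is supported where `1 ≤ m * l j` for all `j ≠ i`, so it can meet the frontier
    -- only in the `i`-th open face.
    have hi : ∀ i, traceOp s K u (mulTest _ (hsm _ m (hFi i)) v) = 0 := by
      intro i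
      refine h i _ fun x hx => ?_
      have hx1 : x ∈ {x | ∀ j, j ≠ i → 1 ≤ m * l j x} := by
        refine closure_minimal ?_ (isClosed_levels l (· ≠ i) m) hx.1
        intro y hy j hji
        by_contra hlt
        apply hy
        have : ∏ j ∈ Finset.univ.erase i, cut l m y j = 0 :=
          Finset.prod_eq_zero (Finset.mem_erase.2 ⟨hji, Finset.mem_univ j⟩)
            (chi_of_le (by linarith))
        simp [coe_mulTest, this]
      have hpos : ∀ j ≠ i, 0 < l j x := fun j hj => by
        by_contra hlt
        have := hx1 j hj
        nlinarith
      obtain ⟨-, j, hj⟩ := hP.mem_frontier.1 hx.2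
      have hji : j = i := by
        by_contra hne
        exact (hpos j hne).ne' hj
      exact ⟨hji ▸ hj, hpos⟩
    conv_lhs => rw [hdec]
    rw [← hD, map_add, map_add, map_sum, hD, hD, h0]
    simp [hD, hi]
  -- and this part tends to zero
  obtain ⟨CF, hCF0, hCF⟩ := exists_fderiv_cut_le (contDiff_edgeWeight (n := 1)) l
  obtain ⟨C, hC0, hC⟩ := exists_stD_le
  obtain ⟨CE, hCE⟩ : ∃ CE, ∀ y ∈ Set.Icc (0 : ι → ℝ) 1, ‖edgeWeight y‖ ≤ CE :=
    isCompact_Icc.exists_bound_of_continuousOn hE.continuous.continuousOn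
  -- If at most the `i`-th cutoff differs from one at `x`, then the same holds nearby, and the
  -- weight vanishes in a whole neighbourhood.
  have hloc : ∀ (m : ℕ) (x : V3) (i : ι), (∀ j ≠ i, 2 < m * l j x) →
      edgeWeight (cut l m x) = 0 ∧ grad (fun x => edgeWeight (cut l m x)) x = 0 := by
    intro m x i hx
    have hev : ∀ᶠ y in nhds x, edgeWeight (cut l m y) = 0 := by
      have : ∀ᶠ y in nhds x, ∀ j, j ≠ i → 2 < m * l j y := by
        rw [Filter.eventually_all]
        intro j
        by_cases hj : j = i
        · simp [hj]
        · filter_upwards [(continuous_const.mul (continuous_aff (l j))).continuousAt.eventually_mem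
            (Ioi_mem_nhds (hx j hj))] with y hy _ using hy
      filter_upwards [this] with y hy
      exact edgeWeight_eq_zero fun j hj => chi_of_ge (hy j hj).le
    refine ⟨hev.self_of_nhds, ?_⟩
    ext k
    have := pd_congr (i := k) (g := fun _ => (0 : ℝ)) hev
    simp only [grad, this]
    simp [pd]
  have hInt : ∀ x ∈ interior K, ∀ᶠ m : ℕ in Filter.atTop,
      edgeWeight (cut l m x) = 0 ∧ grad (fun x => edgeWeight (cut l m x)) x = 0 := by
    intro x hx
    have hpos := hP.mem_interior.1 hx
    have hev : ∀ j, ∀ᶠ m : ℕ in Filter.atTop, 2 < m * l j x := fun j =>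
      (tendsto_natCast_atTop_atTop.atTop_mul_const (hpos j)).eventually_gt_atTop 2
    filter_upwards [Filter.eventually_all.2 hev] with m hm
    exact hloc m x (Classical.arbitrary ι) fun j _ => hm j
  set N := ∑ j, ‖nv (l j)‖
  have hgb : ∀ (m : ℕ) x k, |grad (fun x => edgeWeight (cut l m x)) x k| ≤ (CF * (C * N)) * m := by
    intro m x k
    simp only [grad]
    rw [pd_comp_cut l m hE1]
    refine (Finset.abs_sum_le_sum_abs _ _).trans ?_
    have : (CF * (C * N)) * m = ∑ j, CF * (m * C * ‖nv (l j)‖) := by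
      simp only [N, ← Finset.mul_sum]
      ring
    rw [this]
    refine Finset.sum_le_sum fun j _ => ?_
    rw [abs_mul, abs_mul, abs_mul, Nat.abs_cast]
    gcongr
    · exact hCF m x j
    · exact hC _
    · exact norm_le_pi_norm (nv (l j)) k
  -- volume of the neighbourhood of the edges
  set S : ℕ → Set V3 := fun m => ⋃ p : {p : ι × ι // p.1 ≠ p.2},
    {x | x ∈ K ∧ (0 ≤ l p.1.1 x ∧ m * l p.1.1 x ≤ 2) ∧ (0 ≤ l p.1.2 x ∧ m * l p.1.2 x ≤ 2)}
  have hvol : ∃ V : ℝ, ∀ m : ℕ, 1 ≤ m → volume (S m) ≤ ENNReal.ofReal (V / m ^ 2) := by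
    choose V hV0 hV using fun p : {p : ι × ι // p.1 ≠ p.2} =>
      exists_volume_edge_le hP.bounded (hind p.1.1 p.1.2 p.2)
    refine ⟨∑ p, V p, fun m hm => ?_⟩
    refine (measure_iUnion_le _).trans ?_
    rw [tsum_fintype, Finset.sum_div, ENNReal.ofReal_sum_of_nonneg fun p _ => by
      have := hV0 p
      positivity]
    exact Finset.sum_le_sum fun p _ => hV p m hm
  obtain ⟨V, hV⟩ := hvol
  -- A nonzero gradient forces at least two of the affine functions to be at most `2 / m`.
  have hSmem : ∀ (m : ℕ), ∀ x ∈ K, grad (fun x => edgeWeight (cut l m x)) x ≠ 0 → x ∈ S m := by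
    intro m x hx hne
    by_contra hxS
    simp only [S, Set.mem_iUnion, not_exists] at hxS
    apply hne
    by_cases hex : ∃ i, m * l i x ≤ 2
    · obtain ⟨i, hi⟩ := hex
      refine (hloc m x i fun j hj => ?_).2
      by_contra hlt
      exact hxS ⟨(i, j), hj.symm⟩ ⟨hx, ⟨(hP.mem_iff x).1 hx i, hi⟩, ⟨(hP.mem_iff x).1 hx j, by linarith⟩⟩
    · push Not at hex
      exact (hloc m x (Classical.arbitrary ι) fun j _ => hex j).2
  set T : V3 → ℝ := fun x => weakD s K u x ⬝ᵥ v x - u x ⬝ᵥ codiff s v x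
  have hT : Integrable T (volume.restrict K) :=
    (integrable_dot_test (hasWeakD_weakD hu).1 v).sub (integrable_dot_codiff hu.1 v)
  have hphi : ∀ m, Continuous fun x => edgeWeight (cut l m x) := fun m => (hsm _ m hE).continuous
  have hphib : ∀ m x, ‖edgeWeight (cut l m x)‖ ≤ CE := fun m x => hCE _ (cut_mem l m x)
  have hT1 : ∀ m, Integrable (fun x => edgeWeight (cut l m x) * T x) (volume.restrict K) := fun m =>
    hT.bdd_mul (hphi m).aestronglyMeasurable (Filter.Eventually.of_forall (hphib m))
  have hlim1 : Filter.Tendsto (fun m => ∫ x in K, edgeWeight (cut l m x) * T x) Filter.atTop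
      (nhds 0) := by
    have := tendsto_integral_of_dominated_convergence (μ := volume.restrict K)
      (f := fun _ => (0 : ℝ)) (F := fun m x => edgeWeight (cut l m x) * T x)
      (fun x => CE * |T x|) (fun m => (hT1 m).1) (hT.abs.const_mul _)
      (fun m => Filter.Eventually.of_forall fun x => by
        rw [norm_mul]
        exact mul_le_mul_of_nonneg_right (hphib m x) (abs_nonneg _))
      (by
        filter_upwards [hP.isBody.ae_mem_interior] with x hx
        refine tendsto_const_nhds.congr' ?_
        filter_upwards [hInt x hx] with m hm
        rw [hm.1, zero_mul])
    simpa using this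
  have hgc : ∀ m k, Continuous fun x => grad (fun x => edgeWeight (cut l m x)) x k := fun m k =>
    continuous_pd ((hsm _ m hE).of_le (by exact_mod_cast le_top))
  have hlim2 : ∀ k a b, Filter.Tendsto (fun m => ∫ x in K, u x a *
      (grad (fun x => edgeWeight (cut l m x)) x k * v x b)) Filter.atTop (nhds 0) := by
    intro k a b
    obtain ⟨Bv, hBv⟩ := (v.hasCompactSupport_apply b).exists_bound_of_continuous
      (v.contDiff_one b).continuous
    have hBv0 : 0 ≤ Bv := (norm_nonneg _).trans (hBv 0)
    refine tendsto_integral_of_concentrated hP.isCompact (memLp_apply hu.1 a)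
      (S := S) (C := V) (B := CF * (C * N) * Bv)
      (fun m => (hgc m k).mul (v.contDiff_one b).continuous) ?_ hV ?_ ?_
    · intro m x hx hne
      refine hSmem m x hx fun h0 => hne ?_
      rw [h0]
      simp
    · intro m x _
      rw [abs_mul]
      calc |grad (fun x => edgeWeight (cut l m x)) x k| * |v x b| ≤ (CF * (C * N) * m) * Bv :=
            mul_le_mul (hgb m x k) (hBv x) (abs_nonneg _) ((abs_nonneg _).trans (hgb m x k))
        _ = _ := by ring
    · filter_upwards [hP.isBody.ae_mem_interior] with x hx
      filter_upwards [hInt x hx] with m hm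
      rw [hm.2]
      simp
  have hlim : Filter.Tendsto (fun m => traceOp s K u (mulTest _ (hsm _ m hE) v)) Filter.atTop
      (nhds 0) := by
    have hL2 : ∀ m k a b, Integrable (fun x => u x a *
        (grad (fun x => edgeWeight (cut l m x)) x k * v x b)) (volume.restrict K) := by
      intro m k a b
      have h2 : MemLp (fun x => grad (fun x => edgeWeight (cut l m x)) x k * v x b) 2
          (volume.restrict K) :=
        ((hgc m k).mul (v.contDiff_one b).continuous).memLp_of_hasCompactSupport
          ((v.hasCompactSupport_apply b).mul_left)
      exact (memLp_apply hu.1 a).integrable_mul h2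
    have heq : ∀ m, traceOp s K u (mulTest _ (hsm _ m hE) v) =
        (∫ x in K, edgeWeight (cut l m x) * T x) + ∑ k, ∑ a, ∑ b, cc s k a b * ∫ x in K, u x a *
          (grad (fun x => edgeWeight (cut l m x)) x k * v x b) := by
      intro m
      rw [traceOp_mulTest]
      have e : ∀ x, grad (fun x => edgeWeight (cut l m x)) x ⬝ᵥ flux s (u x) (v x) =
          ∑ k, ∑ a, ∑ b, cc s k a b * (u x a *
            (grad (fun x => edgeWeight (cut l m x)) x k * v x b)) := by
        intro x
        simp only [dotProduct, flux, Finset.mul_sum]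
        refine Finset.sum_congr rfl fun i _ => Finset.sum_congr rfl fun a _ =>
          Finset.sum_congr rfl fun b _ => ?_
        ring
      simp only [e]
      have hI : ∀ k a b, Integrable (fun x => cc s k a b * (u x a *
            (grad (fun x => edgeWeight (cut l m x)) x k * v x b))) (volume.restrict K) :=
        fun k a b => (hL2 m k a b).const_mul _
      rw [integral_add (hT1 m) (integrable_finsetSum _ fun k _ => integrable_finsetSum _ fun a _ =>
        integrable_finsetSum _ fun b _ => hI k a b)]
      congr 1
      rw [integral_finsetSum _ fun k _ => integrable_finsetSum _ fun a _ =>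
        integrable_finsetSum _ fun b _ => hI k a b]
      refine Finset.sum_congr rfl fun k _ => ?_
      rw [integral_finsetSum _ fun a _ => integrable_finsetSum _ fun b _ => hI k a b]
      refine Finset.sum_congr rfl fun a _ => ?_
      rw [integral_finsetSum _ fun b _ => hI k a b]
      exact Finset.sum_congr rfl fun b _ => integral_const_mul _ _
    simp only [heq]
    have := hlim1.add (tendsto_finsetSum Finset.univ fun k _ => tendsto_finsetSum Finset.univ
      fun a _ => tendsto_finsetSum Finset.univ fun b _ => (hlim2 k a b).const_mul (cc s k a b))
    simpa using this
  refine tendsto_nhds_unique (tendsto_const_nhds.congr' ?_) hlim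
  filter_upwards [Filter.eventually_ge_atTop 1] with m hm
  exact hstep m hm

/-! ### Localization of test fields -/

theorem exists_bump {C O : Set V3} (hC : IsCompact C) (hO : IsOpen O) (h : C ⊆ O) :
    ∃ φ : V3 → ℝ, ContDiff ℝ ((⊤ : ℕ∞) : WithTop ℕ∞) φ ∧ tsupport φ ⊆ O ∧ ∀ x ∈ C, φ x = 1 := by
  obtain ⟨t, ht, hCt, htO⟩ := exists_compact_between hC hO h
  obtain ⟨f, hf1, hf0, -⟩ := exists_contMDiffMap_one_nhds_of_subset_interior (n := ⊤) 𝓘(ℝ, V3)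
    hC.isClosed hCt
  refine ⟨f, contMDiff_iff_contDiff.1 f.contMDiff, ?_, fun x hx => hf1.self_of_nhdsSet x hx⟩
  refine (closure_minimal ?_ ht.isClosed).trans htO
  intro x hx
  by_contra hxt
  exact hx (hf0 x hxt)

/-- Since a trace depends only on boundary values, a test field may be replaced by one whose whole
support lies where the form is smooth, provided that its support meets the boundary only there. -/
theorem exists_localized {s : Fin 3} (v : Test s) {B O : Set V3} (hB : IsClosed B) (hO : IsOpen O)
    (h : tsupport v ∩ B ⊆ O) : ∃ v' : Test s, tsupport v' ⊆ O ∧ ∀ x ∈ B, v' x = v x := by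
  obtain ⟨φ, hφ, hs, h1⟩ := exists_bump (v.hasCompactSupport.isCompact.inter_right hB) hO h
  refine ⟨mulTest φ hφ v, ?_, fun x hx => ?_⟩
  · refine Set.Subset.trans (closure_mono ?_) hs
    intro x hx hx0
    apply hx
    simp [coe_mulTest, hx0]
  · rw [coe_mulTest]
    by_cases hxs : x ∈ tsupport v
    · simp [h1 x ⟨hxs, hx⟩]
    · simp [image_eq_zero_of_notMem_tsupport hxs]

/-! ### Traces of continuously differentiable fields -/

theorem continuous_extD {s : Fin 3} {w : Form s} (hw : ∀ a, ContDiff ℝ 1 (fun x => w x a))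
    (b : Fin (proxyDim (s + 1))) : Continuous fun x => extD s w x b :=
  continuous_finsetSum _ fun _ _ => continuous_finsetSum _ fun a _ =>
    continuous_const.mul (continuous_pd (hw a))

theorem memLp_of_continuous {K : Set V3} (hK : IsCompact K) {n : ℕ} {w : V3 → Fin n → ℝ}
    (hw : ∀ a, Continuous (fun x => w x a)) : MemLp w 2 (volume.restrict K) := by
  have hfin : IsFiniteMeasure (volume.restrict K) :=
    isFiniteMeasure_restrict.2 hK.measure_lt_top.ne
  refine memLp_pi fun a => ?_
  obtain ⟨C, hC⟩ := hK.exists_bound_of_continuousOn (hw a).continuousOn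
  refine MemLp.of_bound (hw a).aestronglyMeasurable C ?_
  filter_upwards [ae_restrict_mem hK.isClosed.measurableSet] with x hx using hC x hx

theorem hasWeakD_of_contDiff {s : Fin 3} {K : Set V3} (hK : IsBody K) {w : Form s}
    (hw : ∀ a, ContDiff ℝ 1 (fun x => w x a)) : HasWeakD s K w (extD s w) :=
  hasWeakD_extD hK (fun a => (hw a).contDiffOn)
    (memLp_of_continuous hK.isCompact (continuous_extD hw))

theorem mem_hSpace_of_contDiff {s : Fin 3} {K : Set V3} (hK : IsBody K) {w : Form s}
    (hw : ∀ a, ContDiff ℝ 1 (fun x => w x a)) : w ∈ hSpace s K :=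
  ⟨memLp_of_continuous hK.isCompact fun a => (hw a).continuous, _, hasWeakD_of_contDiff hK hw⟩

/-- The field of Green's formula is smooth if the test field is supported where `p` is smooth. -/
theorem contDiff_flux {s : Fin 3} {O : Set V3} (hO : IsOpen O) {p : Form s}
    (hp : ∀ a, ContDiffOn ℝ 1 (fun x => p x a) O) {v : Test s} (hv : tsupport v ⊆ O) (i : Fin 3) :
    ContDiff ℝ 1 (fun x => flux s (p x) (v x) i) ∧
      tsupport (fun x => flux s (p x) (v x) i) ⊆ tsupport v := by
  have hs : tsupport (fun x => flux s (p x) (v x) i) ⊆ tsupport v := by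
    refine closure_mono fun x hx hx' => hx ?_
    simp [flux, hx']
  refine ⟨?_, hs⟩
  rw [contDiff_iff_contDiffAt]
  intro x
  by_cases hx : x ∈ O
  · refine ContDiffAt.sum fun a _ => ContDiffAt.sum fun b _ => contDiffAt_const.mul
      (ContDiffAt.mul ?_ (v.contDiff_one b).contDiffAt)
    exact (hp a).contDiffAt (hO.mem_nhds hx)
  · have : x ∉ tsupport (fun x => flux s (p x) (v x) i) := fun h => hx (hv (hs h))
    rw [notMem_tsupport_iff_eventuallyEq] at this
    exact contDiffAt_const.congr_of_eventuallyEq this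

theorem tsupport_apply_subset {s : Fin 3} (v : Test s) (b : Fin (proxyDim (s + 1))) :
    tsupport (fun x => v x b) ⊆ tsupport v :=
  closure_mono fun x hx hx' => hx (by change v x b = 0; rw [hx']; rfl)

/-- Outside the support of `v` both integrands vanish, so differentiability of `p` near this support
is enough for the pointwise Green formula. -/
theorem traceOp_eq_integral_diver {s : Fin 3} {K O : Set V3} (hK : IsBody K) (hO : IsOpen O)
    {p : Form s} (hp : ∀ a, ContDiffOn ℝ 1 (fun x => p x a) O) (hw : HasWeakD s K p (extD s p))
    {v : Test s} (hv : tsupport v ⊆ O) :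
    traceOp s K p v = ∫ x in K, diver (fun y => flux s (p y) (v y)) x := by
  rw [traceOp_eq hK hw]
  refine integral_congr_ae (Filter.Eventually.of_forall fun x => ?_)
  by_cases hx : x ∈ O
  · exact (diver_flux s (fun a => ((hp a).contDiffAt (hO.mem_nhds hx)).differentiableAt
      (by norm_num)) fun b => v.differentiable_apply b x).symm
  · have hxv : x ∉ tsupport v := fun h => hx (hv h)
    have h1 : diver (fun y => flux s (p y) (v y)) x = 0 :=
      Finset.sum_eq_zero fun i _ => pd_eq_zero_of_notMem_tsupport
        fun h => hxv ((contDiff_flux hO hp hv i).2 h)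
    have h2 : ∀ i b, pd i (fun y => v y b) x = 0 := fun i b =>
      pd_eq_zero_of_notMem_tsupport fun h => hxv (tsupport_apply_subset v b h)
    simp [h1, dot_codiff, h2, image_eq_zero_of_notMem_tsupport hxv]

/-- Where `f` is nonzero all other inequalities hold strictly, so that `K` and the half space differ
only by points of a null plane. -/
theorem setIntegral_poly_eq_halfspace {ι : Type*} {l : ι → V3 →ᵃ[ℝ] ℝ} {K : Set V3}
    (hP : IsPoly l K) (i : ι) {f : V3 → ℝ} (hf : ∀ x, f x ≠ 0 → ∀ j ≠ i, 0 < l j x) :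
    ∫ x in K, f x = ∫ x in {x | 0 < l i x}, f x := by
  rw [← integral_indicator hP.isClosed.measurableSet, ← integral_indicator
    (isOpen_lt continuous_const (continuous_aff (l i))).measurableSet]
  refine integral_congr_ae ?_
  have h0 : ∀ᵐ x : V3, l i x ≠ 0 := by
    rw [ae_iff]
    simpa using volume_aff_eq_zero (hP.nv_ne i)
  filter_upwards [h0] with x hx
  by_cases hfx : f x = 0
  · simp [Set.indicator_apply, hfx]
  · have : x ∈ K ↔ 0 < l i x := by
      rw [hP.mem_iff]
      constructor
      · exact fun h => lt_of_le_of_ne (h i) hx.symm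
      · intro h j
        by_cases hj : j = i
        · exact hj ▸ h.le
        · exact (hf x hfx j hj).le
    by_cases hxK : x ∈ K
    · rw [Set.indicator_of_mem hxK, Set.indicator_of_mem (by exact this.1 hxK)]
    · rw [Set.indicator_of_notMem hxK, Set.indicator_of_notMem (by exact fun h => hxK (this.2 h))]

theorem diver_flux_support {s : Fin 3} {O : Set V3} (hO : IsOpen O) {p : Form s}
    (hp : ∀ a, ContDiffOn ℝ 1 (fun x => p x a) O) {v : Test s} (hv : tsupport v ⊆ O) {x : V3}
    (hx : diver (fun y => flux s (p y) (v y)) x ≠ 0) : x ∈ O := by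
  by_contra hxO
  exact hx (Finset.sum_eq_zero fun i _ => pd_eq_zero_of_notMem_tsupport
    fun h => hxO (hv ((contDiff_flux hO hp hv i).2 h)))

/-- A field whose tangential part vanishes on a face has no trace there. -/
theorem traceOp_eq_zero_of_symb {ι : Type*} [Fintype ι] {l : ι → V3 →ᵃ[ℝ] ℝ} {K : Set V3}
    (hP : IsPoly l K) (i : ι) {s : Fin 3} {p : Form s} (hpL : p ∈ hSpace s K)
    (hp : ∀ a, ContDiffOn ℝ 1 (fun x => p x a) {x | ∀ j, j ≠ i → 0 < l j x})
    (hw : HasWeakD s K p (extD s p))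
    (h0 : ∀ x ∈ openFace l i, symb s (nv (l i)) (p x) = 0) (v : Test s)
    (hv : tsupport v ∩ frontier K ⊆ openFace l i) : traceOp s K p v = 0 := by
  have hO := isOpen_pos l (· ≠ i)
  -- The field `p` need not be smooth on the whole support of `v`, so `v` is replaced by a field
  -- with the same boundary values that avoids the other faces.
  obtain ⟨v', hv', hvv⟩ := exists_localized v isClosed_frontier hO
    (hv.trans fun x hx => hx.2)
  rw [← (isBoundaryDistribution_traceOp hP hpL).2 v' v hvv,
    traceOp_eq_integral_diver hP.isBody hO hp hw hv',
    setIntegral_poly_eq_halfspace hP i fun x hx => diver_flux_support hO hp hv' hx]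
  refine integral_halfspace_diver (fun k => (contDiff_flux hO hp hv' k).1) (fun k =>
    v'.hasCompactSupport.of_isClosed_subset (isClosed_tsupport _) (contDiff_flux hO hp hv' k).2)
    (hP.nv_ne i) fun x hx => ?_
  rw [dot_flux]
  by_cases hxO : x ∈ {x | ∀ j, j ≠ i → 0 < l j x}
  · rw [h0 x ⟨hx, hxO⟩, zero_dotProduct]
  · have : v' x = 0 := image_eq_zero_of_notMem_tsupport fun h => hxO (hv' h)
    rw [this, dotProduct_zero]

/-! ### Neighbouring elements -/

section Neighbour

variable {ι κ : Type*} {l : ι → V3 →ᵃ[ℝ] ℝ} {μ : κ → V3 →ᵃ[ℝ] ℝ}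
  {K N F : Set V3} {i : ι} {i' : κ}

theorem eventually_line_pos [Finite ι] {p : ι → Prop} {x : V3} (hx : ∀ j, p j → 0 < l j x)
    (e : V3) : ∀ᶠ t : ℝ in nhds 0, ∀ j, p j → 0 < l j (x + t • e) := by
  have hc : Continuous fun t : ℝ => x + t • e := by fun_prop
  have := hc.continuousAt.eventually_mem (x := 0) ((isOpen_pos l p).mem_nhds (by simpa using hx))
  exact this

/-- Suppose that another `μ m` vanished at a relative interior point `x` of `F`, seen as a face of
`K`. A small step from `x` away from a relative interior point of `F`, seen as a face of `N`, would
remain in `F` but make `μ m` negative. -/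
theorem openFace_subset [Finite ι] (hP : IsPoly l K) (hQ : IsPoly μ N)
    (hF : F = {x | x ∈ K ∧ l i x = 0}) (hF' : F = {x | x ∈ N ∧ μ i' x = 0}) :
    openFace l i ⊆ openFace μ i' := by
  rintro x ⟨hx0, hxpos⟩
  have memF : ∀ y, l i y = 0 → (∀ j, j ≠ i → 0 < l j y) → y ∈ F := by
    intro y h1 h2
    rw [hF]
    refine ⟨(hP.mem_iff y).2 fun j => ?_, h1⟩
    by_cases hj : j = i
    · rw [hj, h1]
    · exact (h2 j hj).le
  have hxF := memF x hx0 hxpos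
  have hxN : x ∈ N ∧ μ i' x = 0 := by rw [hF'] at hxF; exact hxF
  refine ⟨hxN.2, fun m hm => ?_⟩
  have h0 : 0 ≤ μ m x := (hQ.mem_iff x).1 hxN.1 m
  refine lt_of_le_of_ne h0 fun hm0 => ?_
  obtain ⟨y, hy0, hypos⟩ := hQ.face i'
  have hyF : y ∈ F := by
    rw [hF']
    refine ⟨(hQ.mem_iff y).2 fun j => ?_, hy0⟩
    by_cases hj : j = i'
    · rw [hj, hy0]
    · exact (hypos j hj).le
  have hyl : l i y = 0 := by rw [hF] at hyF; exact hyF.2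
  have hdir : nv (l i) ⬝ᵥ (y - x) = 0 := by
    have := aff_add (l i) x (y - x)
    rw [add_sub_cancel, hyl, hx0] at this
    linarith
  have hdirm : nv (μ m) ⬝ᵥ (y - x) = μ m y := by
    have := aff_add (μ m) x (y - x)
    rw [add_sub_cancel, ← hm0] at this
    linarith
  obtain ⟨ε, hε, hb⟩ := Metric.eventually_nhds_iff.1
    (eventually_line_pos (p := (· ≠ i)) hxpos (y - x))
  have hz := memF (x + (-(ε / 2)) • (y - x)) (by
    rw [aff_add, dotProduct_smul, hdir, hx0]; simp) (hb (by
      rw [Real.dist_eq, sub_zero, abs_neg, abs_of_pos (by linarith)]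
      linarith))
  rw [hF'] at hz
  have := (hQ.mem_iff _).1 hz.1 m
  rw [aff_add, dotProduct_smul, hdirm, ← hm0, smul_eq_mul] at this
  have := hypos m hm
  nlinarith

/-- Both functions vanish on an open piece of the same plane, so they are proportional. A positive
factor is impossible: a point slightly inside `K` near the face would belong to `N` too, although
the elements meet only in `F`. -/
theorem exists_neg_mul [Finite ι] [Finite κ] (hP : IsPoly l K) (hQ : IsPoly μ N) (hKN : N ∩ K = F)
    (hF : F = {x | x ∈ K ∧ l i x = 0}) (hF' : F = {x | x ∈ N ∧ μ i' x = 0}) :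
    ∃ c < 0, ∀ x, μ i' x = c * l i x := by
  obtain ⟨x, hx0, hxpos⟩ := hP.face i
  have hxQ := openFace_subset hP hQ hF hF' ⟨hx0, hxpos⟩
  set n := nv (l i)
  set n' := nv (μ i')
  have hn := dot_self_pos (hP.nv_ne i)
  have hperp : ∀ e, n ⬝ᵥ e = 0 → n' ⬝ᵥ e = 0 := by
    intro e he
    obtain ⟨ε, hε, hb⟩ := Metric.eventually_nhds_iff.1
      (eventually_line_pos (p := (· ≠ i)) hxpos e)
    have hz := openFace_subset hP hQ hF hF' (show x + (ε / 2) • e ∈ openFace l i from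
      ⟨by rw [aff_add, dotProduct_smul, he, hx0]; simp, hb (by
        rw [Real.dist_eq, sub_zero, abs_of_pos (by linarith)]
        linarith)⟩)
    have := hz.1
    rw [aff_add, hxQ.1, dotProduct_smul, smul_eq_mul, zero_add] at this
    exact (mul_eq_zero.1 this).resolve_left (by positivity)
  set c := n' ⬝ᵥ n / (n ⬝ᵥ n)
  have hpar : n' = c • n := by
    have h1 : n ⬝ᵥ (n' - c • n) = 0 := by
      rw [dotProduct_sub, dotProduct_smul, smul_eq_mul, div_mul_cancel₀ _ hn.ne',
        dotProduct_comm n n', sub_self]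
    have h2 := hperp _ h1
    have h3 : (n' - c • n) ⬝ᵥ (n' - c • n) = 0 := by
      rw [sub_dotProduct, h2, smul_dotProduct, h1]
      simp
    exact sub_eq_zero.1 (dotProduct_self_eq_zero.1 h3)
  have heq : ∀ y, μ i' y = c * l i y := by
    intro y
    have h1 := aff_add (μ i') x (y - x)
    have h2 := aff_add (l i) x (y - x)
    rw [add_sub_cancel] at h1 h2
    rw [h1, h2, hxQ.1, hx0]
    change 0 + n' ⬝ᵥ (y - x) = _
    rw [hpar, smul_dotProduct, smul_eq_mul]
    ring
  refine ⟨c, ?_, heq⟩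
  by_contra hc
  have hc0 : c ≠ 0 := by
    rintro h0
    apply hQ.nv_ne i'
    change n' = 0
    rw [hpar, h0, zero_smul]
  have hcpos : 0 < c := lt_of_le_of_ne (not_lt.1 hc) hc0.symm
  have hev := (eventually_line_pos (p := (· ≠ i)) hxpos n).and
    (eventually_line_pos (p := (· ≠ i')) hxQ.2 n)
  obtain ⟨ε, hε, hb⟩ := Metric.eventually_nhds_iff.1 hev
  obtain ⟨hz1, hz2⟩ := hb (y := ε / 2) (by
    rw [Real.dist_eq, sub_zero, abs_of_pos (by linarith)]
    linarith)
  have hl : 0 < l i (x + (ε / 2) • n) := by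
    rw [aff_add, hx0, dotProduct_smul, smul_eq_mul, zero_add]
    positivity
  have hzF : x + (ε / 2) • n ∈ F := by
    rw [← hKN]
    constructor
    · refine (hQ.mem_iff _).2 fun m => ?_
      by_cases hm : m = i'
      · rw [hm, heq]
        positivity
      · exact (hz2 m hm).le
    · refine (hP.mem_iff _).2 fun m => ?_
      by_cases hm : m = i
      · rw [hm]
        exact hl.le
      · exact (hz1 m hm).le
  rw [hF] at hzF
  exact hl.ne' hzF.2

theorem closure_frontier_subset [Finite ι] (hP : IsPoly l K) (hF : F = {x | x ∈ K ∧ l i x = 0}) :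
    closure (frontier K \ F) ⊆ {x | ∃ j, j ≠ i ∧ l j x = 0} := by
  refine closure_minimal ?_ ?_
  · rintro x ⟨hx, hxF⟩
    obtain ⟨hxK, j, hj⟩ := hP.mem_frontier.1 hx
    refine ⟨j, fun hji => hxF ?_, hj⟩
    rw [hF]
    exact ⟨hxK, hji ▸ hj⟩
  · have : {x | ∃ j, j ≠ i ∧ l j x = 0} = ⋃ j, {x | j ≠ i ∧ l j x = 0} := by ext; simp
    rw [this]
    refine isClosed_iUnion_of_finite fun j => ?_
    by_cases hj : j = i
    · simp [hj]
    · simpa [hj] using isClosed_eq (continuous_aff (l j)) continuous_const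

/-- A point of the `j`-th face is the limit of points on the segment towards a relative interior
point of this face, and on that segment `l i` is positive. -/
theorem mem_closure_frontier [Finite ι] (hP : IsPoly l K) (hF : F = {x | x ∈ K ∧ l i x = 0}) {x : V3}
    (hx : x ∈ K) {j : ι} (hj : j ≠ i) (hxj : l j x = 0) : x ∈ closure (frontier K \ F) := by
  obtain ⟨y, hy0, hypos⟩ := hP.face j
  have hlim : Filter.Tendsto (fun t : ℝ => x + t • (y - x)) (nhdsWithin 0 (Set.Ioi 0)) (nhds x) := by
    have hc : Continuous fun t : ℝ => x + t • (y - x) := by fun_prop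
    have := hc.tendsto 0
    simp only [zero_smul, add_zero] at this
    exact this.mono_left nhdsWithin_le_nhds
  refine mem_closure_of_tendsto hlim ?_
  filter_upwards [Ioo_mem_nhdsGT (show (0 : ℝ) < 1 by norm_num)] with t ht
  have hval : ∀ m, l m (x + t • (y - x)) = (1 - t) * l m x + t * l m y := by
    intro m
    have := aff_add (l m) x (y - x)
    rw [add_sub_cancel] at this
    rw [aff_add, dotProduct_smul, smul_eq_mul, this]
    ring
  have hK : x + t • (y - x) ∈ K := by
    refine (hP.mem_iff _).2 fun m => ?_
    rw [hval]
    have h1 : 0 ≤ l m x := (hP.mem_iff x).1 hx m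
    have h2 : 0 ≤ l m y := by
      by_cases hm : m = j
      · rw [hm, hy0]
      · exact (hypos m hm).le
    have := ht.1
    have : 0 ≤ 1 - t := by linarith [ht.2]
    positivity
  refine ⟨hP.mem_frontier.2 ⟨hK, j, by rw [hval, hxj, hy0]; ring⟩, fun hmem => ?_⟩
  rw [hF] at hmem
  have h1 := hmem.2
  rw [hval] at h1
  have h2 : 0 ≤ l i x := (hP.mem_iff x).1 hx i
  have h3 := hypos i hj.symm
  have := ht.1
  have : 0 ≤ 1 - t := by linarith [ht.2]
  have : 0 < t * l i y := by positivity
  nlinarith [mul_nonneg ‹0 ≤ 1 - t› h2]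

theorem tsupport_inter_frontier_subset [Finite ι] (hP : IsPoly l K) (hF : F = {x | x ∈ K ∧ l i x = 0})
    {s : Fin 3} {v : Test s} (hv : Disjoint (tsupport v) (closure (frontier K \ F))) :
    tsupport v ∩ frontier K ⊆ openFace l i := by
  rintro x ⟨hxv, hx⟩
  have hxK := (hP.mem_frontier.1 hx).1
  have hn : x ∉ closure (frontier K \ F) := Set.disjoint_left.1 hv hxv
  have hxF : x ∈ F := by
    by_contra h
    exact hn (subset_closure ⟨hx, h⟩)
  rw [hF] at hxF
  refine ⟨hxF.2, fun j hj => lt_of_le_of_ne ((hP.mem_iff x).1 hxK j) fun h => ?_⟩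
  exact hn (mem_closure_frontier hP hF hxK hj h.symm)

/-- Both traces are integrals of the divergence of one smooth compactly supported field over
opposite half spaces, and its integral over the whole space is zero. -/
theorem traceOp_neighbour [Finite ι] [Finite κ] (hP : IsPoly l K) (hQ : IsPoly μ N) (hKN : N ∩ K = F)
    (hF : F = {x | x ∈ K ∧ l i x = 0}) (hF' : F = {x | x ∈ N ∧ μ i' x = 0}) {s : Fin 3}
    {w : Form s} (hw : ∀ a, ContDiff ℝ 1 (fun x => w x a)) {v : Test s}
    (hv : tsupport v ⊆ {x | ∀ j, j ≠ i → 0 < l j x} ∩ {x | ∀ j, j ≠ i' → 0 < μ j x}) :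
    traceOp s K w v = -traceOp s N w v := by
  obtain ⟨c, hc, hcl⟩ := exists_neg_mul hP hQ hKN hF hF'
  have hO := (isOpen_pos l (· ≠ i)).inter (isOpen_pos μ (· ≠ i'))
  have hwO : ∀ a, ContDiffOn ℝ 1 (fun x => w x a)
    ({x | ∀ j, j ≠ i → 0 < l j x} ∩ {x | ∀ j, j ≠ i' → 0 < μ j x}) := fun a => (hw a).contDiffOn
  rw [traceOp_eq_integral_diver hP.isBody hO hwO (hasWeakD_of_contDiff hP.isBody hw) hv,
    traceOp_eq_integral_diver hQ.isBody hO hwO (hasWeakD_of_contDiff hQ.isBody hw) hv,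
    setIntegral_poly_eq_halfspace hP i fun x hx => (diver_flux_support hO hwO hv hx).1,
    setIntegral_poly_eq_halfspace hQ i' fun x hx => (diver_flux_support hO hwO hv hx).2]
  set G : V3 → V3 := fun y => flux s (w y) (v y)
  have hG : ∀ k, ContDiff ℝ 1 fun x => G x k := fun k => (contDiff_flux hO hwO hv k).1
  have hGc : ∀ k, HasCompactSupport fun x => G x k := fun k =>
    v.hasCompactSupport.of_isClosed_subset (isClosed_tsupport _) (contDiff_flux hO hwO hv k).2
  have hInt : Integrable (diver G) := by
    change Integrable (fun x => ∑ k, pd k (fun y => G y k) x) _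
    exact integrable_finsetSum _ fun k _ =>
      (continuous_pd (hG k)).integrable_of_hasCompactSupport (hasCompactSupport_pd (hGc k))
  have hset : {x | 0 < μ i' x} = {x | l i x < 0} := by
    ext x
    simp only [Set.mem_ofPred_eq, hcl]
    constructor
    · intro h
      by_contra h'
      nlinarith
    · intro h
      nlinarith
  have hm : MeasurableSet {x | 0 < l i x} :=
    (isOpen_lt continuous_const (continuous_aff (l i))).measurableSet
  have htot := integral_diver_eq_zero hG hGc
  rw [← integral_add_compl hm hInt] at htot
  have hae : ∫ x in {x | 0 < l i x}ᶜ, diver G x = ∫ x in {x | l i x < 0}, diver G x := by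
    refine setIntegral_congr_set ?_
    have h0 : ∀ᵐ x : V3, l i x ≠ 0 := by
      rw [ae_iff]
      simpa using volume_aff_eq_zero (hP.nv_ne i)
    filter_upwards [h0] with x hx
    refine propext ?_
    change ¬ (0 < l i x) ↔ l i x < 0
    rw [not_lt]
    exact ⟨fun h => lt_of_le_of_ne h hx, le_of_lt⟩
  rw [hset, ← hae]
  linarith

/-- Removes the neighbour from the matching condition: the elements of `W` are smooth on all of
space, so their traces can be taken from `K` instead. What remains is to reconcile two support
conditions, which localization does. -/
theorem matchesOnFace_iff [Fintype ι] [Fintype κ] (hP : IsPoly l K) (hQ : IsPoly μ N) (hKN : N ∩ K = F)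
    (hF : F = {x | x ∈ K ∧ l i x = 0}) (hF' : F = {x | x ∈ N ∧ μ i' x = 0}) {s : Fin 3}
    {W : Set (Form s)} (hW : ∀ w ∈ W, ∀ a, ContDiff ℝ 1 (fun x => w x a)) {u : Form s}
    (hu : u ∈ hSpace s K) :
    MatchesOnFace s K F N W (traceOp s K u) ↔ ∃ w ∈ W, ∀ v : Test s,
      tsupport v ∩ frontier K ⊆ openFace l i → traceOp s K u v = traceOp s K w v := by
  have hO := (isOpen_pos l (· ≠ i)).inter (isOpen_pos μ (· ≠ i'))
  have hsub : openFace l i ⊆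
      {x | ∀ j, j ≠ i → 0 < l j x} ∩ {x | ∀ j, j ≠ i' → 0 < μ j x} :=
    fun x hx => ⟨hx.2, (openFace_subset hP hQ hF hF' hx).2⟩
  constructor
  · rintro ⟨w, hw, h⟩
    refine ⟨w, hw, fun v hv => ?_⟩
    obtain ⟨v', hv', hvv⟩ := exists_localized v isClosed_frontier hO (hv.trans hsub)
    have hwH := mem_hSpace_of_contDiff hP.isBody (hW w hw)
    rw [← (isBoundaryDistribution_traceOp hP hu).2 v' v hvv,
      ← (isBoundaryDistribution_traceOp hP hwH).2 v' v hvv,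
      traceOp_neighbour hP hQ hKN hF hF' (hW w hw) hv']
    refine h v' ?_ ?_
    · refine Set.disjoint_left.2 fun x hx hx' => ?_
      obtain ⟨j, hj, hj0⟩ := closure_frontier_subset hP hF hx'
      exact ((hv' hx).1 j hj).ne' hj0
    · refine Set.disjoint_left.2 fun x hx hx' => ?_
      obtain ⟨j, hj, hj0⟩ := closure_frontier_subset hQ hF' hx'
      exact ((hv' hx).2 j hj).ne' hj0
  · rintro ⟨w, hw, h⟩
    refine ⟨w, hw, fun v hv1 hv2 => ?_⟩
    have hs1 := tsupport_inter_frontier_subset hP hF hv1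
    have hs2 := tsupport_inter_frontier_subset hQ hF' hv2
    -- The boundary values are preserved on both frontiers at once, so the traces from `K` and from
    -- `N` are both unaffected.
    obtain ⟨v', hv', hvv⟩ := exists_localized v
      ((isClosed_frontier (s := K)).union (isClosed_frontier (s := N))) hO (by
        rintro x ⟨hxv, hxK | hxN⟩
        · exact hsub (hs1 ⟨hxv, hxK⟩)
        · have h2 := hs2 ⟨hxv, hxN⟩
          exact ⟨(openFace_subset hQ hP hF' hF h2).2, h2.2⟩)
    rw [h v hs1, ← (isBoundaryDistribution_traceOp hP (mem_hSpace_of_contDiff hP.isBody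
        (hW w hw))).2 v' v fun x hx => hvv x (Or.inl hx),
      ← (isBoundaryDistribution_traceOp hQ (mem_hSpace_of_contDiff hQ.isBody
        (hW w hw))).2 v' v fun x hx => hvv x (Or.inr hx)]
    exact traceOp_neighbour hP hQ hKN hF hF' (hW w hw) hv'

end Neighbour

/-! ### Compatibility of traces along edges -/

/-- A function concentrated near the edge `l₁ = l₂ = 0`, but vanishing near the face `l₁ = 0`. -/
def edgeCut (l₁ l₂ : V3 →ᵃ[ℝ] ℝ) (m : ℕ) (x : V3) : ℝ :=
  m * stD (m * l₁ x - 1) * (1 - chi m (l₂ x))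

theorem contDiff_edgeCut (l₁ l₂ : V3 →ᵃ[ℝ] ℝ) (m : ℕ) :
    ContDiff ℝ ((⊤ : ℕ∞) : WithTop ℕ∞) (edgeCut l₁ l₂ m) := by
  refine (contDiff_const.mul (contDiff_stD.comp ?_)).mul
    (contDiff_const.sub (contDiff_chi_aff l₂ m))
  exact (contDiff_const.mul (contDiff_aff l₁)).sub contDiff_const

theorem pd_edgeCut (l₁ l₂ : V3 →ᵃ[ℝ] ℝ) (m : ℕ) (i : Fin 3) (x : V3) :
    pd i (edgeCut l₁ l₂ m) x =
      m * (m * deriv stD (m * l₁ x - 1)) * (1 - chi m (l₂ x)) * nv l₁ i -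
        (m * stD (m * l₁ x - 1)) * (m * stD (m * l₂ x - 1)) * nv l₂ i := by
  have h1 : HasDerivAt (fun t : ℝ => m * stD (m * t - 1))
      (m * (m * deriv stD (m * l₁ x - 1))) (l₁ x) := by
    have ha : HasDerivAt stD (deriv stD (m * l₁ x - 1)) (m * l₁ x - 1) :=
      (contDiff_stD.differentiable (by simp) _).hasDerivAt
    have hb : HasDerivAt (fun t : ℝ => m * t - 1) (m : ℝ) (l₁ x) := by
      simpa using ((hasDerivAt_id (l₁ x)).const_mul (m : ℝ)).sub_const 1
    have := (ha.comp (l₁ x) hb).const_mul (m : ℝ)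
    rw [mul_comm (deriv stD (m * l₁ x - 1)) (m : ℝ)] at this
    exact this
  have h2 : HasDerivAt (fun t : ℝ => 1 - chi m t) (-(m * stD (m * l₂ x - 1))) (l₂ x) :=
    (hasDerivAt_chi m (l₂ x)).const_sub 1
  have hd1 : DifferentiableAt ℝ (fun x => m * stD (m * l₁ x - 1)) x :=
    (h1.comp_hasFDerivAt x (hasFDerivAt_aff l₁ x)).differentiableAt
  have hd2 : DifferentiableAt ℝ (fun x => 1 - chi m (l₂ x)) x :=
    (h2.comp_hasFDerivAt x (hasFDerivAt_aff l₂ x)).differentiableAt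
  have e : edgeCut l₁ l₂ m = fun x => (m * stD (m * l₁ x - 1)) * (1 - chi m (l₂ x)) := rfl
  rw [e, pd_mul hd1 hd2, pd_comp_aff l₂ h2 i, pd_comp_aff (f := fun t => m * stD (m * t - 1)) l₁ h1 i]
  ring

/-- Inside `K` the cutoff is of order `m` and vanishes unless both functions are at most `2 / m`,
which is the critical case of `tendsto_integral_of_concentrated`. -/
theorem tendsto_integral_edgeCut {ι : Type*} [Finite ι] {l : ι → V3 →ᵃ[ℝ] ℝ} {K : Set V3}
    (hP : IsPoly l K) {i j : ι} (hind : crossProduct (nv (l i)) (nv (l j)) ≠ 0) {f c : V3 → ℝ}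
    (hf : MemLp f 2 (volume.restrict K)) (hc : Continuous c) (hcs : HasCompactSupport c) :
    Filter.Tendsto (fun m => ∫ x in K, f x * (c x * edgeCut (l i) (l j) m x)) Filter.atTop
      (nhds 0) := by
  obtain ⟨C, hC0, hC⟩ := exists_stD_le
  obtain ⟨V, -, hV⟩ := exists_volume_edge_le hP.bounded hind
  obtain ⟨B, hB⟩ := hcs.exists_bound_of_continuous hc
  refine tendsto_integral_of_concentrated hP.isCompact hf (S := fun m => {x | x ∈ K ∧
    (0 ≤ l i x ∧ m * l i x ≤ 2) ∧ (0 ≤ l j x ∧ m * l j x ≤ 2)}) (C := V) (B := B * C)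
    (fun m => hc.mul (contDiff_edgeCut _ _ m).continuous) ?_ hV ?_ ?_
  · intro m x hx hne
    have hne' : edgeCut (l i) (l j) m x ≠ 0 := right_ne_zero_of_mul hne
    refine ⟨hx, ⟨(hP.mem_iff x).1 hx i, ?_⟩, ⟨(hP.mem_iff x).1 hx j, ?_⟩⟩
    · by_contra hlt
      apply hne'
      rw [edgeCut, stD_of_gt (by linarith)]
      simp
    · by_contra hlt
      apply hne'
      rw [edgeCut, chi_of_ge (m := m) (t := l j x) (by linarith)]
      simp
  · intro m x _
    have h1 : |1 - chi m (l j x)| ≤ 1 := by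
      have := chi_mem m (l j x)
      rw [abs_of_nonneg (by linarith [this.2])]
      linarith [this.1]
    have h2 : |edgeCut (l i) (l j) m x| ≤ C * m := by
      rw [edgeCut, abs_mul, abs_mul, Nat.abs_cast]
      calc m * |stD (m * l i x - 1)| * |1 - chi m (l j x)| ≤ m * C * 1 := by
            gcongr
            exact hC _
        _ = C * m := by ring
    rw [abs_mul]
    calc |c x| * |edgeCut (l i) (l j) m x| ≤ B * (C * m) :=
          mul_le_mul (hB x) h2 (abs_nonneg _) ((abs_nonneg _).trans (hB x))
      _ = _ := by ring
  · filter_upwards [hP.isBody.ae_mem_interior] with x hx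
    have hev : ∀ᶠ m : ℕ in Filter.atTop, 2 < m * l i x :=
      (tendsto_natCast_atTop_atTop.atTop_mul_const (hP.mem_interior.1 hx i)).eventually_gt_atTop 2
    filter_upwards [hev] with m hm
    rw [edgeCut, stD_of_gt (by linarith)]
    simp

/-- The lower order part of the trace tested with a field concentrated near an edge. -/
def edgeRest (s : Fin 3) (l₁ l₂ : V3 →ᵃ[ℝ] ℝ) (ψ : V3 → ℝ) (p : Form s) (g : Form (s + 1))
    (X : Fin (proxyDim (s + 1)) → ℝ) (m : ℕ) (x : V3) : ℝ :=
  (ψ x * edgeCut l₁ l₂ m x) * (g x ⬝ᵥ X) + edgeCut l₁ l₂ m x * (grad ψ x ⬝ᵥ flux s (p x) X)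

/-- Only `edgeCut` itself occurs in these terms and not its gradient, so they are sums of integrals
of order one that tend to zero. -/
theorem edgeRest_tendsto {ι : Type*} [Finite ι] {l : ι → V3 →ᵃ[ℝ] ℝ} {K : Set V3}
    (hP : IsPoly l K) {i j : ι} (hind : crossProduct (nv (l i)) (nv (l j)) ≠ 0) {s : Fin 3}
    {p : Form s} {g : Form (s + 1)} (hp : MemLp p 2 (volume.restrict K))
    (hg : MemLp g 2 (volume.restrict K)) {ψ : V3 → ℝ}
    (hψ : ContDiff ℝ ((⊤ : ℕ∞) : WithTop ℕ∞) ψ) (hψc : HasCompactSupport ψ)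
    (X : Fin (proxyDim (s + 1)) → ℝ) :
    (∀ m, Integrable (edgeRest s (l i) (l j) ψ p g X m) (volume.restrict K)) ∧
    Filter.Tendsto (fun m => ∫ x in K, edgeRest s (l i) (l j) ψ p g X m x) Filter.atTop
      (nhds 0) := by
  have hψ1 : ContDiff ℝ 1 ψ := hψ.of_le (by exact_mod_cast le_top)
  have e : ∀ m, edgeRest s (l i) (l j) ψ p g X m = fun x =>
      ∑ b, g x b * ((ψ x * X b) * edgeCut (l i) (l j) m x) +
      ∑ k, ∑ a, ∑ b, p x a * ((cc s k a b * pd k ψ x * X b) * edgeCut (l i) (l j) m x) := by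
    intro m
    ext x
    simp only [edgeRest, dotProduct, flux, grad, Finset.mul_sum]
    congr 1
    · refine Finset.sum_congr rfl fun b _ => ?_
      ring
    · refine Finset.sum_congr rfl fun k _ => Finset.sum_congr rfl fun a _ =>
        Finset.sum_congr rfl fun b _ => ?_
      ring
  have hc1 : ∀ b, Continuous fun x => ψ x * X b := fun b => hψ1.continuous.mul continuous_const
  have hs1 : ∀ b, HasCompactSupport fun x => ψ x * X b := fun b => hψc.mul_right
  have hc2 : ∀ k a b, Continuous fun x => cc s k a b * pd k ψ x * X b := fun k a b =>
    (continuous_const.mul (continuous_pd hψ1)).mul continuous_const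
  have hs2 : ∀ k a b, HasCompactSupport fun x => cc s k a b * pd k ψ x * X b := fun k a b =>
    ((hasCompactSupport_pd hψc).mul_left).mul_right
  have hL : ∀ m (c : V3 → ℝ), Continuous c → HasCompactSupport c →
      MemLp (fun x => c x * edgeCut (l i) (l j) m x) 2 (volume.restrict K) := fun m c hc hcs =>
    (hc.mul (contDiff_edgeCut _ _ m).continuous).memLp_of_hasCompactSupport hcs.mul_right
  have hI1 : ∀ m b, Integrable (fun x => g x b * ((ψ x * X b) * edgeCut (l i) (l j) m x))
      (volume.restrict K) := fun m b =>
    (memLp_apply hg b).integrable_mul (hL m _ (hc1 b) (hs1 b))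
  have hI2 : ∀ m k a b, Integrable (fun x => p x a *
      ((cc s k a b * pd k ψ x * X b) * edgeCut (l i) (l j) m x)) (volume.restrict K) :=
    fun m k a b => (memLp_apply hp a).integrable_mul (hL m _ (hc2 k a b) (hs2 k a b))
  have hJ1 : ∀ m, Integrable (fun x => ∑ b, g x b * ((ψ x * X b) * edgeCut (l i) (l j) m x))
      (volume.restrict K) := fun m => integrable_finsetSum _ fun b _ => hI1 m b
  have hJ2 : ∀ m, Integrable (fun x => ∑ k, ∑ a, ∑ b, p x a *
      ((cc s k a b * pd k ψ x * X b) * edgeCut (l i) (l j) m x)) (volume.restrict K) := fun m =>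
    integrable_finsetSum _ fun k _ => integrable_finsetSum _ fun a _ =>
      integrable_finsetSum _ fun b _ => hI2 m k a b
  refine ⟨fun m => by rw [e]; exact (hJ1 m).add (hJ2 m), ?_⟩
  have heq : ∀ m, ∫ x in K, edgeRest s (l i) (l j) ψ p g X m x =
      (∑ b, ∫ x in K, g x b * ((ψ x * X b) * edgeCut (l i) (l j) m x)) +
      ∑ k, ∑ a, ∑ b, ∫ x in K, p x a *
        ((cc s k a b * pd k ψ x * X b) * edgeCut (l i) (l j) m x) := by
    intro m
    rw [e, integral_add (hJ1 m) (hJ2 m), integral_finsetSum _ fun b _ => hI1 m b]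
    congr 1
    rw [integral_finsetSum _ fun k _ => integrable_finsetSum _ fun a _ =>
      integrable_finsetSum _ fun b _ => hI2 m k a b]
    refine Finset.sum_congr rfl fun k _ => ?_
    rw [integral_finsetSum _ fun a _ => integrable_finsetSum _ fun b _ => hI2 m k a b]
    refine Finset.sum_congr rfl fun a _ => ?_
    rw [integral_finsetSum _ fun b _ => hI2 m k a b]
  simp only [heq]
  have := (tendsto_finsetSum Finset.univ fun b _ =>
    tendsto_integral_edgeCut hP hind (memLp_apply hg b) (hc1 b) (hs1 b)).add
    (tendsto_finsetSum Finset.univ fun k _ => tendsto_finsetSum Finset.univ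
      fun a _ => tendsto_finsetSum Finset.univ fun b _ =>
      tendsto_integral_edgeCut hP hind (memLp_apply hp a) (hc2 k a b) (hs2 k a b))
  simpa using this

/-- The test field concentrated near an edge. -/
def edgeTest (s : Fin 3) (l₁ l₂ : V3 →ᵃ[ℝ] ℝ) {ψ : V3 → ℝ}
    (hψ : ContDiff ℝ ((⊤ : ℕ∞) : WithTop ℕ∞) ψ) (hψc : HasCompactSupport ψ)
    (X : Fin (proxyDim (s + 1)) → ℝ) (m : ℕ) : Test s :=
  mkTest s (fun x => (ψ x * edgeCut l₁ l₂ m x) • X)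
    ((hψ.mul (contDiff_edgeCut l₁ l₂ m)).smul contDiff_const) (hψc.mul_right.smul_right)

/-- The gradient of `edgeCut` has two parts of order `m²`, along `nv l₁` and along `nv l₂`. The
condition on `X` removes the first one and leaves the symmetric product of the two cutoff
derivatives. -/
theorem edgeTest_integrand (s : Fin 3) (l₁ l₂ : V3 →ᵃ[ℝ] ℝ) {ψ : V3 → ℝ}
    (hψ : ContDiff ℝ ((⊤ : ℕ∞) : WithTop ℕ∞) ψ) (hψc : HasCompactSupport ψ)
    {X : Fin (proxyDim (s + 1)) → ℝ} (hX : ∀ q, symb s (nv l₁) q ⬝ᵥ X = 0) (m : ℕ) (p : Form s)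
    (g : Form (s + 1)) (x : V3) :
    g x ⬝ᵥ edgeTest s l₁ l₂ hψ hψc X m x - p x ⬝ᵥ codiff s (edgeTest s l₁ l₂ hψ hψc X m) x =
      edgeRest s l₁ l₂ ψ p g X m x -
        (ψ x * ((m * stD (m * l₁ x - 1)) * (m * stD (m * l₂ x - 1)))) *
          (symb s (nv l₂) (p x) ⬝ᵥ X) := by
  have hd1 : DifferentiableAt ℝ ψ x := hψ.differentiable (by simp) x
  have hd2 : DifferentiableAt ℝ (edgeCut l₁ l₂ m) x :=
    (contDiff_edgeCut l₁ l₂ m).differentiable (by simp) x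
  have e : (edgeTest s l₁ l₂ hψ hψc X m : V3 → _) =
      fun y => (ψ y * edgeCut l₁ l₂ m y) • X := rfl
  have hcm : p x ⬝ᵥ codiff s (fun y => (ψ y * edgeCut l₁ l₂ m y) • X) x =
      (ψ x * edgeCut l₁ l₂ m x) * (p x ⬝ᵥ codiff s (fun _ => X) x) -
        grad (fun y => ψ y * edgeCut l₁ l₂ m y) x ⬝ᵥ flux s (p x) X :=
    dot_codiff_mul s (p x) (φ := fun y => ψ y * edgeCut l₁ l₂ m y) (v := fun _ => X)
      (hd1.fun_mul hd2) (fun b => differentiableAt_const _)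
  rw [e, hcm, dotProduct_smul]
  have hc0 : p x ⬝ᵥ codiff s (fun _ => X) x = 0 := by
    rw [dot_codiff]
    simp [pd]
  have hgr : grad (fun y => ψ y * edgeCut l₁ l₂ m y) x = edgeCut l₁ l₂ m x • grad ψ x +
      (ψ x * (m * (m * deriv stD (m * l₁ x - 1)) * (1 - chi m (l₂ x)))) • nv l₁ -
      (ψ x * ((m * stD (m * l₁ x - 1)) * (m * stD (m * l₂ x - 1)))) • nv l₂ := by
    ext k
    simp only [grad, Pi.add_apply, Pi.sub_apply, Pi.smul_apply, smul_eq_mul]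
    rw [pd_mul hd1 hd2, pd_edgeCut]
    ring
  rw [hc0, hgr, sub_dotProduct, add_dotProduct, smul_dotProduct, smul_dotProduct, smul_dotProduct,
    dot_flux s (nv l₁), dot_flux s (nv l₂), hX, edgeRest]
  simp only [smul_eq_mul]
  ring

/-- The transition rises from zero to one on the unit interval, so by the mean value theorem its
slope is one somewhere. The shift by one matches the argument `m * t - 1` in the cutoffs. -/
theorem exists_stD_ge : ∃ α β c : ℝ, 0 < α ∧ α < β ∧ 0 < c ∧
    ∀ t, t ∈ Set.Icc α β → c ≤ stD (t - 1) := by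
  obtain ⟨t, ht, hd⟩ := exists_deriv_eq_slope Real.smoothTransition (show (0 : ℝ) < 1 by norm_num)
    Real.smoothTransition.continuous.continuousOn
    ((Real.smoothTransition.contDiff (n := 1)).differentiable (by norm_num)).differentiableOn
  have h1 : stD t = 1 := by
    rw [stD, hd]
    simp
  have hev : ∀ᶠ y in nhds t, 1 / 2 < stD y :=
    contDiff_stD.continuous.continuousAt.eventually_mem (Ioi_mem_nhds (by rw [h1]; norm_num))
  obtain ⟨ε, hε, hb⟩ := Metric.eventually_nhds_iff.1 hev
  refine ⟨t + 1, t + 1 + ε / 2, 1 / 2, by linarith [ht.1], by linarith, by norm_num, fun y hy => ?_⟩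
  refine (hb ?_).le
  rw [Real.dist_eq, abs_lt]
  constructor <;> linarith [hy.1, hy.2]

/-- Two fields concentrated at the edge are used, one touching the boundary only in the face `j` and
one only in the face `i`. For `u` their contributions of order `m²` cancel by `hXY`, so the sum of
the two pairings tends to zero. On the other hand the pairings may be computed with `wj` and `wi`,
which leaves the integral of the jump against the kernel `HH` of order `m²`. As this kernel lives on
a set of volume of order `m⁻²`, a nonzero jump at `x₀` would keep the integral away from zero. -/
theorem edge_jump {ι : Type*} [Fintype ι] {l : ι → V3 →ᵃ[ℝ] ℝ} {K : Set V3} (hP : IsPoly l K)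
    {i j : ι} (hind : crossProduct (nv (l i)) (nv (l j)) ≠ 0)
    {s : Fin 3} {u : Form s} (hu : u ∈ hSpace s K) {wi wj : Form s}
    (hwi : ∀ a, ContDiff ℝ 1 (fun x => wi x a)) (hwj : ∀ a, ContDiff ℝ 1 (fun x => wj x a))
    (hi : ∀ v : Test s, tsupport v ∩ frontier K ⊆ openFace l i → traceOp s K u v = traceOp s K wi v)
    (hj : ∀ v : Test s, tsupport v ∩ frontier K ⊆ openFace l j → traceOp s K u v = traceOp s K wj v)
    {X Y : Fin (proxyDim (s + 1)) → ℝ} (hX : ∀ q, symb s (nv (l i)) q ⬝ᵥ X = 0)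
    (hY : ∀ q, symb s (nv (l j)) q ⬝ᵥ Y = 0)
    (hXY : ∀ q, symb s (nv (l j)) q ⬝ᵥ X + symb s (nv (l i)) q ⬝ᵥ Y = 0) {x₀ : V3}
    (h0i : l i x₀ = 0) (h0j : l j x₀ = 0) (hpos : ∀ m, m ≠ i ∧ m ≠ j → 0 < l m x₀) :
    symb s (nv (l j)) (wj x₀) ⬝ᵥ X = symb s (nv (l j)) (wi x₀) ⬝ᵥ X := by
  have hind' : crossProduct (nv (l j)) (nv (l i)) ≠ 0 := by
    rw [← cross_anticomm]
    exact neg_ne_zero.2 hind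
  set q : V3 → ℝ := fun x => symb s (nv (l j)) (wj x) ⬝ᵥ X - symb s (nv (l j)) (wi x) ⬝ᵥ X with hq
  have hsc : ∀ (n : V3) (Z : Fin (proxyDim (s + 1)) → ℝ) (w : Form s),
      (∀ a, ContDiff ℝ 1 (fun x => w x a)) → Continuous fun x => symb s n (w x) ⬝ᵥ Z := by
    intro n Z w hw
    exact continuous_finsetSum _ fun b _ => (continuous_finsetSum _ fun k _ =>
      continuous_finsetSum _ fun a _ => continuous_const.mul
        (continuous_const.mul (hw a).continuous)).mul continuous_const
  have hqc : Continuous q := (hsc _ X wj hwj).sub (hsc _ X wi hwi)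
  by_contra hne
  have hq0 : q x₀ ≠ 0 := sub_ne_zero.2 hne
  set q0 := q x₀
  have hq2 : 0 < q0 ^ 2 := by positivity
  -- a bump function at `x₀`
  have hU : {x | q0 ^ 2 / 2 < q0 * q x} ∩ {x | ∀ m, m ≠ i ∧ m ≠ j → 0 < l m x} ∈ nhds x₀ := by
    refine Filter.inter_mem (IsOpen.mem_nhds (isOpen_lt continuous_const
      (continuous_const.mul hqc)) ?_) ((isOpen_pos l _).mem_nhds hpos)
    change q0 ^ 2 / 2 < q0 * q0
    nlinarith
  obtain ⟨ψ, hψU, hψc, hψ, hψr, hψ1⟩ := exists_contDiff_tsupport_subset (n := ⊤) hU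
  have hψn : ∀ x, 0 ≤ ψ x := fun x => (hψr ⟨x, rfl⟩).1
  have hψU' : ∀ x, ψ x ≠ 0 → q0 ^ 2 / 2 < q0 * q x ∧ ∀ m, m ≠ i ∧ m ≠ j → 0 < l m x :=
    fun x hx => hψU (subset_tsupport ψ hx)
  set t1 := edgeTest s (l i) (l j) hψ hψc X
  set t2 := edgeTest s (l j) (l i) hψ hψc Y
  set HH : ℕ → V3 → ℝ := fun m x => ψ x * ((m * stD (m * l i x - 1)) * (m * stD (m * l j x - 1)))
  -- supports
  have hsupp : ∀ (a b : ι) (Z : Fin (proxyDim (s + 1)) → ℝ), (a = i ∧ b = j ∨ a = j ∧ b = i) →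
      ∀ m : ℕ, 1 ≤ m →
      tsupport (edgeTest s (l a) (l b) hψ hψc Z m) ∩ frontier K ⊆ openFace l b := by
    rintro a b Z hab m hm x ⟨hx, hxK⟩
    have hm0 : (0 : ℝ) < m := by exact_mod_cast hm
    have hxψ : x ∈ tsupport ψ := by
      refine closure_mono ?_ hx
      intro y hy h0
      apply hy
      change (ψ y * edgeCut (l a) (l b) m y) • Z = 0
      simp [h0]
    have hla : 0 < l a x := by
      have hcl : IsClosed {y | 1 ≤ m * l a y} :=
        isClosed_le continuous_const (continuous_const.mul (continuous_aff (l a)))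
      have : x ∈ {y | 1 ≤ m * l a y} := by
        refine closure_minimal ?_ hcl hx
        intro y hy
        by_contra hlt
        apply hy
        change (ψ y * edgeCut (l a) (l b) m y) • Z = 0
        rw [edgeCut, stD_of_neg (by
          have : ¬ (1 ≤ m * l a y) := hlt
          linarith)]
        simp
      by_contra hlt
      have : 1 ≤ m * l a x := this
      nlinarith
    have hother := (hψU hxψ).2
    have hall : ∀ c ≠ b, 0 < l c x := by
      intro c hc
      by_cases hca : c = a
      · exact hca ▸ hla
      · refine hother c ?_
        rcases hab with ⟨rfl, rfl⟩ | ⟨rfl, rfl⟩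
        · exact ⟨hca, hc⟩
        · exact ⟨hc, hca⟩
    obtain ⟨-, c, hc⟩ := hP.mem_frontier.1 hxK
    have hcb : c = b := by
      by_contra hcb
      exact (hall c hcb).ne' hc
    exact ⟨hcb ▸ hc, hall⟩
  -- the identity for the jump
  have hgu := hasWeakD_weakD hu
  have hgi := hasWeakD_of_contDiff hP.isBody hwi
  have hgj := hasWeakD_of_contDiff hP.isBody hwj
  have hLi := (mem_hSpace_of_contDiff hP.isBody hwi).1
  have hLj := (mem_hSpace_of_contDiff hP.isBody hwj).1
  have hru1 := edgeRest_tendsto hP hind hu.1 hgu.1 hψ hψc X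
  have hru2 := edgeRest_tendsto hP hind' hu.1 hgu.1 hψ hψc Y
  have hrj := edgeRest_tendsto hP hind hLj hgj.1 hψ hψc X
  have hri := edgeRest_tendsto hP hind' hLi hgi.1 hψ hψc Y
  have hHHc : ∀ m, Continuous (HH m) := fun m => by
    have hst : ∀ a, Continuous fun x => (m : ℝ) * stD (m * l a x - 1) := fun a =>
      continuous_const.mul (contDiff_stD.continuous.comp
        ((continuous_const.mul (continuous_aff (l a))).sub continuous_const))
    exact hψ.continuous.mul ((hst i).mul (hst j))
  have hHHs : ∀ m, HasCompactSupport (HH m) := fun m => hψc.mul_right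
  have hHI : ∀ m (f : V3 → ℝ), Continuous f → Integrable (fun x => HH m x * f x)
      (volume.restrict K) := fun m f hf =>
    ((hHHc m).mul hf).integrable_of_hasCompactSupport (hHHs m).mul_right
  have hT1 : ∀ m (p : Form s) (g : Form (s + 1)) (x : V3),
      g x ⬝ᵥ t1 m x - p x ⬝ᵥ codiff s (t1 m) x = edgeRest s (l i) (l j) ψ p g X m x -
        HH m x * (symb s (nv (l j)) (p x) ⬝ᵥ X) := fun m p g x =>
    edgeTest_integrand s (l i) (l j) hψ hψc hX m p g x
  have hT2 : ∀ m (p : Form s) (g : Form (s + 1)) (x : V3),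
      g x ⬝ᵥ t2 m x - p x ⬝ᵥ codiff s (t2 m) x = edgeRest s (l j) (l i) ψ p g Y m x -
        HH m x * (symb s (nv (l i)) (p x) ⬝ᵥ Y) := fun m p g x => by
    rw [edgeTest_integrand s (l j) (l i) hψ hψc hY m p g x]
    simp only [HH]
    ring
  have hYX : ∀ p, symb s (nv (l i)) p ⬝ᵥ Y = -(symb s (nv (l j)) p ⬝ᵥ X) := fun p => by
    linarith [hXY p]
  -- Here `hYX` cancels the terms of order `m²`, so that no regularity of `u` at the edge is needed.
  have hsumu : ∀ m, traceOp s K u (t1 m) + traceOp s K u (t2 m) =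
      (∫ x in K, edgeRest s (l i) (l j) ψ u (weakD s K u) X m x) +
        ∫ x in K, edgeRest s (l j) (l i) ψ u (weakD s K u) Y m x := by
    intro m
    rw [traceOp, traceOp, ← integral_add (hru1.1 m) (hru2.1 m), ← integral_add]
    · refine integral_congr_ae (Filter.Eventually.of_forall fun x => ?_)
      simp only [hT1, hT2, hYX]
      ring
    · exact (integrable_dot_test hgu.1 _).sub (integrable_dot_codiff hu.1 _)
    · exact (integrable_dot_test hgu.1 _).sub (integrable_dot_codiff hu.1 _)
  have htj : ∀ m, traceOp s K wj (t1 m) =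
      (∫ x in K, edgeRest s (l i) (l j) ψ wj (extD s wj) X m x) -
        ∫ x in K, HH m x * (symb s (nv (l j)) (wj x) ⬝ᵥ X) := by
    intro m
    rw [traceOp_eq hP.isBody hgj, ← integral_sub (hrj.1 m) (hHI m _ (hsc _ X wj hwj))]
    exact integral_congr_ae (Filter.Eventually.of_forall fun x => hT1 m wj _ x)
  have hti : ∀ m, traceOp s K wi (t2 m) =
      (∫ x in K, edgeRest s (l j) (l i) ψ wi (extD s wi) Y m x) +
        ∫ x in K, HH m x * (symb s (nv (l j)) (wi x) ⬝ᵥ X) := by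
    intro m
    rw [traceOp_eq hP.isBody hgi, ← integral_add (hri.1 m) (hHI m _ (hsc _ X wi hwi))]
    refine integral_congr_ae (Filter.Eventually.of_forall fun x => ?_)
    simp only [hT2, hYX]
    ring
  have hlim : Filter.Tendsto (fun m => ∫ x in K, HH m x * q x) Filter.atTop (nhds 0) := by
    have hl := ((hrj.2.add hri.2).sub (hru1.2.add hru2.2))
    simp only [add_zero, sub_zero] at hl
    refine hl.congr' ?_
    filter_upwards [Filter.eventually_ge_atTop 1] with m hm
    -- The cutoff in `t1` vanishes near the face `i`, so `t1` tests the trace on the face `j`, where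
    -- it is that of `wj`; for `t2` the roles are exchanged.
    have e1 := hj (t1 m) (hsupp i j X (Or.inl ⟨rfl, rfl⟩) m hm)
    have e2 := hi (t2 m) (hsupp j i Y (Or.inr ⟨rfl, rfl⟩) m hm)
    have e3 := hsumu m
    have e4 : ∫ x in K, HH m x * q x = (∫ x in K, HH m x * (symb s (nv (l j)) (wj x) ⬝ᵥ X)) -
        ∫ x in K, HH m x * (symb s (nv (l j)) (wi x) ⬝ᵥ X) := by
      rw [← integral_sub (hHI m _ (hsc _ X wj hwj)) (hHI m _ (hsc _ X wi hwi))]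
      refine integral_congr_ae (Filter.Eventually.of_forall fun x => ?_)
      simp only [q]
      ring
    rw [e4]
    linarith [htj m, hti m]
  -- the lower bound
  obtain ⟨α, β, c0, hα, hαβ, hc0, hc⟩ := exists_stD_ge
  have hU' : {x | 1 / 2 < ψ x} ∈ nhds x₀ :=
    (isOpen_lt continuous_const hψ.continuous).mem_nhds (by
      change 1 / 2 < ψ x₀
      rw [hψ1]
      norm_num)
  obtain ⟨c, hcpos, hvol⟩ := exists_le_volume_edge hU' hind h0i h0j hα hαβ
  -- Collects the lower bounds `1 / 2` for `ψ`, `c0` for each cutoff derivative and `q0 ^ 2 / 2` for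
  -- `q0 * q`. The integrand is at least `D * m ^ 2` on a set of volume at least `c / m ^ 2`.
  set D := 1 / 2 * (c0 * c0) * (q0 ^ 2 / 2)
  have hD : 0 < D := by positivity
  have hlow : ∀ᶠ m : ℕ in Filter.atTop, D * c ≤ q0 * ∫ x in K, HH m x * q x := by
    filter_upwards [hvol, Filter.eventually_ge_atTop 1] with m hm hm1
    have hm0 : (0 : ℝ) < m := by exact_mod_cast hm1
    set E := {x | x ∈ {x | 1 / 2 < ψ x} ∧ m * l i x ∈ Set.Icc α β ∧ m * l j x ∈ Set.Icc α β} with hE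
    have hEm : MeasurableSet E := by
      refine (isOpen_lt continuous_const hψ.continuous).measurableSet.inter
        (MeasurableSet.inter ?_ ?_)
      · exact (isClosed_Icc.preimage (continuous_const.mul (continuous_aff (l i)))).measurableSet
      · exact (isClosed_Icc.preimage (continuous_const.mul (continuous_aff (l j)))).measurableSet
    have hEK : E ⊆ K := by
      rintro x ⟨hx1, hx2, hx3⟩
      have hψx : ψ x ≠ 0 := by
        have : 1 / 2 < ψ x := hx1
        linarith
      refine (hP.mem_iff x).2 fun a => ?_
      by_cases hai : a = i
      · rw [hai]
        by_contra hlt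
        have := hx2.1
        nlinarith
      by_cases haj : a = j
      · rw [haj]
        by_contra hlt
        have := hx3.1
        nlinarith
      exact ((hψU' x hψx).2 a ⟨hai, haj⟩).le
    have hEfin : volume E ≠ ⊤ := ((measure_mono hEK).trans_lt hP.isCompact.measure_lt_top).ne
    rw [← integral_const_mul]
    have hge : ∫ x in K, E.indicator (fun _ => D * m ^ 2) x ≤ ∫ x in K, q0 * (HH m x * q x) := by
      refine integral_mono ?_ ((hHI m q hqc).const_mul _) ?_
      · refine Integrable.restrict ?_
        rw [integrable_indicator_iff hEm]
        exact integrableOn_const hEfin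
      · intro x
        have hHn : 0 ≤ HH m x :=
          mul_nonneg (hψn x) (mul_nonneg (mul_nonneg hm0.le (stD_nonneg _))
            (mul_nonneg hm0.le (stD_nonneg _)))
        by_cases hxE : x ∈ E
        · simp only [Set.indicator_of_mem hxE]
          obtain ⟨hx1, hx2, hx3⟩ := hxE
          have hx1' : 1 / 2 < ψ x := hx1
          have h1 := (hψU' x (by linarith)).1
          have h2 := hc _ hx2
          have h3 := hc _ hx3
          have h4 : 1 / 2 * ((m * c0) * (m * c0)) ≤ HH m x := by
            simp only [HH]
            gcongr
            exact mul_nonneg hm0.le (stD_nonneg _)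
          calc D * m ^ 2 = (1 / 2 * ((m * c0) * (m * c0))) * (q0 ^ 2 / 2) := by simp only [D]; ring
            _ ≤ HH m x * (q0 * q x) := by
              gcongr
            _ = q0 * (HH m x * q x) := by ring
        · simp only [Set.indicator_of_notMem hxE]
          by_cases hψx : ψ x = 0
          · simp [HH, hψx]
          · have h1 := (hψU' x hψx).1
            have : 0 ≤ HH m x * (q0 * q x) := mul_nonneg hHn (by linarith)
            linarith
    refine le_trans ?_ hge
    rw [integral_indicator_const _ hEm, smul_eq_mul]
    have hv : c / m ^ 2 ≤ (volume.restrict K).real E := by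
      rw [measureReal_restrict_apply hEm, Set.inter_eq_left.2 hEK]
      exact (ENNReal.ofReal_le_iff_le_toReal hEfin).1 hm
    calc D * c = c / m ^ 2 * (D * m ^ 2) := by field_simp
      _ ≤ _ := by gcongr
  have := (hlim.const_mul q0).congr (fun _ => rfl)
  rw [mul_zero] at this
  have h2 := ge_of_tendsto this hlow
  nlinarith

/-! ### Pullbacks -/

/-- The pullback of the value of an `s`-form by a linear map with matrix `J`. -/
def pullM : (s : Fin 3) → Matrix (Fin 3) (Fin 3) ℝ → (Fin (proxyDim s) → ℝ) → Fin (proxyDim s) → ℝ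
  | 0 => fun _ u => u
  | 1 => fun J (u : V3) => J.transpose.mulVec u
  | 2 => fun J (u : V3) => J.adjugate.mulVec u

theorem pull_apply (s : Fin 3) (F : V3 → V3) (u : Form s) (x : V3) :
    pull s F u x = pullM s (jac F x) (u (F x)) := by
  fin_cases s <;> rfl

theorem pullM_one (s : Fin 3) (u : Fin (proxyDim s) → ℝ) : pullM s 1 u = u := by
  fin_cases s
  · rfl
  · exact (show ∀ u : V3, (1 : Matrix (Fin 3) (Fin 3) ℝ).transpose.mulVec u = u by simp) u
  · exact (show ∀ u : V3, (1 : Matrix (Fin 3) (Fin 3) ℝ).adjugate.mulVec u = u by simp) u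

theorem pullM_mul (s : Fin 3) (J M : Matrix (Fin 3) (Fin 3) ℝ) (u : Fin (proxyDim s) → ℝ) :
    pullM s (J * M) u = pullM s M (pullM s J u) := by
  fin_cases s
  · rfl
  · exact (show ∀ u : V3, (J * M).transpose.mulVec u = M.transpose.mulVec (J.transpose.mulVec u)
      from fun u => by rw [Matrix.transpose_mul, Matrix.mulVec_mulVec]) u
  · exact (show ∀ u : V3, (J * M).adjugate.mulVec u = M.adjugate.mulVec (J.adjugate.mulVec u)
      from fun u => by rw [Matrix.adjugate_mul_distrib, Matrix.mulVec_mulVec]) u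

theorem pullM_add (s : Fin 3) (J : Matrix (Fin 3) (Fin 3) ℝ) (u v : Fin (proxyDim s) → ℝ) :
    pullM s J (u + v) = pullM s J u + pullM s J v := by
  fin_cases s
  · rfl
  · exact Matrix.mulVec_add _ _ _
  · exact Matrix.mulVec_add _ _ _

theorem pullM_smul (s : Fin 3) (J : Matrix (Fin 3) (Fin 3) ℝ) (c : ℝ) (u : Fin (proxyDim s) → ℝ) :
    pullM s J (c • u) = c • pullM s J u := by
  fin_cases s
  · rfl
  · exact Matrix.mulVec_smul _ _ _
  · exact Matrix.mulVec_smul _ _ _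

theorem pullM_sub (s : Fin 3) (J : Matrix (Fin 3) (Fin 3) ℝ) (u v : Fin (proxyDim s) → ℝ) :
    pullM s J (u - v) = pullM s J u - pullM s J v := by
  fin_cases s
  · rfl
  · exact Matrix.mulVec_sub _ _ _
  · exact Matrix.mulVec_sub _ _ _

/-- The value of a pullback is a linear function of the value of the form. -/
theorem exists_pullM_eq_sum (s : Fin 3) (J : Matrix (Fin 3) (Fin 3) ℝ) :
    ∃ M : Matrix (Fin (proxyDim s)) (Fin (proxyDim s)) ℝ, ∀ u a,
      pullM s J u a = ∑ b, M a b * u b := by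
  fin_cases s
  · exact ⟨(1 : Matrix (Fin 1) (Fin 1) ℝ), fun u a =>
      (show ∀ (u : Fin 1 → ℝ) a, u a = (1 : Matrix (Fin 1) (Fin 1) ℝ).mulVec u a by simp) u a⟩
  · exact ⟨J.transpose, fun u a => rfl⟩
  · exact ⟨J.adjugate, fun u a => rfl⟩

theorem symb_add (s : Fin 3) (n : V3) (u v : Fin (proxyDim s) → ℝ) :
    symb s n (u + v) = symb s n u + symb s n v := by
  ext b
  simp only [symb, Pi.add_apply, mul_add, Finset.sum_add_distrib]

theorem symb_smul (s : Fin 3) (n : V3) (c : ℝ) (u : Fin (proxyDim s) → ℝ) :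
    symb s n (c • u) = c • symb s n u := by
  ext b
  simp only [symb, Pi.smul_apply, smul_eq_mul, Finset.mul_sum]
  refine Finset.sum_congr rfl fun i _ => Finset.sum_congr rfl fun a _ => ?_
  ring

theorem symb_zero_apply (n : V3) (u : Fin 1 → ℝ) :
    (symb 0 n u : V3) = fun b => n b * u 0 := by
  refine funext fun (b : Fin 3) => ?_
  change ∑ i : Fin 3, ∑ a : Fin 1, (if i = b then (1 : ℝ) else 0) * (n i * u a) = _
  simp

theorem symb_one_apply (n u : V3) : (symb 1 n u : V3) = crossProduct n u := by
  refine funext fun (b : Fin 3) => ?_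
  change ∑ i : Fin 3, ∑ a : Fin 3, (if b = i + 1 ∧ a = i + 2 then (-1 : ℝ) else
    if b = i + 2 ∧ a = i + 1 then 1 else 0) * (n i * u a) = _
  rw [cross_apply]
  fin_cases b <;> simp [Fin.sum_univ_three] <;> ring

theorem symb_two_apply (n u : V3) : (symb 2 n u : Fin 1 → ℝ) = fun _ => n ⬝ᵥ u := by
  refine funext fun b => ?_
  change ∑ i : Fin 3, ∑ a : Fin 3, (if i = a then (1 : ℝ) else 0) * (n i * u a) = _
  simp [dotProduct]

theorem transpose_mulVec_cross (J : Matrix (Fin 3) (Fin 3) ℝ) (n u : V3) :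
    crossProduct (J.transpose.mulVec n) (J.transpose.mulVec u) =
      J.adjugate.mulVec (crossProduct n u) := by
  rw [Matrix.adjugate_fin_three, cross_apply, cross_apply]
  ext i
  fin_cases i <;>
  simp [Matrix.mulVec, dotProduct, Fin.sum_univ_three] <;> ring

theorem transpose_mulVec_dot (J : Matrix (Fin 3) (Fin 3) ℝ) (n u : V3) :
    J.transpose.mulVec n ⬝ᵥ u = n ⬝ᵥ J.mulVec u := by
  rw [Matrix.mulVec_transpose, Matrix.dotProduct_mulVec]

theorem symb_zero_eq_zero {n : V3} {u : Fin 1 → ℝ} :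
    symb 0 n u = 0 ↔ (fun b => n b * u 0) = (0 : V3) :=
  ⟨fun h => (symb_zero_apply n u).symm.trans h, fun h => (symb_zero_apply n u).trans h⟩

theorem symb_one_eq_zero {n u : V3} : symb 1 n u = 0 ↔ crossProduct n u = 0 :=
  ⟨fun h => (symb_one_apply n u).symm.trans h, fun h => (symb_one_apply n u).trans h⟩

theorem symb_two_eq_zero {n u : V3} : symb 2 n u = 0 ↔ n ⬝ᵥ u = 0 :=
  ⟨fun h => congrFun ((symb_two_apply n u).symm.trans h) (0 : Fin 1),
    fun h => (symb_two_apply n u).trans (funext fun _ => h)⟩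

/-- Pullback commutes with the exterior product by a covector, and covectors transform by the
transpose; hence a vanishing tangential part is preserved. -/
theorem symb_pullM_eq_zero (s : Fin 3) (J : Matrix (Fin 3) (Fin 3) ℝ) {n : V3}
    {u : Fin (proxyDim s) → ℝ} (h : symb s n u = 0) :
    symb s (J.transpose.mulVec n) (pullM s J u) = 0 := by
  match s, u, h with
  | 0, u, h =>
    refine symb_zero_eq_zero.2 ?_
    have h' := congrArg J.transpose.mulVec (symb_zero_eq_zero.1 h)
    rw [Matrix.mulVec_zero] at h'
    refine Eq.trans ?_ h'
    ext b
    simp only [Matrix.mulVec, dotProduct, Finset.sum_mul, mul_assoc]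
    rfl
  | 1, u, h =>
    refine symb_one_eq_zero.2 ?_
    have h' := congrArg J.adjugate.mulVec (symb_one_eq_zero.1 h)
    rw [Matrix.mulVec_zero] at h'
    exact (transpose_mulVec_cross J n u).trans h'
  | 2, u, h =>
    refine symb_two_eq_zero.2 ?_
    have h' := symb_two_eq_zero.1 h
    refine (transpose_mulVec_dot J n _).trans ?_
    refine (show ∀ u : V3, n ⬝ᵥ u = 0 → n ⬝ᵥ J.mulVec (J.adjugate.mulVec u) = 0 from ?_) u h'
    intro u h'
    rw [Matrix.mulVec_mulVec, Matrix.mul_adjugate, Matrix.smul_mulVec,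
      Matrix.one_mulVec, dotProduct_smul, h', smul_zero]

theorem jac_eq {F : V3 → V3} {x : V3} (hF : DifferentiableAt ℝ F x) :
    jac F x = LinearMap.toMatrix' (fderiv ℝ F x : V3 →ₗ[ℝ] V3) := by
  ext i j
  rw [jac, Matrix.of_apply, LinearMap.toMatrix'_apply, pd]
  rw [fderiv_apply hF]
  rfl

theorem jac_comp {F G : V3 → V3} {x : V3} (hG : DifferentiableAt ℝ G (F x))
    (hF : DifferentiableAt ℝ F x) : jac (fun y => G (F y)) x = jac G (F x) * jac F x := by
  have hc : DifferentiableAt ℝ (fun y => G (F y)) x := hG.comp x hF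
  rw [jac_eq hG, jac_eq hF, jac_eq hc, ← LinearMap.toMatrix'_comp]
  congr 1
  have := fderiv_comp x hG hF
  change ((fderiv ℝ (G ∘ F) x : V3 →L[ℝ] V3) : V3 →ₗ[ℝ] V3) = _
  rw [this]
  rfl

theorem pull_comp (s : Fin 3) {F G : V3 → V3} {x : V3} (hG : DifferentiableAt ℝ G (F x))
    (hF : DifferentiableAt ℝ F x) (u : Form s) :
    pull s (fun y => G (F y)) u x = pull s F (pull s G u) x := by
  rw [pull_apply, pull_apply, pull_apply, jac_comp hG hF, pullM_mul]

/-! ### Affine equivalences -/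

/-- The matrix of an affine equivalence. -/
def mat (B : V3 ≃ᵃ[ℝ] V3) : Matrix (Fin 3) (Fin 3) ℝ :=
  LinearMap.toMatrix' (B.linear : V3 →ₗ[ℝ] V3)

theorem mat_mulVec (B : V3 ≃ᵃ[ℝ] V3) (x : V3) : (mat B).mulVec x = B.linear x := by
  rw [mat, LinearMap.toMatrix'_mulVec]
  rfl

theorem affEquiv_apply (B : V3 ≃ᵃ[ℝ] V3) (x : V3) : B x = (mat B).mulVec x + B 0 := by
  rw [mat_mulVec]
  have := B.map_vadd 0 x
  simpa using this

theorem contDiff_affEquiv (B : V3 ≃ᵃ[ℝ] V3) {n : WithTop ℕ∞} : ContDiff ℝ n B := by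
  have : (B : V3 → V3) = fun x => LinearMap.toContinuousLinearMap (B.linear : V3 →ₗ[ℝ] V3) x + B 0 := by
    ext1 x
    rw [affEquiv_apply, mat_mulVec]
    rfl
  rw [this]
  exact (ContinuousLinearMap.contDiff _).add contDiff_const

theorem differentiableAt_affEquiv (B : V3 ≃ᵃ[ℝ] V3) (x : V3) : DifferentiableAt ℝ B x :=
  (contDiff_affEquiv B (n := 1)).differentiable (by norm_num) x

theorem jac_affEquiv (B : V3 ≃ᵃ[ℝ] V3) (x : V3) : jac B x = mat B := by
  ext i j
  rw [jac, Matrix.of_apply, mat, LinearMap.toMatrix'_apply]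
  exact pd_aff ((LinearMap.proj i : V3 →ₗ[ℝ] ℝ).toAffineMap.comp B.toAffineMap) j x

theorem pull_affEquiv (s : Fin 3) (B : V3 ≃ᵃ[ℝ] V3) (u : Form s) (x : V3) :
    pull s B u x = pullM s (mat B) (u (B x)) := by
  rw [pull_apply, jac_affEquiv]

theorem mat_symm_mul (B : V3 ≃ᵃ[ℝ] V3) : mat B.symm * mat B = 1 := by
  rw [mat, mat, ← LinearMap.toMatrix'_comp]
  have : (B.symm.linear : V3 →ₗ[ℝ] V3) ∘ₗ (B.linear : V3 →ₗ[ℝ] V3) = LinearMap.id := by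
    ext1 x
    simp
  rw [this, LinearMap.toMatrix'_id]

theorem mat_mul_symm (B : V3 ≃ᵃ[ℝ] V3) : mat B * mat B.symm = 1 := mat_symm_mul B.symm

theorem mat_trans (B C : V3 ≃ᵃ[ℝ] V3) : mat (B.trans C) = mat C * mat B := by
  rw [mat, mat, mat, ← LinearMap.toMatrix'_comp]
  rfl

theorem pull_pull_symm (s : Fin 3) (B : V3 ≃ᵃ[ℝ] V3) (u : Form s) :
    pull s B (pull s B.symm u) = u := by
  ext1 x
  rw [pull_affEquiv, pull_affEquiv, ← pullM_mul, mat_symm_mul, pullM_one, B.symm_apply_apply]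

theorem pull_symm_pull (s : Fin 3) (B : V3 ≃ᵃ[ℝ] V3) (u : Form s) :
    pull s B.symm (pull s B u) = u := pull_pull_symm s B.symm u

theorem pull_trans (s : Fin 3) (B C : V3 ≃ᵃ[ℝ] V3) (u : Form s) :
    pull s (B.trans C) u = pull s B (pull s C u) := by
  ext1 x
  rw [pull_affEquiv, pull_affEquiv, pull_affEquiv, mat_trans, pullM_mul]
  rfl

theorem pull_sub (s : Fin 3) (B : V3 → V3) (u v : Form s) :
    pull s B (u - v) = pull s B u - pull s B v := by
  ext1 x
  rw [Pi.sub_apply, pull_apply, pull_apply, pull_apply, Pi.sub_apply, pullM_sub]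

theorem contDiff_pull (s : Fin 3) (B : V3 ≃ᵃ[ℝ] V3) {w : Form s} {n : WithTop ℕ∞}
    (hw : ∀ a, ContDiff ℝ n (fun x => w x a)) (a : Fin (proxyDim s)) :
    ContDiff ℝ n (fun x => pull s B w x a) := by
  obtain ⟨M, hM⟩ := exists_pullM_eq_sum s (mat B)
  simp only [pull_affEquiv, hM]
  exact ContDiff.sum fun b _ => contDiff_const.mul ((hw b).comp (contDiff_affEquiv B))

/-- The composition of an affine function with the inverse of an affine equivalence. -/
def pushAff (B : V3 ≃ᵃ[ℝ] V3) (l : V3 →ᵃ[ℝ] ℝ) : V3 →ᵃ[ℝ] ℝ := l.comp B.symm.toAffineMap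

theorem pushAff_apply (B : V3 ≃ᵃ[ℝ] V3) (l : V3 →ᵃ[ℝ] ℝ) (x : V3) :
    pushAff B l x = l (B.symm x) := rfl

theorem pushAff_apply_apply (B : V3 ≃ᵃ[ℝ] V3) (l : V3 →ᵃ[ℝ] ℝ) (x : V3) :
    pushAff B l (B x) = l x := by
  rw [pushAff_apply, B.symm_apply_apply]

theorem nv_comp (l : V3 →ᵃ[ℝ] ℝ) (B : V3 ≃ᵃ[ℝ] V3) :
    nv (l.comp B.toAffineMap) = (mat B).transpose.mulVec (nv l) := by
  ext i
  change l.linear (B.linear (Pi.single i 1)) = _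
  rw [linear_eq_dot, ← mat_mulVec, ← transpose_mulVec_dot]
  simp

theorem nv_pushAff (B : V3 ≃ᵃ[ℝ] V3) (l : V3 →ᵃ[ℝ] ℝ) :
    nv (pushAff B l) = (mat B.symm).transpose.mulVec (nv l) := nv_comp l B.symm

theorem nv_eq_mulVec_pushAff (B : V3 ≃ᵃ[ℝ] V3) (l : V3 →ᵃ[ℝ] ℝ) :
    nv l = (mat B).transpose.mulVec (nv (pushAff B l)) := by
  rw [nv_pushAff, Matrix.mulVec_mulVec, ← Matrix.transpose_mul, mat_symm_mul, Matrix.transpose_one,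
    Matrix.one_mulVec]

theorem IsPoly.image {ι : Type*} {l : ι → V3 →ᵃ[ℝ] ℝ} {K : Set V3} (h : IsPoly l K)
    (B : V3 ≃ᵃ[ℝ] V3) : IsPoly (fun i => pushAff B (l i)) (B '' K) where
  mem_iff x := by
    constructor
    · rintro ⟨y, hy, rfl⟩ j
      rw [pushAff_apply_apply]
      exact (h.mem_iff y).1 hy j
    · intro hx
      exact ⟨B.symm x, (h.mem_iff _).2 hx, B.apply_symm_apply x⟩
  bounded := (h.isCompact.image (contDiff_affEquiv B (n := 0)).continuous).isBounded
  nv_ne j h0 := h.nv_ne j (by rw [nv_eq_mulVec_pushAff B, h0, Matrix.mulVec_zero])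
  face j := by
    obtain ⟨x, hx, hx'⟩ := h.face j
    refine ⟨B x, ?_, fun i hi => ?_⟩
    · rw [pushAff_apply_apply, hx]
    · rw [pushAff_apply_apply]
      exact hx' i hi

theorem cross_pushAff_ne (B : V3 ≃ᵃ[ℝ] V3) {l m : V3 →ᵃ[ℝ] ℝ}
    (h : crossProduct (nv l) (nv m) ≠ 0) :
    crossProduct (nv (pushAff B l)) (nv (pushAff B m)) ≠ 0 := by
  intro h0
  apply h
  rw [nv_eq_mulVec_pushAff B l, nv_eq_mulVec_pushAff B m, transpose_mulVec_cross, h0,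
    Matrix.mulVec_zero]

theorem mem_openFace_pushAff {ι : Type*} {l : ι → V3 →ᵃ[ℝ] ℝ} {B : V3 ≃ᵃ[ℝ] V3} {i : ι} {x : V3} :
    x ∈ openFace (fun i => pushAff B (l i)) i ↔ B.symm x ∈ openFace l i := Iff.rfl

/-! ### The reference elements -/

/-- The coordinates as affine functions. -/
def coordAff (i : Fin 3) : V3 →ᵃ[ℝ] ℝ := (LinearMap.proj i : V3 →ₗ[ℝ] ℝ).toAffineMap

theorem nv_coordAff (i : Fin 3) : nv (coordAff i) = Pi.single i 1 := by
  ext j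
  change (Pi.single j 1 : V3) i = _
  rw [Pi.single_apply, Pi.single_apply]
  simp [eq_comm]

/-- The pyramid in the coordinates centred at its apex. -/
def cone : Set V3 := {x | 0 ≤ x 1 ∧ x 0 ≤ x 2 ∧ x 1 ≤ x 2 ∧ 0 ≤ x 0 ∧ x 2 ≤ 1}

/-- The affine functions which cut out the faces of `cone`: the four triangular faces and the
base. -/
def coneL : Fin 5 → V3 →ᵃ[ℝ] ℝ :=
  ![coordAff 1, coordAff 2 - coordAff 0, coordAff 2 - coordAff 1, coordAff 0,
    AffineMap.const ℝ V3 1 - coordAff 2]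

theorem coneL_apply (i : Fin 5) (x : V3) :
    coneL i x = ![x 1, x 2 - x 0, x 2 - x 1, x 0, 1 - x 2] i := by
  fin_cases i <;> rfl

theorem nv_sub (l m : V3 →ᵃ[ℝ] ℝ) : nv (l - m) = nv l - nv m := rfl

theorem nv_const (c : ℝ) : nv (AffineMap.const ℝ V3 c) = 0 := rfl

theorem nv_coneL (i : Fin 5) : nv (coneL i) =
    ![![0, 1, 0], ![-1, 0, 1], ![0, -1, 1], ![1, 0, 0], ![0, 0, -1]] i := by
  fin_cases i
  · change nv (coordAff 1) = _
    rw [nv_coordAff]; ext j; fin_cases j <;> simp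
  · change nv (coordAff 2 - coordAff 0) = _
    rw [nv_sub, nv_coordAff, nv_coordAff]; ext j; fin_cases j <;> simp
  · change nv (coordAff 2 - coordAff 1) = _
    rw [nv_sub, nv_coordAff, nv_coordAff]; ext j; fin_cases j <;> simp
  · change nv (coordAff 0) = _
    rw [nv_coordAff]; ext j; fin_cases j <;> simp
  · change nv (AffineMap.const ℝ V3 1 - coordAff 2) = _
    rw [nv_sub, nv_const, nv_coordAff]; ext j; fin_cases j <;> simp

theorem cross_coneL_ne (i j : Fin 5) (h : i ≠ j) :
    crossProduct (nv (coneL i)) (nv (coneL j)) ≠ 0 := by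
  rw [nv_coneL, nv_coneL, cross_apply]
  intro h0
  have h1 := congrFun h0 0
  have h2 := congrFun h0 1
  have h3 := congrFun h0 2
  fin_cases i <;> fin_cases j <;> simp at h h1 h2 h3

theorem isBounded_of_abs_le {K : Set V3} (h : ∀ x ∈ K, ∀ i, |x i| ≤ 1) :
    Bornology.IsBounded K := by
  refine (Metric.isBounded_closedBall (x := (0 : V3)) (r := 1)).subset fun x hx => ?_
  rw [mem_closedBall_zero_iff, pi_norm_le_iff_of_nonneg (by norm_num)]
  exact h x hx

theorem isPoly_cone : IsPoly coneL cone where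
  mem_iff x := by
    simp only [cone, Set.mem_ofPred_eq, Fin.forall_fin_succ, coneL_apply]
    simp
  bounded := isBounded_of_abs_le fun x ⟨h1, h2, h3, h4, h5⟩ i => by
    rw [abs_le]
    fin_cases i <;> constructor <;> simp <;> linarith
  nv_ne j h0 := by
    rw [nv_coneL] at h0
    have h1 := congrFun h0 0
    have h2 := congrFun h0 1
    have h3 := congrFun h0 2
    fin_cases j <;> simp at h1 h2 h3
  face j := by
    refine ⟨![![1 / 4, 0, 1 / 2], ![1 / 2, 1 / 4, 1 / 2], ![1 / 4, 1 / 2, 1 / 2],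
      ![0, 1 / 4, 1 / 2], ![1 / 2, 1 / 2, 1]] j, ?_, fun i hi => ?_⟩
    · rw [coneL_apply]
      fin_cases j <;> simp
    · rw [coneL_apply]
      fin_cases j <;> fin_cases i <;>
        first | exact absurd rfl hi | (simp; done) | (simp; norm_num)

/-- The affine functions which cut out the faces of the reference tetrahedron. -/
def tetL : Fin 4 → V3 →ᵃ[ℝ] ℝ :=
  ![coordAff 0, coordAff 1, coordAff 2,
    AffineMap.const ℝ V3 1 - coordAff 0 - coordAff 1 - coordAff 2]

theorem tetL_apply (i : Fin 4) (x : V3) : tetL i x = ![x 0, x 1, x 2, 1 - x 0 - x 1 - x 2] i := by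
  fin_cases i <;> rfl

theorem isPoly_refTet : IsPoly tetL refTet where
  mem_iff x := by
    simp only [refTet, Set.mem_ofPred_eq, Fin.forall_fin_succ, tetL_apply, Fin.sum_univ_three]
    simp
    constructor
    · rintro ⟨⟨h1, h2, h3⟩, h4⟩
      exact ⟨h1, h2, h3, by linarith⟩
    · rintro ⟨h1, h2, h3, h4⟩
      exact ⟨⟨h1, h2, h3⟩, by linarith⟩
  bounded := isBounded_of_abs_le fun x ⟨h1, h2⟩ i => by
    rw [Fin.sum_univ_three] at h2
    have := h1 0
    have := h1 1
    have := h1 2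
    rw [abs_le]
    fin_cases i <;> constructor <;> simp <;> linarith
  nv_ne j h0 := by
    fin_cases j
    · replace h0 : nv (coordAff 0) = 0 := h0
      rw [nv_coordAff] at h0
      simpa using congrFun h0 0
    · replace h0 : nv (coordAff 1) = 0 := h0
      rw [nv_coordAff] at h0
      simpa using congrFun h0 1
    · replace h0 : nv (coordAff 2) = 0 := h0
      rw [nv_coordAff] at h0
      simpa using congrFun h0 2
    · replace h0 : nv (AffineMap.const ℝ V3 1 - coordAff 0 - coordAff 1 - coordAff 2) = 0 := h0
      rw [nv_sub, nv_sub, nv_sub, nv_const, nv_coordAff, nv_coordAff, nv_coordAff] at h0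
      simpa using congrFun h0 0
  face j := by
    refine ⟨![![0, 1 / 4, 1 / 4], ![1 / 4, 0, 1 / 4], ![1 / 4, 1 / 4, 0],
      ![1 / 3, 1 / 3, 1 / 3]] j, ?_, fun i hi => ?_⟩
    · rw [tetL_apply]
      fin_cases j <;> simp <;> norm_num
    · rw [tetL_apply]
      fin_cases j <;> fin_cases i <;>
        first | exact absurd rfl hi | (simp; done) | (simp; norm_num)

/-- The affine functions which cut out the faces of the unit cube. -/
def cubeL : Fin 3 × Bool → V3 →ᵃ[ℝ] ℝ
  | (i, false) => coordAff i
  | (i, true) => AffineMap.const ℝ V3 1 - coordAff i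

theorem isPoly_refCube : IsPoly cubeL refCube where
  mem_iff x := by
    constructor
    · rintro h ⟨i, b⟩
      cases b
      · exact (h i).1
      · exact sub_nonneg.2 (h i).2
    · exact fun h i => ⟨h (i, false), sub_nonneg.1 (h (i, true))⟩
  bounded := isBounded_of_abs_le fun x h i => by
    rw [abs_le]
    constructor <;> linarith [(h i).1, (h i).2]
  nv_ne := by
    rintro ⟨i, b⟩ h0
    have h1 := congrFun h0 i
    cases b
    · replace h1 : nv (coordAff i) i = 0 := h1
      rw [nv_coordAff] at h1
      simp at h1
    · replace h1 : nv (AffineMap.const ℝ V3 1 - coordAff i) i = 0 := h1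
      rw [nv_sub, nv_const, nv_coordAff] at h1
      simp at h1
  face := by
    rintro ⟨i, b⟩
    refine ⟨fun j => if j = i then (if b then 1 else 0) else 1 / 2, ?_, ?_⟩
    · cases b
      · change (if i = i then _ else _) = (0 : ℝ)
        simp
      · change 1 - (if i = i then _ else _) = (0 : ℝ)
        simp
    · rintro ⟨j, b'⟩ hne
      by_cases hji : j = i
      · subst hji
        cases b <;> cases b' <;> simp at hne
        · change (0 : ℝ) < 1 - (if j = j then _ else _)
          simp
        · change (0 : ℝ) < (if j = j then _ else _)
          simp
      · cases b'
        · change (0 : ℝ) < (if j = i then _ else _)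
          rw [if_neg hji]
          norm_num
        · change (0 : ℝ) < 1 - (if j = i then _ else _)
          rw [if_neg hji]
          norm_num

/-- The reflection which maps `cone` to the reference pyramid. -/
def flip : V3 ≃ᵃ[ℝ] V3 :=
  (LinearEquiv.ofInvolutive
    { toFun := fun x : V3 => (![x 0, x 1, -x 2] : V3)
      map_add' := fun x y => by ext i; fin_cases i <;> simp <;> ring
      map_smul' := fun c x => by ext i; fin_cases i <;> simp }
    (fun x => by ext i; fin_cases i <;> simp)).toAffineEquiv.trans
  (AffineEquiv.constVAdd ℝ V3 ![0, 0, 1])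

theorem flip_apply (x : V3) : flip x = ![x 0, x 1, 1 - x 2] := by
  change (![0, 0, 1] : V3) + ![x 0, x 1, -x 2] = _
  ext i
  fin_cases i <;> simp
  ring

theorem image_flip_cone : flip '' cone = refPyramid := by
  ext x
  constructor
  · rintro ⟨y, ⟨h1, h2, h3, h4, h5⟩, rfl⟩
    rw [flip_apply]
    refine ⟨?_, ?_, ?_, ?_, ?_, ?_⟩ <;> simp <;> linarith
  · rintro ⟨h1, h2, h3, h4, h5, h6⟩
    refine ⟨![x 0, x 1, 1 - x 2], ⟨?_, ?_, ?_, ?_, ?_⟩, ?_⟩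
    iterate 5 simp; try linarith
    rw [flip_apply]
    ext i
    fin_cases i <;> simp

/-- The faces of the pyramid as subsets of the zero sets of the defining affine functions. -/
theorem image_refTriFace (A : V3 ≃ᵃ[ℝ] V3) (i : Fin 4) : A '' refTriFace i =
    {x | x ∈ A '' refPyramid ∧ pushAff (flip.trans A) (coneL (Fin.castSucc i)) x = 0} := by
  have key : ∀ y : V3, y ∈ refTriFace i ↔ y ∈ refPyramid ∧
      coneL (Fin.castSucc i) (flip.symm y) = 0 := by
    intro y
    have hy : y = flip (flip.symm y) := (flip.apply_symm_apply y).symm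
    set z := flip.symm y
    rw [hy, coneL_apply, flip_apply]
    fin_cases i
    · exact Iff.rfl
    · change _ ∧ z 0 = 1 - (1 - z 2) ↔ _ ∧ z 2 - z 0 = 0
      constructor <;> rintro ⟨h, h'⟩ <;> exact ⟨h, by linarith⟩
    · change _ ∧ z 1 = 1 - (1 - z 2) ↔ _ ∧ z 2 - z 1 = 0
      constructor <;> rintro ⟨h, h'⟩ <;> exact ⟨h, by linarith⟩
    · exact Iff.rfl
  ext x
  constructor
  · rintro ⟨y, hy, rfl⟩
    refine ⟨⟨y, ((key y).1 hy).1, rfl⟩, ?_⟩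
    have := ((key y).1 hy).2
    change coneL _ (flip.symm (A.symm (A y))) = 0
    rwa [A.symm_apply_apply]
  · rintro ⟨⟨y, hy, rfl⟩, h⟩
    refine ⟨y, (key y).2 ⟨hy, ?_⟩, rfl⟩
    change coneL _ (flip.symm (A.symm (A y))) = 0 at h
    rwa [A.symm_apply_apply] at h

theorem image_refBase (A : V3 ≃ᵃ[ℝ] V3) : A '' refBase =
    {x | x ∈ A '' refPyramid ∧ pushAff (flip.trans A) (coneL 4) x = 0} := by
  have key : ∀ y : V3, y ∈ refBase ↔ y ∈ refPyramid ∧ coneL 4 (flip.symm y) = 0 := by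
    intro y
    have hy : y = flip (flip.symm y) := (flip.apply_symm_apply y).symm
    set z := flip.symm y
    rw [hy, coneL_apply, flip_apply]
    exact Iff.rfl
  ext x
  constructor
  · rintro ⟨y, hy, rfl⟩
    refine ⟨⟨y, ((key y).1 hy).1, rfl⟩, ?_⟩
    have := ((key y).1 hy).2
    change coneL 4 (flip.symm (A.symm (A y))) = 0
    rwa [A.symm_apply_apply]
  · rintro ⟨⟨y, hy, rfl⟩, h⟩
    refine ⟨y, (key y).2 ⟨hy, ?_⟩, rfl⟩
    change coneL 4 (flip.symm (A.symm (A y))) = 0 at h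
    rwa [A.symm_apply_apply] at h

theorem image_face_eq {ι : Type*} {l : ι → V3 →ᵃ[ℝ] ℝ} {N : Set V3} (B : V3 ≃ᵃ[ℝ] V3) {i : ι}
    (hl : ∀ x, l i x = x 2) :
    B '' {x ∈ N | x 2 = 0} = {x | x ∈ B '' N ∧ pushAff B (l i) x = 0} := by
  ext x
  constructor
  · rintro ⟨y, ⟨hy, h0⟩, rfl⟩
    exact ⟨⟨y, hy, rfl⟩, by rw [pushAff_apply_apply, hl, h0]⟩
  · rintro ⟨⟨y, hy, rfl⟩, h⟩
    rw [pushAff_apply_apply, hl] at h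
    exact ⟨y, ⟨hy, h⟩, rfl⟩

/-! ### Polynomials under affine substitutions -/

section Poly

open MvPolynomial

theorem eval_bind₁' {σ τ : Type*} (g : σ → MvPolynomial τ ℝ) (p : MvPolynomial σ ℝ) (x : τ → ℝ) :
    eval x (bind₁ g p) = eval (fun i => eval x (g i)) p := by
  have := eval₂Hom_bind₁ (RingHom.id ℝ) x g p
  exact this

theorem bind₁_eq_sum {σ τ : Type*} (g : σ → MvPolynomial τ ℝ) (p : MvPolynomial σ ℝ) :
    bind₁ g p = ∑ d ∈ p.support, C (p.coeff d) * ∏ i ∈ d.support, g i ^ d i := by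
  rw [bind₁, aeval_def, eval₂_eq]
  rfl

theorem totalDegree_bind₁_le {σ τ : Type*} (g : σ → MvPolynomial τ ℝ)
    (hg : ∀ i, (g i).totalDegree ≤ 1) (p : MvPolynomial σ ℝ) :
    (bind₁ g p).totalDegree ≤ p.totalDegree := by
  rw [bind₁_eq_sum]
  refine totalDegree_finsetSum_le fun d hd => ?_
  refine (totalDegree_mul _ _).trans ?_
  rw [totalDegree_C, zero_add]
  refine (totalDegree_finsetProd _ _).trans ?_
  refine le_trans ?_ (le_totalDegree hd)
  refine Finset.sum_le_sum fun i _ => ?_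
  refine (totalDegree_pow _ _).trans ?_
  calc d i * (g i).totalDegree ≤ d i * 1 := Nat.mul_le_mul_left _ (hg i)
    _ = d i := mul_one _

theorem degreeOf_bind₁_le {σ τ : Type*} (g : σ → MvPolynomial τ ℝ) (i : τ) (j : σ)
    (hj : (g j).degreeOf i ≤ 1) (h : ∀ j' ≠ j, (g j').degreeOf i = 0) (p : MvPolynomial σ ℝ) :
    (bind₁ g p).degreeOf i ≤ p.degreeOf j := by
  classical
  rw [bind₁_eq_sum]
  refine (degreeOf_sum_le i _ _).trans (Finset.sup_le fun d hd => ?_)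
  refine (degreeOf_C_mul_le _ _ _).trans ?_
  refine (degreeOf_prod_le i _ _).trans ?_
  refine le_trans ?_ (monomial_le_degreeOf j hd)
  calc ∑ j' ∈ d.support, (g j' ^ d j').degreeOf i ≤ ∑ j' ∈ d.support, if j' = j then d j else 0 := by
        refine Finset.sum_le_sum fun j' _ => ?_
        refine (degreeOf_pow_le _ _ _).trans ?_
        split_ifs with hjj
        · rw [hjj]
          calc d j * (g j).degreeOf i ≤ d j * 1 := Nat.mul_le_mul_left _ hj
            _ = d j := mul_one _
        · rw [h j' hjj, mul_zero]
    _ ≤ d j := by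
        rw [Finset.sum_ite_eq' d.support j]
        split_ifs <;> simp

theorem totalDegree_aff_le {σ : Type*} [Fintype σ] (c : σ → ℝ) (b : ℝ) :
    (∑ j, C (c j) * X j + C b : MvPolynomial σ ℝ).totalDegree ≤ 1 := by
  refine (totalDegree_add _ _).trans (max_le ?_ (by simp))
  refine totalDegree_finsetSum_le fun j _ => (totalDegree_mul _ _).trans ?_
  rw [totalDegree_C, zero_add, totalDegree_X]

/-- The components of an affine map as polynomials. -/
def affPoly (B : V3 ≃ᵃ[ℝ] V3) (i : Fin 3) : MvPolynomial (Fin 3) ℝ :=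
  ∑ j, C (mat B i j) * X j + C (B 0 i)

theorem eval_affPoly (B : V3 ≃ᵃ[ℝ] V3) (i : Fin 3) (x : V3) : eval x (affPoly B i) = B x i := by
  rw [affEquiv_apply B x]
  simp [affPoly, Matrix.mulVec, dotProduct]

theorem eval_bind₁_affPoly (B : V3 ≃ᵃ[ℝ] V3) (p : MvPolynomial (Fin 3) ℝ) (x : V3) :
    eval x (bind₁ (affPoly B) p) = eval (B x) p := by
  rw [eval_bind₁']
  simp only [eval_affPoly]

theorem totalDegree_bind₁_affPoly (B : V3 ≃ᵃ[ℝ] V3) (p : MvPolynomial (Fin 3) ℝ) :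
    (bind₁ (affPoly B) p).totalDegree ≤ p.totalDegree :=
  totalDegree_bind₁_le _ (fun _ => totalDegree_aff_le _ _) p

theorem totalDegree_C_mul_le {σ : Type*} (c : ℝ) (p : MvPolynomial σ ℝ) :
    (C c * p).totalDegree ≤ p.totalDegree := by
  refine (totalDegree_mul _ _).trans ?_
  rw [totalDegree_C, zero_add]

theorem contDiff_eval {σ : Type*} (p : MvPolynomial σ ℝ) {g : σ → V3 → ℝ} {n : WithTop ℕ∞}
    (hg : ∀ i, ContDiff ℝ n (g i)) : ContDiff ℝ n (fun x => eval (fun i => g i x) p) := by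
  induction p using MvPolynomial.induction_on with
  | C a => simpa using contDiff_const
  | add p q hp hq => simpa using hp.add hq
  | mul_X p i hp => simpa using hp.mul (hg i)

theorem contDiff_eval_self (p : MvPolynomial (Fin 3) ℝ) {n : WithTop ℕ∞} :
    ContDiff ℝ n (fun x : V3 => eval x p) :=
  contDiff_eval p (g := fun i x => x i) fun i => contDiff_apply ℝ ℝ i

/-! ### The spaces on tetrahedra -/

theorem sub_homogeneousComponent_totalDegree {p : MvPolynomial (Fin 3) ℝ} {k : ℕ}
    (hp : p.totalDegree ≤ k) (hk : 1 ≤ k) :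
    (p - homogeneousComponent k p).totalDegree ≤ k - 1 := by
  refine Finset.sup_le fun d hd => ?_
  rw [mem_support_iff, coeff_sub, coeff_homogeneousComponent] at hd
  have hne : d.degree ≠ k := fun h => hd (by rw [if_pos h, sub_self])
  rw [if_neg hne, sub_zero] at hd
  have hle : d.degree ≤ k := (le_totalDegree (mem_support_iff.2 hd)).trans hp
  change d.degree ≤ k - 1
  omega

theorem totalDegree_X_mul_le {p : MvPolynomial (Fin 3) ℝ} {k : ℕ} (hk : 1 ≤ k)
    (hp : p.totalDegree ≤ k - 1) (j : Fin 3) : (X j * p).totalDegree ≤ k := by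
  refine (totalDegree_mul _ _).trans ?_
  rw [totalDegree_X]
  omega

/-- The part of degree `k + 1` of `∑ j, X j * p j` is the product of `x` with the part of degree `k`
of `p`. The orthogonality condition is thus a degree bound, a form in which sums and affine
substitutions are easy to handle. -/
theorem mem_tetSpace_one {k : ℕ} (hk : 1 ≤ k) {w : V3 → V3} : w ∈ tetSpace 1 k ↔
    ∃ p : Fin 3 → MvPolynomial (Fin 3) ℝ, (∀ j, (p j).totalDegree ≤ k) ∧
      (∑ j, X j * p j).totalDegree ≤ k ∧ ∀ x, w x = fun j => eval x (p j) := by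
  constructor
  · rintro ⟨p, q, hp, hq, hpq, hw⟩
    refine ⟨fun j => p j + q j, fun j => ?_, ?_, fun x => ?_⟩
    · refine (totalDegree_add _ _).trans (max_le ?_ (hq j).totalDegree_le)
      exact (hp j).trans (Nat.sub_le _ _)
    · simp only [mul_add, Finset.sum_add_distrib, hpq, add_zero]
      exact totalDegree_finsetSum_le fun j _ => totalDegree_X_mul_le hk (hp j) j
    · rw [hw]
      simp
  · rintro ⟨p, hp, hX, hw⟩
    refine ⟨fun j => p j - homogeneousComponent k (p j), fun j => homogeneousComponent k (p j),
      fun j => sub_homogeneousComponent_totalDegree (hp j) hk,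
      fun j => homogeneousComponent_isHomogeneous _ _, ?_, fun x => ?_⟩
    · have hhom : (∑ j, X j * homogeneousComponent k (p j) : MvPolynomial (Fin 3) ℝ).IsHomogeneous
          (1 + k) :=
        IsHomogeneous.sum _ _ _ fun j _ =>
          (isHomogeneous_X ℝ j).mul (homogeneousComponent_isHomogeneous _ _)
      by_contra hne
      have h1 := hhom.totalDegree hne
      have h2 : (∑ j, X j * homogeneousComponent k (p j) : MvPolynomial (Fin 3) ℝ) =
          ∑ j, X j * p j - ∑ j, X j * (p j - homogeneousComponent k (p j)) := by
        simp [mul_sub]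
      have h3 : (∑ j, X j * homogeneousComponent k (p j) :
          MvPolynomial (Fin 3) ℝ).totalDegree ≤ k := by
        rw [h2]
        refine (totalDegree_sub _ _).trans (max_le hX ?_)
        exact totalDegree_finsetSum_le fun j _ =>
          totalDegree_X_mul_le hk (sub_homogeneousComponent_totalDegree (hp j) hk) j
      omega
    · rw [hw]
      simp

/-- The lower order part of `q` times `x` can be moved into `p`, so homogeneity of `q` is not
essential. -/
theorem mem_tetSpace_two {k : ℕ} (hk : 1 ≤ k) {w : V3 → V3} : w ∈ tetSpace 2 k ↔
    ∃ (p : Fin 3 → MvPolynomial (Fin 3) ℝ) (q : MvPolynomial (Fin 3) ℝ),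
      (∀ j, (p j).totalDegree ≤ k - 1) ∧ q.totalDegree ≤ k - 1 ∧
      ∀ x, w x = fun j => eval x (p j) + eval x q * x j := by
  constructor
  · rintro ⟨p, q, hp, hq, hw⟩
    exact ⟨p, q, hp, hq.totalDegree_le, hw⟩
  · rintro ⟨p, q, hp, hq, hw⟩
    refine ⟨fun j => p j + X j * (q - homogeneousComponent (k - 1) q),
      homogeneousComponent (k - 1) q, fun j => ?_, homogeneousComponent_isHomogeneous _ _,
      fun x => ?_⟩
    · refine (totalDegree_add _ _).trans (max_le (hp j) ?_)
      rcases Nat.lt_or_ge 1 k with hk1 | hk1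
      · exact totalDegree_X_mul_le (by omega)
          (sub_homogeneousComponent_totalDegree hq (by omega)) j
      · have h0 : k - 1 = 0 := by omega
        rw [h0] at hq ⊢
        rw [totalDegree_eq_zero_iff_eq_C.1 (Nat.le_zero.1 hq)]
        simp
    · rw [hw]
      ext j
      simp
      ring

theorem tetSpace_add_smul {s : Fin 3} {k : ℕ} (hk : 1 ≤ k) {w w' : Form s} (hw : w ∈ tetSpace s k)
    (hw' : w' ∈ tetSpace s k) (c : ℝ) : w + c • w' ∈ tetSpace s k := by
  match s, w, w', hw, hw' with
  | 0, w, w', ⟨p, hp, hw⟩, ⟨p', hp', hw'⟩ =>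
    refine ⟨p + C c * p', (totalDegree_add _ _).trans
      (max_le hp ((totalDegree_C_mul_le _ _).trans hp')), fun x => ?_⟩
    refine funext fun (j : Fin 1) => ?_
    change w x j + c * w' x j = _
    rw [congrFun (hw x) j, congrFun (hw' x) j]
    simp
  | 1, w, w', hw, hw' =>
    obtain ⟨p, hp, hX, hw⟩ := (mem_tetSpace_one hk).1 hw
    obtain ⟨p', hp', hX', hw'⟩ := (mem_tetSpace_one hk).1 hw'
    refine (mem_tetSpace_one hk).2 ⟨fun j => p j + C c * p' j, fun j => ?_, ?_, fun x => ?_⟩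
    · exact (totalDegree_add _ _).trans (max_le (hp j) ((totalDegree_C_mul_le _ _).trans (hp' j)))
    · have : ∑ j, X j * (p j + C c * p' j) = ∑ j, X j * p j + C c * ∑ j, X j * p' j := by
        rw [Finset.mul_sum, ← Finset.sum_add_distrib]
        refine Finset.sum_congr rfl fun j _ => ?_
        ring
      rw [this]
      exact (totalDegree_add _ _).trans (max_le hX ((totalDegree_C_mul_le _ _).trans hX'))
    · refine funext fun (j : Fin 3) => ?_
      change w x j + c * w' x j = _
      rw [congrFun (hw x) j, congrFun (hw' x) j]
      simp
  | 2, w, w', hw, hw' =>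
    obtain ⟨p, q, hp, hq, hw⟩ := (mem_tetSpace_two hk).1 hw
    obtain ⟨p', q', hp', hq', hw'⟩ := (mem_tetSpace_two hk).1 hw'
    refine (mem_tetSpace_two hk).2 ⟨fun j => p j + C c * p' j, q + C c * q', fun j => ?_, ?_,
      fun x => ?_⟩
    · exact (totalDegree_add _ _).trans (max_le (hp j) ((totalDegree_C_mul_le _ _).trans (hp' j)))
    · exact (totalDegree_add _ _).trans (max_le hq ((totalDegree_C_mul_le _ _).trans hq'))
    · refine funext fun (j : Fin 3) => ?_
      change w x j + c * w' x j = _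
      rw [congrFun (hw x) j, congrFun (hw' x) j]
      simp
      ring

theorem zero_mem_tetSpace (s : Fin 3) (k : ℕ) : (0 : Form s) ∈ tetSpace s k := by
  match s with
  | 0 => exact ⟨0, by simp, fun x => by ext; simp⟩
  | 1 => exact ⟨0, 0, by simp, fun j => isHomogeneous_zero _ _ _, by simp, fun x => funext fun (j : Fin 3) => by
      change (0 : ℝ) = eval x 0 + eval x 0
      simp⟩
  | 2 => exact ⟨0, 0, by simp, isHomogeneous_zero _ _ _, fun x => funext fun (j : Fin 3) => by
      change (0 : ℝ) = eval x 0 + eval x 0 * x j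
      simp⟩

theorem contDiff_of_mem_tetSpace {s : Fin 3} {k : ℕ} {w : Form s} (hw : w ∈ tetSpace s k)
    {n : WithTop ℕ∞} (a : Fin (proxyDim s)) : ContDiff ℝ n (fun x => w x a) := by
  match s, w, hw, a with
  | 0, w, ⟨p, hp, hw⟩, a => simpa only [hw] using contDiff_eval_self p
  | 1, w, ⟨p, q, hp, hq, hpq, hw⟩, a =>
    simpa only [hw] using (contDiff_eval_self (p a)).add (contDiff_eval_self (q a))
  | 2, w, ⟨p, q, hp, hq, hw⟩, a =>
    simpa only [hw] using (contDiff_eval_self (p a)).add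
      ((contDiff_eval_self q).mul (contDiff_apply ℝ ℝ a))

/-- Because of this invariance the shape of a neighbouring tetrahedron is irrelevant and the space
may be used in the coordinates of the cone. -/
theorem pull_mem_tetSpace {s : Fin 3} {k : ℕ} (hk : 1 ≤ k) {w : Form s} (hw : w ∈ tetSpace s k)
    (B : V3 ≃ᵃ[ℝ] V3) : pull s B w ∈ tetSpace s k := by
  match s, w, hw with
  | 0, w, ⟨p, hp, hw⟩ =>
    refine ⟨bind₁ (affPoly B) p, (totalDegree_bind₁_affPoly B p).trans hp, fun x => ?_⟩
    rw [eval_bind₁_affPoly]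
    exact hw (B x)
  | 1, w, hw =>
    obtain ⟨p, hp, hX, hw⟩ := (mem_tetSpace_one hk).1 hw
    have hlin : ∀ c : Fin 3 → ℝ, (∑ j, C (c j) * bind₁ (affPoly B) (p j)).totalDegree ≤ k :=
      fun c => totalDegree_finsetSum_le fun j _ => (totalDegree_C_mul_le _ _).trans
        ((totalDegree_bind₁_affPoly B _).trans (hp j))
    refine (mem_tetSpace_one hk).2 ⟨fun i => ∑ j, C (mat B j i) * bind₁ (affPoly B) (p j),
      fun i => hlin _, ?_, fun x => ?_⟩
    · have : ∑ i, X i * ∑ j, C (mat B j i) * bind₁ (affPoly B) (p j) =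
          bind₁ (affPoly B) (∑ j, X j * p j) - ∑ j, C (B 0 j) * bind₁ (affPoly B) (p j) := by
        simp only [map_sum, map_mul, bind₁_X_right, affPoly]
        simp only [Fin.sum_univ_three]
        ring
      rw [this]
      exact (totalDegree_sub _ _).trans (max_le ((totalDegree_bind₁_affPoly B _).trans hX) (hlin _))
    · refine (pull_affEquiv 1 B w x).trans ?_
      change (mat B).transpose.mulVec (w (B x)) = _
      rw [hw]
      ext i
      simp [Matrix.mulVec, dotProduct, eval_bind₁_affPoly]
  | 2, w, hw =>
    obtain ⟨p, q, hp, hq, hw⟩ := (mem_tetSpace_two hk).1 hw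
    refine (mem_tetSpace_two hk).2 ⟨fun i => ∑ j, C ((mat B).adjugate i j) *
      bind₁ (affPoly B) (p j) + C ((mat B).adjugate.mulVec (B 0) i) * bind₁ (affPoly B) q,
      C (mat B).det * bind₁ (affPoly B) q, fun i => ?_, ?_, fun x => ?_⟩
    · refine (totalDegree_add _ _).trans (max_le ?_ ?_)
      · exact totalDegree_finsetSum_le fun j _ => (totalDegree_C_mul_le _ _).trans
          ((totalDegree_bind₁_affPoly B _).trans (hp j))
      · exact (totalDegree_C_mul_le _ _).trans ((totalDegree_bind₁_affPoly B _).trans hq)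
    · exact (totalDegree_C_mul_le _ _).trans ((totalDegree_bind₁_affPoly B _).trans hq)
    · refine (pull_affEquiv 2 B w x).trans ?_
      change (mat B).adjugate.mulVec (w (B x)) = _
      -- The radial factor `B x` splits into its linear part, which the adjugate turns into `det`
      -- times `x`, and a constant, which joins the part of lower degree.
      have e : w (B x) = (fun j => eval (B x) (p j)) +
          eval (B x) q • ((mat B).mulVec x + B 0) := by
        rw [hw, ← affEquiv_apply]
        rfl
      rw [e, Matrix.mulVec_add, Matrix.mulVec_smul, Matrix.mulVec_add, Matrix.mulVec_mulVec,
        Matrix.adjugate_mul, Matrix.smul_mulVec, Matrix.one_mulVec]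
      ext i
      simp [Matrix.mulVec, dotProduct, eval_bind₁_affPoly]
      ring

end Poly

/-! ### The spaces on hexahedra -/

/-- The unit square in the plane `x 2 = c`. -/
def square (c : ℝ) : Set V3 := {x | x 2 = c ∧ x 0 ∈ Set.Icc (0 : ℝ) 1 ∧ x 1 ∈ Set.Icc (0 : ℝ) 1}

/-- Such a function attains its minimum over the square at its zeros. A nonzero slope in the first
variable forces this variable to be `0` or `1` there, according to the sign of the slope. -/
theorem eq_of_affine_min {a b d x y x' y' : ℝ} (ha : a ≠ 0) (hx : x ∈ Set.Icc (0 : ℝ) 1)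
    (hy : y ∈ Set.Icc (0 : ℝ) 1) (hx' : x' ∈ Set.Icc (0 : ℝ) 1) (hy' : y' ∈ Set.Icc (0 : ℝ) 1)
    (h : ∀ x ∈ Set.Icc (0 : ℝ) 1, ∀ y ∈ Set.Icc (0 : ℝ) 1, 0 ≤ a * x + b * y + d)
    (h1 : a * x + b * y + d = 0) (h2 : a * x' + b * y' + d = 0) : x = x' := by
  have m0 : (0 : ℝ) ∈ Set.Icc (0 : ℝ) 1 := by simp
  have m1 : (1 : ℝ) ∈ Set.Icc (0 : ℝ) 1 := by simp
  have key : ∀ x ∈ Set.Icc (0 : ℝ) 1, ∀ y ∈ Set.Icc (0 : ℝ) 1, a * x + b * y + d = 0 →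
      (0 < a → x = 0) ∧ (a < 0 → x = 1) := by
    intro x hx y hy h0
    have e0 := h 0 m0 y hy
    have e1 := h 1 m1 y hy
    refine ⟨fun hp => le_antisymm ?_ hx.1, fun hn => le_antisymm hx.2 ?_⟩
    · by_contra hlt
      have := mul_pos hp (not_le.1 hlt)
      linarith
    · by_contra hlt
      have := mul_neg_of_neg_of_pos hn (sub_pos.2 (not_le.1 hlt))
      linarith
  rcases lt_or_gt_of_ne ha with hn | hp
  · rw [(key x hx y hy h1).2 hn, (key x' hx' y' hy' h2).2 hn]
  · rw [(key x hx y hy h1).1 hp, (key x' hx' y' hy' h2).1 hp]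

theorem affEquiv_apply_coord (G : V3 ≃ᵃ[ℝ] V3) (x : V3) (i : Fin 3) :
    G x i = mat G i 0 * x 0 + mat G i 1 * x 1 + mat G i 2 * x 2 + G 0 i := by
  rw [affEquiv_apply G x]
  simp [Matrix.mulVec, dotProduct, Fin.sum_univ_three]

section Square

variable {G : V3 ≃ᵃ[ℝ] V3} {c c' : ℝ}

/-- The `i`-th component of `G` is affine and nonnegative on the square. If it depended on both
variables, it would vanish at one vertex at most, whereas its zeros include the preimages of a whole
edge. -/
theorem mat_row_of_square (h : Set.MapsTo G (square c) (square c'))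
    (h' : Set.MapsTo G.symm (square c') (square c)) (i : Fin 3) (hi : i = 0 ∨ i = 1) :
    mat G i 0 = 0 ∨ mat G i 1 = 0 := by
  by_contra hne
  push Not at hne
  obtain ⟨ha, hb⟩ := hne
  -- two points of the edge `x i = 0`
  obtain ⟨p, q, hp, hq, hpi, hqi, hpq⟩ : ∃ p q : V3, p ∈ square c' ∧ q ∈ square c' ∧ p i = 0 ∧
      q i = 0 ∧ p ≠ q := by
    rcases hi with rfl | rfl
    · refine ⟨![0, 0, c'], ![0, 1, c'], ?_, ?_, rfl, rfl, fun h => ?_⟩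
      · simp [square]
      · simp [square]
      · simpa using congrFun h 1
    · refine ⟨![0, 0, c'], ![1, 0, c'], ?_, ?_, rfl, rfl, fun h => ?_⟩
      · simp [square]
      · simp [square]
      · simpa using congrFun h 0
  have hP := h' hp
  have hQ := h' hq
  set d := mat G i 2 * c + G 0 i
  have hmin : ∀ x ∈ Set.Icc (0 : ℝ) 1, ∀ y ∈ Set.Icc (0 : ℝ) 1,
      0 ≤ mat G i 0 * x + mat G i 1 * y + d := by
    intro x hx y hy
    have hm : (![x, y, c] : V3) ∈ square c := ⟨rfl, hx, hy⟩
    have h0 : 0 ≤ G ![x, y, c] i := by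
      rcases hi with rfl | rfl
      · exact (h hm).2.1.1
      · exact (h hm).2.2.1
    rw [affEquiv_apply_coord] at h0
    simp at h0
    simp only [d]
    linarith
  have hz : ∀ r : V3, r ∈ square c' → r i = 0 →
      mat G i 0 * G.symm r 0 + mat G i 1 * G.symm r 1 + d = 0 := by
    intro r hr hri
    have h1 := affEquiv_apply_coord G (G.symm r) i
    rw [G.apply_symm_apply, hri, (h' hr).1] at h1
    simp only [d]
    linarith
  apply hpq
  have e0 : G.symm p 0 = G.symm q 0 := eq_of_affine_min ha hP.2.1 hP.2.2 hQ.2.1 hQ.2.2 hmin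
    (hz p hp hpi) (hz q hq hqi)
  have e1 : G.symm p 1 = G.symm q 1 := by
    refine eq_of_affine_min hb hP.2.2 hP.2.1 hQ.2.2 hQ.2.1 (b := mat G i 0) (d := d) ?_ ?_ ?_
    · intro y hy x hx
      linarith [hmin x hx y hy]
    · linarith [hz p hp hpi]
    · linarith [hz q hq hqi]
  apply G.symm.injective
  ext j
  fin_cases j
  · exact e0
  · exact e1
  · exact hP.1.trans hQ.1.symm

theorem mat_two_of_square (h : Set.MapsTo G (square c) (square c')) :
    mat G 2 0 = 0 ∧ mat G 2 1 = 0 := by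
  have h0 := (h (show (![0, 0, c] : V3) ∈ square c by simp [square])).1
  have h1 := (h (show (![1, 0, c] : V3) ∈ square c by simp [square])).1
  have h2 := (h (show (![0, 1, c] : V3) ∈ square c by simp [square])).1
  rw [affEquiv_apply_coord] at h0 h1 h2
  simp at h0 h1 h2
  constructor <;> linarith

theorem apply_two_of_square (h : Set.MapsTo G (square c) (square c')) {x : V3} (hx : x 2 = c) :
    G x 2 = c' := by
  have h0 := (h (show (![0, 0, c] : V3) ∈ square c by simp [square])).1
  rw [affEquiv_apply_coord] at h0 ⊢
  rw [(mat_two_of_square h).1, (mat_two_of_square h).2, hx]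
  simp at h0
  linarith

theorem det_mat_ne_zero (G : V3 ≃ᵃ[ℝ] V3) : (mat G).det ≠ 0 := by
  intro h0
  have := congrArg Matrix.det (mat_mul_symm G)
  rw [Matrix.det_mul, h0, zero_mul, Matrix.det_one] at this
  exact zero_ne_one this

/-- An affine map between two squares maps each coordinate to a function of one coordinate. -/
theorem mat_of_square (h : Set.MapsTo G (square c) (square c'))
    (h' : Set.MapsTo G.symm (square c') (square c)) :
    (mat G 0 1 = 0 ∧ mat G 1 0 = 0) ∨ (mat G 0 0 = 0 ∧ mat G 1 1 = 0) := by
  have h2 := mat_two_of_square h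
  have hd := det_mat_ne_zero G
  rw [Matrix.det_fin_three, h2.1, h2.2] at hd
  rcases mat_row_of_square h h' 0 (Or.inl rfl) with a | a <;>
    rcases mat_row_of_square h h' 1 (Or.inr rfl) with b | b
  · exact absurd (by rw [a, b]; ring) hd
  · exact Or.inr ⟨a, b⟩
  · exact Or.inl ⟨a, b⟩
  · exact absurd (by rw [a, b]; ring) hd

open MvPolynomial

/-- The substitution on polynomials induced by an affine map between two squares. -/
def squarePoly (G : V3 ≃ᵃ[ℝ] V3) (c c' : ℝ) : Fin 3 → MvPolynomial (Fin 3) ℝ :=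
  ![C (mat G 0 0) * X 0 + C (mat G 0 1) * X 1 + C (mat G 0 2 * c + G 0 0),
    C (mat G 1 0) * X 0 + C (mat G 1 1) * X 1 + C (mat G 1 2 * c + G 0 1), C c']

theorem eval_bind₁_squarePoly (h : Set.MapsTo G (square c) (square c')) {x : V3} (hx : x 2 = c)
    (p : MvPolynomial (Fin 3) ℝ) : eval x (bind₁ (squarePoly G c c') p) = eval (G x) p := by
  rw [eval_bind₁']
  congr 1
  congr 1
  ext i
  fin_cases i
  · change eval x (C (mat G 0 0) * X 0 + C (mat G 0 1) * X 1 + C (mat G 0 2 * c + G 0 0)) = G x 0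
    rw [affEquiv_apply_coord G x, hx]
    simp
    ring
  · change eval x (C (mat G 1 0) * X 0 + C (mat G 1 1) * X 1 + C (mat G 1 2 * c + G 0 1)) = G x 1
    rw [affEquiv_apply_coord G x, hx]
    simp
    ring
  · change eval x (C c') = G x 2
    rw [apply_two_of_square h hx]
    simp

theorem degreeOf_lin_le (i j : Fin 3) (a b : ℝ) :
    (C a * X j + C b : MvPolynomial (Fin 3) ℝ).degreeOf i ≤ if i = j then 1 else 0 := by
  refine (degreeOf_add_le _ _ _).trans (max_le ?_ (by simp))
  refine (degreeOf_C_mul_le _ _ _).trans ?_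
  rw [degreeOf_X]

theorem degreeOf_bind₁_squarePoly_id (h : mat G 0 1 = 0 ∧ mat G 1 0 = 0)
    (p : MvPolynomial (Fin 3) ℝ) (i : Fin 3) :
    (bind₁ (squarePoly G c c') p).degreeOf i ≤ p.degreeOf i := by
  have e : squarePoly G c c' = ![C (mat G 0 0) * X 0 + C (mat G 0 2 * c + G 0 0),
      C (mat G 1 1) * X 1 + C (mat G 1 2 * c + G 0 1), C c'] := by
    rw [squarePoly, h.1, h.2]
    simp
  rw [e]
  refine degreeOf_bind₁_le _ i i ?_ ?_ p
  · fin_cases i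
    · exact (degreeOf_lin_le _ _ _ _).trans (by simp)
    · exact (degreeOf_lin_le _ _ _ _).trans (by simp)
    · exact (degreeOf_C _ _).le.trans (by simp)
  · intro j hj
    refine Nat.le_zero.1 ?_
    fin_cases j
    · exact (degreeOf_lin_le _ _ _ _).trans (by rw [if_neg]; rintro rfl; exact hj rfl)
    · exact (degreeOf_lin_le _ _ _ _).trans (by rw [if_neg]; rintro rfl; exact hj rfl)
    · exact (degreeOf_C _ _).le

theorem degreeOf_bind₁_squarePoly_swap (h : mat G 0 0 = 0 ∧ mat G 1 1 = 0)
    (p : MvPolynomial (Fin 3) ℝ) (i : Fin 3) :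
    (bind₁ (squarePoly G c c') p).degreeOf i ≤ p.degreeOf (Equiv.swap 0 1 i) := by
  have e : squarePoly G c c' = ![C (mat G 0 1) * X 1 + C (mat G 0 2 * c + G 0 0),
      C (mat G 1 0) * X 0 + C (mat G 1 2 * c + G 0 1), C c'] := by
    rw [squarePoly, h.1, h.2]
    simp
  rw [e]
  refine degreeOf_bind₁_le _ i _ ?_ ?_ p
  · fin_cases i
    · exact (degreeOf_lin_le _ _ _ _).trans (by simp)
    · exact (degreeOf_lin_le _ _ _ _).trans (by simp)
    · exact (degreeOf_C _ _).le.trans (by simp)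
  · intro j hj
    refine Nat.le_zero.1 ?_
    fin_cases j
    · exact (degreeOf_lin_le _ _ _ _).trans (by rw [if_neg]; rintro rfl; exact hj rfl)
    · exact (degreeOf_lin_le _ _ _ _).trans (by rw [if_neg]; rintro rfl; exact hj rfl)
    · exact (degreeOf_C _ _).le

theorem symb_base_zero {a : ℝ} {u : Fin 1 → ℝ} (h : u 0 = 0) : symb 0 ![0, 0, a] u = 0 :=
  symb_zero_eq_zero.2 (by rw [h]; ext; simp)

theorem symb_base_one {a : ℝ} {u : V3} (h0 : u 0 = 0) (h1 : u 1 = 0) : symb 1 ![0, 0, a] u = 0 :=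
  symb_one_eq_zero.2 (by
    rw [cross_apply]
    ext i
    fin_cases i <;> simp [h0, h1])

theorem symb_base_two {a : ℝ} {u : V3} (h : u 2 = 0) : symb 2 ![0, 0, a] u = 0 :=
  symb_two_eq_zero.2 (by simp [dotProduct, Fin.sum_univ_three, h])

/-- The traces on a square of the pullback of a form in `cubeSpace` are those of another such
form. -/
theorem exists_cubeSpace_trace (h : Set.MapsTo G (square c) (square c'))
    (h' : Set.MapsTo G.symm (square c') (square c)) {s : Fin 3} {k : ℕ} {e : Form s}
    (he : e ∈ cubeSpace s k) (a : ℝ) : ∃ e' ∈ cubeSpace s k, ∀ x, x 2 = c →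
      symb s ![0, 0, a] (pull s G e x - e' x) = 0 := by
  have h2 := mat_two_of_square h
  match s, e, he with
  | 0, e, ⟨p, hp, he⟩ =>
    refine ⟨fun x _ => eval x (bind₁ (squarePoly G c c') p), ⟨_, fun i => ?_, fun x => rfl⟩,
      fun x hx => symb_base_zero ?_⟩
    · rcases mat_of_square h h' with hm | hm
      · exact (degreeOf_bind₁_squarePoly_id hm p i).trans (hp i)
      · exact (degreeOf_bind₁_squarePoly_swap hm p i).trans (hp _)
    · refine sub_eq_zero.2 ((congrFun (he (G x)) (0 : Fin 1)).trans ?_)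
      exact (eval_bind₁_squarePoly h hx p).symm
  | 1, e, ⟨p, hp, he⟩ =>
    refine ⟨fun x => fun j : Fin 3 => eval x ((![C (mat G 0 0) * bind₁ (squarePoly G c c') (p 0) +
        C (mat G 1 0) * bind₁ (squarePoly G c c') (p 1),
        C (mat G 0 1) * bind₁ (squarePoly G c c') (p 0) +
        C (mat G 1 1) * bind₁ (squarePoly G c c') (p 1), 0] : Fin 3 → MvPolynomial (Fin 3) ℝ) j),
      ⟨_, fun i j => ?_, fun x => rfl⟩, fun x hx => ?_⟩
    · rcases mat_of_square h h' with hm | hm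
      · rw [hm.1, hm.2]
        fin_cases j
        · simp only [C_0, zero_mul, add_zero]
          refine (degreeOf_C_mul_le _ _ _).trans ((degreeOf_bind₁_squarePoly_id hm _ i).trans ?_)
          exact hp i 0
        · simp only [C_0, zero_mul, zero_add]
          refine (degreeOf_C_mul_le _ _ _).trans ((degreeOf_bind₁_squarePoly_id hm _ i).trans ?_)
          exact hp i 1
        · simp
      · rw [hm.1, hm.2]
        fin_cases j
        · simp only [C_0, zero_mul, zero_add]
          refine (degreeOf_C_mul_le _ _ _).trans ((degreeOf_bind₁_squarePoly_swap hm _ i).trans ?_)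
          refine (hp _ 1).trans ?_
          fin_cases i <;> simp [Equiv.swap_apply_of_ne_of_ne]
        · simp only [C_0, zero_mul, add_zero]
          refine (degreeOf_C_mul_le _ _ _).trans ((degreeOf_bind₁_squarePoly_swap hm _ i).trans ?_)
          refine (hp _ 0).trans ?_
          fin_cases i <;> simp [Equiv.swap_apply_of_ne_of_ne]
        · simp
    · have hv : pull 1 G e x = (mat G).transpose.mulVec (fun j => eval (G x) (p j)) := by
        refine (pull_affEquiv 1 G e x).trans ?_
        exact congrArg (mat G).transpose.mulVec (he (G x))
      refine symb_base_one (sub_eq_zero.2 ?_) (sub_eq_zero.2 ?_)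
      · refine (congrFun hv (0 : Fin 3)).trans ?_
        simp [Matrix.mulVec, dotProduct, Fin.sum_univ_three, h2.1, eval_bind₁_squarePoly h hx]
      · refine (congrFun hv (1 : Fin 3)).trans ?_
        simp [Matrix.mulVec, dotProduct, Fin.sum_univ_three, h2.2, eval_bind₁_squarePoly h hx]
  | 2, e, ⟨p, hp, he⟩ =>
    refine ⟨fun x => fun j : Fin 3 => eval x ((![0, 0, C (mat G 0 0 * mat G 1 1 - mat G 0 1 * mat G 1 0) *
        bind₁ (squarePoly G c c') (p 2)] : Fin 3 → MvPolynomial (Fin 3) ℝ) j),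
      ⟨_, fun i j => ?_, fun x => rfl⟩, fun x hx => ?_⟩
    · fin_cases j
      · simp
      · simp
      · refine (degreeOf_C_mul_le _ _ _).trans ?_
        rcases mat_of_square h h' with hm | hm
        · exact (degreeOf_bind₁_squarePoly_id hm _ i).trans (hp i 2)
        · refine (degreeOf_bind₁_squarePoly_swap hm _ i).trans ((hp _ 2).trans ?_)
          fin_cases i <;> simp [Equiv.swap_apply_of_ne_of_ne]
    · have hv : pull 2 G e x = (mat G).adjugate.mulVec (fun j => eval (G x) (p j)) := by
        refine (pull_affEquiv 2 G e x).trans ?_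
        exact congrArg (mat G).adjugate.mulVec (he (G x))
      refine symb_base_two (sub_eq_zero.2 ?_)
      refine (congrFun hv (2 : Fin 3)).trans ?_
      rw [Matrix.adjugate_fin_three]
      simp [Matrix.mulVec, dotProduct, Fin.sum_univ_three, h2.1, h2.2, eval_bind₁_squarePoly h hx]

end Square

open MvPolynomial in
theorem cubeSpace_add_smul {s : Fin 3} {k : ℕ} {w w' : Form s} (hw : w ∈ cubeSpace s k)
    (hw' : w' ∈ cubeSpace s k) (c : ℝ) : w + c • w' ∈ cubeSpace s k := by
  match s, w, w', hw, hw' with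
  | 0, w, w', ⟨p, hp, hw⟩, ⟨p', hp', hw'⟩ =>
    refine ⟨p + C c * p', fun i => (degreeOf_add_le _ _ _).trans
      (max_le (hp i) ((degreeOf_C_mul_le _ _ _).trans (hp' i))), fun x => ?_⟩
    refine funext fun (j : Fin 1) => ?_
    change w x j + c * w' x j = _
    rw [congrFun (hw x) j, congrFun (hw' x) j]
    simp
  | 1, w, w', ⟨p, hp, hw⟩, ⟨p', hp', hw'⟩ =>
    refine ⟨fun j => p j + C c * p' j, fun i j => (degreeOf_add_le _ _ _).trans
      (max_le (hp i j) ((degreeOf_C_mul_le _ _ _).trans (hp' i j))), fun x => ?_⟩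
    refine funext fun (j : Fin 3) => ?_
    change w x j + c * w' x j = _
    rw [congrFun (hw x) j, congrFun (hw' x) j]
    simp
  | 2, w, w', ⟨p, hp, hw⟩, ⟨p', hp', hw'⟩ =>
    refine ⟨fun j => p j + C c * p' j, fun i j => (degreeOf_add_le _ _ _).trans
      (max_le (hp i j) ((degreeOf_C_mul_le _ _ _).trans (hp' i j))), fun x => ?_⟩
    refine funext fun (j : Fin 3) => ?_
    change w x j + c * w' x j = _
    rw [congrFun (hw x) j, congrFun (hw' x) j]
    simp

theorem zero_mem_cubeSpace (s : Fin 3) (k : ℕ) : (0 : Form s) ∈ cubeSpace s k := by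
  match s with
  | 0 => exact ⟨0, by simp, fun x => by ext; simp⟩
  | 1 => exact ⟨fun _ => 0, by simp, fun x => funext fun (j : Fin 3) => by
      change (0 : ℝ) = MvPolynomial.eval x 0
      simp⟩
  | 2 => exact ⟨fun _ => 0, by simp, fun x => funext fun (j : Fin 3) => by
      change (0 : ℝ) = MvPolynomial.eval x 0
      simp⟩

theorem contDiff_of_mem_cubeSpace {s : Fin 3} {k : ℕ} {w : Form s} (hw : w ∈ cubeSpace s k)
    {n : WithTop ℕ∞} (a : Fin (proxyDim s)) : ContDiff ℝ n (fun x => w x a) := by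
  match s, w, hw, a with
  | 0, w, ⟨p, hp, hw⟩, a => simpa only [hw] using contDiff_eval_self p
  | 1, w, ⟨p, hp, hw⟩, a => simpa only [hw] using contDiff_eval_self (p a)
  | 2, w, ⟨p, hp, hw⟩, a => simpa only [hw] using contDiff_eval_self (p a)

theorem contDiff_of_mem_hexSpace {s : Fin 3} {k : ℕ} {H : V3 ≃ᵃ[ℝ] V3} {w : Form s}
    (hw : w ∈ hexSpace s k H) {n : WithTop ℕ∞} (a : Fin (proxyDim s)) :
    ContDiff ℝ n (fun x => w x a) := by
  rw [← pull_symm_pull s H w]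
  exact contDiff_pull s H.symm (contDiff_of_mem_cubeSpace hw) a

/-! ### Homogeneous coordinates -/

theorem hasFDerivAt_coord (i : Fin 3) (x : V3) :
    HasFDerivAt (fun y : V3 => y i) (ContinuousLinearMap.proj (R := ℝ) (φ := fun _ : Fin 3 => ℝ) i) x :=
  (ContinuousLinearMap.proj (R := ℝ) (φ := fun _ : Fin 3 => ℝ) i).hasFDerivAt

theorem differentiableAt_comp_coord {g : ℝ → ℝ} {g' : ℝ} {i : Fin 3} {x : V3}
    (h : HasDerivAt g g' (x i)) : DifferentiableAt ℝ (fun y : V3 => g (y i)) x :=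
  (h.comp_hasFDerivAt x (hasFDerivAt_coord i x)).differentiableAt

theorem pd_comp_coord {g : ℝ → ℝ} {g' : ℝ} {i : Fin 3} {x : V3} (h : HasDerivAt g g' (x i))
    (j : Fin 3) : pd j (fun y : V3 => g (y i)) x = if i = j then g' else 0 := by
  have h' : HasFDerivAt (fun y : V3 => g (y i)) _ x := h.comp_hasFDerivAt x (hasFDerivAt_coord i x)
  rw [pd, h'.fderiv]
  simp [Pi.single_apply]

section Product

variable {g₀ g₁ g₂ : ℝ → ℝ} {d₀ d₁ d₂ : ℝ} {x : V3}

theorem differentiableAt_prod (h₀ : HasDerivAt g₀ d₀ (x 0)) (h₁ : HasDerivAt g₁ d₁ (x 1))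
    (h₂ : HasDerivAt g₂ d₂ (x 2)) :
    DifferentiableAt ℝ (fun y : V3 => g₀ (y 0) * g₁ (y 1) * g₂ (y 2)) x :=
  ((differentiableAt_comp_coord h₀).fun_mul (differentiableAt_comp_coord h₁)).fun_mul
    (differentiableAt_comp_coord h₂)

theorem pd_prod (h₀ : HasDerivAt g₀ d₀ (x 0)) (h₁ : HasDerivAt g₁ d₁ (x 1))
    (h₂ : HasDerivAt g₂ d₂ (x 2)) (i : Fin 3) :
    pd i (fun y : V3 => g₀ (y 0) * g₁ (y 1) * g₂ (y 2)) x =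
      ![d₀ * g₁ (x 1) * g₂ (x 2), g₀ (x 0) * d₁ * g₂ (x 2), g₀ (x 0) * g₁ (x 1) * d₂] i := by
  rw [pd_mul ((differentiableAt_comp_coord h₀).fun_mul (differentiableAt_comp_coord h₁))
    (differentiableAt_comp_coord h₂), pd_mul (differentiableAt_comp_coord h₀)
    (differentiableAt_comp_coord h₁), pd_comp_coord h₀, pd_comp_coord h₁, pd_comp_coord h₂]
  fin_cases i <;> simp

end Product

/-- The projective map from the infinite pyramid to `cone`. -/
def coneMap (x : V3) : V3 := ![x 0 / (1 + x 2), x 1 / (1 + x 2), 1 / (1 + x 2)]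

/-- The inverse of `coneMap`. -/
def coneInv (x : V3) : V3 := ![x 0 / x 2, x 1 / x 2, 1 / x 2 - 1]

theorem coneInv_coneMap {x : V3} (hx : 1 + x 2 ≠ 0) : coneInv (coneMap x) = x := by
  ext i
  fin_cases i
  · change x 0 / (1 + x 2) / (1 / (1 + x 2)) = x 0
    field_simp
  · change x 1 / (1 + x 2) / (1 / (1 + x 2)) = x 1
    field_simp
  · change 1 / (1 / (1 + x 2)) - 1 = x 2
    field_simp
    ring

theorem coneMap_coneInv {x : V3} (hx : x 2 ≠ 0) : coneMap (coneInv x) = x := by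
  have e : 1 + (1 / x 2 - 1) = 1 / x 2 := by ring
  ext i
  fin_cases i
  · change x 0 / x 2 / (1 + (1 / x 2 - 1)) = x 0
    rw [e]
    field_simp
  · change x 1 / x 2 / (1 + (1 / x 2 - 1)) = x 1
    rw [e]
    field_simp
  · change 1 / (1 + (1 / x 2 - 1)) = x 2
    rw [e]
    field_simp

theorem one_add_coneInv (x : V3) : 1 + coneInv x 2 = (x 2)⁻¹ := by
  change 1 + (1 / x 2 - 1) = _
  ring

theorem contDiffAt_coord (i : Fin 3) (x : V3) : ContDiffAt ℝ 1 (fun y : V3 => y i) x :=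
  (contDiff_apply ℝ ℝ i).contDiffAt

theorem differentiableAt_coneMap {x : V3} (hx : 1 + x 2 ≠ 0) : DifferentiableAt ℝ coneMap x := by
  have h1 : ContDiffAt ℝ 1 (fun y : V3 => 1 + y 2) x := contDiffAt_const.add (contDiffAt_coord 2 x)
  refine differentiableAt_pi.2 fun i => ContDiffAt.differentiableAt ?_ one_ne_zero
  fin_cases i
  · exact (contDiffAt_coord 0 x).div h1 hx
  · exact (contDiffAt_coord 1 x).div h1 hx
  · exact contDiffAt_const.div h1 hx

theorem differentiableAt_coneInv {x : V3} (hx : x 2 ≠ 0) : DifferentiableAt ℝ coneInv x := by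
  refine differentiableAt_pi.2 fun i => ContDiffAt.differentiableAt ?_ one_ne_zero
  fin_cases i
  · exact (contDiffAt_coord 0 x).div (contDiffAt_coord 2 x) hx
  · exact (contDiffAt_coord 1 x).div (contDiffAt_coord 2 x) hx
  · exact (contDiffAt_const.div (contDiffAt_coord 2 x) hx).sub contDiffAt_const

theorem jac_congr {F G : V3 → V3} {x : V3} (h : F =ᶠ[nhds x] G) : jac F x = jac G x := by
  ext i j
  exact pd_congr (h.mono fun y hy => congrFun hy i)

theorem pull_congr (s : Fin 3) {F G : V3 → V3} {x : V3} (h : F =ᶠ[nhds x] G) (u : Form s) :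
    pull s F u x = pull s G u x := by
  rw [pull_apply, pull_apply, jac_congr h, h.self_of_nhds]

theorem jac_id (x : V3) : jac (fun y => y) x = 1 := by
  rw [jac_eq differentiableAt_fun_id, fderiv_fun_id]
  exact LinearMap.toMatrix'_id

theorem eventually_one_add {x : V3} (hx : 1 + x 2 ≠ 0) : ∀ᶠ y : V3 in nhds x, 1 + y 2 ≠ 0 :=
  (continuous_const.add (continuous_apply 2)).continuousAt.eventually_ne hx

theorem eventually_ne_zero {x : V3} (hx : x 2 ≠ 0) : ∀ᶠ y : V3 in nhds x, y 2 ≠ 0 :=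
  (continuous_apply 2).continuousAt.eventually_ne hx

theorem pull_coneMap_coneInv (s : Fin 3) {x : V3} (hx : 1 + x 2 ≠ 0) (f : Form s) :
    pull s coneMap (pull s coneInv f) x = f x := by
  have h2 : coneMap x 2 ≠ 0 := by
    change 1 / (1 + x 2) ≠ 0
    exact one_div_ne_zero hx
  rw [← pull_comp s (differentiableAt_coneInv h2) (differentiableAt_coneMap hx),
    pull_congr s (G := fun y => y) ((eventually_one_add hx).mono fun y hy => coneInv_coneMap hy),
    pull_apply, jac_id, pullM_one]

theorem pull_coneInv_coneMap (s : Fin 3) {x : V3} (hx : x 2 ≠ 0) (f : Form s) :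
    pull s coneInv (pull s coneMap f) x = f x := by
  have h2 : 1 + coneInv x 2 ≠ 0 := by
    rw [one_add_coneInv]
    exact inv_ne_zero hx
  rw [← pull_comp s (differentiableAt_coneMap h2) (differentiableAt_coneInv hx),
    pull_congr s (G := fun y => y) ((eventually_ne_zero hx).mono fun y hy => coneMap_coneInv hy),
    pull_apply, jac_id, pullM_one]

theorem flip_coneMap {x : V3} (hx : 1 + x 2 ≠ 0) : flip (coneMap x) = projMap x := by
  rw [flip_apply]
  ext i
  fin_cases i
  · rfl
  · rfl
  · change 1 - 1 / (1 + x 2) = x 2 / (1 + x 2)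
    field_simp
    ring

theorem pull_projMap (s : Fin 3) (A : V3 ≃ᵃ[ℝ] V3) {x : V3} (hx : 1 + x 2 ≠ 0) (u : Form s) :
    pull s (fun y => A (projMap y)) u x = pull s coneMap (pull s (flip.trans A) u) x := by
  rw [← pull_comp s (differentiableAt_affEquiv _ _) (differentiableAt_coneMap hx)]
  refine pull_congr s ((eventually_one_add hx).mono fun y hy => ?_) u
  change A (projMap y) = A (flip (coneMap y))
  rw [flip_coneMap hy]

theorem one_add_pos_of_mem {x : V3} (hx : x ∈ infPyramid) : 0 < 1 + x 2 := by
  have := hx.2.2.2.2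
  linarith

theorem coneInv_mem {x : V3} (hx : x ∈ cone) (h0 : 0 < x 2) : coneInv x ∈ infPyramid := by
  obtain ⟨h1, h2, h3, h4, h5⟩ := hx
  refine ⟨div_nonneg h4 h0.le, (div_le_one h0).2 h2, div_nonneg h1 h0.le, (div_le_one h0).2 h3, ?_⟩
  change 0 ≤ 1 / x 2 - 1
  have := (one_le_div h0).2 h5
  linarith

/-- Membership in the approximation space in terms of homogeneous coordinates. -/
theorem mem_approxSpace_iff {s : Fin 3} {k : ℕ} {A : V3 ≃ᵃ[ℝ] V3} {u : Form s} :
    u ∈ approxSpace s k A ↔ ∃ f ∈ infSpace s k, ∀ x ∈ cone, 0 < x 2 →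
      pull s (flip.trans A) u x = pull s coneInv f x := by
  constructor
  · rintro ⟨f, hf, h⟩
    refine ⟨f, hf, fun x hx h0 => ?_⟩
    have hm := coneInv_mem hx h0
    have h1 := h _ hm
    rw [pull_projMap s A (one_add_pos_of_mem hm).ne'] at h1
    rw [← pull_coneInv_coneMap s h0.ne' (pull s (flip.trans A) u), pull_apply s coneInv,
      pull_apply s coneInv, h1]
  · rintro ⟨f, hf, h⟩
    refine ⟨f, hf, fun x hx => ?_⟩
    have hp := one_add_pos_of_mem hx
    rw [pull_projMap s A hp.ne', ← pull_coneMap_coneInv s hp.ne' f, pull_apply s coneMap,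
      pull_apply s coneMap, h]
    · obtain ⟨h1, h2, h3, h4, h5⟩ := hx
      refine ⟨div_nonneg h3 hp.le, ?_, ?_, div_nonneg h1 hp.le, ?_⟩
      · exact div_le_div_of_nonneg_right h2 hp.le
      · exact div_le_div_of_nonneg_right h4 hp.le
      · exact (div_le_one hp).2 (by linarith)
    · exact one_div_pos.2 hp

theorem jac_coneInv {x : V3} (hx : x 2 ≠ 0) : jac coneInv x =
    !![1 / x 2, 0, -x 0 / x 2 ^ 2; 0, 1 / x 2, -x 1 / x 2 ^ 2; 0, 0, -1 / x 2 ^ 2] := by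
  have hinv : HasDerivAt (fun t : ℝ => t⁻¹) (-(x 2 ^ 2)⁻¹) (x 2) := hasDerivAt_inv hx
  have h1 : ∀ t : ℝ, HasDerivAt (fun _ : ℝ => (1 : ℝ)) 0 t := fun t => hasDerivAt_const t 1
  have hid : ∀ t : ℝ, HasDerivAt (fun t : ℝ => t) 1 t := fun t => hasDerivAt_id t
  have e0 : (fun y : V3 => coneInv y 0) = fun y => y 0 * 1 * (y 2)⁻¹ := by
    ext y
    change y 0 / y 2 = _
    ring
  have e1 : (fun y : V3 => coneInv y 1) = fun y => 1 * y 1 * (y 2)⁻¹ := by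
    ext y
    change y 1 / y 2 = _
    ring
  have e2 : (fun y : V3 => coneInv y 2) = fun y => (fun t => t⁻¹ - 1) (y 2) := by
    ext y
    change 1 / y 2 - 1 = _
    simp
  ext i j
  rw [jac, Matrix.of_apply]
  fin_cases i
  · change pd j (fun y => coneInv y 0) x = _
    rw [e0, pd_prod (hid _) (h1 _) hinv]
    fin_cases j <;> simp <;> ring
  · change pd j (fun y => coneInv y 1) x = _
    rw [e1, pd_prod (h1 _) (hid _) hinv]
    fin_cases j <;> simp <;> ring
  · change pd j (fun y => coneInv y 2) x = _
    rw [e2, pd_comp_coord (hinv.sub_const 1)]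
    fin_cases j <;> simp <;> ring

theorem pull_coneInv_one {x : V3} (hx : x 2 ≠ 0) (f : V3 → V3) :
    (pull 1 coneInv f x : V3) = ![f (coneInv x) 0 / x 2, f (coneInv x) 1 / x 2,
      -(x 0 * f (coneInv x) 0 + x 1 * f (coneInv x) 1 + f (coneInv x) 2) / x 2 ^ 2] := by
  change (jac coneInv x).transpose.mulVec (f (coneInv x)) = _
  rw [jac_coneInv hx]
  ext i
  fin_cases i <;> simp [Matrix.mulVec, dotProduct, Fin.sum_univ_three] <;> ring

theorem pull_coneInv_two {x : V3} (hx : x 2 ≠ 0) (f : V3 → V3) :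
    (pull 2 coneInv f x : V3) = ![(-f (coneInv x) 0 + x 0 * f (coneInv x) 2) / x 2 ^ 3,
      (-f (coneInv x) 1 + x 1 * f (coneInv x) 2) / x 2 ^ 3, f (coneInv x) 2 / x 2 ^ 2] := by
  change (jac coneInv x).adjugate.mulVec (f (coneInv x)) = _
  rw [jac_coneInv hx, Matrix.adjugate_fin_three]
  ext i
  fin_cases i <;> simp [Matrix.mulVec, dotProduct, Fin.sum_univ_three] <;> field_simp

/-! ### Homogeneous functions -/

/-- The monomials in homogeneous coordinates; `hmon a b c` is homogeneous of degree `c`. -/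
def hmon (a b c : ℕ) (x : V3) : ℝ := (x 0 / x 2) ^ a * (x 1 / x 2) ^ b * x 2 ^ c

/-- The span of the monomials in homogeneous coordinates. -/
def homSpace : Submodule ℝ (V3 → ℝ) := Submodule.span ℝ {f | ∃ a b c, f = hmon a b c}

theorem hmon_mem (a b c : ℕ) : hmon a b c ∈ homSpace := Submodule.subset_span ⟨a, b, c, rfl⟩

theorem contDiffOn_hmon (a b c : ℕ) {n : WithTop ℕ∞} :
    ContDiffOn ℝ n (hmon a b c) {x | 0 < x 2} := by
  have hc : ∀ i : Fin 3, ContDiffOn ℝ n (fun x : V3 => x i) {x | 0 < x 2} := fun i =>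
    (contDiff_apply ℝ ℝ i).contDiffOn
  have hd : ∀ i : Fin 3, ContDiffOn ℝ n (fun x : V3 => x i / x 2) {x | 0 < x 2} := fun i =>
    (hc i).div (hc 2) fun x hx => (ne_of_gt hx)
  exact (((hd 0).pow a).mul ((hd 1).pow b)).mul ((hc 2).pow c)

theorem abs_hmon_le {x : V3} (hx : x ∈ cone) (a b c : ℕ) : |hmon a b c x| ≤ 1 := by
  obtain ⟨h1, h2, h3, h4, h5⟩ := hx
  have hz : 0 ≤ x 2 := h4.trans h2
  have e0 : 0 ≤ x 0 / x 2 := div_nonneg h4 hz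
  have e1 : 0 ≤ x 1 / x 2 := div_nonneg h1 hz
  rw [hmon, abs_of_nonneg (by positivity)]
  exact mul_le_one₀ (mul_le_one₀ (pow_le_one₀ e0 (div_le_one_of_le₀ h2 hz)) (by positivity)
    (pow_le_one₀ e1 (div_le_one_of_le₀ h3 hz))) (by positivity) (pow_le_one₀ hz h5)

theorem pd_pow {i : Fin 3} {f : V3 → ℝ} {x : V3} (hf : DifferentiableAt ℝ f x) (n : ℕ) :
    pd i (fun y => f y ^ n) x = n * f x ^ (n - 1) * pd i f x := by
  have h : HasFDerivAt (fun y => f y ^ n) _ x :=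
    (hasDerivAt_pow n (f x)).comp_hasFDerivAt x hf.hasFDerivAt
  rw [pd, h.fderiv]
  rfl

/-- Differentiation lowers the degree by one: up to the factor `1 / x 2` the result consists of
monomials of the same degree. Truncated exponents `a - 1` and `b - 1` are harmless, as the
coefficient is zero when truncation takes place. -/
theorem pd_hmon {x : V3} (hx : 0 < x 2) (a b c : ℕ) (i : Fin 3) :
    pd i (hmon a b c) x = ![a * hmon (a - 1) b c x, b * hmon a (b - 1) c x,
      -(a * hmon a b c x) - b * hmon a b c x + c * hmon a b c x] i / x 2 := by
  have hz := hx.ne'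
  have hd : ∀ j, DifferentiableAt ℝ (fun y => coneInv y j) x :=
    differentiableAt_pi.1 (differentiableAt_coneInv hz)
  have h2 : HasDerivAt (fun t : ℝ => t ^ c) (c * x 2 ^ (c - 1)) (x 2) := hasDerivAt_pow c _
  have hj : ∀ j, pd i (fun y => coneInv y j) x = jac coneInv x j i := fun j => rfl
  have e : hmon a b c = fun y => coneInv y 0 ^ a * coneInv y 1 ^ b * y 2 ^ c := rfl
  have hpow : ∀ n : ℕ, (n : ℝ) * x 2 ^ (n - 1) = n * x 2 ^ n / x 2 := by
    intro n
    rcases n with _ | n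
    · simp
    · rw [Nat.add_sub_cancel, pow_succ]
      field_simp
  have hpow' : ∀ (n : ℕ) (t : ℝ), (n : ℝ) * (t / x 2) ^ (n - 1) * (-t / x 2 ^ 2) =
      -(n * (t / x 2) ^ n) / x 2 := by
    intro n t
    rcases n with _ | n
    · simp
    · have e : (t / x 2) ^ (n + 1) = (t / x 2) ^ n * (t / x 2) := pow_succ _ _
      rw [Nat.add_sub_cancel, e]
      ring
  rw [e, pd_mul (((hd 0).fun_pow a).fun_mul ((hd 1).fun_pow b)) (differentiableAt_comp_coord h2),
    pd_mul ((hd 0).fun_pow a) ((hd 1).fun_pow b), pd_pow (hd 0), pd_pow (hd 1), pd_comp_coord h2,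
    hj, hj, jac_coneInv hz, hpow c]
  change _ = ![a * ((x 0 / x 2) ^ (a - 1) * (x 1 / x 2) ^ b * x 2 ^ c),
    b * ((x 0 / x 2) ^ a * (x 1 / x 2) ^ (b - 1) * x 2 ^ c),
    -(a * ((x 0 / x 2) ^ a * (x 1 / x 2) ^ b * x 2 ^ c)) -
    b * ((x 0 / x 2) ^ a * (x 1 / x 2) ^ b * x 2 ^ c) +
    c * ((x 0 / x 2) ^ a * (x 1 / x 2) ^ b * x 2 ^ c)] i / x 2
  change (x 0 / x 2) ^ a * (x 1 / x 2) ^ b * _ + ((x 0 / x 2) ^ a *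
    (b * (x 1 / x 2) ^ (b - 1) * _) + a * (x 0 / x 2) ^ (a - 1) * _ * (x 1 / x 2) ^ b) *
    x 2 ^ c = _
  fin_cases i
  · simp
    ring
  · simp
    ring
  · simp only [Fin.reduceFinMk, Matrix.of_apply, Matrix.cons_val, if_true]
    rw [hpow', hpow']
    ring

/-! ### Fields with homogeneous components -/

/-- In polar coordinates the weight `r ^ 2` of dimension three cancels the square of `r⁻¹`. -/
theorem memLp_inv_norm {K : Set V3} (hK : IsCompact K) (b : V3) :
    MemLp (fun x : V3 => ‖x - b‖⁻¹) 2 (volume.restrict K) := by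
  have hm : Measurable fun x : V3 => ‖x - b‖⁻¹ := by fun_prop
  rw [memLp_two_iff_integrable_sq hm.aestronglyMeasurable]
  obtain ⟨R, hR⟩ := hK.isBounded.subset_closedBall b
  have h1 : Integrable (fun x : V3 => (Set.Iic R).indicator (fun r : ℝ => (r⁻¹) ^ 2) ‖x‖) := by
    rw [integrable_fun_norm_addHaar volume (f := (Set.Iic R).indicator (fun r : ℝ => (r⁻¹) ^ 2))]
    have h2 : IntegrableOn (Set.indicator (Set.Iic R) (fun _ : ℝ => (1 : ℝ))) (Set.Ioi 0) := by
      rw [integrableOn_indicator_iff measurableSet_Iic]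
      refine (integrableOn_const (s := Set.Icc 0 R) (by simp)).mono_set ?_
      intro x hx
      exact ⟨hx.2.le, hx.1⟩
    refine h2.congr_fun (fun x (hx : 0 < x) => ?_) measurableSet_Ioi
    simp only [Set.indicator, Module.finrank_fin_fun, smul_eq_mul]
    split_ifs
    · field_simp
    · simp
  have h3 : Integrable (fun x : V3 => (Set.Iic R).indicator (fun r : ℝ => (r⁻¹) ^ 2) ‖x - b‖) :=
    h1.comp_sub_right b
  refine (h3.integrableOn (s := K)).congr_fun (fun x hx => ?_) hK.measurableSet
  have : ‖x - b‖ ≤ R := by simpa [dist_eq_norm] using hR hx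
  simp [Set.indicator, this]

theorem pd_comp_affEquiv {q : V3 → ℝ} (G : V3 ≃ᵃ[ℝ] V3) {x : V3}
    (hq : DifferentiableAt ℝ q (G x)) (i : Fin 3) :
    pd i (fun y => q (G y)) x = ∑ j, pd j q (G x) * mat G j i := by
  have hG := differentiableAt_affEquiv G x
  have h1 : fderiv ℝ (fun y => q (G y)) x = (fderiv ℝ q (G x)).comp (fderiv ℝ G x) :=
    fderiv_comp x hq hG
  have h2 : fderiv ℝ G x (Pi.single i 1) = fun j => mat G j i := by
    ext j
    rw [← jac_affEquiv G x, jac, Matrix.of_apply, pd, fderiv_apply hG]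
    rfl
  rw [pd, h1]
  change fderiv ℝ q (G x) (fderiv ℝ G x (Pi.single i 1)) = _
  rw [h2]
  have h3 : (fun j => mat G j i) = ∑ j, mat G j i • (Pi.single j 1 : V3) := by
    rw [pi_eq_sum_univ (fun j => mat G j i)]
    refine Finset.sum_congr rfl fun j _ => ?_
    congr 1
    ext k
    simp [Pi.single_apply, eq_comm]
  rw [h3, map_sum]
  refine Finset.sum_congr rfl fun j _ => ?_
  rw [map_smul, smul_eq_mul, mul_comm]
  rfl

theorem isOpen_pos_two : IsOpen {x : V3 | 0 < x 2} := isOpen_lt continuous_const (continuous_apply 2)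

/-- The degree is nonnegative and the quotients lie in the unit interval, so the monomials remain
bounded up to the apex; the derivative bound is `pd_hmon`. -/
theorem homSpace_bounds {q : V3 → ℝ} (hq : q ∈ homSpace) : ContDiffOn ℝ 1 q {x | 0 < x 2} ∧
    ∃ C, 0 ≤ C ∧ ∀ x ∈ cone, 0 < x 2 → |q x| ≤ C ∧ ∀ i, |pd i q x| ≤ C / x 2 := by
  induction hq using Submodule.span_induction with
  | mem q h =>
    obtain ⟨a, b, c, rfl⟩ := h
    refine ⟨contDiffOn_hmon a b c, a + b + c + 1, by positivity, fun x hx h0 => ⟨?_, fun i => ?_⟩⟩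
    · refine (abs_hmon_le hx a b c).trans ?_
      have : (0 : ℝ) ≤ a + b + c := by positivity
      linarith
    · rw [pd_hmon h0, abs_div, abs_of_pos h0]
      refine div_le_div_of_nonneg_right ?_ h0.le
      have ha : (0 : ℝ) ≤ a := by positivity
      have hb : (0 : ℝ) ≤ b := by positivity
      have hc : (0 : ℝ) ≤ c := by positivity
      have hm : ∀ (n : ℕ) (a b : ℕ), |n * hmon a b c x| ≤ n := by
        intro n a b
        rw [abs_mul, Nat.abs_cast]
        exact mul_le_of_le_one_right (by positivity) (abs_hmon_le hx a b c)
      fin_cases i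
      · exact (hm a (a - 1) b).trans (by linarith)
      · exact (hm b a (b - 1)).trans (by linarith)
      · change |-(a * hmon a b c x) - b * hmon a b c x + c * hmon a b c x| ≤ _
        have h1 := abs_le.1 (hm a a b)
        have h2 := abs_le.1 (hm b a b)
        have h3 := abs_le.1 (hm c a b)
        rw [abs_le]
        constructor <;> linarith
  | zero =>
    refine ⟨contDiffOn_const, 0, le_rfl, fun x _ _ => ⟨by simp, fun i => ?_⟩⟩
    have : pd i (0 : V3 → ℝ) x = 0 := by
      rw [pd, fderiv_zero]
      rfl
    rw [this]
    simp
  | add f g _ _ hf hg =>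
    obtain ⟨hfc, C, hC, hf⟩ := hf
    obtain ⟨hgc, D, hD, hg⟩ := hg
    refine ⟨hfc.add hgc, C + D, by positivity, fun x hx h0 => ⟨?_, fun i => ?_⟩⟩
    · exact (abs_add_le _ _).trans (add_le_add (hf x hx h0).1 (hg x hx h0).1)
    · have hn := isOpen_pos_two.mem_nhds (show x ∈ {x : V3 | 0 < x 2} from h0)
      have e : pd i (f + g) x = pd i f x + pd i g x :=
        pd_add ((hfc.contDiffAt hn).differentiableAt one_ne_zero)
          ((hgc.contDiffAt hn).differentiableAt one_ne_zero)
      rw [e, add_div]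
      exact (abs_add_le _ _).trans (add_le_add ((hf x hx h0).2 i) ((hg x hx h0).2 i))
  | smul c f _ hf =>
    obtain ⟨hfc, C, hC, hf⟩ := hf
    refine ⟨hfc.const_smul c, |c| * C, by positivity, fun x hx h0 => ⟨?_, fun i => ?_⟩⟩
    · change |c * f x| ≤ _
      rw [abs_mul]
      exact mul_le_mul_of_nonneg_left (hf x hx h0).1 (abs_nonneg c)
    · have hn := isOpen_pos_two.mem_nhds (show x ∈ {x : V3 | 0 < x 2} from h0)
      have e : pd i (c • f) x = c * pd i f x :=
        pd_const_mul ((hfc.contDiffAt hn).differentiableAt one_ne_zero)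
      rw [e, abs_mul, mul_div_assoc]
      exact mul_le_mul_of_nonneg_left ((hf x hx h0).2 i) (abs_nonneg c)

/-- The components of the form are homogeneous functions away from the apex. -/
def HasHom {s : Fin 3} (P : Form s) : Prop := ∀ a, ∃ q ∈ homSpace, ∀ x, 0 < x 2 → P x a = q x

section Push

variable {s : Fin 3} {P : Form s} (B : V3 ≃ᵃ[ℝ] V3)

/-- The open half space at the apex of the pyramid. -/
def apexHalf (B : V3 ≃ᵃ[ℝ] V3) : Set V3 := {x | 0 < B.symm x 2}

theorem isOpen_apexHalf : IsOpen (apexHalf B) :=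
  isOpen_lt continuous_const ((continuous_apply 2).comp (contDiff_affEquiv B.symm (n := 0)).continuous)

theorem exists_hom_push (hP : HasHom P) (a : Fin (proxyDim s)) :
    ∃ q ∈ homSpace, ∀ x ∈ apexHalf B, pull s B.symm P x a = q (B.symm x) := by
  choose q hq hPq using hP
  obtain ⟨M, hM⟩ := exists_pullM_eq_sum s (mat B.symm)
  refine ⟨∑ b, M a b • q b, Submodule.sum_mem _ fun b _ => Submodule.smul_mem _ _ (hq b),
    fun x hx => ?_⟩
  rw [pull_affEquiv, hM, Finset.sum_apply]
  refine Finset.sum_congr rfl fun b _ => ?_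
  rw [hPq b _ hx]
  rfl

theorem contDiffOn_push (hP : HasHom P) (a : Fin (proxyDim s)) :
    ContDiffOn ℝ 1 (fun x => pull s B.symm P x a) (apexHalf B) := by
  obtain ⟨q, hq, h⟩ := exists_hom_push B hP a
  refine ContDiffOn.congr ?_ h
  exact (homSpace_bounds hq).1.comp (contDiff_affEquiv B.symm).contDiffOn fun x hx => hx

theorem isPoly_image_cone : IsPoly (fun i => pushAff B (coneL i)) (B '' cone) := isPoly_cone.image B

theorem mem_of_interior {x : V3} (hx : x ∈ interior (B '' cone)) : B.symm x ∈ cone ∧ x ∈ apexHalf B := by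
  have h := (isPoly_image_cone B).mem_interior.1 hx
  refine ⟨(isPoly_cone.mem_iff _).2 fun j => (h j).le, ?_⟩
  have h1 : 0 < coneL 1 (B.symm x) := h 1
  have h3 : 0 < coneL 3 (B.symm x) := h 3
  rw [coneL_apply] at h1 h3
  simp at h1 h3
  exact h3.trans h1

/-- In the cone the height `x 2` dominates all coordinates, hence it is comparable to the distance
from the apex. -/
theorem exists_inv_le : ∃ Λ, 0 ≤ Λ ∧ ∀ x ∈ cone, 0 < x 2 → 1 / x 2 ≤ Λ * ‖B x - B 0‖⁻¹ := by
  set L := LinearMap.toContinuousLinearMap (B.linear : V3 →ₗ[ℝ] V3)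
  refine ⟨‖L‖, norm_nonneg _, fun x hx h0 => ?_⟩
  obtain ⟨h1, h2, h3, h4, h5⟩ := hx
  have hn : ‖x‖ ≤ x 2 := by
    rw [pi_norm_le_iff_of_nonneg h0.le]
    intro i
    rw [Real.norm_eq_abs, abs_le]
    fin_cases i <;> constructor <;> simp <;> linarith
  have hL : B x - B 0 = L x := by
    rw [affEquiv_apply B x, mat_mulVec]
    simp [L]
  have hne : B x - B 0 ≠ 0 := by
    rw [sub_ne_zero]
    intro h
    have := congrFun (B.injective h) 2
    rw [this] at h0
    exact lt_irrefl _ h0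
  have hpos : 0 < ‖B x - B 0‖ := norm_pos_iff.2 hne
  have hle : ‖B x - B 0‖ ≤ ‖L‖ * x 2 := by
    rw [hL]
    exact (L.le_opNorm x).trans (mul_le_mul_of_nonneg_left hn (norm_nonneg _))
  rw [← div_eq_mul_inv, div_le_div_iff₀ h0 hpos, one_mul]
  exact hle

/-- The function is bounded and its gradient is bounded by a multiple of the inverse distance from
the apex `B 0`, which is square integrable. -/
theorem memLp_push {q f : V3 → ℝ} (hq : q ∈ homSpace)
    (hf : ∀ x ∈ apexHalf B, f x = q (B.symm x)) :
    MemLp f 2 (volume.restrict (B '' cone)) ∧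
      ∀ i, MemLp (pd i f) 2 (volume.restrict (B '' cone)) := by
  have hP := isPoly_image_cone B
  obtain ⟨hc, C, hC, hb⟩ := homSpace_bounds hq
  obtain ⟨Λ, hΛ, hinv⟩ := exists_inv_le B
  have hInt : ∀ᵐ x ∂volume.restrict (B '' cone), x ∈ interior (B '' cone) := hP.isBody.ae_mem_interior
  have hmeas : volume.restrict (B '' cone) = volume.restrict (interior (B '' cone)) := by
    rw [← Measure.restrict_restrict_of_subset interior_subset]
    exact (Measure.restrict_eq_self_of_ae_mem hInt).symm
  have hfc : ContDiffOn ℝ 1 f (apexHalf B) := by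
    refine ContDiffOn.congr ?_ hf
    exact hc.comp (contDiff_affEquiv B.symm).contDiffOn fun x hx => hx
  have hsub : interior (B '' cone) ⊆ apexHalf B := fun x hx => (mem_of_interior B hx).2
  have haes : ∀ g : V3 → ℝ, ContinuousOn g (apexHalf B) →
      AEStronglyMeasurable g (volume.restrict (B '' cone)) := by
    intro g hg
    rw [hmeas]
    exact (hg.mono hsub).aestronglyMeasurable isOpen_interior.measurableSet
  constructor
  · have : IsFiniteMeasure (volume.restrict (B '' cone)) :=
      ⟨by simpa using hP.isCompact.measure_lt_top⟩
    refine MemLp.of_bound (haes f hfc.continuousOn) C ?_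
    filter_upwards [hInt] with x hx
    obtain ⟨h1, h2⟩ := mem_of_interior B hx
    rw [hf x h2]
    exact (hb _ h1 h2).1
  · intro i
    set M := ∑ j, |mat B.symm j i|
    have hM : 0 ≤ M := Finset.sum_nonneg fun j _ => abs_nonneg _
    refine MemLp.of_le ((memLp_inv_norm hP.isCompact (B 0)).const_mul (C * M * Λ))
      (haes _ (continuousOn_pd (isOpen_apexHalf B) hfc)) ?_
    filter_upwards [hInt] with x hx
    obtain ⟨h1, h2⟩ := mem_of_interior B hx
    have hev : f =ᶠ[nhds x] fun y => q (B.symm y) :=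
      Filter.mem_of_superset ((isOpen_apexHalf B).mem_nhds h2) hf
    have hqd : DifferentiableAt ℝ q (B.symm x) :=
      (hc.contDiffAt (isOpen_pos_two.mem_nhds h2)).differentiableAt one_ne_zero
    rw [pd_congr hev, pd_comp_affEquiv B.symm hqd, Real.norm_eq_abs, Real.norm_eq_abs]
    have hi := hinv _ h1 h2
    rw [B.apply_symm_apply] at hi
    rw [abs_of_nonneg (show 0 ≤ C * M * Λ * ‖x - B 0‖⁻¹ by positivity)]
    calc |∑ j, pd j q (B.symm x) * mat B.symm j i|
        ≤ ∑ j, |pd j q (B.symm x) * mat B.symm j i| := Finset.abs_sum_le_sum_abs _ _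
      _ ≤ ∑ j, C / B.symm x 2 * |mat B.symm j i| := by
          refine Finset.sum_le_sum fun j _ => ?_
          rw [abs_mul]
          exact mul_le_mul_of_nonneg_right ((hb _ h1 h2).2 j) (abs_nonneg _)
      _ = C * M * (1 / B.symm x 2) := by rw [← Finset.mul_sum]; ring
      _ ≤ C * M * (Λ * ‖x - B 0‖⁻¹) := mul_le_mul_of_nonneg_left hi (by positivity)
      _ = C * M * Λ * ‖x - B 0‖⁻¹ := by ring

theorem push_mem_hSpace (hP : HasHom P) : pull s B.symm P ∈ hSpace s (B '' cone) ∧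
    HasWeakD s (B '' cone) (pull s B.symm P) (extD s (pull s B.symm P)) := by
  have hm := fun a => memLp_push B (exists_hom_push B hP a).choose_spec.1
    (f := fun x => pull s B.symm P x a) (exists_hom_push B hP a).choose_spec.2
  have hw : HasWeakD s (B '' cone) (pull s B.symm P) (extD s (pull s B.symm P)) := by
    refine hasWeakD_extD (isPoly_image_cone B).isBody (fun a => (contDiffOn_push B hP a).mono
      fun x hx => (mem_of_interior B hx).2) (memLp_pi fun b => ?_)
    exact memLp_finsetSum _ fun i _ => memLp_finsetSum _ fun a _ => ((hm a).2 i).const_mul _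
  exact ⟨⟨memLp_pi fun a => (hm a).1, _, hw⟩, hw⟩

end Push

/-! ### The triangular faces of the cone -/

/-- The coordinate which is proportional to `x 2` on a triangular face. -/
def fj : Fin 4 → Fin 3 := ![1, 0, 1, 0]

/-- The coordinate which is free on a triangular face. -/
def fo : Fin 4 → Fin 3 := ![0, 1, 0, 1]

/-- The constant of proportionality on a triangular face. -/
def fe : Fin 4 → ℝ := ![0, 1, 1, 0]

/-- The triangular faces in coordinates. -/
def facePt (i : Fin 4) (t z : ℝ) : V3 := ![![t, 0, z], ![z, t, z], ![t, z, z], ![0, t, z]] i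

theorem mem_tri_iff {i : Fin 4} {x : V3} : x ∈ openFace coneL i.castSucc ↔
    x (fj i) = fe i * x 2 ∧ 0 < x (fo i) ∧ x (fo i) < x 2 ∧ x 2 < 1 := by
  have key : x ∈ openFace coneL i.castSucc ↔ coneL i.castSucc x = 0 ∧
      ∀ j, j ≠ i.castSucc → 0 < coneL j x := Iff.rfl
  rw [key]
  simp only [coneL_apply]
  fin_cases i
  · simp [Fin.forall_fin_succ, fj, fo, fe]
    intro h
    constructor
    · rintro ⟨h1, h2, h3, h4⟩
      exact ⟨h3, h1, h4⟩
    · rintro ⟨h1, h2, h3⟩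
      exact ⟨h2, by linarith, h1, h3⟩
  · simp [Fin.forall_fin_succ, fj, fo, fe]
    constructor
    · rintro ⟨h, h1, h2, h3, h4⟩
      exact ⟨by linarith, h1, h2, h4⟩
    · rintro ⟨h, h1, h2, h3⟩
      exact ⟨by linarith, h1, h2, by linarith, h3⟩
  · simp [Fin.forall_fin_succ, fj, fo, fe]
    constructor
    · rintro ⟨h, h1, h2, h3, h4⟩
      exact ⟨by linarith, h3, h2, h4⟩
    · rintro ⟨h, h1, h2, h3⟩
      exact ⟨by linarith, by linarith, h2, h1, h3⟩
  · simp [Fin.forall_fin_succ, fj, fo, fe]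
    intro h h1 h2 _
    linarith

theorem facePt_eq {i : Fin 4} {x : V3} (hx : x (fj i) = fe i * x 2) :
    x = facePt i (x (fo i)) (x 2) := by
  ext j
  fin_cases i <;> fin_cases j <;> simp [facePt, fo, fj, fe] at hx ⊢ <;> exact hx

theorem facePt_coord (i : Fin 4) (t z : ℝ) : facePt i t z (fj i) = fe i * z ∧
    facePt i t z (fo i) = t ∧ facePt i t z 2 = z := by
  fin_cases i <;> simp [facePt, fj, fo, fe]

theorem facePt_mem (i : Fin 4) {t z : ℝ} (h0 : 0 < t) (h1 : t < z) (h2 : z < 1) :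
    facePt i t z ∈ openFace coneL i.castSucc := by
  obtain ⟨e1, e2, e3⟩ := facePt_coord i t z
  rw [mem_tri_iff, e1, e2, e3]
  exact ⟨rfl, h0, h1, h2⟩

theorem mem_base_iff {x : V3} : x ∈ openFace coneL 4 ↔
    x 2 = 1 ∧ (0 < x 0 ∧ x 0 < 1) ∧ 0 < x 1 ∧ x 1 < 1 := by
  have key : x ∈ openFace coneL 4 ↔ coneL 4 x = 0 ∧ ∀ j, j ≠ 4 → 0 < coneL j x := Iff.rfl
  rw [key]
  simp only [coneL_apply]
  simp [Fin.forall_fin_succ]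
  constructor
  · rintro ⟨h, h1, h2, h3, h4⟩
    have : x 2 = 1 := by linarith
    rw [this] at h2 h3
    exact ⟨this, ⟨h4, h2⟩, h1, h3⟩
  · rintro ⟨h, ⟨h1, h2⟩, h3, h4⟩
    rw [h]
    exact ⟨by norm_num, h3, h2, h4, h1⟩

theorem nv_tri (i : Fin 4) : ∃ c : ℝ, c ≠ 0 ∧
    nv (coneL i.castSucc) = c • (Pi.single (fj i) 1 - fe i • Pi.single 2 1 : V3) := by
  rw [nv_coneL]
  fin_cases i
  · exact ⟨1, one_ne_zero, by ext j; fin_cases j <;> simp [fj, fe]⟩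
  · exact ⟨-1, by norm_num, by ext j; fin_cases j <;> simp [fj, fe]⟩
  · exact ⟨-1, by norm_num, by ext j; fin_cases j <;> simp [fj, fe]⟩
  · exact ⟨1, one_ne_zero, by ext j; fin_cases j <;> simp [fj, fe]⟩

theorem symb_tri_zero {n : V3} {u : Fin 1 → ℝ} (h : u 0 = 0) : symb 0 n u = 0 :=
  symb_zero_eq_zero.2 (by rw [h]; ext; simp)

/-- The plane of the face is spanned by the direction of its base edge and the radial direction `x`,
which are independent as `x 2 ≠ 0`. A vector orthogonal to both is parallel to the normal. -/
theorem symb_tri_one {i : Fin 4} {x u : V3} (hx : x (fj i) = fe i * x 2) (h2 : x 2 ≠ 0)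
    (ho : u (fo i) = 0) (h : x ⬝ᵥ u = 0) : symb 1 (nv (coneL i.castSucc)) u = 0 := by
  rw [symb_one_eq_zero, nv_coneL, cross_apply]
  rw [dotProduct, Fin.sum_univ_three] at h
  fin_cases i <;> simp [fj, fo, fe] at hx ho h ⊢
  · rw [ho] at h ⊢
    rw [hx] at h
    have : u 2 = 0 := by simpa [h2] using h
    simp [this]
  · rw [ho] at h ⊢
    rw [hx] at h
    have : u 0 + u 2 = 0 := by
      have : x 2 * (u 0 + u 2) = 0 := by linarith
      simpa [h2] using this
    have e : u 2 = -u 0 := by linarith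
    simp [e]
  · rw [ho] at h ⊢
    rw [hx] at h
    have : u 1 + u 2 = 0 := by
      have : x 2 * (u 1 + u 2) = 0 := by linarith
      simpa [h2] using this
    have e : u 2 = -u 1 := by linarith
    simp [e]
  · rw [ho] at h ⊢
    rw [hx] at h
    have : u 2 = 0 := by simpa [h2] using h
    simp [this]

theorem symb_tri_two {i : Fin 4} {u : V3} (h : u (fj i) = fe i * u 2) :
    symb 2 (nv (coneL i.castSucc)) u = 0 := by
  rw [symb_two_eq_zero]
  obtain ⟨c, -, hc⟩ := nv_tri i
  rw [hc, smul_dotProduct, sub_dotProduct, smul_dotProduct, single_one_dotProduct,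
    single_one_dotProduct, h]
  simp

/-! ### The traces of homogeneous fields -/

/-- The form has homogeneous components, and its traces are those of polynomial forms. -/
structure Good (s : Fin 3) (k : ℕ) (P : Form s) : Prop where
  hom : HasHom P
  tri : ∀ i : Fin 4, ∃ w ∈ tetSpace s k, ∀ x ∈ openFace coneL i.castSucc,
    symb s (nv (coneL i.castSucc)) (P x - w x) = 0
  base : ∃ w ∈ cubeSpace s k, ∀ x ∈ openFace coneL 4, symb s (nv (coneL 4)) (P x - w x) = 0

section Good

variable {s : Fin 3} {k : ℕ} {P Q : Form s}

theorem pos_of_mem_tri {i : Fin 4} {x : V3} (hx : x ∈ openFace coneL i.castSucc) : 0 < x 2 := by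
  obtain ⟨-, h1, h2, -⟩ := mem_tri_iff.1 hx
  exact h1.trans h2

theorem pos_of_mem_base {x : V3} (hx : x ∈ openFace coneL 4) : 0 < x 2 := by
  rw [(mem_base_iff.1 hx).1]
  exact one_pos

theorem Good.congr (hP : Good s k P) (h : ∀ x, 0 < x 2 → Q x = P x) : Good s k Q where
  hom a := by
    obtain ⟨q, hq, h'⟩ := hP.hom a
    exact ⟨q, hq, fun x hx => by rw [h x hx, h' x hx]⟩
  tri i := by
    obtain ⟨w, hw, h'⟩ := hP.tri i
    exact ⟨w, hw, fun x hx => by rw [h x (pos_of_mem_tri hx), h' x hx]⟩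
  base := by
    obtain ⟨w, hw, h'⟩ := hP.base
    exact ⟨w, hw, fun x hx => by rw [h x (pos_of_mem_base hx), h' x hx]⟩

theorem symb_comb {n : V3} {u v u' v' : Fin (proxyDim s) → ℝ} {c : ℝ} (h : symb s n (u - v) = 0)
    (h' : symb s n (u' - v') = 0) : symb s n ((u + c • u') - (v + c • v')) = 0 := by
  have : (u + c • u') - (v + c • v') = (u - v) + c • (u' - v') := by
    rw [smul_sub]
    abel
  rw [this, symb_add, symb_smul, h, h']
  simp

theorem Good.add_smul (hk : 1 ≤ k) (hP : Good s k P) (hQ : Good s k Q) (c : ℝ) :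
    Good s k (P + c • Q) where
  hom a := by
    obtain ⟨q, hq, h⟩ := hP.hom a
    obtain ⟨q', hq', h'⟩ := hQ.hom a
    refine ⟨q + c • q', Submodule.add_mem _ hq (Submodule.smul_mem _ _ hq'), fun x hx => ?_⟩
    change P x a + c * Q x a = q x + c * q' x
    rw [h x hx, h' x hx]
  tri i := by
    obtain ⟨w, hw, h⟩ := hP.tri i
    obtain ⟨w', hw', h'⟩ := hQ.tri i
    exact ⟨w + c • w', tetSpace_add_smul hk hw hw' c, fun x hx => symb_comb (h x hx) (h' x hx)⟩
  base := by
    obtain ⟨w, hw, h⟩ := hP.base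
    obtain ⟨w', hw', h'⟩ := hQ.base
    exact ⟨w + c • w', cubeSpace_add_smul hw hw' c, fun x hx => symb_comb (h x hx) (h' x hx)⟩

theorem symb_zero_right (n : V3) : symb s n 0 = 0 := by
  ext b
  simp [symb]

theorem Good.zero : Good s k 0 where
  hom a := ⟨0, Submodule.zero_mem _, fun x _ => rfl⟩
  tri i := ⟨0, zero_mem_tetSpace s k, fun x _ => by simp [symb_zero_right]⟩
  base := ⟨0, zero_mem_cubeSpace s k, fun x _ => by simp [symb_zero_right]⟩

theorem Good.add (hk : 1 ≤ k) (hP : Good s k P) (hQ : Good s k Q) : Good s k (P + Q) := by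
  simpa using hP.add_smul hk hQ 1

theorem Good.smul (hk : 1 ≤ k) (hQ : Good s k Q) (c : ℝ) : Good s k (c • Q) := by
  simpa using Good.zero.add_smul hk hQ c

end Good

/-! ### Weighted monomials -/

/-- The monomials which span the weighted spaces. -/
def wmon (a b c : ℕ) (x : V3) : ℝ := x 0 ^ a * x 1 ^ b / (1 + x 2) ^ c

theorem wmon_coneInv (a b c : ℕ) (x : V3) : wmon a b c (coneInv x) = hmon a b c x := by
  rw [wmon, one_add_coneInv, hmon]
  simp [coneInv]

theorem wmon_eq (a b c : ℕ) : wmon a b c = fun y => (fun t => t ^ a) (y 0) * (fun t => t ^ b) (y 1) *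
    (fun t => ((1 + t) ^ c)⁻¹) (y 2) := by
  ext y
  simp [wmon, div_eq_mul_inv]

theorem hasDerivAt_inv_pow {t : ℝ} (ht : 1 + t ≠ 0) (c : ℕ) :
    HasDerivAt (fun t : ℝ => ((1 + t) ^ c)⁻¹) (-(c / (1 + t) ^ (c + 1))) t := by
  have h1 : HasDerivAt (fun t : ℝ => (1 + t) ^ c) (c * (1 + t) ^ (c - 1) * 1) t :=
    ((hasDerivAt_id t).const_add 1).pow c
  have h2 := h1.inv (pow_ne_zero c ht)
  refine h2.congr_deriv ?_
  rcases c with _ | c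
  · simp
  · rw [Nat.add_sub_cancel]
    field_simp
    ring

theorem differentiableAt_wmon {x : V3} (hx : 1 + x 2 ≠ 0) (a b c : ℕ) :
    DifferentiableAt ℝ (wmon a b c) x := by
  rw [wmon_eq]
  exact differentiableAt_prod (hasDerivAt_pow a _) (hasDerivAt_pow b _) (hasDerivAt_inv_pow hx c)

theorem pd_wmon {x : V3} (hx : 1 + x 2 ≠ 0) (a b c : ℕ) (i : Fin 3) :
    pd i (wmon a b c) x =
      ![a * wmon (a - 1) b c x, b * wmon a (b - 1) c x, -(c * wmon a b (c + 1) x)] i := by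
  rw [wmon_eq, pd_prod (hasDerivAt_pow a _) (hasDerivAt_pow b _) (hasDerivAt_inv_pow hx c)]
  fin_cases i <;> simp [wmon] <;> ring

theorem one_add_coneInv_ne {x : V3} (hx : 0 < x 2) : 1 + coneInv x 2 ≠ 0 := by
  rw [one_add_coneInv]
  exact inv_ne_zero hx.ne'

theorem pd_wmon_coneInv {x : V3} (hx : 0 < x 2) (a b c : ℕ) (i : Fin 3) :
    pd i (wmon a b c) (coneInv x) =
      ![a * hmon (a - 1) b c x, b * hmon a (b - 1) c x, -(c * hmon a b (c + 1) x)] i := by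
  rw [pd_wmon (one_add_coneInv_ne hx), wmon_coneInv, wmon_coneInv, wmon_coneInv]

theorem weighted_eq (k l m : ℤ) : weighted k l m = Submodule.span ℝ {f | ∃ a b c : ℕ,
    (c : ℤ) ≤ k ∧ (a : ℤ) ≤ c + l - k ∧ (b : ℤ) ≤ c + m - k ∧ f = wmon a b c} := rfl

theorem wmon_mem {k l m : ℤ} {a b c : ℕ} (hc : (c : ℤ) ≤ k) (ha : (a : ℤ) ≤ c + l - k)
    (hb : (b : ℤ) ≤ c + m - k) : wmon a b c ∈ weighted k l m :=
  Submodule.subset_span ⟨a, b, c, hc, ha, hb, rfl⟩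

theorem hmon_succ (x : V3) (a b c : ℕ) : hmon a b (c + 1) x = hmon a b c x * x 2 := by
  rw [hmon, hmon, pow_succ]
  ring

theorem hmon_succ_left (x : V3) (a b c : ℕ) :
    hmon (a + 1) b c x = x 0 / x 2 * hmon a b c x := by
  rw [hmon, hmon, pow_succ]
  ring

theorem hmon_succ_mid (x : V3) (a b c : ℕ) :
    hmon a (b + 1) c x = x 1 / x 2 * hmon a b c x := by
  rw [hmon, hmon, pow_succ]
  ring

/-- The exponents of the coordinates `fj i` and `fo i`. -/
def nex (i : Fin 4) (a b : ℕ) : ℕ := ![b, a, b, a] i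

/-- The exponent of the coordinate `fo i`. -/
def tex (i : Fin 4) (a b : ℕ) : ℕ := ![a, b, a, b] i

/-- On the face one quotient equals `fe i`, which is `0` or `1`, and the denominator of the other
one is absorbed by `x 2 ^ c`. For `fe i = 0` only monomials with exponent `nex i a b = 0` survive.
-/
theorem hmon_face {i : Fin 4} {x : V3} (hx : x ∈ openFace coneL i.castSucc) {a b c e : ℕ}
    (h : tex i a b + e = c) :
    hmon a b c x = fe i ^ nex i a b * (x (fo i) ^ tex i a b * x 2 ^ e) := by
  have h0 := (pos_of_mem_tri hx).ne'
  have h1 := (mem_tri_iff.1 hx).1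
  have hq : ∀ n (t : ℝ), (t / x 2) ^ n * x 2 ^ (n + e) = t ^ n * x 2 ^ e := by
    intro n t
    rw [pow_add, div_pow]
    field_simp
  have hz : x (fj i) / x 2 = fe i := by rw [h1]; field_simp
  have key : hmon a b c x = (x (fj i) / x 2) ^ nex i a b * ((x (fo i) / x 2) ^ tex i a b * x 2 ^ c) := by
    rw [hmon]
    fin_cases i <;> simp [fj, fo, nex, tex] <;> ring
  rw [key, hz, ← h, hq]

theorem hmon_base {x : V3} (hx : x ∈ openFace coneL 4) (a b c : ℕ) :
    hmon a b c x = x 0 ^ a * x 1 ^ b := by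
  rw [hmon, (mem_base_iff.1 hx).1]
  simp

section FacePoly

open MvPolynomial

/-- The monomials in the coordinates of a triangular face. -/
def facePoly (i : Fin 4) (r : ℝ) (t e : ℕ) : MvPolynomial (Fin 3) ℝ := C r * (X (fo i) ^ t * X 2 ^ e)

theorem eval_facePoly (i : Fin 4) (r : ℝ) (t e : ℕ) (x : V3) :
    eval x (facePoly i r t e) = r * (x (fo i) ^ t * x 2 ^ e) := by
  simp [facePoly]

theorem totalDegree_facePoly_le (i : Fin 4) (r : ℝ) (t e : ℕ) :
    (facePoly i r t e).totalDegree ≤ t + e := by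
  refine (totalDegree_C_mul_le _ _).trans ((totalDegree_mul _ _).trans (add_le_add ?_ ?_))
  · exact (totalDegree_pow _ _).trans (by rw [totalDegree_X, mul_one])
  · exact (totalDegree_pow _ _).trans (by rw [totalDegree_X, mul_one])

/-- The monomials in the coordinates of the base. -/
def basePoly (r : ℝ) (a b : ℕ) : MvPolynomial (Fin 3) ℝ := C r * (X 0 ^ a * X 1 ^ b)

theorem eval_basePoly (r : ℝ) (a b : ℕ) (x : V3) :
    eval x (basePoly r a b) = r * (x 0 ^ a * x 1 ^ b) := by
  simp [basePoly]

theorem degreeOf_basePoly_le (r : ℝ) (a b : ℕ) (i : Fin 3) :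
    (basePoly r a b).degreeOf i ≤ ![a, b, 0] i := by
  refine (degreeOf_C_mul_le _ _ _).trans ((degreeOf_mul_le _ _ _).trans
    ((add_le_add (degreeOf_pow_le _ _ _) (degreeOf_pow_le _ _ _)).trans ?_))
  rw [degreeOf_X, degreeOf_X]
  fin_cases i <;> simp

end FacePoly

section Generators

open MvPolynomial

theorem good_one_of {k : ℕ} (hk : 1 ≤ k) {P : V3 → V3}
    (hhom : ∀ r : Fin 3, ∃ q ∈ homSpace, ∀ x : V3, 0 < x 2 → P x r = q x)
    (htri : ∀ i : Fin 4, ∃ p : Fin 3 → MvPolynomial (Fin 3) ℝ, (∀ j, (p j).totalDegree ≤ k) ∧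
      (∑ j, X j * p j).totalDegree ≤ k ∧ ∀ x ∈ openFace coneL i.castSucc,
        P x (fo i) = eval x (p (fo i)) ∧ x ⬝ᵥ P x = x ⬝ᵥ fun j => eval x (p j))
    (hbase : ∃ p₀ p₁ : MvPolynomial (Fin 3) ℝ, (∀ i, p₀.degreeOf i ≤ ![k - 1, k, k] i) ∧
      (∀ i, p₁.degreeOf i ≤ ![k, k - 1, k] i) ∧ ∀ x ∈ openFace coneL 4,
        P x 0 = eval x p₀ ∧ P x 1 = eval x p₁) : Good 1 k P where
  hom := hhom
  tri i := by
    obtain ⟨p, h1, h2, h3⟩ := htri i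
    refine ⟨fun x => fun j : Fin 3 => eval x (p j), (mem_tetSpace_one hk).2 ⟨p, h1, h2, fun _ => rfl⟩,
      fun x hx => ?_⟩
    refine symb_tri_one (mem_tri_iff.1 hx).1 (pos_of_mem_tri hx).ne' ?_ ?_
    · exact sub_eq_zero.2 (h3 x hx).1
    · exact (dotProduct_sub x (P x) (fun j => eval x (p j))).trans (sub_eq_zero.2 (h3 x hx).2)
  base := by
    obtain ⟨p₀, p₁, h0, h1, h⟩ := hbase
    refine ⟨fun x => fun j : Fin 3 => eval x ((![p₀, p₁, 0] : Fin 3 → MvPolynomial (Fin 3) ℝ) j),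
      ⟨_, fun i j => ?_, fun _ => rfl⟩, fun x hx => ?_⟩
    · fin_cases j
      · refine (h0 i).trans ?_
        fin_cases i <;> simp
      · refine (h1 i).trans ?_
        fin_cases i <;> simp
      · simp
    · rw [nv_coneL]
      exact symb_base_one (sub_eq_zero.2 (h x hx).1) (sub_eq_zero.2 (h x hx).2)

theorem good_two_of {k : ℕ} (hk : 1 ≤ k) {P : V3 → V3}
    (hhom : ∀ r : Fin 3, ∃ q ∈ homSpace, ∀ x : V3, 0 < x 2 → P x r = q x)
    (htri : ∀ i : Fin 4, ∃ p : MvPolynomial (Fin 3) ℝ, p.totalDegree ≤ k - 1 ∧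
      ∀ x ∈ openFace coneL i.castSucc, P x (fj i) - fe i * P x 2 = eval x p)
    (hbase : ∃ p : MvPolynomial (Fin 3) ℝ, (∀ i, p.degreeOf i ≤ k - 1) ∧
      ∀ x ∈ openFace coneL 4, P x 2 = eval x p) : Good 2 k P where
  hom := hhom
  tri i := by
    obtain ⟨p, h1, h2⟩ := htri i
    refine ⟨fun x => fun j : Fin 3 => eval x ((Pi.single (fj i) p : Fin 3 → MvPolynomial (Fin 3) ℝ) j),
      (mem_tetSpace_two hk).2 ⟨Pi.single (fj i) p, 0, fun j => ?_, by simp, fun x => by simp⟩,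
      fun x hx => symb_tri_two ?_⟩
    · rw [Pi.single_apply]
      split_ifs
      · exact h1
      · simp
    · have h3 := h2 x hx
      have hne : (2 : Fin 3) ≠ fj i := by fin_cases i <;> simp [fj]
      change P x (fj i) - eval x ((Pi.single (fj i) p : Fin 3 → MvPolynomial (Fin 3) ℝ) (fj i)) =
        fe i * (P x 2 - eval x ((Pi.single (fj i) p : Fin 3 → MvPolynomial (Fin 3) ℝ) 2))
      rw [Pi.single_eq_same, Pi.single_eq_of_ne hne]
      simp
      linarith
  base := by
    obtain ⟨p, h1, h⟩ := hbase
    refine ⟨fun x => fun j : Fin 3 => eval x ((![0, 0, p] : Fin 3 → MvPolynomial (Fin 3) ℝ) j),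
      ⟨_, fun i j => ?_, fun _ => rfl⟩, fun x hx => ?_⟩
    · fin_cases j
      · simp
      · simp
      · refine (h1 i).trans ?_
        fin_cases i <;> simp
    · rw [nv_coneL]
      exact symb_base_two (sub_eq_zero.2 (h x hx))

theorem good_zero_mon {a b c k : ℕ} (ha : a ≤ c) (hb : b ≤ c) (hc : c ≤ k) :
    Good 0 k (pull 0 coneInv fun x _ => wmon a b c x) where
  hom _ := ⟨hmon a b c, hmon_mem a b c, fun x _ => wmon_coneInv a b c x⟩
  tri i := by
    obtain ⟨e, he⟩ : ∃ e, tex i a b + e = c := by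
      refine ⟨c - tex i a b, ?_⟩
      fin_cases i <;> simp [tex] <;> omega
    refine ⟨fun x _ => eval x (facePoly i (fe i ^ nex i a b) (tex i a b) e),
      ⟨_, (totalDegree_facePoly_le _ _ _ _).trans (by omega), fun _ => rfl⟩, fun x hx => ?_⟩
    refine symb_tri_zero (sub_eq_zero.2 ?_)
    exact (wmon_coneInv a b c x).trans ((hmon_face hx he).trans (eval_facePoly _ _ _ _ x).symm)
  base := by
    refine ⟨fun x _ => eval x (basePoly 1 a b), ⟨_, fun i => (degreeOf_basePoly_le _ _ _ _).trans ?_,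
      fun _ => rfl⟩, fun x hx => ?_⟩
    · fin_cases i <;> simp <;> omega
    · refine symb_tri_zero (sub_eq_zero.2 ?_)
      exact (wmon_coneInv a b c x).trans ((hmon_base hx a b c).trans
        ((eval_basePoly 1 a b x).trans (one_mul _)).symm)

/-- The rays through the apex are the images of the vertical lines of the infinite pyramid, so the
radial component only sees the third component of the form. In particular it vanishes for horizontal
forms. -/
theorem dot_pull_coneInv_one {x : V3} (hx : x 2 ≠ 0) (f : V3 → V3) :
    x ⬝ᵥ (pull 1 coneInv f x : V3) = -(f (coneInv x) 2 / x 2) := by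
  rw [pull_coneInv_one hx, dotProduct, Fin.sum_univ_three]
  simp
  field_simp
  ring

theorem pull_one_fst (a b n : ℕ) {x : V3} (hx : 0 < x 2) :
    (pull 1 coneInv (fun x => (![wmon a b (n + 2) x, 0, 0] : V3)) x : V3) =
    ![hmon a b (n + 1) x, 0, -hmon (a + 1) b (n + 1) x] := by
  refine (pull_coneInv_one hx.ne' _).trans ?_
  ext r
  fin_cases r
  · change wmon a b (n + 2) (coneInv x) / x 2 = hmon a b (n + 1) x
    rw [wmon_coneInv, hmon_succ]
    field_simp
  · simp
  · change -(x 0 * wmon a b (n + 2) (coneInv x) + x 1 * 0 + 0) / x 2 ^ 2 = -hmon (a + 1) b (n + 1) x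
    rw [wmon_coneInv, hmon_succ, hmon_succ_left]
    field_simp
    ring

theorem dot_pull_one_fst (a b n : ℕ) {x : V3} (hx : 0 < x 2) :
    x ⬝ᵥ (pull 1 coneInv (fun x => (![wmon a b (n + 2) x, 0, 0] : V3)) x : V3) = 0 := by
  refine (dot_pull_coneInv_one hx.ne' _).trans ?_
  simp

/-- The radial component is zero. On a face with free coordinate `x 0` the tangential trace is that
of `q * (x 2, 0, -x 0)`, which is orthogonal to `x` identically as the first kind space demands; the
factor `x 2` is available since `a + 2 ≤ c`. On the other two triangular faces nothing is left. -/
theorem good_one_fst {a b c k : ℕ} (hk : 1 ≤ k) (ha : a + 2 ≤ c) (hb : b + 1 ≤ c) (hc : c ≤ k + 1) :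
    Good 1 k (pull 1 coneInv fun x => (![wmon a b c x, 0, 0] : V3)) := by
  obtain ⟨n, rfl⟩ : ∃ n, c = n + 2 := ⟨c - 2, by omega⟩
  refine good_one_of hk (fun r => ?_) (fun i => ?_) ?_
  · fin_cases r
    · exact ⟨_, hmon_mem a b (n + 1), fun x hx => congrFun (pull_one_fst a b n hx) (0 : Fin 3)⟩
    · exact ⟨0, Submodule.zero_mem _, fun x hx => congrFun (pull_one_fst a b n hx) (1 : Fin 3)⟩
    · exact ⟨_, Submodule.neg_mem _ (hmon_mem (a + 1) b (n + 1)), fun x hx => congrFun (pull_one_fst a b n hx) (2 : Fin 3)⟩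
  · by_cases hi : fo i = 0
    · have ht : tex i a b = a := by fin_cases i <;> simp [fo, tex] at hi ⊢
      set q := facePoly i (fe i ^ nex i a b) a (n - a)
      have hq : q.totalDegree ≤ n := (totalDegree_facePoly_le _ _ _ _).trans (by omega)
      refine ⟨![q * X 2, 0, -(q * X 0)], fun j => ?_, ?_, fun x hx => ⟨?_, ?_⟩⟩
      · fin_cases j
        · exact (totalDegree_mul _ _).trans (by rw [totalDegree_X]; omega)
        · simp
        · simp only [Fin.reduceFinMk, Matrix.cons_val, totalDegree_neg]
          exact (totalDegree_mul _ _).trans (by rw [totalDegree_X]; omega)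
      · have : ∑ j, X j * (![q * X 2, 0, -(q * X 0)] : Fin 3 → MvPolynomial (Fin 3) ℝ) j = 0 := by
          simp [Fin.sum_univ_three]
          ring
        rw [this]
        simp
      · rw [hi]
        refine (congrFun (pull_one_fst a b n (pos_of_mem_tri hx)) (0 : Fin 3)).trans ?_
        have := hmon_face hx (a := a) (b := b) (c := n + 1) (e := n - a + 1) (by rw [ht]; omega)
        rw [ht, hi] at this
        change hmon a b (n + 1) x = eval x (q * X 2)
        rw [this, map_mul, eval_facePoly, eval_X, hi, pow_succ]
        ring
      · refine (dot_pull_one_fst a b n (pos_of_mem_tri hx)).trans ?_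
        simp [dotProduct, Fin.sum_univ_three]
        ring
    · have hi' : fo i = 1 := by fin_cases i <;> simp [fo] at hi ⊢
      refine ⟨0, fun j => by simp, by simp, fun x hx => ⟨?_, ?_⟩⟩
      · rw [hi']
        refine (congrFun (pull_one_fst a b n (pos_of_mem_tri hx)) (1 : Fin 3)).trans ?_
        simp
      · refine (dot_pull_one_fst a b n (pos_of_mem_tri hx)).trans ?_
        simp [dotProduct]
  · refine ⟨basePoly 1 a b, 0, fun i => (degreeOf_basePoly_le _ _ _ _).trans ?_, by simp,
      fun x hx => ⟨?_, ?_⟩⟩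
    · fin_cases i <;> simp <;> omega
    · refine (congrFun (pull_one_fst a b n (pos_of_mem_base hx)) (0 : Fin 3)).trans ?_
      rw [eval_basePoly, one_mul]
      exact hmon_base hx a b _
    · refine (congrFun (pull_one_fst a b n (pos_of_mem_base hx)) (1 : Fin 3)).trans ?_
      simp

theorem pull_one_snd (a b n : ℕ) {x : V3} (hx : 0 < x 2) :
    (pull 1 coneInv (fun x => (![0, wmon a b (n + 2) x, 0] : V3)) x : V3) =
    ![0, hmon a b (n + 1) x, -hmon a (b + 1) (n + 1) x] := by
  refine (pull_coneInv_one hx.ne' _).trans ?_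
  ext r
  fin_cases r
  · simp
  · change wmon a b (n + 2) (coneInv x) / x 2 = hmon a b (n + 1) x
    rw [wmon_coneInv, hmon_succ]
    field_simp
  · change -(x 0 * 0 + x 1 * wmon a b (n + 2) (coneInv x) + 0) / x 2 ^ 2 = -hmon a (b + 1) (n + 1) x
    rw [wmon_coneInv, hmon_succ, hmon_succ_mid]
    field_simp
    ring

theorem dot_pull_one_snd (a b n : ℕ) {x : V3} (hx : 0 < x 2) :
    x ⬝ᵥ (pull 1 coneInv (fun x => (![0, wmon a b (n + 2) x, 0] : V3)) x : V3) = 0 := by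
  refine (dot_pull_coneInv_one hx.ne' _).trans ?_
  simp

theorem good_one_snd {a b c k : ℕ} (hk : 1 ≤ k) (ha : a + 1 ≤ c) (hb : b + 2 ≤ c) (hc : c ≤ k + 1) :
    Good 1 k (pull 1 coneInv fun x => (![0, wmon a b c x, 0] : V3)) := by
  obtain ⟨n, rfl⟩ : ∃ n, c = n + 2 := ⟨c - 2, by omega⟩
  refine good_one_of hk (fun r => ?_) (fun i => ?_) ?_
  · fin_cases r
    · exact ⟨0, Submodule.zero_mem _, fun x hx => congrFun (pull_one_snd a b n hx) (0 : Fin 3)⟩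
    · exact ⟨_, hmon_mem a b (n + 1), fun x hx => congrFun (pull_one_snd a b n hx) (1 : Fin 3)⟩
    · exact ⟨_, Submodule.neg_mem _ (hmon_mem a (b + 1) (n + 1)), fun x hx => congrFun (pull_one_snd a b n hx) (2 : Fin 3)⟩
  · by_cases hi : fo i = 1
    · have ht : tex i a b = b := by fin_cases i <;> simp [fo, tex] at hi ⊢
      set q := facePoly i (fe i ^ nex i a b) b (n - b)
      have hq : q.totalDegree ≤ n := (totalDegree_facePoly_le _ _ _ _).trans (by omega)
      refine ⟨![0, q * X 2, -(q * X 1)], fun j => ?_, ?_, fun x hx => ⟨?_, ?_⟩⟩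
      · fin_cases j
        · simp
        · exact (totalDegree_mul _ _).trans (by rw [totalDegree_X]; omega)
        · simp only [Fin.reduceFinMk, Matrix.cons_val, totalDegree_neg]
          exact (totalDegree_mul _ _).trans (by rw [totalDegree_X]; omega)
      · have : ∑ j, X j * (![0, q * X 2, -(q * X 1)] : Fin 3 → MvPolynomial (Fin 3) ℝ) j = 0 := by
          simp [Fin.sum_univ_three]
          ring
        rw [this]
        simp
      · rw [hi]
        refine (congrFun (pull_one_snd a b n (pos_of_mem_tri hx)) (1 : Fin 3)).trans ?_
        have := hmon_face hx (a := a) (b := b) (c := n + 1) (e := n - b + 1) (by rw [ht]; omega)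
        rw [ht, hi] at this
        change hmon a b (n + 1) x = eval x (q * X 2)
        rw [this, map_mul, eval_facePoly, eval_X, hi, pow_succ]
        ring
      · refine (dot_pull_one_snd a b n (pos_of_mem_tri hx)).trans ?_
        simp [dotProduct, Fin.sum_univ_three]
        ring
    · have hi' : fo i = 0 := by fin_cases i <;> simp [fo] at hi ⊢
      refine ⟨0, fun j => by simp, by simp, fun x hx => ⟨?_, ?_⟩⟩
      · rw [hi']
        refine (congrFun (pull_one_snd a b n (pos_of_mem_tri hx)) (0 : Fin 3)).trans ?_
        simp
      · refine (dot_pull_one_snd a b n (pos_of_mem_tri hx)).trans ?_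
        simp [dotProduct]
  · refine ⟨0, basePoly 1 a b, by simp, fun i => (degreeOf_basePoly_le _ _ _ _).trans ?_,
      fun x hx => ⟨?_, ?_⟩⟩
    · fin_cases i <;> simp <;> omega
    · refine (congrFun (pull_one_snd a b n (pos_of_mem_base hx)) (0 : Fin 3)).trans ?_
      simp
    · refine (congrFun (pull_one_snd a b n (pos_of_mem_base hx)) (1 : Fin 3)).trans ?_
      rw [eval_basePoly, one_mul]
      exact hmon_base hx a b _

/-- The pullback of a gradient is the gradient of the homogeneous monomial. Its tangential part on a
triangular face is the gradient of the restriction, a polynomial of degree at most `k`, so its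
components have degree at most `k - 1`. -/
theorem good_one_grad {a b c k : ℕ} (hk : 1 ≤ k) (ha : a ≤ c) (hb : b ≤ c) (hc : c ≤ k) :
    Good 1 k (pull 1 coneInv (grad (wmon a b c))) := by
  rcases c with _ | n
  · obtain rfl : a = 0 := by omega
    obtain rfl : b = 0 := by omega
    refine Good.zero.congr fun x hx => ?_
    refine (pull_coneInv_one hx.ne' _).trans ?_
    have h0 : ∀ i, grad (wmon 0 0 0) (coneInv x) i = 0 := by
      intro i
      rw [grad, pd_wmon_coneInv hx]
      fin_cases i <;> simp
    refine funext fun (r : Fin 3) => ?_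
    change _ = (0 : ℝ)
    fin_cases r <;> simp [h0]
  have hP : ∀ x : V3, 0 < x 2 → (pull 1 coneInv (grad (wmon a b (n + 1))) x : V3) =
      ![a * hmon (a - 1) b n x, b * hmon a (b - 1) n x, ((n : ℝ) + 1 - a - b) * hmon a b n x] := by
    intro x hx
    refine (pull_coneInv_one hx.ne' _).trans ?_
    have hg : ∀ i, grad (wmon a b (n + 1)) (coneInv x) i = ![a * hmon (a - 1) b (n + 1) x,
        b * hmon a (b - 1) (n + 1) x, -((n + 1 : ℕ) * hmon a b (n + 1 + 1) x)] i :=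
      fun i => pd_wmon_coneInv hx _ _ _ _
    have h1 : (a : ℝ) * (x 0 / x 2 * hmon (a - 1) b n x) = a * hmon a b n x := by
      rcases a with _ | a
      · simp
      · rw [Nat.add_sub_cancel, hmon_succ_left]
    have h2 : (b : ℝ) * (x 1 / x 2 * hmon a (b - 1) n x) = b * hmon a b n x := by
      rcases b with _ | b
      · simp
      · rw [Nat.add_sub_cancel, hmon_succ_mid]
    ext r
    rw [hg, hg, hg]
    simp only [hmon_succ]
    fin_cases r
    · simp
      field_simp
    · simp
      field_simp
    · simp only [Fin.reduceFinMk, Matrix.cons_val]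
      have : -(x 0 * (a * (hmon (a - 1) b n x * x 2)) + x 1 * (b * (hmon a (b - 1) n x * x 2)) +
          -((n + 1 : ℕ) * (hmon a b n x * x 2 * x 2))) / x 2 ^ 2 =
          (n + 1 : ℕ) * hmon a b n x - a * (x 0 / x 2 * hmon (a - 1) b n x) -
            b * (x 1 / x 2 * hmon a (b - 1) n x) := by
        field_simp
        ring
      rw [this, h1, h2]
      push_cast
      ring
  -- Euler's identity: the radial derivative of a function of degree `n + 1` is `n + 1` times the
  -- function.
  have hdot : ∀ x : V3, 0 < x 2 →
      x ⬝ᵥ (pull 1 coneInv (grad (wmon a b (n + 1))) x : V3) = (n + 1 : ℕ) * hmon a b (n + 1) x := by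
    intro x hx
    refine (dot_pull_coneInv_one hx.ne' _).trans ?_
    rw [grad, pd_wmon_coneInv hx]
    simp only [Matrix.cons_val, hmon_succ]
    field_simp
  refine good_one_of hk (fun r => ?_) (fun i => ?_) ?_
  · fin_cases r
    · exact ⟨_, Submodule.smul_mem _ (a : ℝ) (hmon_mem (a - 1) b n), fun x hx => congrFun (hP x hx) (0 : Fin 3)⟩
    · exact ⟨_, Submodule.smul_mem _ (b : ℝ) (hmon_mem a (b - 1) n), fun x hx => congrFun (hP x hx) (1 : Fin 3)⟩
    · exact ⟨_, Submodule.smul_mem _ ((n : ℝ) + 1 - a - b) (hmon_mem a b n),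
        fun x hx => congrFun (hP x hx) (2 : Fin 3)⟩
  · set t := tex i a b with ht
    have htn : t ≤ n + 1 := by fin_cases i <;> simp [tex, ht] <;> omega
    set r := fe i ^ nex i a b
    have hfo2 : (2 : Fin 3) ≠ fo i := by fin_cases i <;> simp [fo]
    -- the gradient of the restriction to the face
    set p₁ := facePoly i (r * t) (t - 1) (n + 1 - t)
    set p₂ := facePoly i (r * (n + 1 - t : ℕ)) t (n + 1 - t - 1)
    have hp₁ : p₁.totalDegree ≤ n := by
      rcases Nat.eq_zero_or_pos t with h0 | h0
      · simp [p₁, h0, facePoly]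
      · exact (totalDegree_facePoly_le _ _ _ _).trans (by omega)
    have hp₂ : p₂.totalDegree ≤ n := by
      rcases Nat.eq_zero_or_pos (n + 1 - t) with h0 | h0
      · simp [p₂, h0, facePoly]
      · exact (totalDegree_facePoly_le _ _ _ _).trans (by omega)
    set p : Fin 3 → MvPolynomial (Fin 3) ℝ := Pi.single (fo i) p₁ + Pi.single 2 p₂
    have hpo : p (fo i) = p₁ := by simp [p, Pi.single_eq_of_ne hfo2.symm]
    have hp2 : p 2 = p₂ := by simp [p, Pi.single_eq_of_ne hfo2]
    have hpj : ∀ j, (p j).totalDegree ≤ n := by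
      intro j
      refine (totalDegree_add _ _).trans (max_le ?_ ?_)
      · rw [Pi.single_apply]
        split_ifs
        · exact hp₁
        · simp
      · rw [Pi.single_apply]
        split_ifs
        · exact hp₂
        · simp
    have hdotp : ∀ x : V3, x ⬝ᵥ (fun j => eval x (p j)) = x (fo i) * eval x p₁ + x 2 * eval x p₂ := by
      intro x
      have : (fun j => eval x (p j)) = Pi.single (fo i) (eval x p₁) + Pi.single 2 (eval x p₂) := by
        ext j
        simp only [p, Pi.add_apply, map_add, Pi.single_apply]
        congr 1 <;> split_ifs <;> simp
      rw [this, dotProduct_add, dotProduct_single, dotProduct_single]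
    refine ⟨p, fun j => (hpj j).trans (by omega), ?_, fun x hx => ⟨?_, ?_⟩⟩
    · refine totalDegree_finsetSum_le fun j _ => totalDegree_X_mul_le hk ((hpj j).trans ?_) j
      omega
    · rw [hpo, eval_facePoly]
      have key : ∀ a' b' : ℕ, tex i a' b' = t - 1 → nex i a' b' = nex i a b → t ≠ 0 →
          hmon a' b' n x = r * (x (fo i) ^ (t - 1) * x 2 ^ (n + 1 - t)) := by
        intro a' b' h1 h2 h3
        rw [hmon_face hx (e := n + 1 - t) (by rw [h1]; omega), h1, h2]
      have hv := hP x (pos_of_mem_tri hx)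
      have hfin : (pull 1 coneInv (grad (wmon a b (n + 1))) x : V3) (fo i) =
          t * hmon (![a - 1, a, a - 1, a] i) (![b, b - 1, b, b - 1] i) n x := by
        refine (congrFun hv (fo i)).trans ?_
        fin_cases i <;> simp [fo, ht, tex]
      refine hfin.trans ?_
      rcases Nat.eq_zero_or_pos t with h0 | h0
      · rw [h0]
        simp
      · rw [key _ _ ?_ ?_ h0.ne']
        · ring
        · rw [ht]
          fin_cases i <;> simp [tex]
        · fin_cases i <;> simp [nex]
    · refine (hdot x (pos_of_mem_tri hx)).trans ?_
      rw [hdotp, eval_facePoly, eval_facePoly,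
        hmon_face hx (e := n + 1 - t) (by rw [← ht]; omega), ← ht]
      -- The two summands of Euler's identity for the restriction to the face; their factors `t` and
      -- `n + 1 - t` add up to the degree.
      have e1 : x (fo i) * (r * t * (x (fo i) ^ (t - 1) * x 2 ^ (n + 1 - t))) =
          t * (r * (x (fo i) ^ t * x 2 ^ (n + 1 - t))) := by
        rcases Nat.eq_zero_or_pos t with h0 | h0
        · rw [h0]
          simp
        · obtain ⟨t', ht'⟩ : ∃ t', t = t' + 1 := ⟨t - 1, by omega⟩
          rw [ht', Nat.add_sub_cancel, pow_succ (x (fo i)) t']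
          ring
      have e2 : x 2 * (r * (n + 1 - t : ℕ) * (x (fo i) ^ t * x 2 ^ (n + 1 - t - 1))) =
          (n + 1 - t : ℕ) * (r * (x (fo i) ^ t * x 2 ^ (n + 1 - t))) := by
        rcases Nat.eq_zero_or_pos (n + 1 - t) with h0 | h0
        · rw [h0]
          simp
        · obtain ⟨t', ht'⟩ : ∃ t', n + 1 - t = t' + 1 := ⟨n + 1 - t - 1, by omega⟩
          rw [ht', Nat.add_sub_cancel, pow_succ (x 2) t']
          ring
      rw [e1, e2, Nat.cast_sub htn]
      ring
  · refine ⟨basePoly a (a - 1) b, basePoly b a (b - 1), fun i => ?_, fun i => ?_, fun x hx => ⟨?_, ?_⟩⟩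
    · refine (degreeOf_basePoly_le _ _ _ _).trans ?_
      fin_cases i <;> simp <;> omega
    · refine (degreeOf_basePoly_le _ _ _ _).trans ?_
      fin_cases i <;> simp <;> omega
    · refine (congrFun (hP x (pos_of_mem_base hx)) (0 : Fin 3)).trans ?_
      rw [eval_basePoly, ← hmon_base hx _ _ n]
      rfl
    · refine (congrFun (hP x (pos_of_mem_base hx)) (1 : Fin 3)).trans ?_
      rw [eval_basePoly, ← hmon_base hx _ _ n]
      rfl

end Generators

section GeneratorsTwo

open MvPolynomial

/-- The pulled back field is a multiple of the radial field `x`, which is tangential to every face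
through the apex. Only the base sees its normal component. -/
theorem good_two_thd {a b c k : ℕ} (hk : 1 ≤ k) (ha : a + 3 ≤ c) (hb : b + 3 ≤ c) (hc : c ≤ k + 2) :
    Good 2 k (pull 2 coneInv fun x => (![0, 0, wmon a b c x] : V3)) := by
  obtain ⟨n, rfl⟩ : ∃ n, c = n + 2 := ⟨c - 2, by omega⟩
  have hP : ∀ x : V3, 0 < x 2 → (pull 2 coneInv (fun x => (![0, 0, wmon a b (n + 2) x] : V3)) x : V3) =
      ![hmon (a + 1) b n x, hmon a (b + 1) n x, hmon a b n x] := by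
    intro x hx
    refine (pull_coneInv_two hx.ne' _).trans ?_
    simp only [Matrix.cons_val, wmon_coneInv, hmon_succ, hmon_succ_left, hmon_succ_mid]
    ext r
    fin_cases r <;> simp <;> field_simp
  refine good_two_of hk (fun r => ?_) (fun i => ⟨0, by simp, fun x hx => ?_⟩) ?_
  · fin_cases r
    · exact ⟨_, hmon_mem (a + 1) b n, fun x hx => congrFun (hP x hx) (0 : Fin 3)⟩
    · exact ⟨_, hmon_mem a (b + 1) n, fun x hx => congrFun (hP x hx) (1 : Fin 3)⟩
    · exact ⟨_, hmon_mem a b n, fun x hx => congrFun (hP x hx) (2 : Fin 3)⟩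
  · have h2 := (pos_of_mem_tri hx).ne'
    have h1 := (mem_tri_iff.1 hx).1
    have hj : x (fj i) / x 2 = fe i := by rw [h1]; field_simp
    refine (congrArg (fun v : V3 => v (fj i) - fe i * v 2) (hP x (pos_of_mem_tri hx))).trans ?_
    rw [← hj, hmon_succ_left, hmon_succ_mid]
    fin_cases i <;> simp [fj]
  · refine ⟨basePoly 1 a b, fun i => (degreeOf_basePoly_le _ _ _ _).trans ?_, fun x hx => ?_⟩
    · fin_cases i <;> simp <;> omega
    · refine (congrFun (hP x (pos_of_mem_base hx)) (2 : Fin 3)).trans ?_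
      rw [eval_basePoly, one_mul]
      exact hmon_base hx a b _

theorem natCast_mul_hmon_left (x : V3) (a b c : ℕ) :
    (a : ℝ) * (x 0 / x 2 * hmon (a - 1) b c x) = a * hmon a b c x := by
  rcases a with _ | a
  · simp
  · rw [Nat.add_sub_cancel, hmon_succ_left]

theorem natCast_mul_hmon_mid (x : V3) (a b c : ℕ) :
    (b : ℝ) * (x 1 / x 2 * hmon a (b - 1) c x) = b * hmon a b c x := by
  rcases b with _ | b
  · simp
  · rw [Nat.add_sub_cancel, hmon_succ_mid]

theorem pull_two_fst (a b n : ℕ) {x : V3} (hx : 0 < x 2) :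
    (pull 2 coneInv (fun x => (![0, pd 2 (wmon a b (n + 2)) x, -pd 1 (wmon a b (n + 2)) x] : V3)) x : V3) =
      ![-(b * (x 0 / x 2 * hmon a (b - 1) n x)), (n + 2 - b) * hmon a b n x,
        -(b * hmon a (b - 1) n x)] := by
  have hz := hx.ne'
  refine (pull_coneInv_two hz _).trans ?_
  simp only [Matrix.cons_val, pd_wmon_coneInv hx, hmon_succ]
  rw [sub_mul, ← natCast_mul_hmon_mid]
  ext r
  fin_cases r <;> simp <;> field_simp
  ring

theorem pull_two_snd (a b n : ℕ) {x : V3} (hx : 0 < x 2) :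
    (pull 2 coneInv (fun x => (![-pd 2 (wmon a b (n + 2)) x, 0, pd 0 (wmon a b (n + 2)) x] : V3)) x : V3) =
      ![(a - (n + 2)) * hmon a b n x, a * (x 1 / x 2 * hmon (a - 1) b n x),
        a * hmon (a - 1) b n x] := by
  have hz := hx.ne'
  refine (pull_coneInv_two hz _).trans ?_
  simp only [Matrix.cons_val, pd_wmon_coneInv hx, hmon_succ]
  rw [sub_mul, ← natCast_mul_hmon_left]
  ext r
  fin_cases r <;> simp <;> field_simp
  ring

/-- A multiple of the normal component on a triangular face. -/
def ntr (i : Fin 4) (v : V3) : ℝ := v (fj i) - fe i * v 2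

/-- The normal trace of `pull_two_fst` on a triangular face. -/
theorem trace_two_fst (a b n : ℕ) {i : Fin 4} {x : V3} (hx : x ∈ openFace coneL i.castSucc) :
    ntr i (pull 2 coneInv (fun x => (![0, pd 2 (wmon a b (n + 2)) x, -pd 1 (wmon a b (n + 2)) x] : V3)) x) =
      if fj i = 1 then (n + 2) * hmon a b n x else 0 := by
  have h2 := (pos_of_mem_tri hx).ne'
  have h1 := (mem_tri_iff.1 hx).1
  have hj : x (fj i) / x 2 = fe i := by rw [h1]; field_simp
  have hb := natCast_mul_hmon_mid x a b n
  refine (congrArg (ntr i) (pull_two_fst a b n (pos_of_mem_tri hx))).trans ?_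
  rw [ntr, ← hj]
  fin_cases i <;> simp [fj] <;> first | linear_combination hb | ring

/-- The normal trace of `pull_two_snd` on a triangular face. -/
theorem trace_two_snd (a b n : ℕ) {i : Fin 4} {x : V3} (hx : x ∈ openFace coneL i.castSucc) :
    ntr i (pull 2 coneInv (fun x => (![-pd 2 (wmon a b (n + 2)) x, 0, pd 0 (wmon a b (n + 2)) x] : V3)) x) =
      if fj i = 0 then -((n + 2) * hmon a b n x) else 0 := by
  have h2 := (pos_of_mem_tri hx).ne'
  have h1 := (mem_tri_iff.1 hx).1
  have hj : x (fj i) / x 2 = fe i := by rw [h1]; field_simp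
  have hb := natCast_mul_hmon_left x a b n
  refine (congrArg (ntr i) (pull_two_snd a b n (pos_of_mem_tri hx))).trans ?_
  rw [ntr, ← hj]
  fin_cases i <;> simp [fj] <;> first | linear_combination -hb | ring

/-- By `trace_two_fst` only the two faces with `fj i = 1` see a normal trace. There the exponent of
the free coordinate is `a ≤ n`, which makes the trace a polynomial of degree `n ≤ k - 1`. -/
theorem good_two_fst {a b c k : ℕ} (hk : 1 ≤ k) (ha : a + 2 ≤ c) (hb : b + 1 ≤ c) (hc : c ≤ k + 1) :
    Good 2 k (pull 2 coneInv fun x => (![0, pd 2 (wmon a b c) x, -pd 1 (wmon a b c) x] : V3)) := by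
  obtain ⟨n, rfl⟩ : ∃ n, c = n + 2 := ⟨c - 2, by omega⟩
  refine good_two_of hk (fun r => ?_) (fun i => ?_) ?_
  · fin_cases r
    · rcases b with _ | b
      · exact ⟨0, Submodule.zero_mem _, fun x hx =>
          (congrFun (pull_two_fst a 0 n hx) (0 : Fin 3)).trans (by simp)⟩
      · refine ⟨_, Submodule.smul_mem _ (-(b + 1 : ℝ)) (hmon_mem (a + 1) b n), fun x hx =>
          (congrFun (pull_two_fst a (b + 1) n hx) (0 : Fin 3)).trans ?_⟩
        simp [hmon_succ_left]
        ring
    · exact ⟨_, Submodule.smul_mem _ (n + 2 - b : ℝ) (hmon_mem a b n), fun x hx =>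
        congrFun (pull_two_fst a b n hx) (1 : Fin 3)⟩
    · refine ⟨_, Submodule.smul_mem _ (-b : ℝ) (hmon_mem a (b - 1) n), fun x hx =>
        (congrFun (pull_two_fst a b n hx) (2 : Fin 3)).trans ?_⟩
      simp
  · by_cases hi : fj i = 1
    · have ht : tex i a b = a := by fin_cases i <;> simp [fj, tex] at hi ⊢
      refine ⟨facePoly i ((n + 2) * fe i ^ nex i a b) a (n - a),
        (totalDegree_facePoly_le _ _ _ _).trans (by omega), fun x hx => ?_⟩
      refine (trace_two_fst a b n hx).trans ?_
      rw [if_pos hi, eval_facePoly, hmon_face hx (e := n - a) (by omega), ht]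
      ring
    · refine ⟨0, by simp, fun x hx => (trace_two_fst a b n hx).trans ?_⟩
      rw [if_neg hi]
      simp
  · refine ⟨basePoly (-b) a (b - 1), fun i => (degreeOf_basePoly_le _ _ _ _).trans ?_, fun x hx => ?_⟩
    · fin_cases i <;> simp <;> omega
    · refine (congrFun (pull_two_fst a b n (pos_of_mem_base hx)) (2 : Fin 3)).trans ?_
      rw [eval_basePoly, ← hmon_base hx a (b - 1) n]
      simp

theorem good_two_snd {a b c k : ℕ} (hk : 1 ≤ k) (ha : a + 1 ≤ c) (hb : b + 2 ≤ c) (hc : c ≤ k + 1) :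
    Good 2 k (pull 2 coneInv fun x => (![-pd 2 (wmon a b c) x, 0, pd 0 (wmon a b c) x] : V3)) := by
  obtain ⟨n, rfl⟩ : ∃ n, c = n + 2 := ⟨c - 2, by omega⟩
  refine good_two_of hk (fun r => ?_) (fun i => ?_) ?_
  · fin_cases r
    · exact ⟨_, Submodule.smul_mem _ (a - (n + 2) : ℝ) (hmon_mem a b n), fun x hx =>
        congrFun (pull_two_snd a b n hx) (0 : Fin 3)⟩
    · rcases a with _ | a
      · exact ⟨0, Submodule.zero_mem _, fun x hx =>
          (congrFun (pull_two_snd 0 b n hx) (1 : Fin 3)).trans (by simp)⟩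
      · refine ⟨_, Submodule.smul_mem _ (a + 1 : ℝ) (hmon_mem a (b + 1) n), fun x hx =>
          (congrFun (pull_two_snd (a + 1) b n hx) (1 : Fin 3)).trans ?_⟩
        simp [hmon_succ_mid]
    · exact ⟨_, Submodule.smul_mem _ (a : ℝ) (hmon_mem (a - 1) b n), fun x hx =>
        congrFun (pull_two_snd a b n hx) (2 : Fin 3)⟩
  · by_cases hi : fj i = 0
    · have ht : tex i a b = b := by fin_cases i <;> simp [fj, tex] at hi ⊢
      refine ⟨facePoly i (-((n + 2) * fe i ^ nex i a b)) b (n - b),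
        (totalDegree_facePoly_le _ _ _ _).trans (by omega), fun x hx => ?_⟩
      refine (trace_two_snd a b n hx).trans ?_
      rw [if_pos hi, eval_facePoly, hmon_face hx (e := n - b) (by omega), ht]
      ring
    · refine ⟨0, by simp, fun x hx => (trace_two_snd a b n hx).trans ?_⟩
      rw [if_neg hi]
      simp
  · refine ⟨basePoly a (a - 1) b, fun i => (degreeOf_basePoly_le _ _ _ _).trans ?_, fun x hx => ?_⟩
    · fin_cases i <;> simp <;> omega
    · refine (congrFun (pull_two_snd a b n (pos_of_mem_base hx)) (2 : Fin 3)).trans ?_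
      rw [eval_basePoly, ← hmon_base hx (a - 1) b n]
      rfl

end GeneratorsTwo

theorem differentiableAt_of_mem_weighted {k l m : ℤ} {f : V3 → ℝ} (hf : f ∈ weighted k l m) {x : V3}
    (hx : 1 + x 2 ≠ 0) : DifferentiableAt ℝ f x := by
  rw [weighted_eq] at hf
  induction hf using Submodule.span_induction with
  | mem f hf =>
    obtain ⟨a, b, c, -, -, -, rfl⟩ := hf
    exact differentiableAt_wmon hx a b c
  | zero => exact differentiableAt_const _
  | add f g _ _ h1 h2 => exact h1.add h2
  | smul r f _ h => exact h.const_smul r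

/-- Induction over the generators of a weighted space, for forms obtained by a linear differential
operator. -/
theorem good_of_weighted {s : Fin 3} {n : ℕ} (hn : 1 ≤ n) {k l m : ℤ} {T : (V3 → ℝ) → Form s}
    (hadd : ∀ f ∈ weighted k l m, ∀ g ∈ weighted k l m, ∀ x, 1 + x 2 ≠ 0 → T (f + g) x = T f x + T g x)
    (hsmul : ∀ r : ℝ, ∀ f ∈ weighted k l m, ∀ x, 1 + x 2 ≠ 0 → T (r • f) x = r • T f x)
    (hgen : ∀ a b c : ℕ, (c : ℤ) ≤ k → (a : ℤ) ≤ c + l - k → (b : ℤ) ≤ c + m - k →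
      Good s n (pull s coneInv (T (wmon a b c)))) {f : V3 → ℝ} (hf : f ∈ weighted k l m) :
    Good s n (pull s coneInv (T f)) := by
  have hf' := hf
  rw [weighted_eq] at hf
  have hc : ∀ x : V3, 0 < x 2 → 1 + coneInv x 2 ≠ 0 := fun x hx => one_add_coneInv_ne hx
  induction hf using Submodule.span_induction with
  | mem f hf =>
    obtain ⟨a, b, c, h1, h2, h3, rfl⟩ := hf
    exact hgen a b c h1 h2 h3
  | zero =>
    refine Good.zero.congr fun x hx => ?_
    -- That `T` vanishes at zero is read off from its compatibility with multiplication by the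
    -- scalar zero.
    have h := hsmul 0 0 (Submodule.zero_mem _) (coneInv x) (hc x hx)
    rw [zero_smul, zero_smul] at h
    rw [pull_apply, h]
    simpa using pullM_smul s (jac coneInv x) (0 : ℝ) (0 : Fin (proxyDim s) → ℝ)
  | add f g hf hg h1 h2 =>
    refine ((h1 hf).add hn (h2 hg)).congr fun x hx => ?_
    rw [pull_apply, hadd f hf g hg _ (hc x hx), pullM_add, Pi.add_apply, pull_apply, pull_apply]
  | smul r f hf h =>
    refine ((h hf).smul hn r).congr fun x hx => ?_
    rw [pull_apply, hsmul r f hf _ (hc x hx), pullM_smul, Pi.smul_apply, pull_apply]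

theorem pd_add_of_mem {k l m : ℤ} {f g : V3 → ℝ} (hf : f ∈ weighted k l m) (hg : g ∈ weighted k l m)
    {x : V3} (hx : 1 + x 2 ≠ 0) (i : Fin 3) : pd i (f + g) x = pd i f x + pd i g x :=
  pd_add (differentiableAt_of_mem_weighted hf hx) (differentiableAt_of_mem_weighted hg hx)

theorem pd_smul_of_mem {k l m : ℤ} {f : V3 → ℝ} (hf : f ∈ weighted k l m) (r : ℝ)
    {x : V3} (hx : 1 + x 2 ≠ 0) (i : Fin 3) : pd i (r • f) x = r * pd i f x :=
  pd_const_mul (differentiableAt_of_mem_weighted hf hx)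

theorem curl_horizontal (f g : V3 → ℝ) (x : V3) : curl (fun y => ![f y, g y, 0]) x =
    ![0, pd 2 f x, -pd 1 f x] + ![-pd 2 g x, 0, pd 0 g x] := by
  have h : ∀ i, pd i (fun _ : V3 => (0 : ℝ)) x = 0 := fun i => by simp [pd]
  ext r
  fin_cases r
  · change pd 1 (fun _ : V3 => (0 : ℝ)) x - pd 2 g x = 0 + -pd 2 g x
    rw [h]
    ring
  · change pd 2 f x - pd 0 (fun _ : V3 => (0 : ℝ)) x = pd 2 f x + 0
    rw [h]
    ring
  · change pd 0 g x - pd 1 f x = -pd 1 f x + pd 0 g x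
    ring

theorem good_of_eq_add {s : Fin 3} {k : ℕ} (hk : 1 ≤ k) {f u v : Form s}
    (hu : Good s k (pull s coneInv u)) (hv : Good s k (pull s coneInv v)) (h : ∀ x, f x = u x + v x) :
    Good s k (pull s coneInv f) :=
  (hu.add hk hv).congr fun x _ => by
    rw [Pi.add_apply, pull_apply, pull_apply, pull_apply, ← pullM_add, h]

theorem vec_add (a b c a' b' c' : ℝ) :
    (![a + a', b + b', c + c'] : V3) = ![a, b, c] + ![a', b', c'] := by
  simp

theorem vec_smul (r a b c : ℝ) : (![r * a, r * b, r * c] : V3) = r • ![a, b, c] := by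
  simp

/-- The forms of the approximation space have homogeneous components and polynomial traces. -/
theorem good_of_mem_infSpace {s : Fin 3} {k : ℕ} (hk : 1 ≤ k) {f : Form s} (hf : f ∈ infSpace s k) :
    Good s k (pull s coneInv f) := by
  match s with
  | 0 =>
    obtain ⟨p, hp, h⟩ := hf
    obtain rfl : f = fun x _ => p x := funext h
    refine good_of_weighted (s := 0) (T := fun p => (fun x _ => p x : V3 → Fin 1 → ℝ)) hk
      (fun f _ g _ x _ => rfl) (fun r f _ x _ => rfl) (fun a b c h1 h2 h3 => ?_) hp
    exact good_zero_mon (by omega) (by omega) (by omega)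
  | 1 =>
    obtain ⟨f', hf', g, hg, p, hp, h⟩ := hf
    have e1 := good_of_weighted (T := fun p => (fun x => ![p x, 0, 0] : V3 → V3)) (s := 1) hk
      (fun f _ g _ x _ => .trans (by simp; rfl) (vec_add (f x) 0 0 (g x) 0 0))
      (fun r f _ x _ => .trans (by simp; rfl) (vec_smul r (f x) 0 0))
      (fun a b c h1 h2 h3 => good_one_fst hk (by omega) (by omega) (by omega)) hf'
    have e2 := good_of_weighted (T := fun p => (fun x => ![0, p x, 0] : V3 → V3)) (s := 1) hk
      (fun f _ g _ x _ => .trans (by simp; rfl) (vec_add 0 (f x) 0 0 (g x) 0))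
      (fun r f _ x _ => .trans (by simp; rfl) (vec_smul r 0 (f x) 0))
      (fun a b c h1 h2 h3 => good_one_snd hk (by omega) (by omega) (by omega)) hg
    have e3 := good_of_weighted (T := fun p => grad p) (s := 1) hk
      (fun f hf g hg x hx => funext fun i => pd_add_of_mem hf hg hx i)
      (fun r f hf x hx => funext fun i => pd_smul_of_mem hf r hx i)
      (fun a b c h1 h2 h3 => good_one_grad hk (by omega) (by omega) (by omega)) hp
    have e4 := good_of_eq_add (s := 1) (f := fun x => (![f' x, g x, 0] : V3)) hk e1 e2
      fun x => .trans (by simp; rfl) (vec_add (f' x) 0 0 0 (g x) 0)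
    exact good_of_eq_add hk e4 e3 h
  | 2 =>
    obtain ⟨h', hh', f', hf', g, hg, h⟩ := hf
    have e1 := good_of_weighted (T := fun p => (fun x => ![0, 0, p x] : V3 → V3)) (s := 2) hk
      (fun f _ g _ x _ => .trans (by simp; rfl) (vec_add 0 0 (f x) 0 0 (g x)))
      (fun r f _ x _ => .trans (by simp; rfl) (vec_smul r 0 0 (f x)))
      (fun a b c h1 h2 h3 => good_two_thd hk (by omega) (by omega) (by omega)) hh'
    have e2 := good_of_weighted (T := fun p => (fun x => ![0, pd 2 p x, -pd 1 p x] : V3 → V3)) (s := 2)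
      hk (fun f hf g hg x hx => .trans (by
          simp only [pd_add_of_mem hf hg hx, zero_add, neg_add]; rfl)
        (vec_add 0 (pd 2 f x) (-pd 1 f x) 0 (pd 2 g x) (-pd 1 g x)))
      (fun r f hf x hx => .trans (by simp only [pd_smul_of_mem hf r hx, mul_zero, mul_neg]; rfl)
        (vec_smul r 0 (pd 2 f x) (-pd 1 f x)))
      (fun a b c h1 h2 h3 => good_two_fst hk (by omega) (by omega) (by omega)) hf'
    have e3 := good_of_weighted (T := fun p => (fun x => ![-pd 2 p x, 0, pd 0 p x] : V3 → V3)) (s := 2)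
      hk (fun f hf g hg x hx => .trans (by
          simp only [pd_add_of_mem hf hg hx, zero_add, neg_add]; rfl)
        (vec_add (-pd 2 f x) 0 (pd 0 f x) (-pd 2 g x) 0 (pd 0 g x)))
      (fun r f hf x hx => .trans (by simp only [pd_smul_of_mem hf r hx, mul_zero, mul_neg]; rfl)
        (vec_smul r (-pd 2 f x) 0 (pd 0 f x)))
      (fun a b c h1 h2 h3 => good_two_snd hk (by omega) (by omega) (by omega)) hg
    exact good_of_eq_add hk e1 (good_of_eq_add (s := 2) (f := curl fun y => ![f' y, g y, 0]) hk e2 e3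
      (curl_horizontal f' g)) h

/-- The spaces on the infinite pyramid are linear. -/
theorem infSpace_add_smul {s : Fin 3} {k : ℕ} {f g : Form s} (hf : f ∈ infSpace s k)
    (hg : g ∈ infSpace s k) (c : ℝ) : ∃ h ∈ infSpace s k, ∀ x, 1 + x 2 ≠ 0 → h x = f x + c • g x := by
  match s with
  | 0 =>
    obtain ⟨p, hp, h⟩ := hf
    obtain ⟨p', hp', h'⟩ := hg
    refine ⟨fun x _ => (p + c • p') x, ⟨_, Submodule.add_mem _ hp (Submodule.smul_mem _ c hp'),
      fun _ => rfl⟩, fun x _ => ?_⟩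
    rw [h, h']
    rfl
  | 1 =>
    obtain ⟨f₁, hf₁, g₁, hg₁, p₁, hp₁, h₁⟩ := hf
    obtain ⟨f₂, hf₂, g₂, hg₂, p₂, hp₂, h₂⟩ := hg
    refine ⟨fun x => (![(f₁ + c • f₂) x, (g₁ + c • g₂) x, 0] + grad (p₁ + c • p₂) x : V3),
      ⟨_, Submodule.add_mem _ hf₁ (Submodule.smul_mem _ c hf₂),
        _, Submodule.add_mem _ hg₁ (Submodule.smul_mem _ c hg₂),
        _, Submodule.add_mem _ hp₁ (Submodule.smul_mem _ c hp₂), fun _ => rfl⟩, fun x hx => ?_⟩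
    rw [h₁, h₂]
    refine funext fun (i : Fin 3) => ?_
    change ![(f₁ + c • f₂) x, (g₁ + c • g₂) x, 0] i + pd i (p₁ + c • p₂) x =
      ![f₁ x, g₁ x, 0] i + pd i p₁ x + c * (![f₂ x, g₂ x, 0] i + pd i p₂ x)
    rw [pd_add_of_mem hp₁ (Submodule.smul_mem _ c hp₂) hx, pd_smul_of_mem hp₂ c hx]
    fin_cases i <;> simp <;> ring
  | 2 =>
    obtain ⟨d₁, hd₁, f₁, hf₁, g₁, hg₁, h₁⟩ := hf
    obtain ⟨d₂, hd₂, f₂, hf₂, g₂, hg₂, h₂⟩ := hg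
    refine ⟨fun x => (![0, 0, (d₁ + c • d₂) x] +
      curl (fun y => ![(f₁ + c • f₂) y, (g₁ + c • g₂) y, 0]) x : V3),
      ⟨_, Submodule.add_mem _ hd₁ (Submodule.smul_mem _ c hd₂),
        _, Submodule.add_mem _ hf₁ (Submodule.smul_mem _ c hf₂),
        _, Submodule.add_mem _ hg₁ (Submodule.smul_mem _ c hg₂), fun _ => rfl⟩, fun x hx => ?_⟩
    have key : (![0, 0, (d₁ + c • d₂) x] + curl (fun y => ![(f₁ + c • f₂) y, (g₁ + c • g₂) y, 0]) x : V3) =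
        ![0, 0, d₁ x] + curl (fun y => ![f₁ y, g₁ y, 0]) x +
          c • (![0, 0, d₂ x] + curl (fun y => ![f₂ y, g₂ y, 0]) x) := by
      rw [curl_horizontal, curl_horizontal, curl_horizontal]
      simp only [pd_add_of_mem hf₁ (Submodule.smul_mem _ c hf₂) hx, pd_smul_of_mem hf₂ c hx,
        pd_add_of_mem hg₁ (Submodule.smul_mem _ c hg₂) hx, pd_smul_of_mem hg₂ c hx]
      ext i
      fin_cases i <;> simp <;> ring
    rw [h₁, h₂]
    exact key

theorem zero_mem_infSpace (s : Fin 3) (k : ℕ) : (0 : Form s) ∈ infSpace s k := by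
  match s with
  | 0 => exact ⟨0, Submodule.zero_mem _, fun _ => rfl⟩
  | 1 =>
    refine ⟨0, Submodule.zero_mem _, 0, Submodule.zero_mem _, 0, Submodule.zero_mem _, fun x =>
      funext fun (i : Fin 3) => ?_⟩
    change 0 = ![(0 : ℝ), 0, 0] i + pd i (fun _ => 0) x
    fin_cases i <;> simp [pd]
  | 2 =>
    refine ⟨0, Submodule.zero_mem _, 0, Submodule.zero_mem _, 0, Submodule.zero_mem _, fun x => ?_⟩
    rw [curl_horizontal]
    refine funext fun (i : Fin 3) => ?_
    change 0 = ![(0 : ℝ), 0, 0] i + (![0, pd 2 (fun _ => 0) x, -pd 1 (fun _ => 0) x] i +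
      ![-pd 2 (fun _ => 0) x, 0, pd 0 (fun _ => 0) x] i)
    fin_cases i <;> simp [pd]

/-! ### Interpolation of scalar polynomials given on the triangular faces -/

section ScalarLift

open MvPolynomial

/-- The span of the weighted monomials without the constants. -/
def weightedPos (k : ℕ) : Submodule ℝ (V3 → ℝ) :=
  Submodule.span ℝ {f | ∃ a b c : ℕ, 1 ≤ c ∧ c ≤ k ∧ a ≤ c ∧ b ≤ c ∧ f = wmon a b c}

theorem weightedPos_le (k : ℕ) : weightedPos k ≤ weighted k k k := by
  refine Submodule.span_le.2 ?_
  rintro f ⟨a, b, c, -, h2, h3, h4, rfl⟩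
  exact wmon_mem (by omega) (by omega) (by omega)

/-- The inverse of the Euler operator in homogeneous coordinates. -/
theorem exists_euler {k : ℕ} {p : V3 → ℝ} (hp : p ∈ weightedPos k) : ∃ p' ∈ weighted k k k,
    ∀ x : V3, 0 < x 2 → -(pd 2 p' (coneInv x) / x 2) = p (coneInv x) := by
  induction hp using Submodule.span_induction with
  | mem f hf =>
    obtain ⟨a, b, c, h1, h2, h3, h4, rfl⟩ := hf
    have hm : wmon a b c ∈ weighted k k k := wmon_mem (by omega) (by omega) (by omega)
    -- The third derivative of `wmon a b c` carries the factor `-c`, which can be divided out as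
    -- constants are excluded.
    refine ⟨(c : ℝ)⁻¹ • wmon a b c, Submodule.smul_mem _ _ hm, fun x hx => ?_⟩
    have hc : (c : ℝ) ≠ 0 := by
      have : c ≠ 0 := by omega
      exact_mod_cast this
    rw [pd_smul_of_mem hm _ (one_add_coneInv_ne hx), pd_wmon_coneInv hx, wmon_coneInv]
    simp only [Matrix.cons_val, hmon_succ]
    field_simp
  | zero =>
    refine ⟨0, Submodule.zero_mem _, fun x hx => ?_⟩
    have := pd_smul_of_mem (Submodule.zero_mem (weighted k k k)) 0 (one_add_coneInv_ne hx) 2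
    rw [zero_smul, zero_mul] at this
    rw [this]
    simp
  | add f g _ _ hf hg =>
    obtain ⟨p, hp, h⟩ := hf
    obtain ⟨p', hp', h'⟩ := hg
    refine ⟨p + p', Submodule.add_mem _ hp hp', fun x hx => ?_⟩
    rw [pd_add_of_mem hp hp' (one_add_coneInv_ne hx), Pi.add_apply, ← h x hx, ← h' x hx]
    ring
  | smul r f _ hf =>
    obtain ⟨p, hp, h⟩ := hf
    refine ⟨r • p, Submodule.smul_mem _ r hp, fun x hx => ?_⟩
    rw [pd_smul_of_mem hp r (one_add_coneInv_ne hx), Pi.smul_apply, ← h x hx, smul_eq_mul]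
    ring

theorem sum_le_totalDegree {q : MvPolynomial (Fin 3) ℝ} {d : Fin 3 →₀ ℕ} (hd : d ∈ q.support) :
    d 0 + d 1 + d 2 ≤ q.totalDegree := by
  have h := le_totalDegree hd
  rwa [Finsupp.sum_fintype _ _ (fun _ => rfl), Fin.sum_univ_three] at h

/-- Each variable is replaced by a monomial with exactly one factor `1 / (1 + y 2)`, so the degree
of a term becomes its weight `c`. The hypotheses `hA` and `hB` keep the other exponents, including
those of the blending factors, below this weight. -/
theorem eval_weightedPos_mem {k : ℕ} {q : MvPolynomial (Fin 3) ℝ} (hq : q.totalDegree ≤ k)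
    (h0 : coeff 0 q = 0) (r : Fin 3 → ℝ) (A B : Fin 3 → ℕ) (α β : ℕ)
    (hA : ∀ d : Fin 3 →₀ ℕ, 1 ≤ d 0 + d 1 + d 2 →
      α + (A 0 * d 0 + A 1 * d 1 + A 2 * d 2) ≤ d 0 + d 1 + d 2)
    (hB : ∀ d : Fin 3 →₀ ℕ, 1 ≤ d 0 + d 1 + d 2 →
      β + (B 0 * d 0 + B 1 * d 1 + B 2 * d 2) ≤ d 0 + d 1 + d 2) :
    (fun y : V3 => y 0 ^ α * y 1 ^ β *
      eval (fun j => r j * y 0 ^ A j * y 1 ^ B j * (1 / (1 + y 2))) q) ∈ weightedPos k := by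
  have e : (fun y : V3 => y 0 ^ α * y 1 ^ β *
      eval (fun j => r j * y 0 ^ A j * y 1 ^ B j * (1 / (1 + y 2))) q) =
      ∑ d ∈ q.support, (coeff d q * (r 0 ^ d 0 * r 1 ^ d 1 * r 2 ^ d 2)) •
        wmon (α + (A 0 * d 0 + A 1 * d 1 + A 2 * d 2)) (β + (B 0 * d 0 + B 1 * d 1 + B 2 * d 2))
          (d 0 + d 1 + d 2) := by
    ext y
    rw [eval_eq', Finset.mul_sum, Finset.sum_apply]
    refine Finset.sum_congr rfl fun d _ => ?_
    rw [Fin.prod_univ_three, Pi.smul_apply, smul_eq_mul, wmon]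
    simp only [mul_pow, ← pow_mul, pow_add, one_div, inv_pow]
    ring
  rw [e]
  refine Submodule.sum_mem _ fun d hd => Submodule.smul_mem _ _ (Submodule.subset_span ?_)
  have h1 : 1 ≤ d 0 + d 1 + d 2 := by
    by_contra h
    have hd0 : d = 0 := by
      ext j
      fin_cases j <;> simp <;> omega
    rw [hd0, mem_support_iff] at hd
    exact hd h0
  exact ⟨_, _, _, h1, (sum_le_totalDegree hd).trans hq, hA d h1, hB d h1, rfl⟩

/-- The vertices of the base. -/
def corner : Fin 4 → V3 := ![![1, 0, 1], ![1, 1, 1], ![0, 1, 1], ![0, 0, 1]]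

theorem corner_weightedPos_mem {k : ℕ} {q : MvPolynomial (Fin 3) ℝ} (hq : q.totalDegree ≤ k)
    (h0 : coeff 0 q = 0) (m : Fin 4) {α β : ℕ} (hα : α ≤ 1) (hβ : β ≤ 1) :
    (fun y : V3 => y 0 ^ α * y 1 ^ β * eval ((1 / (1 + y 2)) • corner m) q) ∈ weightedPos k := by
  have := eval_weightedPos_mem hq h0 (corner m) 0 0 α β
    (fun d h => by simp only [Pi.zero_apply]; omega) (fun d h => by simp only [Pi.zero_apply]; omega)
  convert this using 5 with y
  ext j
  simp
  ring

theorem face_weightedPos_mem {k : ℕ} {q : MvPolynomial (Fin 3) ℝ} (hq : q.totalDegree ≤ k)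
    (h0 : coeff 0 q = 0) (i : Fin 4) {β : ℕ} (hβ : β ≤ 1) :
    (fun y : V3 => y (fj i) ^ β *
      eval (facePt i (y (fo i) * (1 / (1 + y 2))) (1 / (1 + y 2))) q) ∈ weightedPos k := by
  fin_cases i
  · have := eval_weightedPos_mem hq h0 ![1, 0, 1] ![1, 0, 0] 0 0 β (fun d h => by simp; omega)
      (fun d h => by simp; omega)
    convert this using 5 with y
    · simp [fj]
    · ext j
      fin_cases j <;> simp [facePt, fo]
  · have := eval_weightedPos_mem hq h0 ![1, 1, 1] 0 ![0, 1, 0] β 0 (fun d h => by simp; omega)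
      (fun d h => by simp; omega)
    convert this using 5 with y
    · simp [fj]
    · ext j
      fin_cases j <;> simp [facePt, fo]
  · have := eval_weightedPos_mem hq h0 ![1, 1, 1] ![1, 0, 0] 0 0 β (fun d h => by simp; omega)
      (fun d h => by simp; omega)
    convert this using 5 with y
    · simp [fj]
    · ext j
      fin_cases j <;> simp [facePt, fo]
  · have := eval_weightedPos_mem hq h0 ![0, 1, 1] 0 ![0, 1, 0] β 0 (fun d h => by simp; omega)
      (fun d h => by simp; omega)
    convert this using 5 with y
    · simp [fj]
    · ext j
      fin_cases j <;> simp [facePt, fo]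

/-- Transfinite interpolation: polynomials on the triangular faces which agree on the common edges
have a common extension. -/
theorem exists_scalar_lift {k : ℕ} {χ : Fin 4 → MvPolynomial (Fin 3) ℝ}
    (hχ : ∀ i, (χ i).totalDegree ≤ k) (h0 : ∀ i, coeff 0 (χ i) = 0)
    (hedge : ∀ m : Fin 4, ∀ z : ℝ, 0 < z → z < 1 →
      eval (z • corner m) (χ m) = eval (z • corner m) (χ (m + 1))) :
    ∃ p ∈ weightedPos k, ∀ i : Fin 4, ∀ x ∈ openFace coneL i.castSucc,
      p (coneInv x) = eval x (χ i) := by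
  set F : Fin 4 → V3 → ℝ := fun i y =>
    eval (facePt i (y (fo i) * (1 / (1 + y 2))) (1 / (1 + y 2))) (χ i) with hF
  set E : Fin 4 → V3 → ℝ := fun m y => eval ((1 / (1 + y 2)) • corner m) (χ m) with hE
  have hF' := fun (i : Fin 4) (β : ℕ) (hβ : β ≤ 1) => face_weightedPos_mem (hχ i) (h0 i) i hβ
  have hE' := fun (i : Fin 4) (α β : ℕ) (hα : α ≤ 1) (hβ : β ≤ 1) =>
    corner_weightedPos_mem (hχ i) (h0 i) i hα hβ
  -- The Coons patch over the square cross section: linear blending between opposite faces minus the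
  -- bilinear interpolation of the four edges. Blending raises an exponent in the transversal
  -- variable to one, which the weighted space permits only for terms with `c ≥ 1`.
  refine ⟨fun y => (1 - y 1) * F 0 y + y 0 * F 1 y + y 1 * F 2 y + (1 - y 0) * F 3 y -
    (y 0 * (1 - y 1) * E 0 y + y 0 * y 1 * E 1 y + (1 - y 0) * y 1 * E 2 y +
      (1 - y 0) * (1 - y 1) * E 3 y), ?_, fun i x hx => ?_⟩
  · have hm := Submodule.sub_mem _ (Submodule.add_mem _ (Submodule.add_mem _ (Submodule.add_mem _
      (Submodule.sub_mem _ (hF' 0 0 (by simp)) (hF' 0 1 (by simp))) (hF' 1 1 (by simp)))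
      (hF' 2 1 (by simp))) (Submodule.sub_mem _ (hF' 3 0 (by simp)) (hF' 3 1 (by simp))))
      (Submodule.add_mem _ (Submodule.add_mem _ (Submodule.add_mem _
        (Submodule.sub_mem _ (hE' 0 1 0 (by simp) (by simp)) (hE' 0 1 1 (by simp) (by simp)))
        (hE' 1 1 1 (by simp) (by simp)))
        (Submodule.sub_mem _ (hE' 2 0 1 (by simp) (by simp)) (hE' 2 1 1 (by simp) (by simp))))
        (Submodule.sub_mem _ (Submodule.sub_mem _ (hE' 3 0 0 (by simp) (by simp))
          (hE' 3 1 0 (by simp) (by simp))) (Submodule.sub_mem _ (hE' 3 0 1 (by simp) (by simp))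
          (hE' 3 1 1 (by simp) (by simp)))))
    convert hm using 1
    ext y
    simp only [Pi.add_apply, Pi.sub_apply, pow_zero, pow_one, hF, hE]
    simp only [fj, Matrix.cons_val]
    ring
  · have hz := pos_of_mem_tri hx
    obtain ⟨hx1, h1, h2, h3⟩ := mem_tri_iff.1 hx
    have e1 : 1 / (1 + coneInv x 2) = x 2 := by rw [one_add_coneInv]; simp
    have eF : ∀ j, F j (coneInv x) = eval (facePt j (x (fo j)) (x 2)) (χ j) := by
      intro j
      have e2 : coneInv x (fo j) * x 2 = x (fo j) := by
        have : coneInv x (fo j) = x (fo j) / x 2 := by fin_cases j <;> simp [fo, coneInv]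
        rw [this]
        field_simp
      simp only [hF, e1, e2]
    have eE : ∀ j, E j (coneInv x) = eval (x 2 • corner j) (χ j) := by
      intro j
      simp only [hE, e1]
    have hi : F i (coneInv x) = eval x (χ i) := by
      rw [eF, ← facePt_eq hx1]
    have hed := fun m => hedge m (x 2) hz h3
    change (1 - x 1 / x 2) * F 0 (coneInv x) + x 0 / x 2 * F 1 (coneInv x) +
      x 1 / x 2 * F 2 (coneInv x) + (1 - x 0 / x 2) * F 3 (coneInv x) -
      (x 0 / x 2 * (1 - x 1 / x 2) * E 0 (coneInv x) + x 0 / x 2 * (x 1 / x 2) * E 1 (coneInv x) +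
        (1 - x 0 / x 2) * (x 1 / x 2) * E 2 (coneInv x) +
        (1 - x 0 / x 2) * (1 - x 1 / x 2) * E 3 (coneInv x)) = _
    have hj : x (fj i) / x 2 = fe i := by rw [hx1]; field_simp
    rw [← hi]
    -- On a given face the extensions from its two adjacent faces reduce to the values on the common
    -- edges, where they cancel against the bilinear terms.
    have c00 : x 1 = 0 → facePt 1 (x 1) (x 2) = x 2 • corner 0 := fun h => by
      ext j; fin_cases j <;> simp [facePt, corner, h]
    have c01 : x 1 = 0 → facePt 3 (x 1) (x 2) = x 2 • corner 3 := fun h => by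
      ext j; fin_cases j <;> simp [facePt, corner, h]
    have c10 : x 0 = x 2 → facePt 0 (x 0) (x 2) = x 2 • corner 0 := fun h => by
      ext j; fin_cases j <;> simp [facePt, corner, h]
    have c11 : x 0 = x 2 → facePt 2 (x 0) (x 2) = x 2 • corner 1 := fun h => by
      ext j; fin_cases j <;> simp [facePt, corner, h]
    have c20 : x 1 = x 2 → facePt 1 (x 1) (x 2) = x 2 • corner 1 := fun h => by
      ext j; fin_cases j <;> simp [facePt, corner, h]
    have c21 : x 1 = x 2 → facePt 3 (x 1) (x 2) = x 2 • corner 2 := fun h => by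
      ext j; fin_cases j <;> simp [facePt, corner, h]
    have c30 : x 0 = 0 → facePt 0 (x 0) (x 2) = x 2 • corner 3 := fun h => by
      ext j; fin_cases j <;> simp [facePt, corner, h]
    have c31 : x 0 = 0 → facePt 2 (x 0) (x 2) = x 2 • corner 2 := fun h => by
      ext j; fin_cases j <;> simp [facePt, corner, h]
    have hed0 := hed 0
    have hed1 := hed 1
    have hed2 := hed 2
    have hed3 := hed 3
    simp only [Fin.reduceAdd, zero_add] at hed0 hed1 hed2 hed3
    have g0 := eF 0
    have g1 := eF 1
    have g2 := eF 2
    have g3 := eF 3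
    simp only [fo, Matrix.cons_val] at g0 g1 g2 g3
    have k0 := eE 0
    have k1 := eE 1
    have k2 := eE 2
    have k3 := eE 3
    fin_cases i
    · simp only [fj, fe, Fin.zero_eta, Matrix.cons_val] at hj hx1 ⊢
      rw [zero_mul] at hx1
      rw [c00 hx1, ← hed0, ← k0] at g1
      rw [c01 hx1, ← k3] at g3
      rw [hj, g1, g3]
      ring
    · simp only [fj, fe, Matrix.cons_val, Fin.mk_one] at hj hx1 ⊢
      rw [one_mul] at hx1
      rw [c10 hx1, ← k0] at g0
      rw [c11 hx1, ← hed1, ← k1] at g2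
      rw [hj, g0, g2]
      ring
    · simp only [fj, fe, Fin.reduceFinMk, Matrix.cons_val] at hj hx1 ⊢
      rw [one_mul] at hx1
      rw [c20 hx1, ← k1] at g1
      rw [c21 hx1, ← hed2, ← k2] at g3
      rw [hj, g1, g3]
      ring
    · simp only [fj, fe, Fin.reduceFinMk, Matrix.cons_val] at hj hx1 ⊢
      rw [zero_mul] at hx1
      rw [c30 hx1, ← hed3, ← k3] at g0
      rw [c31 hx1, ← k2] at g2
      rw [hj, g0, g2]
      ring

end ScalarLift

/-! ### Edge traces, and the linear structure of the attainable traces -/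

/-- The trace of a form on an edge of direction `d`. -/
def tang : (s : Fin 3) → V3 → (Fin (proxyDim s) → ℝ) → ℝ
  | 0 => fun _ (u : Fin 1 → ℝ) => u 0
  | 1 => fun d (u : V3) => d ⬝ᵥ u
  | 2 => fun _ _ => 0

theorem exists_pull_add_smul {s : Fin 3} {k : ℕ} {f g : Form s} (hf : f ∈ infSpace s k)
    (hg : g ∈ infSpace s k) (c : ℝ) : ∃ h ∈ infSpace s k, ∀ x : V3, 0 < x 2 →
      pull s coneInv h x = pull s coneInv f x + c • pull s coneInv g x := by
  obtain ⟨h, hh, e⟩ := infSpace_add_smul hf hg c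
  refine ⟨h, hh, fun x hx => ?_⟩
  rw [pull_apply, pull_apply, pull_apply, e _ (one_add_coneInv_ne hx), pullM_add, pullM_smul]

section Attain

variable {E : Type*} {s : Fin 3} {k : ℕ} {Λ : Fin 4 → V3 → (Fin (proxyDim s) → ℝ) → E}

/-- The values `τ` of the trace `Λ` on the triangular faces are attained. -/
def Attain (s : Fin 3) (k : ℕ) (Λ : Fin 4 → V3 → (Fin (proxyDim s) → ℝ) → E)
    (τ : Fin 4 → V3 → E) : Prop :=
  ∃ f ∈ infSpace s k, ∀ i : Fin 4, ∀ x ∈ openFace coneL i.castSucc,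
    Λ i x (pull s coneInv f x) = τ i x

theorem Attain.congr {τ τ' : Fin 4 → V3 → E} (h : Attain s k Λ τ)
    (e : ∀ i : Fin 4, ∀ x ∈ openFace coneL i.castSucc, τ i x = τ' i x) : Attain s k Λ τ' := by
  obtain ⟨f, hf, h⟩ := h
  exact ⟨f, hf, fun i x hx => (h i x hx).trans (e i x hx)⟩

variable [AddCommGroup E] [Module ℝ E]

theorem Attain.add_smul (hΛ : ∀ i x u v (c : ℝ), Λ i x (u + c • v) = Λ i x u + c • Λ i x v)
    {τ τ' : Fin 4 → V3 → E} (h : Attain s k Λ τ) (h' : Attain s k Λ τ') (c : ℝ) :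
    Attain s k Λ (fun i x => τ i x + c • τ' i x) := by
  obtain ⟨f, hf, h⟩ := h
  obtain ⟨g, hg, h'⟩ := h'
  obtain ⟨p, hp, e⟩ := exists_pull_add_smul hf hg c
  refine ⟨p, hp, fun i x hx => ?_⟩
  rw [e x (pos_of_mem_tri hx), hΛ, h i x hx, h' i x hx]

theorem Attain.zero (hΛ : ∀ i x u v (c : ℝ), Λ i x (u + c • v) = Λ i x u + c • Λ i x v) :
    Attain s k Λ (fun _ _ => 0) := by
  refine ⟨0, zero_mem_infSpace s k, fun i x _ => ?_⟩
  have h1 : pull s coneInv (0 : Form s) x = 0 := by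
    rw [pull_apply]
    simpa using pullM_smul s (jac coneInv x) (0 : ℝ) (0 : Fin (proxyDim s) → ℝ)
  -- With this scalar the linearity hypothesis reads `Λ 0 = Λ 0 - Λ 0`.
  have h2 := hΛ i x 0 0 (-1)
  rw [h1]
  simpa using h2

theorem Attain.sum (hΛ : ∀ i x u v (c : ℝ), Λ i x (u + c • v) = Λ i x u + c • Λ i x v)
    {ι : Type*} (t : Finset ι) {c : ι → ℝ} {τ : ι → Fin 4 → V3 → E}
    (h : ∀ j ∈ t, Attain s k Λ (τ j)) : Attain s k Λ (fun i x => ∑ j ∈ t, c j • τ j i x) := by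
  classical
  induction t using Finset.induction_on with
  | empty => exact (Attain.zero hΛ).congr fun i x _ => by simp
  | insert a t ha ih =>
    refine ((ih fun j hj => h j (Finset.mem_insert_of_mem hj)).add_smul hΛ
      (h a (Finset.mem_insert_self a t)) (c a)).congr fun i x _ => ?_
    rw [Finset.sum_insert ha, add_comm]

end Attain

/-! ### Monomials on the triangular faces -/

section FaceExpansion

open MvPolynomial

/-- The expansion of a polynomial on a triangular face. -/
theorem eval_face (q : MvPolynomial (Fin 3) ℝ) {i : Fin 4} {x : V3} (hx : x (fj i) = fe i * x 2) :
    eval x q = ∑ d ∈ q.support, (coeff d q * fe i ^ d (fj i)) *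
      (x (fo i) ^ d (fo i) * x 2 ^ (d (fj i) + d 2)) := by
  rw [eval_eq']
  refine Finset.sum_congr rfl fun d _ => ?_
  have : ∏ j, x j ^ d j = x (fj i) ^ d (fj i) * x (fo i) ^ d (fo i) * x 2 ^ d 2 := by
    rw [Fin.prod_univ_three]
    fin_cases i <;> simp only [fj, fo, Matrix.cons_val, Fin.zero_eta, Fin.mk_one, Fin.reduceFinMk] <;> ring
  rw [this, hx, mul_pow, pow_add]
  ring

theorem face_degree_le {q : MvPolynomial (Fin 3) ℝ} {d : Fin 3 →₀ ℕ} (hd : d ∈ q.support)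
    (i : Fin 4) : d (fo i) + (d (fj i) + d 2) ≤ q.totalDegree := by
  have := sum_le_totalDegree hd
  fin_cases i <;> simp [fj, fo] <;> omega

/-- The coefficients of the linear function which is `1` at `fe i` and `0` at `1 - fe i`. -/
theorem blend {i j : Fin 4} (h : fj j = fj i) :
    (1 - fe i) + (2 * fe i - 1) * fe j = if j = i then 1 else 0 := by
  fin_cases i <;> fin_cases j <;> simp [fj, fe] at h ⊢
  all_goals norm_num

/-! ### Forms with given traces on the triangular faces -/

/-- The normal trace on the triangular faces. -/
def normalTr (i : Fin 4) (_ : V3) (u : Fin (proxyDim (2 : Fin 3)) → ℝ) : ℝ := ntr i u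

theorem normalTr_add_smul (i : Fin 4) (x : V3) (u v : Fin (proxyDim (2 : Fin 3)) → ℝ) (c : ℝ) :
    normalTr i x (u + c • v) = normalTr i x u + c • normalTr i x v := by
  have : ∀ u v : V3, ntr i (u + c • v) = ntr i u + c • ntr i v := by
    intro u v
    simp [ntr]
    ring
  exact this u v

theorem attain_two_fst {a b n k : ℕ} (ha : a ≤ n) (hb : b ≤ n + 1) (hn : n + 1 ≤ k) :
    Attain 2 k normalTr (fun i x => if fj i = 1 then (n + 2) * hmon a b n x else 0) := by
  refine ⟨fun x => (![0, 0, 0] + curl (fun y => ![wmon a b (n + 2) y, 0, 0]) x : V3),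
    ⟨0, Submodule.zero_mem _, wmon a b (n + 2), wmon_mem (by push_cast; omega) (by push_cast; omega)
      (by push_cast; omega), 0, Submodule.zero_mem _, fun _ => rfl⟩, fun i x hx => ?_⟩
  refine Eq.trans ?_ (trace_two_fst a b n hx)
  refine congrArg (fun f : V3 → V3 => ntr i (pull 2 coneInv f x)) (funext fun y => ?_)
  have h := curl_horizontal (wmon a b (n + 2)) 0 y
  refine (congrArg (![0, 0, 0] + ·) h).trans ?_
  have h0 : ∀ i, pd i 0 y = 0 := fun i => by
    change pd i (fun _ => 0) y = 0
    simp [pd]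
  simp [h0]

theorem attain_two_snd {a b n k : ℕ} (ha : a ≤ n + 1) (hb : b ≤ n) (hn : n + 1 ≤ k) :
    Attain 2 k normalTr (fun i x => if fj i = 0 then -((n + 2) * hmon a b n x) else 0) := by
  refine ⟨fun x => (![0, 0, 0] + curl (fun y => ![0, wmon a b (n + 2) y, 0]) x : V3),
    ⟨0, Submodule.zero_mem _, 0, Submodule.zero_mem _, wmon a b (n + 2), wmon_mem (by push_cast; omega)
      (by push_cast; omega) (by push_cast; omega), fun _ => rfl⟩, fun i x hx => ?_⟩
  refine Eq.trans ?_ (trace_two_snd a b n hx)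
  refine congrArg (fun f : V3 → V3 => ntr i (pull 2 coneInv f x)) (funext fun y => ?_)
  have h := curl_horizontal 0 (wmon a b (n + 2)) y
  refine (congrArg (![0, 0, 0] + ·) h).trans ?_
  have h0 : ∀ i, pd i 0 y = 0 := fun i => by
    change pd i (fun _ => 0) y = 0
    simp [pd]
  simp [h0]

/-- Combining the generators with `b = 0` and `b = 1` (or `a = 0` and `a = 1`) as in `blend` gives a
factor that is one on the face `i` and zero on the opposite face. The other pair of faces has zero
trace anyway. -/
theorem attain_two_mon {k t e : ℕ} (h : t + e + 1 ≤ k) (i : Fin 4) :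
    Attain 2 k normalTr
      (fun j x => if j = i then x (fo i) ^ t * x 2 ^ e else 0) := by
  have hc : ((t + e : ℕ) : ℝ) + 2 ≠ 0 := by positivity
  have hΛ := normalTr_add_smul
  by_cases hi : fj i = 1
  · have hfo : fo i = 0 := by fin_cases i <;> simp [fj, fo] at hi ⊢
    have h1 := ((Attain.zero hΛ).add_smul hΛ (attain_two_fst (a := t) (b := 0) (n := t + e) (k := k)
      (by omega) (by omega) h) ((1 - fe i) / ((t + e : ℕ) + 2))).add_smul hΛ (attain_two_fst (a := t)
      (b := 1) (n := t + e) (k := k) (by omega) (by omega) h) ((2 * fe i - 1) / ((t + e : ℕ) + 2))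
    refine h1.congr fun j x hx => ?_
    by_cases hj : fj j = 1
    · have ht : ∀ b, tex j t b = t := fun b => by fin_cases j <;> simp [fj, tex] at hj ⊢
      have hn : ∀ b, nex j t b = b := fun b => by fin_cases j <;> simp [fj, nex] at hj ⊢
      have hfj : fo j = 0 := by fin_cases j <;> simp [fj, fo] at hj ⊢
      simp only [if_pos hj, smul_eq_mul]
      rw [hmon_face hx (e := e) (by rw [ht]), hmon_face hx (e := e) (by rw [ht]), ht, ht, hn, hn, hfj,
        hfo, ← boole_mul, ← blend (hj.trans hi.symm)]
      field_simp
      ring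
    · have : j ≠ i := fun h => hj (h ▸ hi)
      simp [hj, this]
  · have hi : fj i = 0 := by fin_cases i <;> simp [fj] at hi ⊢
    have hfo : fo i = 1 := by fin_cases i <;> simp [fj, fo] at hi ⊢
    have h1 := ((Attain.zero hΛ).add_smul hΛ (attain_two_snd (a := 0) (b := t) (n := t + e) (k := k)
      (by omega) (by omega) h) (-((1 - fe i) / ((t + e : ℕ) + 2)))).add_smul hΛ (attain_two_snd (a := 1)
      (b := t) (n := t + e) (k := k) (by omega) (by omega) h) (-((2 * fe i - 1) / ((t + e : ℕ) + 2)))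
    refine h1.congr fun j x hx => ?_
    by_cases hj : fj j = 0
    · have ht : ∀ b, tex j b t = t := fun b => by fin_cases j <;> simp [fj, tex] at hj ⊢
      have hn : ∀ b, nex j b t = b := fun b => by fin_cases j <;> simp [fj, nex] at hj ⊢
      have hfj : fo j = 1 := by fin_cases j <;> simp [fj, fo] at hj ⊢
      simp only [if_pos hj, smul_eq_mul]
      rw [hmon_face hx (e := e) (by rw [ht]), hmon_face hx (e := e) (by rw [ht]), ht, ht, hn, hn, hfj,
        hfo, ← boole_mul, ← blend (hj.trans hi.symm)]
      field_simp
      ring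
    · have : j ≠ i := fun h => hj (h ▸ hi)
      simp [hj, this]

/-- Normal traces need no compatibility along edges: every polynomial of degree at most `k - 1` is
attained on each face separately, monomial by monomial. -/
theorem lateral_lift_two {k : ℕ} (hk : 1 ≤ k) {w : Fin 4 → Form (2 : Fin 3)} (hw : ∀ i, w i ∈ tetSpace 2 k) :
    ∃ f ∈ infSpace 2 k, ∀ i : Fin 4, ∀ x ∈ openFace coneL i.castSucc,
      symb 2 (nv (coneL i.castSucc)) (pull 2 coneInv f x - w i x) = 0 := by
  have hΛ := normalTr_add_smul
  choose p q hp _ h using hw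
  -- The part of `w` that is a multiple of `x` is tangential to the face, so only `p` contributes to
  -- the normal trace.
  set r : Fin 4 → MvPolynomial (Fin 3) ℝ := fun i => p i (fj i) - C (fe i) * p i 2 with hr
  have hdeg : ∀ i, (r i).totalDegree ≤ k - 1 := fun i =>
    (totalDegree_sub _ _).trans (max_le (hp i _) ((totalDegree_C_mul_le _ _).trans (hp i _)))
  have hA : Attain 2 k normalTr (fun j x => eval x (r j)) := by
    have h1 := Attain.sum hΛ (k := k) Finset.univ (c := fun _ => 1) (fun (i : Fin 4) _ =>
      Attain.sum hΛ (k := k) (r i).support (c := fun d => coeff d (r i) * fe i ^ d (fj i))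
        (fun d hd => attain_two_mon (t := d (fo i)) (e := d (fj i) + d 2) (k := k)
          (by have := (face_degree_le hd i).trans (hdeg i); omega) i))
    refine h1.congr fun j x hx => ?_
    simp only [smul_eq_mul, one_mul]
    rw [Finset.sum_eq_single j, eval_face (r j) (mem_tri_iff.1 hx).1]
    · simp
    · intro i _ hi
      simp [hi.symm]
    · simp
  obtain ⟨f, hf, hA⟩ := hA
  refine ⟨f, hf, fun i x hx => symb_tri_two ?_⟩
  have h1 : ntr i (pull 2 coneInv f x) = _ := hA i x hx
  have hx1 := (mem_tri_iff.1 hx).1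
  have h2 : ntr i (w i x) = eval x (r i) := by
    refine (congrArg (ntr i) (h i x)).trans ?_
    rw [ntr, hx1]
    simp [hr]
    ring
  have h3 := h1.trans h2.symm
  change (pull 2 coneInv f x : V3) (fj i) - (w i x : V3) (fj i) = fe i * ((pull 2 coneInv f x : V3) (2 : Fin 3) - (w i x : V3) (2 : Fin 3))
  change (pull 2 coneInv f x : V3) (fj i) - fe i * (pull 2 coneInv f x : V3) (2 : Fin 3) = (w i x : V3) (fj i) - fe i * (w i x : V3) (2 : Fin 3) at h3
  linear_combination h3

/-- The components of a one-form on the triangular faces: in the direction of a base edge and in the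
radial direction. -/
def edgeTr (i : Fin 4) (x : V3) (u : Fin (proxyDim (1 : Fin 3)) → ℝ) : ℝ × ℝ :=
  ((u : V3) (fo i), x ⬝ᵥ (u : V3))

theorem edgeTr_add_smul (i : Fin 4) (x : V3) (u v : Fin (proxyDim (1 : Fin 3)) → ℝ) (c : ℝ) :
    edgeTr i x (u + c • v) = edgeTr i x u + c • edgeTr i x v := by
  refine Prod.ext rfl ?_
  have : ∀ u v : V3, x ⬝ᵥ (u + c • v) = x ⬝ᵥ u + c * (x ⬝ᵥ v) := by
    intro u v
    rw [dotProduct_add, dotProduct_smul, smul_eq_mul]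
  exact this u v

theorem attain_one_fst {a b n k : ℕ} (ha : a ≤ n) (hb : b ≤ n + 1) (hn : n + 1 ≤ k) :
    Attain 1 k edgeTr (fun i x => (if fo i = 0 then hmon a b (n + 1) x else 0, 0)) := by
  refine ⟨fun x => (![wmon a b (n + 2) x, 0, 0] + grad 0 x : V3), ⟨wmon a b (n + 2),
    wmon_mem (by push_cast; omega) (by push_cast; omega) (by push_cast; omega), 0,
    Submodule.zero_mem _, 0, Submodule.zero_mem _, fun _ => rfl⟩, fun i x hx => ?_⟩
  have h0 : (fun x => (![wmon a b (n + 2) x, 0, 0] + grad 0 x : V3)) =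
      fun x => ![wmon a b (n + 2) x, 0, 0] := by
    ext x j
    have : pd j 0 x = 0 := by
      change pd j (fun _ => 0) x = 0
      simp [pd]
    simp [grad, this]
  have hz := pos_of_mem_tri hx
  refine (congrArg (fun f : V3 → V3 => edgeTr i x (pull 1 coneInv f x)) h0).trans ?_
  refine Prod.ext ?_ (dot_pull_one_fst a b n hz)
  refine (congrFun (pull_one_fst a b n hz) (fo i)).trans ?_
  fin_cases i <;> simp [fo]

theorem attain_one_snd {a b n k : ℕ} (ha : a ≤ n + 1) (hb : b ≤ n) (hn : n + 1 ≤ k) :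
    Attain 1 k edgeTr (fun i x => (if fo i = 1 then hmon a b (n + 1) x else 0, 0)) := by
  refine ⟨fun x => (![0, wmon a b (n + 2) x, 0] + grad 0 x : V3), ⟨0, Submodule.zero_mem _,
    wmon a b (n + 2), wmon_mem (by push_cast; omega) (by push_cast; omega) (by push_cast; omega),
    0, Submodule.zero_mem _, fun _ => rfl⟩, fun i x hx => ?_⟩
  have h0 : (fun x => (![0, wmon a b (n + 2) x, 0] + grad 0 x : V3)) =
      fun x => ![0, wmon a b (n + 2) x, 0] := by
    ext x j
    have : pd j 0 x = 0 := by
      change pd j (fun _ => 0) x = 0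
      simp [pd]
    simp [grad, this]
  have hz := pos_of_mem_tri hx
  refine (congrArg (fun f : V3 → V3 => edgeTr i x (pull 1 coneInv f x)) h0).trans ?_
  refine Prod.ext ?_ (dot_pull_one_snd a b n hz)
  refine (congrFun (pull_one_snd a b n hz) (fo i)).trans ?_
  fin_cases i <;> simp [fo]

/-- The same blending as for two-forms. The horizontal generators restrict to monomials of degree `n
+ 1` whose free exponent is at most `n`, which is why a factor `x 2` is required. -/
theorem attain_one_mon {k t e : ℕ} (he : 1 ≤ e) (h : t + e ≤ k) (i : Fin 4) :
    Attain 1 k edgeTr (fun j x => (if j = i then x (fo i) ^ t * x 2 ^ e else 0, 0)) := by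
  have hΛ := edgeTr_add_smul
  obtain ⟨n, hn⟩ : ∃ n, t + e = n + 1 := ⟨t + e - 1, by omega⟩
  by_cases hi : fo i = 0
  · have hi' : fj i = 1 := by fin_cases i <;> simp [fj, fo] at hi ⊢
    have h1 := ((Attain.zero hΛ).add_smul hΛ (attain_one_fst (a := t) (b := 0) (n := n) (k := k)
      (by omega) (by omega) (by omega)) (1 - fe i)).add_smul hΛ (attain_one_fst (a := t)
      (b := 1) (n := n) (k := k) (by omega) (by omega) (by omega)) (2 * fe i - 1)
    refine h1.congr fun j x hx => ?_
    by_cases hj : fo j = 0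
    · have hj' : fj j = 1 := by fin_cases j <;> simp [fj, fo] at hj ⊢
      have ht : ∀ b, tex j t b = t := fun b => by fin_cases j <;> simp [fo, tex] at hj ⊢
      have hnx : ∀ b, nex j t b = b := fun b => by fin_cases j <;> simp [fo, nex] at hj ⊢
      simp only [if_pos hj]
      rw [hmon_face hx (e := e) (by rw [ht, hn]), hmon_face hx (e := e) (by rw [ht, hn]), ht, ht, hnx,
        hnx, hj, hi, ← boole_mul, ← blend (hj'.trans hi'.symm)]
      refine Prod.ext ?_ (by simp)
      simp
      ring
    · have : j ≠ i := fun h => hj (h ▸ hi)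
      simp [hj, this]
  · have hi : fo i = 1 := by fin_cases i <;> simp [fo] at hi ⊢
    have hi' : fj i = 0 := by fin_cases i <;> simp [fj, fo] at hi ⊢
    have h1 := ((Attain.zero hΛ).add_smul hΛ (attain_one_snd (a := 0) (b := t) (n := n) (k := k)
      (by omega) (by omega) (by omega)) (1 - fe i)).add_smul hΛ (attain_one_snd (a := 1)
      (b := t) (n := n) (k := k) (by omega) (by omega) (by omega)) (2 * fe i - 1)
    refine h1.congr fun j x hx => ?_
    by_cases hj : fo j = 1
    · have hj' : fj j = 0 := by fin_cases j <;> simp [fj, fo] at hj ⊢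
      have ht : ∀ b, tex j b t = t := fun b => by fin_cases j <;> simp [fo, tex] at hj ⊢
      have hnx : ∀ b, nex j b t = b := fun b => by fin_cases j <;> simp [fo, nex] at hj ⊢
      simp only [if_pos hj]
      rw [hmon_face hx (e := e) (by rw [ht, hn]), hmon_face hx (e := e) (by rw [ht, hn]), ht, ht, hnx,
        hnx, hj, hi, ← boole_mul, ← blend (hj'.trans hi'.symm)]
      refine Prod.ext ?_ (by simp)
      simp
      ring
    · have : j ≠ i := fun h => hj (h ▸ hi)
      simp [hj, this]

/-- If `x · w` vanishes on a triangular face, then the component `w (fo i)` is divisible by `x 2`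
there. -/
theorem eval_face_zero {i : Fin 4} {p : Fin 3 → MvPolynomial (Fin 3) ℝ}
    (h : ∀ x ∈ openFace coneL i.castSucc, x ⬝ᵥ (fun j => eval x (p j)) = 0) {t : ℝ} (h0 : 0 < t)
    (h1 : t < 1) : eval (facePt i t 0) (p (fo i)) = 0 := by
  have hcont : ∀ q : MvPolynomial (Fin 3) ℝ, ∃ r : Polynomial ℝ, ∀ z, r.eval z = eval (facePt i t z) q := by
    intro q
    refine ⟨aeval (![![Polynomial.C t, 0, Polynomial.X], ![Polynomial.X, Polynomial.C t, Polynomial.X],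
      ![Polynomial.C t, Polynomial.X, Polynomial.X], ![0, Polynomial.C t, Polynomial.X]] i) q, fun z => ?_⟩
    have := MvPolynomial.eval₂_comp_left (Polynomial.evalRingHom z) (algebraMap ℝ (Polynomial ℝ))
      (![![Polynomial.C t, 0, Polynomial.X], ![Polynomial.X, Polynomial.C t, Polynomial.X],
      ![Polynomial.C t, Polynomial.X, Polynomial.X], ![0, Polynomial.C t, Polynomial.X]] i) q
    rw [aeval_def]
    refine this.trans ?_
    have e : (Polynomial.evalRingHom z).comp (algebraMap ℝ (Polynomial ℝ)) = RingHom.id ℝ := by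
      ext r
      simp
    rw [e]
    refine congrArg (fun g => eval₂ (RingHom.id ℝ) g q) ?_
    ext j
    fin_cases i <;> fin_cases j <;> simp [facePt]
  choose r hr using fun j => hcont (p j)
  -- The radial component along the line of the face where the free coordinate is `t`, as a
  -- polynomial in `z`. It vanishes for `t < z < 1`, hence identically, and at `z = 0` only the term
  -- with `fo i` remains.
  set R : Polynomial ℝ := Polynomial.C t * r (fo i) +
    Polynomial.X * (Polynomial.C (fe i) * r (fj i) + r 2) with hR
  have hev : ∀ z, R.eval z = facePt i t z ⬝ᵥ fun j => eval (facePt i t z) (p j) := by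
    intro z
    simp only [hR, Polynomial.eval_add, Polynomial.eval_mul, Polynomial.eval_C, Polynomial.eval_X, hr]
    rw [dotProduct, Fin.sum_univ_three]
    fin_cases i <;> simp [facePt, fo, fj, fe] <;> ring
  have hR0 : R = 0 := by
    refine Polynomial.eq_zero_of_infinite_isRoot _ ((Set.Ioo_infinite h1).mono fun z hz => ?_)
    change R.eval z = 0
    rw [hev]
    exact h _ (facePt_mem i h0 hz.1 hz.2)
  have := congrArg (Polynomial.eval 0) hR0
  simp only [hR, Polynomial.eval_add, Polynomial.eval_mul, Polynomial.eval_C, Polynomial.eval_X, hr,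
    zero_mul, add_zero, Polynomial.eval_zero] at this
  exact (mul_eq_zero.1 this).resolve_left h0.ne'

end FaceExpansion

/-! ### Lifting compatible traces from the triangular faces -/

section LateralLift

open MvPolynomial

theorem continuous_eval_smul (q : MvPolynomial (Fin 3) ℝ) (c : V3) :
    Continuous fun z : ℝ => eval (z • c) q :=
  (contDiff_eval_self q (n := 0)).continuous.comp (continuous_id.smul continuous_const)

theorem coeff_zero_eq_eval (q : MvPolynomial (Fin 3) ℝ) : coeff 0 q = eval 0 q := by
  rw [← constantCoeff_eq, eval_zero]

/-- By continuity along the edges the four polynomials have a common value at the apex. This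
constant is itself in the space, and the differences are interpolated by `exists_scalar_lift`. -/
theorem lateral_lift_zero {k : ℕ} {w : Fin 4 → Form (0 : Fin 3)} (hw : ∀ i, w i ∈ tetSpace 0 k)
    (hedge : ∀ m : Fin 4, ∀ z : ℝ, 0 < z → z < 1 →
      tang 0 (corner m) (w m (z • corner m)) = tang 0 (corner m) (w (m + 1) (z • corner m))) :
    ∃ f ∈ infSpace 0 k, ∀ i : Fin 4, ∀ x ∈ openFace coneL i.castSucc,
      symb 0 (nv (coneL i.castSucc)) (pull 0 coneInv f x - w i x) = 0 := by
  choose p hp h using hw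
  have hw' : ∀ i (x d : V3), tang 0 d (w i x) = eval x (p i) := fun i x d =>
    congrFun (h i x) (0 : Fin 1)
  simp only [hw'] at hedge
  have hedge0 : ∀ m : Fin 4, eval 0 (p m) = eval 0 (p (m + 1)) := by
    intro m
    have h1 : Set.EqOn (fun z : ℝ => eval (z • corner m) (p m))
        (fun z : ℝ => eval (z • corner m) (p (m + 1))) (Set.Ioo 0 1) := fun z hz => hedge m z hz.1 hz.2
    have h2 := h1.closure (continuous_eval_smul _ _) (continuous_eval_smul _ _)
    rw [closure_Ioo zero_ne_one] at h2
    simpa using h2 (Set.left_mem_Icc.2 zero_le_one)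
  have hconst : ∀ i, eval 0 (p i) = eval 0 (p 0) := by
    intro i
    fin_cases i
    · rfl
    · exact (hedge0 0).symm
    · exact ((hedge0 0).trans (hedge0 1)).symm
    · exact hedge0 3
  set c := eval 0 (p 0)
  obtain ⟨q, hq, hqe⟩ := exists_scalar_lift (k := k) (χ := fun i => p i - C c)
    (fun i => (totalDegree_sub_C_le _ _).trans (hp i))
    (fun i => by rw [coeff_zero_eq_eval, map_sub, eval_C, hconst, sub_self])
    (fun m z h0 h1 => by rw [map_sub, map_sub, hedge m z h0 h1, eval_C])
  refine ⟨fun x _ => (c • wmon 0 0 0 + q) x, ⟨_, Submodule.add_mem _ (Submodule.smul_mem _ c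
    (wmon_mem (by omega) (by omega) (by omega))) (weightedPos_le k hq), fun _ => rfl⟩,
    fun i x hx => symb_tri_zero ?_⟩
  change c * wmon 0 0 0 (coneInv x) + q (coneInv x) - tang 0 0 (w i x) = 0
  rw [hw', hqe i x hx]
  simp [wmon]

theorem dot_eq_zero_of_cross {n x a : V3} (hn : n ≠ 0) (hx : n ⬝ᵥ x = 0) (h : crossProduct n a = 0) :
    x ⬝ᵥ a = 0 := by
  have h1 := cross_cross_eq_smul_sub_smul' x n a
  rw [h, map_zero, hx, zero_smul, sub_zero] at h1
  exact (smul_eq_zero.1 h1.symm).resolve_right hn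

theorem nv_tri_ne (i : Fin 4) : nv (coneL i.castSucc) ≠ 0 := by
  obtain ⟨c, hc, h⟩ := nv_tri i
  rw [h]
  refine smul_ne_zero hc fun h0 => ?_
  have := congrFun h0 (fj i)
  fin_cases i <;> simp [fj] at this

theorem nv_tri_dot {i : Fin 4} {x : V3} (hx : x (fj i) = fe i * x 2) :
    nv (coneL i.castSucc) ⬝ᵥ x = 0 := by
  obtain ⟨c, -, hc⟩ := nv_tri i
  rw [hc, smul_dotProduct, sub_dotProduct, smul_dotProduct, single_one_dotProduct,
    single_one_dotProduct, hx]
  simp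

/-- Without a radial component only the component along the base edge matters. By `eval_face_zero`
the terms without a factor `x 2` cancel on the face, and the remaining monomials are attained by
`attain_one_mon`. -/
theorem lateral_lift_one_of_dot {k : ℕ} {p : Fin 4 → Fin 3 → MvPolynomial (Fin 3) ℝ}
    (hp : ∀ i j, (p i j).totalDegree ≤ k)
    (hdot : ∀ i : Fin 4, ∀ x ∈ openFace coneL i.castSucc, x ⬝ᵥ (fun j => eval x (p i j)) = 0) :
    Attain 1 k edgeTr (fun i x => (eval x (p i (fo i)), 0)) := by
  have hΛ := edgeTr_add_smul
  have h1 := Attain.sum hΛ (k := k) Finset.univ (c := fun _ => 1) (fun (i : Fin 4) _ =>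
    Attain.sum hΛ (k := k) ((p i (fo i)).support.filter fun d => 1 ≤ d (fj i) + d 2)
      (c := fun d => coeff d (p i (fo i)) * fe i ^ d (fj i))
      (fun d hd => attain_one_mon (t := d (fo i)) (e := d (fj i) + d 2) (k := k)
        (Finset.mem_filter.1 hd).2
        ((face_degree_le (Finset.mem_filter.1 hd).1 i).trans (hp i _)) i))
  refine h1.congr fun j x hx => ?_
  obtain ⟨hx1, h2, h3, h4⟩ := mem_tri_iff.1 hx
  have e0 := eval_face_zero (hdot j) h2 (h3.trans h4)
  obtain ⟨c1, c2, c3⟩ := facePt_coord j (x (fo j)) 0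
  rw [eval_face (i := j) _ (by rw [c1, c3]), c2, c3, ← Finset.sum_filter_add_sum_filter_not _
    (fun d : Fin 3 →₀ ℕ => 1 ≤ d (fj j) + d 2)] at e0
  rw [Finset.sum_eq_zero (s := Finset.filter (fun d : Fin 3 →₀ ℕ => 1 ≤ d (fj j) + d 2) _)
    (fun d hd => by
      have := (Finset.mem_filter.1 hd).2
      rw [zero_pow (by omega)]
      simp), zero_add] at e0
  rw [Finset.sum_eq_single j]
  · refine Prod.ext ?_ ?_
    · have e1 : ∑ d ∈ (p j (fo j)).support with ¬1 ≤ d (fj j) + d 2,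
          coeff d (p j (fo j)) * fe j ^ d (fj j) * (x (fo j) ^ d (fo j) * x 2 ^ (d (fj j) + d 2)) = 0 := by
        rw [← e0]
        refine Finset.sum_congr rfl fun d hd => ?_
        have : d (fj j) + d 2 = 0 := by
          have := (Finset.mem_filter.1 hd).2
          omega
        rw [this, pow_zero, pow_zero]
      have e2 : eval x (p j (fo j)) = _ := eval_face _ hx1
      rw [← Finset.sum_filter_add_sum_filter_not _ (fun d : Fin 3 →₀ ℕ => 1 ≤ d (fj j) + d 2), e1,
        add_zero] at e2
      rw [e2]
      simp [Prod.fst_sum]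
    · simp [Prod.snd_sum]
  · intro i _ hi
    simp [hi.symm]
  · simp

/-- The radial components `x ⬝ᵥ w` are polynomials of degree at most `k`, by the defining condition
of the first kind space; they vanish at the apex and agree on the edges. Interpolated and integrated
along rays by `exists_euler`, they become the radial components of a gradient in the space. What
remains has no radial component and is lifted face by face. -/
theorem lateral_lift_one {k : ℕ} (hk : 1 ≤ k) {w : Fin 4 → Form (1 : Fin 3)}
    (hw : ∀ i, w i ∈ tetSpace 1 k)
    (hedge : ∀ m : Fin 4, ∀ z : ℝ, 0 < z → z < 1 →
      tang 1 (corner m) (w m (z • corner m)) = tang 1 (corner m) (w (m + 1) (z • corner m))) :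
    ∃ f ∈ infSpace 1 k, ∀ i : Fin 4, ∀ x ∈ openFace coneL i.castSucc,
      symb 1 (nv (coneL i.castSucc)) (pull 1 coneInv f x - w i x) = 0 := by
  choose p hp hX h using fun i => (mem_tetSpace_one hk).1 (hw i)
  have htang : ∀ i (x d : V3), tang 1 d (w i x) = d ⬝ᵥ fun j => eval x (p i j) := fun i x d =>
    congrArg (fun v : V3 => d ⬝ᵥ v) (h i x)
  have hXe : ∀ i (x : V3), eval x (∑ j, X j * p i j) = x ⬝ᵥ fun j => eval x (p i j) := by
    intro i x
    simp [dotProduct]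
  obtain ⟨q, hq, hqe⟩ := exists_scalar_lift (k := k) (χ := fun i => ∑ j, X j * p i j) hX
    (fun i => by rw [coeff_zero_eq_eval, hXe]; simp)
    (fun m z h0 h1 => by
      have := hedge m z h0 h1
      rw [htang, htang] at this
      rw [hXe, hXe, smul_dotProduct, smul_dotProduct, this])
  obtain ⟨q', hq', he⟩ := exists_euler hq
  have hmem : (fun x => (![0, 0, 0] + grad q' x : V3)) ∈ infSpace 1 k :=
    ⟨0, Submodule.zero_mem _, 0, Submodule.zero_mem _, q', hq', fun _ => rfl⟩
  set f₁ : Form (1 : Fin 3) := fun x => (![0, 0, 0] + grad q' x : V3) with hf₁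
  have hdot₁ : ∀ i : Fin 4, ∀ x ∈ openFace coneL i.castSucc,
      x ⬝ᵥ (pull 1 coneInv f₁ x : V3) = x ⬝ᵥ (w i x : V3) := by
    intro i x hx
    refine (dot_pull_coneInv_one (pos_of_mem_tri hx).ne' _).trans ?_
    refine Eq.trans ?_ (htang i x x).symm
    rw [← hXe, ← hqe i x hx, ← he x (pos_of_mem_tri hx)]
    change -((![0, 0, 0] + grad q' (coneInv x) : V3) (2 : Fin 3) / x 2) = _
    simp [grad]
  -- The traces of the gradient are again those of polynomials in the first kind space, so the
  -- remainder `w - w'` is polynomial as well.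
  choose w' hw' hs using (good_of_mem_infSpace hk hmem).tri
  choose p' hp' _ hp'e using fun i => (mem_tetSpace_one hk).1
    (tetSpace_add_smul hk (hw i) (hw' i) (-1))
  have hdot : ∀ i : Fin 4, ∀ x ∈ openFace coneL i.castSucc, x ⬝ᵥ (fun j => eval x (p' i j)) = 0 := by
    intro i x hx
    have h1 := dot_eq_zero_of_cross (nv_tri_ne i) (nv_tri_dot (mem_tri_iff.1 hx).1)
      (symb_one_eq_zero.1 (hs i x hx))
    have h2 : x ⬝ᵥ (pull 1 coneInv f₁ x : V3) - x ⬝ᵥ (w' i x : V3) = 0 :=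
      (dotProduct_sub x (pull 1 coneInv f₁ x : V3) (w' i x : V3)).symm.trans h1
    refine (congrArg (fun v : V3 => x ⬝ᵥ v) (hp'e i x)).symm.trans ?_
    change x ⬝ᵥ ((w i x : V3) + (-1 : ℝ) • (w' i x : V3)) = 0
    have h3 : x ⬝ᵥ ((w i x : V3) + (-1 : ℝ) • (w' i x : V3)) =
        x ⬝ᵥ (w i x : V3) + (-1 : ℝ) * (x ⬝ᵥ (w' i x : V3)) :=
      (dotProduct_add x (w i x : V3) ((-1 : ℝ) • (w' i x : V3))).trans
        (congrArg _ (dotProduct_smul (-1 : ℝ) x (w' i x : V3)))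
    refine h3.trans ?_
    have h4 := hdot₁ i x hx
    linarith
  obtain ⟨f₂, hf₂, h₂⟩ := lateral_lift_one_of_dot hp' hdot
  obtain ⟨f, hf, e⟩ := exists_pull_add_smul hmem hf₂ 1
  refine ⟨f, hf, fun i x hx => ?_⟩
  have hs₂ : symb 1 (nv (coneL i.castSucc)) (pull 1 coneInv f₂ x - (w i + (-1 : ℝ) • w' i) x) = 0 := by
    obtain ⟨e1, e2⟩ := Prod.ext_iff.1 (h₂ i x hx)
    refine symb_tri_one (mem_tri_iff.1 hx).1 (pos_of_mem_tri hx).ne' ?_ ?_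
    · exact sub_eq_zero.2 (e1.trans (congrFun (hp'e i x) (fo i)).symm)
    · refine (dotProduct_sub x (pull 1 coneInv f₂ x : V3) ((w i + (-1 : ℝ) • w' i) x : V3)).trans
        (sub_eq_zero.2 (e2.trans ?_))
      exact ((congrArg (fun v : V3 => x ⬝ᵥ v) (hp'e i x)).trans (hdot i x hx)).symm
  have e3 := e x (pos_of_mem_tri hx)
  have e4 : pull 1 coneInv f x - w i x = (pull 1 coneInv f₁ x - w' i x) +
      (pull 1 coneInv f₂ x - (w i + (-1 : ℝ) • w' i) x) := by
    rw [e3, Pi.add_apply, Pi.smul_apply, one_smul, neg_one_smul]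
    abel
  rw [e4, symb_add, hs i x hx, hs₂, add_zero]

/-- Polynomial forms on the triangular faces whose traces agree on the common edges are the traces
of a form of the approximation space. -/
theorem lateral_lift {s : Fin 3} {k : ℕ} (hk : 1 ≤ k) {w : Fin 4 → Form s}
    (hw : ∀ i, w i ∈ tetSpace s k)
    (hedge : ∀ m : Fin 4, ∀ z : ℝ, 0 < z → z < 1 →
      tang s (corner m) (w m (z • corner m)) = tang s (corner m) (w (m + 1) (z • corner m))) :
    ∃ f ∈ infSpace s k, ∀ i : Fin 4, ∀ x ∈ openFace coneL i.castSucc,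
      symb s (nv (coneL i.castSucc)) (pull s coneInv f x - w i x) = 0 := by
  match s with
  | 0 => exact lateral_lift_zero hw hedge
  | 1 => exact lateral_lift_one hk hw hedge
  | 2 => exact lateral_lift_two hk hw

end LateralLift

/-! ### Lifting traces from the base -/

section BaseLift

open MvPolynomial

/-- The extension of a polynomial on the base, homogeneous of degree `c`. -/
def baseExt (c : ℕ) (p : MvPolynomial (Fin 3) ℝ) (y : V3) : ℝ := eval ![y 0, y 1, 1] p / (1 + y 2) ^ c

theorem baseExt_mem {c : ℕ} {p : MvPolynomial (Fin 3) ℝ} {K L M : ℤ} (hc : (c : ℤ) = K)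
    (h0 : (p.degreeOf 0 : ℤ) ≤ L) (h1 : (p.degreeOf 1 : ℤ) ≤ M) : baseExt c p ∈ weighted K L M := by
  have e : baseExt c p = ∑ d ∈ p.support, coeff d p • wmon (d 0) (d 1) c := by
    ext y
    rw [baseExt, eval_eq', Finset.sum_div, Finset.sum_apply]
    refine Finset.sum_congr rfl fun d _ => ?_
    rw [Fin.prod_univ_three]
    simp [wmon]
    ring
  rw [e]
  refine Submodule.sum_mem _ fun d hd => Submodule.smul_mem _ _ (wmon_mem hc.le ?_ ?_)
  · have : ((d 0 : ℕ) : ℤ) ≤ p.degreeOf 0 := by exact_mod_cast monomial_le_degreeOf 0 hd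
    omega
  · have : ((d 1 : ℕ) : ℤ) ≤ p.degreeOf 1 := by exact_mod_cast monomial_le_degreeOf 1 hd
    omega

theorem baseExt_tri {i : Fin 4} {x : V3} (hx : x ∈ openFace coneL i.castSucc) (c : ℕ)
    (p : MvPolynomial (Fin 3) ℝ) :
    baseExt c p (coneInv x) = eval (facePt i (x (fo i) / x 2) 1) p * x 2 ^ c := by
  have hz := (pos_of_mem_tri hx).ne'
  have hx1 := (mem_tri_iff.1 hx).1
  have e : (![coneInv x 0, coneInv x 1, 1] : V3) = facePt i (x (fo i) / x 2) 1 := by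
    ext j
    fin_cases i <;> fin_cases j <;> simp [facePt, fo, fj, fe, coneInv] at hx1 ⊢ <;> simp [hx1, hz]
  rw [baseExt, one_add_coneInv, e]
  simp

theorem baseExt_base {x : V3} (hx : x ∈ openFace coneL 4) (c : ℕ) (p : MvPolynomial (Fin 3) ℝ) :
    baseExt c p (coneInv x) = eval x p := by
  have h2 := (mem_base_iff.1 hx).1
  have e : (![coneInv x 0, coneInv x 1, 1] : V3) = x := by
    ext j
    fin_cases j <;> simp [coneInv, h2]
  rw [baseExt, one_add_coneInv, e, h2]
  simp

theorem pd_zero (i : Fin 3) (x : V3) : pd i 0 x = 0 := by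
  change pd i (fun _ => 0) x = 0
  simp [pd]

theorem mem_infSpace_one {k : ℕ} {f g : V3 → ℝ} (hf : f ∈ weighted (k + 1) (k - 1) k)
    (hg : g ∈ weighted (k + 1) k (k - 1)) : (fun x => (![f x, g x, 0] : V3)) ∈ infSpace 1 k := by
  refine ⟨f, hf, g, hg, 0, Submodule.zero_mem _, fun x => ?_⟩
  have : grad 0 x = 0 := funext fun i => pd_zero i x
  rw [this, add_zero]

theorem mem_infSpace_two {k : ℕ} {h : V3 → ℝ} (hh : h ∈ weighted (k + 2) (k - 1) (k - 1)) :
    (fun x => (![0, 0, h x] : V3)) ∈ infSpace 2 k := by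
  refine ⟨h, hh, 0, Submodule.zero_mem _, 0, Submodule.zero_mem _, fun x => ?_⟩
  refine Eq.trans ?_ (congrArg (![0, 0, h x] + ·) (curl_horizontal 0 0 x)).symm
  simp [pd_zero]

/-- The polynomial on the base is extended with the largest weight, the one for which the exponents
are restricted only by the degrees on the base. On a triangular face this extension is a power of `x
2` times the value at a point of the base edge. So functions vanish on the triangular faces,
one-forms have neither a component along the base edge nor a radial component there, and two-forms
are radial. -/
theorem base_lift {s : Fin 3} {k : ℕ} (hk : 1 ≤ k) {q : Form s} (hq : q ∈ cubeSpace s k)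
    (hedge : ∀ (i : Fin 4) (t : ℝ), 0 < t → t < 1 →
      tang s (Pi.single (fo i) 1) (q (facePt i t 1)) = 0) :
    ∃ f ∈ infSpace s k, (∀ i : Fin 4, ∀ x ∈ openFace coneL i.castSucc,
      symb s (nv (coneL i.castSucc)) (pull s coneInv f x) = 0) ∧
      ∀ x ∈ openFace coneL 4, symb s (nv (coneL 4)) (pull s coneInv f x - q x) = 0 := by
  have hfrac : ∀ {i : Fin 4} {x : V3}, x ∈ openFace coneL i.castSucc →
      0 < x (fo i) / x 2 ∧ x (fo i) / x 2 < 1 := fun {i x} hx => by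
    obtain ⟨-, h1, h2, -⟩ := mem_tri_iff.1 hx
    have hz := pos_of_mem_tri hx
    exact ⟨div_pos h1 hz, (div_lt_one hz).2 h2⟩
  match s with
  | 0 =>
    obtain ⟨p, hp, h⟩ := hq
    refine ⟨fun x _ => baseExt k p x, ⟨_, baseExt_mem rfl (by exact_mod_cast hp 0)
      (by exact_mod_cast hp 1), fun _ => rfl⟩, fun i x hx => symb_tri_zero ?_, fun x hx =>
      symb_tri_zero (sub_eq_zero.2 ?_)⟩
    · refine (baseExt_tri hx k p).trans ?_
      have := hedge i _ (hfrac hx).1 (hfrac hx).2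
      rw [show eval (facePt i (x (fo i) / x 2) 1) p = 0 from
        (congrFun (h (facePt i (x (fo i) / x 2) 1)) (0 : Fin 1)).symm.trans this, zero_mul]
    · exact (baseExt_base hx k p).trans (congrFun (h x) (0 : Fin 1)).symm
  | 1 =>
    obtain ⟨p, hp, h⟩ := hq
    have d00 : (p 0).degreeOf 0 ≤ k - 1 := by simpa using hp 0 0
    have d10 : (p 0).degreeOf 1 ≤ k := by simpa using hp 1 0
    have d01 : (p 1).degreeOf 0 ≤ k := by simpa using hp 0 1
    have d11 : (p 1).degreeOf 1 ≤ k - 1 := by simpa using hp 1 1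
    refine ⟨fun x => (![baseExt (k + 1) (p 0) x, baseExt (k + 1) (p 1) x, 0] : V3),
      mem_infSpace_one (baseExt_mem (by simp) (by omega) (by omega))
        (baseExt_mem (by simp) (by omega) (by omega)), fun i x hx => ?_, fun x hx => ?_⟩
    · have hz := (pos_of_mem_tri hx).ne'
      refine symb_tri_one (mem_tri_iff.1 hx).1 hz ?_ ?_
      · have h1 := hedge i _ (hfrac hx).1 (hfrac hx).2
        have h2 : eval (facePt i (x (fo i) / x 2) 1) (p (fo i)) = 0 := by
          refine Eq.trans ?_ h1
          refine Eq.trans ?_ (congrArg (fun v : V3 => Pi.single (fo i) 1 ⬝ᵥ v)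
            (h (facePt i (x (fo i) / x 2) 1))).symm
          simp
        have h3 : baseExt (k + 1) (p (fo i)) (coneInv x) = 0 := by
          rw [baseExt_tri hx, h2, zero_mul]
        refine (congrFun (pull_coneInv_one hz _) (fo i)).trans ?_
        fin_cases i <;> simp [fo] at h3 ⊢ <;> simp [h3]
      · refine (dot_pull_coneInv_one hz _).trans ?_
        simp
    · rw [nv_coneL]
      have h2 := (mem_base_iff.1 hx).1
      have hP := pull_coneInv_one (pos_of_mem_base hx).ne'
        (fun x => (![baseExt (k + 1) (p 0) x, baseExt (k + 1) (p 1) x, 0] : V3))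
      refine symb_base_one (sub_eq_zero.2 ?_) (sub_eq_zero.2 ?_)
      · refine (congrFun hP (0 : Fin 3)).trans (Eq.trans ?_ (congrFun (h x) (0 : Fin 3)).symm)
        simp [h2, baseExt_base hx]
      · refine (congrFun hP (1 : Fin 3)).trans (Eq.trans ?_ (congrFun (h x) (1 : Fin 3)).symm)
        simp [h2, baseExt_base hx]
  | 2 =>
    obtain ⟨p, hp, h⟩ := hq
    have d0 : (p 2).degreeOf 0 ≤ k - 1 := by simpa using hp 0 2
    have d1 : (p 2).degreeOf 1 ≤ k - 1 := by simpa using hp 1 2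
    refine ⟨fun x => (![0, 0, baseExt (k + 2) (p 2) x] : V3),
      mem_infSpace_two (baseExt_mem (by simp) (by omega) (by omega)), fun i x hx => ?_, fun x hx => ?_⟩
    · have hz := (pos_of_mem_tri hx).ne'
      have hP := pull_coneInv_two hz (fun x => (![0, 0, baseExt (k + 2) (p 2) x] : V3))
      refine symb_tri_two ((congrFun hP (fj i)).trans (Eq.trans ?_
        (congrArg (fun t => fe i * t) (congrFun hP (2 : Fin 3))).symm))
      have hx1 := (mem_tri_iff.1 hx).1
      fin_cases i <;> simp [fj, fe] at hx1 ⊢ <;> simp [hx1] <;> field_simp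
    · rw [nv_coneL]
      have h2 := (mem_base_iff.1 hx).1
      have hP := pull_coneInv_two (pos_of_mem_base hx).ne'
        (fun x => (![0, 0, baseExt (k + 2) (p 2) x] : V3))
      refine symb_base_two (sub_eq_zero.2 ?_)
      refine (congrFun hP (2 : Fin 3)).trans (Eq.trans ?_ (congrFun (h x) (2 : Fin 3)).symm)
      simp [h2, baseExt_base hx]

end BaseLift

/-! ### Edges -/

theorem tang_smul {s : Fin 3} {c : ℝ} (hc : c ≠ 0) {d : V3} {u v : Fin (proxyDim s) → ℝ}
    (h : tang s (c • d) u = tang s (c • d) v) : tang s d u = tang s d v := by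
  match s, u, v, h with
  | 0, u, v, h => exact h
  | 1, u, v, h =>
    have e : ∀ w : V3, (c • d) ⬝ᵥ w = c * (d ⬝ᵥ w) := fun w => smul_dotProduct c d w
    have h' : c * (d ⬝ᵥ (u : V3)) = c * (d ⬝ᵥ (v : V3)) := (e u).symm.trans (h.trans (e v))
    exact mul_left_cancel₀ hc h'
  | 2, u, v, h => rfl

theorem tang_zero (s : Fin 3) (d : V3) : tang s d 0 = 0 := by
  match s with
  | 0 => rfl
  | 1 => exact dotProduct_zero d
  | 2 => rfl

theorem tang_pullM {s : Fin 3} (J : Matrix (Fin 3) (Fin 3) ℝ) {n m : V3} {u v : Fin (proxyDim s) → ℝ}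
    (h : tang s (crossProduct n m) u = tang s (crossProduct n m) v) :
    tang s (crossProduct (J.transpose.mulVec n) (J.transpose.mulVec m)) (pullM s J u) =
      tang s (crossProduct (J.transpose.mulVec n) (J.transpose.mulVec m)) (pullM s J v) := by
  match s, u, v, h with
  | 0, u, v, h => exact h
  | 1, u, v, h =>
    have e : ∀ w : V3, crossProduct (J.transpose.mulVec n) (J.transpose.mulVec m) ⬝ᵥ
        J.transpose.mulVec w = J.det * (crossProduct n m ⬝ᵥ w) := by
      intro w
      rw [transpose_mulVec_cross, dotProduct_comm, transpose_mulVec_dot, Matrix.mulVec_mulVec,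
        Matrix.mul_adjugate, Matrix.smul_mulVec, Matrix.one_mulVec, dotProduct_smul, smul_eq_mul,
        dotProduct_comm w]
    exact (e u).trans ((congrArg (J.det * ·) h).trans (e v).symm)
  | 2, u, v, h => rfl

/-- Supplies the vectors `X` and `Y` for `edge_jump`, so that the quantity compared there becomes a
nonzero multiple of the edge trace. -/
theorem tang_edge {ι : Type*} [Fintype ι] {l : ι → V3 →ᵃ[ℝ] ℝ} {K : Set V3} (hP : IsPoly l K)
    {i j : ι} (hind : crossProduct (nv (l i)) (nv (l j)) ≠ 0)
    {s : Fin 3} {u : Form s} (hu : u ∈ hSpace s K) {wi wj : Form s}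
    (hwi : ∀ a, ContDiff ℝ 1 (fun x => wi x a)) (hwj : ∀ a, ContDiff ℝ 1 (fun x => wj x a))
    (hi : ∀ v : Test s, tsupport v ∩ frontier K ⊆ openFace l i → traceOp s K u v = traceOp s K wi v)
    (hj : ∀ v : Test s, tsupport v ∩ frontier K ⊆ openFace l j → traceOp s K u v = traceOp s K wj v)
    {x₀ : V3} (h0i : l i x₀ = 0) (h0j : l j x₀ = 0) (hpos : ∀ m, m ≠ i ∧ m ≠ j → 0 < l m x₀) :
    tang s (crossProduct (nv (l i)) (nv (l j))) (wi x₀) =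
      tang s (crossProduct (nv (l i)) (nv (l j))) (wj x₀) := by
  set n := nv (l i)
  set m := nv (l j)
  match s with
  | 0 =>
    set d := crossProduct n m with hd
    have hdd : d ⬝ᵥ d ≠ 0 := fun h => hind (dotProduct_self_eq_zero.1 h)
    have e : ∀ (a : V3) (q : Fin 1 → ℝ) (X : V3), (symb 0 a q : V3) ⬝ᵥ X = q 0 * (a ⬝ᵥ X) := by
      intro a q X
      refine (congrArg (fun v : V3 => v ⬝ᵥ X) (symb_zero_apply a q)).trans ?_
      simp only [dotProduct, Finset.mul_sum]
      exact Finset.sum_congr rfl fun b _ => by ring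
    have t1 : m ⬝ᵥ crossProduct n d = -(d ⬝ᵥ d) := by
      rw [triple_product_permutation, triple_product_permutation, ← cross_anticomm, dotProduct_neg]
    have t2 : n ⬝ᵥ crossProduct d m = -(d ⬝ᵥ d) := by
      rw [triple_product_permutation, ← cross_anticomm, dotProduct_neg]
    -- The vectors are orthogonal to `n` and to `m` respectively, and `m ⬝ᵥ X = -(n ⬝ᵥ Y)` is
    -- nonzero.
    have h := edge_jump hP hind (s := 0) hu hwi hwj hi hj (X := crossProduct n d)
      (Y := -crossProduct d m)
      (fun q => (e n q _).trans (by rw [dot_self_cross, mul_zero]))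
      (fun q => (e m q _).trans (by rw [dotProduct_neg, dot_cross_self, neg_zero, mul_zero]))
      (fun q => (congrArg₂ (· + ·) (e m q _) (e n q _)).trans (by
        rw [dotProduct_neg, t1, t2]; ring)) h0i h0j hpos
    have h1 := (e m (wj x₀) _).symm.trans (h.trans (e m (wi x₀) _))
    rw [t1] at h1
    exact (mul_right_cancel₀ (neg_ne_zero.2 hdd) h1).symm
  | 1 =>
    have e : ∀ a q X : V3, (symb 1 a q : V3) ⬝ᵥ X = crossProduct a q ⬝ᵥ X := fun a q X =>
      congrArg (fun v : V3 => v ⬝ᵥ X) (symb_one_apply a q)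
    have t : ∀ q : V3, crossProduct m q ⬝ᵥ n = crossProduct n m ⬝ᵥ q := by
      intro q
      rw [dotProduct_comm, ← triple_product_permutation, dotProduct_comm]
    have c0 : ∀ a q : V3, crossProduct a q ⬝ᵥ a = 0 := fun a q => by
      rw [dotProduct_comm, dot_self_cross]
    have c1 : ∀ q : V3, crossProduct m q ⬝ᵥ n + crossProduct n q ⬝ᵥ m = 0 := by
      intro q
      simp only [cross_apply, dotProduct, Fin.sum_univ_three, Matrix.cons_val]
      ring
    -- With the normals themselves as vectors, the pairing is the triple product of `m`, `q` and
    -- `n`, which is the component of `q` along `crossProduct n m`.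
    have h := edge_jump hP hind (s := 1) hu hwi hwj hi hj (X := n) (Y := m)
      (fun q => (e n q n).trans (c0 n q)) (fun q => (e m q m).trans (c0 m q))
      (fun q => (congrArg₂ (· + ·) (e m q n) (e n q m)).trans (c1 q)) h0i h0j hpos
    have h1 := (e m (wj x₀) _).symm.trans (h.trans (e m (wi x₀) _))
    exact ((t _).symm.trans (h1.trans (t _))).symm
  | 2 => rfl

/-! ### Forms with equal traces on a face -/

theorem mem_hSpace_congr {s : Fin 3} {K : Set V3} {u u' : Form s} (hu : u ∈ hSpace s K)
    (e : u =ᵐ[volume.restrict K] u') : u' ∈ hSpace s K := by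
  obtain ⟨h, g, hg⟩ := hu
  exact ⟨(memLp_congr_ae e).1 h, g, hg.congr_left e⟩

theorem traceOp_congr {s : Fin 3} {K : Set V3} (hK : IsBody K) {u u' : Form s} (hu : u ∈ hSpace s K)
    (e : u =ᵐ[volume.restrict K] u') : traceOp s K u = traceOp s K u' := by
  obtain ⟨h, g, hg⟩ := hu
  ext v
  rw [traceOp_eq hK hg, traceOp_eq hK (hg.congr_left e)]
  refine integral_congr_ae ?_
  filter_upwards [e] with x hx
  rw [hx]

section Hom

open MvPolynomial

theorem exists_hom_eval (p : MvPolynomial (Fin 3) ℝ) :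
    ∃ q ∈ homSpace, ∀ x : V3, 0 < x 2 → eval x p = q x := by
  refine ⟨∑ d ∈ p.support, coeff d p • hmon (d 0) (d 1) (d 0 + d 1 + d 2),
    Submodule.sum_mem _ fun d _ => Submodule.smul_mem _ _ (hmon_mem _ _ _), fun x hx => ?_⟩
  rw [eval_eq', Finset.sum_apply]
  refine Finset.sum_congr rfl fun d _ => ?_
  rw [Fin.prod_univ_three, Pi.smul_apply, smul_eq_mul, hmon, pow_add, pow_add, div_pow, div_pow]
  field_simp

theorem hasHom_of_mem_tetSpace {s : Fin 3} {k : ℕ} (hk : 1 ≤ k) {w : Form s} (hw : w ∈ tetSpace s k) :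
    HasHom w := by
  match s, w, hw with
  | 0, w, hw =>
    obtain ⟨p, -, h⟩ := hw
    intro a
    obtain ⟨q, hq, e⟩ := exists_hom_eval p
    exact ⟨q, hq, fun x hx => (congrFun (h x) a).trans (e x hx)⟩
  | 1, w, hw =>
    obtain ⟨p, -, -, h⟩ := (mem_tetSpace_one hk).1 hw
    intro a
    obtain ⟨q, hq, e⟩ := exists_hom_eval (p a)
    exact ⟨q, hq, fun x hx => (congrFun (h x) a).trans (e x hx)⟩
  | 2, w, hw =>
    obtain ⟨p, r, -, -, h⟩ := hw
    intro (a : Fin 3)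
    obtain ⟨q, hq, e⟩ := exists_hom_eval (p a + r * X a)
    refine ⟨q, hq, fun x hx => (congrFun (h x) a).trans (Eq.trans ?_ (e x hx))⟩
    rw [map_add, map_mul, eval_X]

theorem hasHom_of_mem_cubeSpace {s : Fin 3} {k : ℕ} {w : Form s} (hw : w ∈ cubeSpace s k) :
    HasHom w := by
  match s, w, hw with
  | 0, w, hw =>
    obtain ⟨p, -, h⟩ := hw
    intro a
    obtain ⟨q, hq, e⟩ := exists_hom_eval p
    exact ⟨q, hq, fun x hx => (congrFun (h x) a).trans (e x hx)⟩
  | 1, w, hw =>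
    obtain ⟨p, -, h⟩ := hw
    intro a
    obtain ⟨q, hq, e⟩ := exists_hom_eval (p a)
    exact ⟨q, hq, fun x hx => (congrFun (h x) a).trans (e x hx)⟩
  | 2, w, hw =>
    obtain ⟨p, -, h⟩ := hw
    intro a
    obtain ⟨q, hq, e⟩ := exists_hom_eval (p a)
    exact ⟨q, hq, fun x hx => (congrFun (h x) a).trans (e x hx)⟩

theorem HasHom.add_smul {s : Fin 3} {P Q : Form s} (hP : HasHom P) (hQ : HasHom Q) (c : ℝ) :
    HasHom (P + c • Q) := by
  intro a
  obtain ⟨q, hq, h⟩ := hP a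
  obtain ⟨q', hq', h'⟩ := hQ a
  refine ⟨q + c • q', Submodule.add_mem _ hq (Submodule.smul_mem _ _ hq'), fun x hx => ?_⟩
  change P x a + c * Q x a = q x + c * q' x
  rw [h x hx, h' x hx]

end Hom

section FaceEq

variable {s : Fin 3} (B : V3 ≃ᵃ[ℝ] V3)

/-- The traces of the two forms on the pyramid `B '' cone` agree on a face. -/
def FaceEq (i : Fin 5) (u w : Form s) : Prop :=
  ∀ v : Test s, tsupport v ∩ frontier (B '' cone) ⊆ openFace (fun i => pushAff B (coneL i)) i →
    traceOp s (B '' cone) u v = traceOp s (B '' cone) w v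

variable {B} {i : Fin 5} {u u' w w' : Form s}

theorem FaceEq.trans (h : FaceEq B i u w) (h' : FaceEq B i w w') : FaceEq B i u w' :=
  fun v hv => (h v hv).trans (h' v hv)

theorem FaceEq.symm (h : FaceEq B i u w) : FaceEq B i w u := fun v hv => (h v hv).symm

theorem FaceEq.add_smul (hu : u ∈ hSpace s (B '' cone)) (hu' : u' ∈ hSpace s (B '' cone))
    (hw : w ∈ hSpace s (B '' cone)) (hw' : w' ∈ hSpace s (B '' cone)) (h : FaceEq B i u w)
    (h' : FaceEq B i u' w') (c : ℝ) : FaceEq B i (u + c • u') (w + c • w') := fun v hv => by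
  have hK := (isPoly_image_cone B).isBody
  rw [traceOp_add_smul hK hu hu', traceOp_add_smul hK hw hw', h v hv, h' v hv]

theorem symb_push {Q : Form s} (h : ∀ x ∈ openFace coneL i, symb s (nv (coneL i)) (Q x) = 0) {x : V3}
    (hx : x ∈ openFace (fun i => pushAff B (coneL i)) i) :
    symb s (nv (pushAff B (coneL i))) (pull s B.symm Q x) = 0 := by
  rw [nv_pushAff, pull_affEquiv]
  exact symb_pullM_eq_zero s _ (h _ (mem_openFace_pushAff.1 hx))

theorem pull_add_smul (F : V3 → V3) (u v : Form s) (c : ℝ) :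
    pull s F (u + c • v) = pull s F u + c • pull s F v := by
  ext1 x
  rw [Pi.add_apply, Pi.smul_apply, pull_apply, pull_apply, pull_apply, Pi.add_apply, Pi.smul_apply,
    pullM_add, pullM_smul]

/-- At least one pair of opposite triangular faces does not contain the face `i`. The two strict
inequalities of this pair add up to a positive height over the apex. -/
theorem apexHalf_of_pos {x : V3} (hx : ∀ j, j ≠ i → 0 < pushAff B (coneL j) x) : x ∈ apexHalf B := by
  change 0 < B.symm x 2
  have h : ∀ j, j ≠ i → 0 < ![B.symm x 1, B.symm x 2 - B.symm x 0, B.symm x 2 - B.symm x 1, B.symm x 0,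
      1 - B.symm x 2] j := by
    intro j hj
    rw [← coneL_apply]
    exact hx j hj
  by_cases hi : i = 1 ∨ i = 3
  · have h0 := h 0 (by rcases hi with rfl | rfl <;> decide)
    have h2 := h 2 (by rcases hi with rfl | rfl <;> decide)
    simp at h0 h2
    linarith
  · push Not at hi
    have h1 := h 1 hi.1.symm
    have h3 := h 3 hi.2.symm
    simp at h1 h3
    linarith

/-- The forms may be singular at the apex, but the difference is smooth near each open face, so
`traceOp_eq_zero_of_symb` applies to it. -/
theorem faceEq_of_hom {P Q : Form s} (hP : HasHom P) (hQ : HasHom Q)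
    (h : ∀ x ∈ openFace coneL i, symb s (nv (coneL i)) (P x - Q x) = 0) :
    FaceEq B i (pull s B.symm P) (pull s B.symm Q) := fun v hv => by
  have hK := isPoly_image_cone B
  obtain ⟨h1, h2⟩ := push_mem_hSpace B (hP.add_smul hQ (-1))
  have h0 := traceOp_eq_zero_of_symb hK i h1
    (fun a => (contDiffOn_push B (hP.add_smul hQ (-1)) a).mono fun x hx => apexHalf_of_pos hx) h2
    (fun x hx => symb_push (fun y hy => by
      rw [Pi.add_apply, Pi.smul_apply, neg_one_smul, ← sub_eq_add_neg]
      exact h y hy) hx) v hv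
  rw [pull_add_smul, traceOp_add_smul hK.isBody (push_mem_hSpace B hP).1 (push_mem_hSpace B hQ).1] at h0
  linarith

theorem faceEq_of_contDiff (hw : ∀ a, ContDiff ℝ 1 (fun x => w x a))
    (hw' : ∀ a, ContDiff ℝ 1 (fun x => w' x a))
    (h : ∀ x ∈ openFace coneL i, symb s (nv (coneL i)) (pull s B w x - pull s B w' x) = 0) :
    FaceEq B i w w' := fun v hv => by
  have hK := isPoly_image_cone B
  have hd : ∀ a, ContDiff ℝ 1 (fun x => (w + (-1 : ℝ) • w') x a) := fun a =>
    (hw a).add ((hw' a).const_smul (-1 : ℝ))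
  have h0 := traceOp_eq_zero_of_symb hK i (mem_hSpace_of_contDiff hK.isBody hd)
    (fun a => (hd a).contDiffOn) (hasWeakD_of_contDiff hK.isBody hd)
    (fun x hx => by
      have e : w + (-1 : ℝ) • w' = pull s B.symm (pull s B w + (-1 : ℝ) • pull s B w') := by
        rw [← pull_add_smul, pull_symm_pull]
      rw [e]
      refine symb_push (fun y hy => ?_) hx
      rw [Pi.add_apply, Pi.smul_apply, neg_one_smul, ← sub_eq_add_neg]
      exact h y hy) v hv
  rw [traceOp_add_smul hK.isBody (mem_hSpace_of_contDiff hK.isBody hw)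
    (mem_hSpace_of_contDiff hK.isBody hw')] at h0
  linarith

theorem tang_faceEq {i j : Fin 5} (hij : i ≠ j) (hu : u ∈ hSpace s (B '' cone))
    (hw : ∀ a, ContDiff ℝ 1 (fun x => w x a)) (hw' : ∀ a, ContDiff ℝ 1 (fun x => w' x a))
    (hi : FaceEq B i u w) (hj : FaceEq B j u w') {x : V3} (h0i : coneL i x = 0) (h0j : coneL j x = 0)
    (hpos : ∀ m, m ≠ i ∧ m ≠ j → 0 < coneL m x) :
    tang s (crossProduct (nv (coneL i)) (nv (coneL j))) (pull s B w x) =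
      tang s (crossProduct (nv (coneL i)) (nv (coneL j))) (pull s B w' x) := by
  have h := tang_edge (isPoly_image_cone B) (cross_pushAff_ne B (cross_coneL_ne i j hij)) hu hw hw'
    hi hj (x₀ := B x) (by rw [pushAff_apply_apply, h0i]) (by rw [pushAff_apply_apply, h0j])
    (fun m hm => by rw [pushAff_apply_apply]; exact hpos m hm)
  rw [pull_affEquiv, pull_affEquiv, nv_eq_mulVec_pushAff B (coneL i), nv_eq_mulVec_pushAff B (coneL j)]
  exact tang_pullM _ h

end FaceEq

/-! ### Construction of a form with the given trace -/

section Assembly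

variable {s : Fin 3} {k : ℕ} {B H : V3 ≃ᵃ[ℝ] V3}

theorem mem_square_one {x : V3} : x ∈ square 1 ↔ x ∈ cone ∧ coneL 4 x = 0 := by
  rw [coneL_apply]
  constructor
  · rintro ⟨h2, ⟨h0, h0'⟩, h1, h1'⟩
    refine ⟨⟨h1, ?_, ?_, h0, h2.le⟩, ?_⟩
    · rwa [h2]
    · rwa [h2]
    · simp [h2]
  · rintro ⟨⟨h1, h2, h3, h4, -⟩, h⟩
    have h5 : x 2 = 1 := by
      simp at h
      linarith
    rw [h5] at h2 h3
    exact ⟨h5, ⟨h4, h2⟩, h1, h3⟩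

theorem mem_square_zero {x : V3} : x ∈ square 0 ↔ x ∈ {x ∈ refCube | x 2 = 0} := by
  constructor
  · rintro ⟨h2, h0, h1⟩
    refine ⟨fun i => ?_, h2⟩
    fin_cases i
    · exact h0
    · exact h1
    · simp [h2]
  · rintro ⟨h, h2⟩
    exact ⟨h2, h 0, h 1⟩

theorem mapsTo_square
    (hH : H '' {x ∈ refCube | x 2 = 0} = B '' {x | x ∈ cone ∧ coneL 4 x = 0}) :
    Set.MapsTo (B.trans H.symm) (square 1) (square 0) := by
  intro x hx
  have h : B x ∈ B '' {x | x ∈ cone ∧ coneL 4 x = 0} := ⟨x, mem_square_one.1 hx, rfl⟩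
  rw [← hH] at h
  obtain ⟨y, hy, e⟩ := h
  change H.symm (B x) ∈ square 0
  rw [← e, H.symm_apply_apply]
  exact mem_square_zero.2 hy

theorem mapsTo_square'
    (hH : H '' {x ∈ refCube | x 2 = 0} = B '' {x | x ∈ cone ∧ coneL 4 x = 0}) :
    Set.MapsTo (B.trans H.symm).symm (square 0) (square 1) := by
  intro x hx
  have h : H x ∈ H '' {x ∈ refCube | x 2 = 0} := ⟨x, mem_square_zero.1 hx, rfl⟩
  rw [hH] at h
  obtain ⟨y, hy, e⟩ := h
  change B.symm (H x) ∈ square 1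
  rw [← e, B.symm_apply_apply]
  exact mem_square_one.2 hy

/-- The traces on the base of the forms on a neighbouring hexahedron, in the coordinates of the
cone. -/
theorem exists_faceEq_cube
    (hH : H '' {x ∈ refCube | x 2 = 0} = B '' {x | x ∈ cone ∧ coneL 4 x = 0})
    {w : Form s} (hw : w ∈ hexSpace s k H) :
    ∃ e ∈ cubeSpace s k, FaceEq B 4 w (pull s B.symm e) := by
  obtain ⟨e, he, h⟩ := exists_cubeSpace_trace (mapsTo_square hH) (mapsTo_square' hH) hw (-1)
  refine ⟨e, he, faceEq_of_contDiff (contDiff_of_mem_hexSpace hw)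
    (contDiff_pull s B.symm (contDiff_of_mem_cubeSpace he)) fun x hx => ?_⟩
  have h1 := h x (mem_base_iff.1 hx).1
  rw [pull_trans, pull_symm_pull] at h1
  rw [pull_pull_symm, nv_coneL]
  exact h1

theorem exists_faceEq_hex
    (hH : H '' {x ∈ refCube | x 2 = 0} = B '' {x | x ∈ cone ∧ coneL 4 x = 0})
    {e : Form s} (he : e ∈ cubeSpace s k) :
    ∃ w ∈ hexSpace s k H, FaceEq B 4 (pull s B.symm e) w := by
  set G := B.trans H.symm with hG
  have hmat : mat G.symm 2 0 = 0 ∧ mat G.symm 2 1 = 0 := mat_two_of_square (mapsTo_square' hH)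
  -- The scalar is chosen such that `(0, 0, a)` is the base normal transported by `G`, so that
  -- pulling back by `G` returns `nv (coneL 4)`.
  obtain ⟨e', he', h⟩ := exists_cubeSpace_trace (mapsTo_square' hH) (mapsTo_square hH) he
    (-(mat G.symm 2 2))
  have hwm : pull s H.symm e' ∈ hexSpace s k H := by
    change pull s H (pull s H.symm e') ∈ cubeSpace s k
    rwa [pull_pull_symm]
  refine ⟨pull s H.symm e', hwm, faceEq_of_contDiff
    (contDiff_pull s B.symm (contDiff_of_mem_cubeSpace he)) (contDiff_of_mem_hexSpace hwm)
    fun x hx => ?_⟩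
  have h1 := h (G x) (mapsTo_square hH (mem_square_one.2 ⟨(isPoly_cone.mem_iff x).2 fun j => ?_, hx.1⟩)).1
  · have h2 := symb_pullM_eq_zero s (mat G) h1
    have hn : (mat G).transpose.mulVec ![0, 0, -(mat G.symm 2 2)] = nv (coneL 4) := by
      rw [nv_eq_mulVec_pushAff G (coneL 4), nv_pushAff, nv_coneL]
      congr 1
      ext j
      fin_cases j <;> simp [Matrix.mulVec, dotProduct, Fin.sum_univ_three, hmat.1, hmat.2]
    rw [hn, pullM_sub, ← pull_affEquiv, ← pull_affEquiv, pull_pull_symm, hG, pull_trans] at h2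
    rw [pull_pull_symm]
    exact h2
  · by_cases hj : j = 4
    · rw [hj, hx.1]
    · exact (hx.2 j hj).le

/-- The forms of the approximation space as forms on the pyramid. -/
theorem push_mem {f : Form s} (hk : 1 ≤ k) (hf : f ∈ infSpace s k) :
    pull s B.symm (pull s coneInv f) ∈ hSpace s (B '' cone) :=
  (push_mem_hSpace B (good_of_mem_infSpace hk hf).hom).1

theorem exists_faceEq_tet (hk : 1 ≤ k) {f : Form s} (hf : f ∈ infSpace s k) (i : Fin 4) :
    ∃ w ∈ tetSpace s k, FaceEq B i.castSucc (pull s B.symm (pull s coneInv f)) w := by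
  have hg := good_of_mem_infSpace hk hf
  obtain ⟨w, hw, h⟩ := hg.tri i
  exact ⟨pull s B.symm w, pull_mem_tetSpace hk hw B.symm,
    faceEq_of_hom hg.hom (hasHom_of_mem_tetSpace hk hw) h⟩

theorem exists_faceEq_base (hH : H '' {x ∈ refCube | x 2 = 0} = B '' {x | x ∈ cone ∧ coneL 4 x = 0})
    (hk : 1 ≤ k) {f : Form s} (hf : f ∈ infSpace s k) :
    ∃ w ∈ hexSpace s k H, FaceEq B 4 (pull s B.symm (pull s coneInv f)) w := by
  have hg := good_of_mem_infSpace hk hf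
  obtain ⟨e, he, h⟩ := hg.base
  obtain ⟨w, hw, h'⟩ := exists_faceEq_hex hH he
  exact ⟨w, hw, (faceEq_of_hom hg.hom (hasHom_of_mem_cubeSpace he) h).trans h'⟩

theorem cross_lateral (m : Fin 4) : ∃ c : ℝ, c ≠ 0 ∧
    crossProduct (nv (coneL m.castSucc)) (nv (coneL (m + 1).castSucc)) = c • corner m := by
  rw [nv_coneL, nv_coneL, cross_apply]
  fin_cases m
  · exact ⟨1, by norm_num, by ext j; fin_cases j <;> simp [corner]⟩
  · exact ⟨1, by norm_num, by ext j; fin_cases j <;> simp [corner]⟩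
  · exact ⟨1, by norm_num, by ext j; fin_cases j <;> simp [corner]⟩
  · exact ⟨1, by norm_num, by ext j; fin_cases j <;> simp [corner]⟩

theorem cross_base (i : Fin 4) : ∃ c : ℝ, c ≠ 0 ∧
    crossProduct (nv (coneL i.castSucc)) (nv (coneL 4)) = c • (Pi.single (fo i) 1 : V3) := by
  rw [nv_coneL, nv_coneL, cross_apply]
  fin_cases i
  · exact ⟨-1, by norm_num, by ext j; fin_cases j <;> simp [fo]⟩
  · exact ⟨-1, by norm_num, by ext j; fin_cases j <;> simp [fo]⟩
  · exact ⟨1, by norm_num, by ext j; fin_cases j <;> simp [fo]⟩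
  · exact ⟨1, by norm_num, by ext j; fin_cases j <;> simp [fo]⟩

theorem coneL_lateral (m : Fin 4) {z : ℝ} (h0 : 0 < z) (h1 : z < 1) :
    coneL m.castSucc (z • corner m) = 0 ∧ coneL (m + 1).castSucc (z • corner m) = 0 ∧
      ∀ j, j ≠ m.castSucc ∧ j ≠ (m + 1).castSucc → 0 < coneL j (z • corner m) := by
  simp only [coneL_apply]
  fin_cases m <;> simp [corner, Fin.forall_fin_succ, h0, h1]

theorem coneL_base (i : Fin 4) {t : ℝ} (h0 : 0 < t) (h1 : t < 1) :
    coneL i.castSucc (facePt i t 1) = 0 ∧ coneL 4 (facePt i t 1) = 0 ∧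
      ∀ j, j ≠ i.castSucc ∧ j ≠ 4 → 0 < coneL j (facePt i t 1) := by
  simp only [coneL_apply]
  fin_cases i <;> simp [facePt, Fin.forall_fin_succ, h0, h1]

theorem castSucc_ne_add_one (m : Fin 4) : m.castSucc ≠ (m + 1).castSucc := by
  fin_cases m <;> decide

theorem contDiff_zero_form (a : Fin (proxyDim s)) : ContDiff ℝ 1 (fun x => (0 : Form s) x a) :=
  contDiff_const

/-- A form whose traces on the faces are polynomial has the same trace as a form of the
approximation space. -/
theorem exists_approx (hH : H '' {x ∈ refCube | x 2 = 0} = B '' {x | x ∈ cone ∧ coneL 4 x = 0})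
    (hk : 1 ≤ k) {u : Form s} (hu : u ∈ hSpace s (B '' cone))
    (htri : ∀ i : Fin 4, ∃ w ∈ tetSpace s k, FaceEq B i.castSucc u w)
    (hbase : ∃ w ∈ hexSpace s k H, FaceEq B 4 u w) :
    ∃ f ∈ infSpace s k, traceOp s (B '' cone) u =
      traceOp s (B '' cone) (pull s B.symm (pull s coneInv f)) := by
  have hP := isPoly_image_cone B
  have hK := hP.isBody
  choose w hw hwu using htri
  have hwc : ∀ i a, ContDiff ℝ 1 (fun x => w i x a) := fun i => contDiff_of_mem_tetSpace (hw i)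
  -- the lateral faces
  obtain ⟨f₁, hf₁, h₁⟩ := lateral_lift hk (w := fun i => pull s B (w i))
    (fun i => pull_mem_tetSpace hk (hw i) B) (fun m z h0 h1 => by
      obtain ⟨c, hc, hcr⟩ := cross_lateral m
      obtain ⟨e1, e2, e3⟩ := coneL_lateral m h0 h1
      refine tang_smul hc ?_
      rw [← hcr]
      exact tang_faceEq (castSucc_ne_add_one m) hu (hwc m) (hwc (m + 1)) (hwu m) (hwu (m + 1)) e1 e2 e3)
  have hg₁ := good_of_mem_infSpace hk hf₁
  set p₁ := pull s B.symm (pull s coneInv f₁) with hp₁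
  have hp₁m : p₁ ∈ hSpace s (B '' cone) := push_mem hk hf₁
  have hlat₁ : ∀ i : Fin 4, FaceEq B i.castSucc p₁ (w i) := by
    intro i
    have h := faceEq_of_hom (B := B) hg₁.hom (hasHom_of_mem_tetSpace hk (pull_mem_tetSpace hk (hw i) B))
      (h₁ i)
    rwa [pull_symm_pull] at h
  have hz : (0 : Form s) ∈ hSpace s (B '' cone) := mem_hSpace_of_contDiff hK contDiff_zero_form
  set u₁ : Form s := u + (-1 : ℝ) • p₁ with hu₁
  have hu₁m : u₁ ∈ hSpace s (B '' cone) := add_smul_mem_hSpace hu hp₁m (-1)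
  have hlat : ∀ i : Fin 4, FaceEq B i.castSucc u₁ 0 := by
    intro i
    have hwm := mem_hSpace_of_contDiff hK (hwc i)
    have h := FaceEq.add_smul hu hp₁m hwm hwm (hwu i) (hlat₁ i) (-1)
    have e : w i + (-1 : ℝ) • w i = 0 := by
      rw [neg_one_smul, add_neg_cancel]
    rwa [e] at h
  -- the base
  obtain ⟨wH, hwH, hwHu⟩ := hbase
  obtain ⟨e, he, hee⟩ := exists_faceEq_cube hH hwH
  obtain ⟨e₁, he₁, hee₁⟩ := hg₁.base
  have hq : e + (-1 : ℝ) • e₁ ∈ cubeSpace s k := cubeSpace_add_smul he he₁ (-1)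
  set q : Form s := e + (-1 : ℝ) • e₁ with hqdef
  have hsm : ∀ e ∈ cubeSpace s k, ∀ a, ContDiff ℝ 1 (fun x => pull s B.symm e x a) := fun e he =>
    contDiff_pull s B.symm (contDiff_of_mem_cubeSpace he)
  have hbq : FaceEq B 4 u₁ (pull s B.symm q) := by
    rw [hqdef, pull_add_smul]
    exact FaceEq.add_smul hu hp₁m (mem_hSpace_of_contDiff hK (hsm e he))
      (mem_hSpace_of_contDiff hK (hsm e₁ he₁)) (hwHu.trans hee)
      (faceEq_of_hom hg₁.hom (hasHom_of_mem_cubeSpace he₁) hee₁) (-1)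
  -- The trace of `u₁` is zero on the triangular faces and that of `q` on the base; compatibility
  -- along the base edges gives the vanishing edge traces of `q`.
  obtain ⟨f₂, hf₂, h₂, h₂'⟩ := base_lift hk hq (fun i t h0 h1 => by
    obtain ⟨c, hc, hcr⟩ := cross_base i
    obtain ⟨e1, e2, e3⟩ := coneL_base i h0 h1
    have h := tang_faceEq (by fin_cases i <;> decide) hu₁m contDiff_zero_form (hsm q hq) (hlat i) hbq e1
      e2 e3
    rw [pull_pull_symm, hcr] at h
    rw [← tang_smul hc h]
    have h0' : pull s B (0 : Form s) (facePt i t 1) = 0 := by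
      rw [pull_apply]
      simpa using pullM_smul s (jac B (facePt i t 1)) (0 : ℝ) (0 : Fin (proxyDim s) → ℝ)
    rw [h0', tang_zero])
  have hg₂ := good_of_mem_infSpace hk hf₂
  set p₂ := pull s B.symm (pull s coneInv f₂) with hp₂
  have hp₂m : p₂ ∈ hSpace s (B '' cone) := push_mem hk hf₂
  have hall : ∀ i, FaceEq B i u₁ p₂ := by
    intro i
    refine Fin.lastCases ?_ (fun i => ?_) i
    · exact hbq.trans (faceEq_of_hom hg₂.hom (hasHom_of_mem_cubeSpace hq) h₂').symm
    · have h := faceEq_of_hom (B := B) (i := i.castSucc) hg₂.hom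
        (hasHom_of_mem_tetSpace hk (zero_mem_tetSpace s k)) (fun x hx => by
          rw [Pi.zero_apply, sub_zero]
          exact h₂ i x hx)
      have h0 : pull s B.symm (0 : Form s) = 0 := by
        have := pull_sub s B.symm (0 : Form s) 0
        rwa [sub_self, sub_self] at this
      rw [h0] at h
      exact (hlat i).trans h.symm
  -- The traces agree on every open face, and the edges cannot carry a remaining part.
  have hzero := traceOp_eq_zero_of_openFace hP
    (fun i j h => cross_pushAff_ne B (cross_coneL_ne i j h)) (add_smul_mem_hSpace hu₁m hp₂m (-1))
    (fun i v hv => by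
      rw [traceOp_add_smul hK hu₁m hp₂m, hall i v hv]
      ring)
  obtain ⟨f, hf, e₃⟩ := exists_pull_add_smul hf₁ hf₂ 1
  refine ⟨f, hf, ?_⟩
  -- The sum is represented by `f` only at points beyond the apex plane, which is enough almost
  -- everywhere on the pyramid.
  have hae : p₁ + (1 : ℝ) • p₂ =ᵐ[volume.restrict (B '' cone)] pull s B.symm (pull s coneInv f) := by
    filter_upwards [hK.ae_mem_interior] with x hx
    have h := e₃ _ (mem_of_interior B hx).2
    rw [Pi.add_apply, Pi.smul_apply, hp₁, hp₂, pull_affEquiv, pull_affEquiv, pull_affEquiv, h,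
      pullM_add, pullM_smul]
  rw [← traceOp_congr hK (add_smul_mem_hSpace hp₁m hp₂m 1) hae]
  ext v
  have h := hzero v
  rw [traceOp_add_smul hK hu₁m hp₂m, hu₁, traceOp_add_smul hK hu hp₁m] at h
  rw [traceOp_add_smul hK hp₁m hp₂m]
  linarith

end Assembly

variable {s : Fin 3} {k : ℕ} {A : V3 ≃ᵃ[ℝ] V3}

theorem image_cone_eq (A : V3 ≃ᵃ[ℝ] V3) : flip.trans A '' cone = A '' refPyramid := by
  rw [← image_flip_cone, Set.image_image]
  rfl

/-- The approximation space consists of the images of the forms on the infinite pyramid, up to their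
values on a null set. -/
theorem exists_ae_eq_of_mem_approxSpace {u : Form s} (hu : u ∈ approxSpace s k A) :
    ∃ f ∈ infSpace s k, pull s (flip.trans A).symm (pull s coneInv f)
      =ᵐ[volume.restrict (flip.trans A '' cone)] u := by
  obtain ⟨f, hf, h⟩ := mem_approxSpace_iff.1 hu
  refine ⟨f, hf, ?_⟩
  filter_upwards [(isPoly_image_cone (flip.trans A)).isBody.ae_mem_interior] with x hx
  obtain ⟨hx, hx2⟩ := mem_of_interior (flip.trans A) hx
  rw [pull_affEquiv, ← h _ hx hx2, ← pull_affEquiv, pull_symm_pull]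

theorem push_mem_approxSpace {f : Form s} (hf : f ∈ infSpace s k) :
    pull s (flip.trans A).symm (pull s coneInv f) ∈ approxSpace s k A :=
  mem_approxSpace_iff.2 ⟨f, hf, fun x _ _ => by rw [pull_pull_symm]⟩

theorem matchesOnFace_tet_iff {T : V3 ≃ᵃ[ℝ] V3} {i : Fin 4}
    (hT : IsNeighbour (flip.trans A '' cone) (A '' refTriFace i) refTet T) {u : Form s}
    (hu : u ∈ hSpace s (flip.trans A '' cone)) :
    MatchesOnFace s (flip.trans A '' cone) (A '' refTriFace i) (T '' refTet) (tetSpace s k)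
      (traceOp s (flip.trans A '' cone) u) ↔
      ∃ w ∈ tetSpace s k, FaceEq (flip.trans A) i.castSucc u w :=
  matchesOnFace_iff (i := i.castSucc) (i' := 2) (isPoly_image_cone _) (isPoly_refTet.image T) hT.1
    ((image_refTriFace A i).trans (by rw [image_cone_eq]))
    (hT.2.symm.trans (image_face_eq (l := tetL) T fun x => by simp [tetL_apply]))
    (fun _ hw a => contDiff_of_mem_tetSpace hw a) hu

theorem matchesOnFace_hex_iff {H : V3 ≃ᵃ[ℝ] V3}
    (hH : IsNeighbour (flip.trans A '' cone) (A '' refBase) refCube H) {u : Form s}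
    (hu : u ∈ hSpace s (flip.trans A '' cone)) :
    MatchesOnFace s (flip.trans A '' cone) (A '' refBase) (H '' refCube) (hexSpace s k H)
      (traceOp s (flip.trans A '' cone) u) ↔
      ∃ w ∈ hexSpace s k H, FaceEq (flip.trans A) 4 u w :=
  matchesOnFace_iff (i := 4) (i' := (2, false)) (isPoly_image_cone _) (isPoly_refCube.image H) hH.1
    ((image_refBase A).trans (by rw [image_cone_eq]))
    (hH.2.symm.trans (image_face_eq (l := cubeL) H fun x => rfl))
    (fun _ hw a => contDiff_of_mem_hexSpace hw a) hu

theorem image_refBase_eq (A : V3 ≃ᵃ[ℝ] V3) :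
    A '' refBase = flip.trans A '' {x | x ∈ cone ∧ coneL 4 x = 0} := by
  rw [image_refBase, ← image_cone_eq]
  ext x
  constructor
  · rintro ⟨⟨y, hy, rfl⟩, h⟩
    exact ⟨y, ⟨hy, by rwa [pushAff_apply_apply] at h⟩, rfl⟩
  · rintro ⟨y, ⟨hy, h⟩, rfl⟩
    exact ⟨⟨y, hy, rfl⟩, by rwa [pushAff_apply_apply]⟩

end Pyr

end

/-! ### The main theorem -/

theorem mainTheorem10 (s : Fin 3) (k : ℕ) (hk : 1 ≤ k) (A : Pyr.V3 ≃ᵃ[ℝ] Pyr.V3)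
    (K : Set Pyr.V3) (hK : K = A '' Pyr.refPyramid)
    (T : Fin 4 → (Pyr.V3 ≃ᵃ[ℝ] Pyr.V3))
    (hT : ∀ i, Pyr.IsNeighbour K (A '' Pyr.refTriFace i) Pyr.refTet (T i))
    (H : Pyr.V3 ≃ᵃ[ℝ] Pyr.V3)
    (hH : Pyr.IsNeighbour K (A '' Pyr.refBase) Pyr.refCube H) :
    (∀ u ∈ Pyr.hSpace s K, Pyr.IsBoundaryDistribution s K (Pyr.traceOp s K u)) ∧
    (∀ u ∈ Pyr.hSpace s K, ∀ u' ∈ Pyr.hSpace s K, ∀ c : ℝ, u + c • u' ∈ Pyr.hSpace s K ∧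
      Pyr.traceOp s K (u + c • u') = Pyr.traceOp s K u + c • Pyr.traceOp s K u') ∧
    Pyr.approxSpace s k A ⊆ Pyr.hSpace s K ∧
    Pyr.traceOp s K '' Pyr.approxSpace s k A =
      {τ | τ ∈ Pyr.traceOp s K '' Pyr.hSpace s K ∧
        (∀ i, Pyr.MatchesOnFace s K (A '' Pyr.refTriFace i) (T i '' Pyr.refTet)
          (Pyr.tetSpace s k) τ) ∧
        Pyr.MatchesOnFace s K (A '' Pyr.refBase) (H '' Pyr.refCube) (Pyr.hexSpace s k H) τ} := by
  rw [← Pyr.image_cone_eq] at hK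
  subst hK
  have hP := Pyr.isPoly_image_cone (Pyr.flip.trans A)
  have hH' := hH.2.trans (Pyr.image_refBase_eq A)
  refine ⟨fun u hu => Pyr.isBoundaryDistribution_traceOp hP hu, fun u hu u' hu' c =>
    ⟨Pyr.add_smul_mem_hSpace hu hu' c, funext fun v =>
      Pyr.traceOp_add_smul hP.isBody hu hu' c v⟩, fun u hu => ?_, Set.Subset.antisymm ?_ ?_⟩
  · obtain ⟨f, hf, e⟩ := Pyr.exists_ae_eq_of_mem_approxSpace hu
    exact Pyr.mem_hSpace_congr (Pyr.push_mem hk hf) e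
  · rintro _ ⟨u, hu, rfl⟩
    -- An element of the approximation space is prescribed only on the pyramid without its apex; the
    -- representative given by `f` has the same trace and controlled values near the open faces.
    obtain ⟨f, hf, e⟩ := Pyr.exists_ae_eq_of_mem_approxSpace hu
    have hm := Pyr.push_mem (B := Pyr.flip.trans A) hk hf
    rw [← Pyr.traceOp_congr hP.isBody hm e]
    exact ⟨⟨_, hm, rfl⟩,
      fun i => (Pyr.matchesOnFace_tet_iff (hT i) hm).2 (Pyr.exists_faceEq_tet hk hf i),
      (Pyr.matchesOnFace_hex_iff hH hm).2 (Pyr.exists_faceEq_base hH' hk hf)⟩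
  · rintro _ ⟨⟨u, hu, rfl⟩, htri, hbase⟩
    obtain ⟨f, hf, e⟩ := Pyr.exists_approx hH' hk hu
      (fun i => (Pyr.matchesOnFace_tet_iff (hT i) hu).1 (htri i))
      ((Pyr.matchesOnFace_hex_iff hH hu).1 hbase)
    exact ⟨_, Pyr.push_mem_approxSpace hf, e.symm⟩
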